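/- Let $\Sigma$ be a finite alphabet with $|\Sigma|\ge 2$ and let $\Xi$ be an infinite set of variables, disjoint from $\Sigma$, with a distinguished \emph{universe variable} $\mathfrak{u}\in\Xi$. A \emph{$2\mathsf{FC[REG]}$-CQ} is a conjunctive query $\Psi=\mathsf{Ans}(\vec x)\leftarrow\bigwedge_{i=1}^{n}\chi_i$ whose atoms are word equations $x\doteq\alpha$ with $x\in\Xi$, $\alpha\in(\Sigma\cup\Xi)^*$, $|\alpha|\le 2$, or regular constraints $x\,\dot\in\,\gamma$ with $x\in\Xi$ and $\gamma$ a regular expression over $\Sigma$. The head $\vec x$ is a tuple of distinct variables that occur in the body and differ from $\mathfrak u$ (the free variables); all other variables except $\mathfrak u$ are existentially quantified. A substitution $\sigma$ (a morphism to $\Sigma^*$ that fixes the letters) satisfies an atom if $\sigma(x)=\sigma(\alpha)$, respectively $\sigma(x)\in L(\gamma)$, and all its variables are mapped to factors of $\sigma(\mathfrak u)$; quantifiers range over the factors of $\sigma(\mathfrak u)$; and $[\![\Psi]\!](w)$ is the set of the tuples $\sigma(\vec x)$ with $\sigma\models\Psi$ and $\sigma(\mathfrak u)=w$. Let $\mathrm{var}(\chi)$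 be the set of the variables of $\chi$ other than $\mathfrak u$ (which is treated as a constant). $\Psi$ is \emph{acyclic} if it has a join tree: an (undirected) tree whose node set is the set of atoms of $\Psi$, such that whenever $x\in\mathrm{var}(\chi_i)\cap\mathrm{var}(\chi_j)$, $x$ occurs in every atom on the path between $\chi_i$ and $\chi_j$. Let $|\Psi|$ be the length of $\Psi$, that is, the total length of its head, word equations and regular constraints. The computational model is a random access machine with uniform cost whose word size is at least a constant multiple of the logarithm of the input size and such that every symbol of the input fits into a word; the input consists of $\Psi$ and $w$, and factors of $w$ are output as spans of $w$. **Proposition.** 1. There is a machine that, given an acyclic $2\mathsf{FC[REG]}$-CQ $\Psi$ and a word $w\in\Sigma^*$, decides whether $[\![\Psi]\!](w)\neq\emptyset$ (for Boolean $\Psi$, that is, with empty head, this is the model checking problem) in time $O\big(|\Psi|^2(|w|+1)^3\big)$. 2. There is a machine that, given an acyclic $2\mathsf{FC[REG]}$-CQ $\Psi$ and a word $w\in\Sigma^*$, enumerates $[\![\Psi]\!](w)$, every tuple exactly once, with delay $O\big(|\Psi|^2(|w|+1)^3\big)$: the time before the first result, between two consecutive results, and between the last result and termination (or the whole running time if there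 is no result) is bounded by this. The constants may depend on $\Sigma$, but not on $\Psi$, on $w$ or on the word size. For $|w|\ge1$ the bounds are $O(|\Psi|^2|w|^3)$. -/

import Mathlib

namespace FC

/-! ### Conjunctive queries of the logic FC with regular constraints -/

/-- Words over the terminal alphabet `{0, …, k-1}`. -/
abbrev Word (k : ℕ) := List (Fin k)

/-- The infinite set of variables. -/
abbrev Variable := ℕ

/-- The universe variable, which always stands for the input word. -/
def univVar : Variable := 0

/-- The symbols of a pattern: terminal letters and variables. -/
inductive Sym (k : ℕ) where
  | letter (a : Fin k)
  | var (x : Variable)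

/-- Atoms: a word equation `x ≐ α` whose left side is a variable and whose right side is a
pattern, or a regular constraint `x ∈ γ` with a regular expression `γ`. -/
inductive Atom (k : ℕ) where
  | eqn (x : Variable) (α : List (Sym k))
  | mem (x : Variable) (γ : RegularExpression (Fin k))

/-- The variables of an atom. The universe variable is treated as a constant: by convention it
is not counted. -/
def Atom.vars {k : ℕ} : Atom k → Set Variable
  | .eqn x α => {y | y ≠ univVar ∧ (y = x ∨ Sym.var y ∈ α)}
  | .mem x _ => {y | y ≠ univVar ∧ y = x}

/-- A conjunctive query `Ans(head) ← ⋀ body`. The head is the tuple of the free variables; all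
other variables of the body are existentially quantified. -/
structure RegCQ (k : ℕ) where
  head : List Variable
  body : List (Atom k)
  head_nodup : head.Nodup
  head_free : ∀ x ∈ head, ∃ χ ∈ body, x ∈ χ.vars

/-- A pattern substitution, given by its values on the variables. -/
abbrev Subst (k : ℕ) := Variable → Word k

/-- The value of a pattern under the morphism that extends `σ` and fixes the letters. -/
def Subst.apply {k : ℕ} (σ : Subst k) (α : List (Sym k)) : Word k :=
  α.flatMap fun s => match s with
    | .letter a => [a]
    | .var x => σ x

/-- `σ ⊨ χ` for an atom `χ`; here `u <:+: v` says that `u` is a factor of `v`. -/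
def Atom.Sat {k : ℕ} (σ : Subst k) (χ : Atom k) : Prop :=
  (match χ with
    | .eqn x α => σ x = σ.apply α
    | .mem x γ => σ x ∈ γ.matches') ∧
  ∀ y ∈ χ.vars, σ y <:+: σ univVar

/-- `σ ⊨ Ψ`: the quantified variables, that is, the variables of the body outside the head, can
be reassigned to factors of `σ univVar` such that every atom becomes true. -/
def RegCQ.Sat {k : ℕ} (σ : Subst k) (Ψ : RegCQ k) : Prop :=
  ∃ τ : Subst k,
    (∀ y, τ y ≠ σ y → y ∉ Ψ.head ∧ (∃ χ ∈ Ψ.body, y ∈ χ.vars) ∧ τ y <:+: σ univVar) ∧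
    ∀ χ ∈ Ψ.body, χ.Sat τ

/-- The result `⟦Ψ⟧(w)`: the tuples `σ(head)` for the `σ ⊨ Ψ` that send the universe variable
to `w`. -/
def RegCQ.results {k : ℕ} (Ψ : RegCQ k) (w : Word k) : Set (List (Word k)) :=
  {t | ∃ σ : Subst k, σ univVar = w ∧ Ψ.Sat σ ∧ t = Ψ.head.map σ}

/-- Every word equation has a right side of length at most two. -/
def RegCQ.IsBinary {k : ℕ} (Ψ : RegCQ k) : Prop :=
  ∀ x α, Atom.eqn x α ∈ Ψ.body → α.length ≤ 2

/-- `T` is a join tree of `Ψ`: a tree on the set of the atoms of `Ψ` such that a variable of two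
atoms occurs in every atom on the path between them. -/
def RegCQ.IsJoinTree {k : ℕ} (Ψ : RegCQ k) (T : SimpleGraph {χ : Atom k // χ ∈ Ψ.body}) : Prop :=
  T.IsTree ∧
  ∀ (χ₁ χ₂ : {χ : Atom k // χ ∈ Ψ.body}) (p : T.Walk χ₁ χ₂), p.IsPath →
    ∀ x, x ∈ χ₁.1.vars → x ∈ χ₂.1.vars → ∀ χ ∈ p.support, x ∈ χ.1.vars

/-- A query is acyclic if it has a join tree. -/
def RegCQ.IsAcyclic {k : ℕ} (Ψ : RegCQ k) : Prop :=
  ∃ T, Ψ.IsJoinTree T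

/-! ### Sizes and the encoding of the input -/

/-- The number of symbols of a regular expression. -/
def regexSize {k : ℕ} : RegularExpression (Fin k) → ℕ
  | .zero => 1
  | .epsilon => 1
  | .char _ => 1
  | .plus p q => regexSize p + regexSize q + 1
  | .comp p q => regexSize p + regexSize q + 1
  | .star p => regexSize p + 1

/-- The length of an atom. -/
def Atom.size {k : ℕ} : Atom k → ℕ
  | .eqn _ α => 1 + α.length
  | .mem _ γ => 1 + regexSize γ

/-- The size `|Ψ|` of a query. -/
def RegCQ.size {k : ℕ} (Ψ : RegCQ k) : ℕ :=
  Ψ.head.length + (Ψ.body.map Atom.size).sum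

/-- A regular expression in postfix notation. -/
def encodeRegex {k : ℕ} : RegularExpression (Fin k) → List ℕ
  | .zero => [0]
  | .epsilon => [1]
  | .char a => [2, a]
  | .plus p q => encodeRegex p ++ encodeRegex q ++ [3]
  | .comp p q => encodeRegex p ++ encodeRegex q ++ [4]
  | .star p => encodeRegex p ++ [5]

def encodeSym {k : ℕ} : Sym k → List ℕ
  | .letter a => [0, a]
  | .var x => [1, x]

/-- An atom: a tag, the variable on the left, the length of the right side, the right side. -/
def encodeAtom {k : ℕ} : Atom k → List ℕ
  | .eqn x α => [0, x, α.length] ++ α.flatMap encodeSym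
  | .mem x γ => [1, x, (encodeRegex γ).length] ++ encodeRegex γ

/-- The input that consists of a query and a word, as a sequence of machine words. -/
def encode {k : ℕ} (Ψ : RegCQ k) (w : Word k) : List ℕ :=
  [Ψ.head.length] ++ Ψ.head ++
  [Ψ.body.length] ++ Ψ.body.flatMap encodeAtom ++
  [w.length] ++ w.map (fun a => (a : ℕ))

/-! ### Random access machines with uniform cost -/

/-- The instructions. A machine has registers, named by numbers in the program, and a memory,
whose cells are addressed by the contents of registers. -/
inductive Instr where
  | const (d n : ℕ)
  | copy (d a : ℕ)
  | add (d a b : ℕ)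
  | sub (d a b : ℕ)
  | mul (d a b : ℕ)
  | div (d a b : ℕ)
  | load (d a : ℕ)
  | store (a b : ℕ)
  | jump (l : ℕ)
  | jzero (a l : ℕ)
  | write (a : ℕ)
  | emit

/-- A program is a finite list of instructions. -/
abbrev Program := List Instr

/-- A configuration. The output device collects words in `buffer`; emitting turns the content of
the buffer into the next entry of `emitted`, the list of the results output so far. -/
structure Config where
  pc : ℕ
  reg : ℕ → ℕ
  mem : ℕ → ℕ
  buffer : List ℕ
  emitted : List (List ℕ)

/-- Write `v` into register `d`, reduced to `W` bits, and go on to the next instruction. -/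
def Config.set (W : ℕ) (c : Config) (d v : ℕ) : Config :=
  { c with pc := c.pc + 1, reg := Function.update c.reg d (v % 2 ^ W) }

/-- The effect of one instruction on a machine with words of `W` bits. Subtraction is truncated
at `0`, division is integer division. -/
def Instr.exec (W : ℕ) (c : Config) : Instr → Config
  | .const d n => c.set W d n
  | .copy d a => c.set W d (c.reg a)
  | .add d a b => c.set W d (c.reg a + c.reg b)
  | .sub d a b => c.set W d (c.reg a - c.reg b)
  | .mul d a b => c.set W d (c.reg a * c.reg b)
  | .div d a b => c.set W d (c.reg a / c.reg b)
  | .load d a => c.set W d (c.mem (c.reg a))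
  | .store a b => { c with pc := c.pc + 1, mem := Function.update c.mem (c.reg a) (c.reg b) }
  | .jump l => { c with pc := l }
  | .jzero a l => { c with pc := if c.reg a = 0 then l else c.pc + 1 }
  | .write a => { c with pc := c.pc + 1, buffer := c.buffer ++ [c.reg a] }
  | .emit => { c with pc := c.pc + 1, buffer := [], emitted := c.emitted ++ [c.buffer] }

/-- The machine halts when the program counter leaves the program. -/
def Program.Halted (P : Program) (c : Config) : Prop :=
  P.length ≤ c.pc

/-- One step, which costs one unit of time; a halted machine does not change any more. -/
def Program.step (P : Program) (W : ℕ) (c : Config) : Config :=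
  match P[c.pc]? with
  | some i => i.exec W c
  | none => c

/-- At the start the input is in the memory, its length is in register `0`, and everything else
is zero or empty. -/
def initial (input : List ℕ) : Config where
  pc := 0
  reg := Function.update (fun _ => 0) 0 input.length
  mem := fun i => input.getD i 0
  buffer := []
  emitted := []

/-- The configuration after `t` steps. -/
def Program.run (P : Program) (W : ℕ) (input : List ℕ) (t : ℕ) : Config :=
  (P.step W)^[t] (initial input)

/-- Words of `W` bits suffice for the input, and `W` is at least `c` times the logarithm of the
size of the input. -/
def WordSize (c W : ℕ) (input : List ℕ) : Prop :=
  (input.length + 2) ^ c ≤ 2 ^ W ∧ ∀ n ∈ input, n < 2 ^ W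

/-- Within `T` steps the program halts with the truth value of `A` in register `0`. -/
def Program.DecidesIn (P : Program) (W : ℕ) (input : List ℕ) (T : ℕ) (A : Prop) : Prop :=
  P.Halted (P.run W input T) ∧
  (A → (P.run W input T).reg 0 = 1) ∧
  (¬ A → (P.run W input T).reg 0 = 0)

/-- The program enumerates the set `S` with delay `D`: it halts after it has output a
representation (in the sense of `rep`) of every element of `S` exactly once and of nothing else,
and whenever it has run for some time, it outputs another result or is found halted within `D`
further steps. So at most `D` steps pass before the first result, between two consecutive
results, and between the last result and termination. -/
def Program.EnumeratesWithDelay {R : Type} (P : Program) (W : ℕ) (input : List ℕ) (D : ℕ)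
    (rep : List ℕ → R → Prop) (S : Set R) : Prop :=
  (∃ T, P.Halted (P.run W input T) ∧
    ∃ out : List R, List.Forall₂ rep (P.run W input T).emitted out ∧
      out.Nodup ∧ ∀ r, r ∈ out ↔ r ∈ S) ∧
  ∀ t, P.Halted (P.run W input (t + D)) ∨
    (P.run W input t).emitted.length < (P.run W input (t + D)).emitted.length

/-- Factors of `w` are output as spans: the sequence `i₁, j₁, i₂, j₂, …` represents the tuple of
the factors `w_{[i₁,j₁⟩}, w_{[i₂,j₂⟩}, …`, where `w_{[i,j⟩} = w_i ⋯ w_{j-1}` and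
`1 ≤ i ≤ j ≤ |w| + 1`. -/
def RepresentsTuple {k : ℕ} (w : Word k) : List ℕ → List (Word k) → Prop
  | [], [] => True
  | i :: j :: b, u :: t =>
      (1 ≤ i ∧ i ≤ j ∧ j ≤ w.length + 1 ∧ u = (w.drop (i - 1)).take (j - i)) ∧
        RepresentsTuple w b t
  | _, _ => False

end FC

/-!
Both programs are the machine code of programs in a small imperative language with scalar variables,
arrays, bounded loops and a bounded search operator. The compiler is proved correct once and for all
(`Expr.evaluates`, `Cmd.runs`). Running times are bounded statically: the number of the iterations
of a loop is a constant, the number `n = |w| + 1` of the positions of `w`, or one of the parameters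
of the query, all at most `S = 5 * |Ψ|`. So the running time of a program without recursion is
bounded by a monomial `k * S ^ a * n ^ b` that can be read off from its text (`Expr.cost`,
`Cmd.cost`), and `a ≤ 2`, `b ≤ 3` are checked by evaluation. The array cells of a state, with at most
six indices each, are laid out in the memory in Horner form, which needs only a word size that is a
constant multiple of the logarithm of the input size.

The algorithm rests on the observation that an atom `x ≐ y z` of a query is determined by a triple
`(i, p, q)` of positions: `x` is the factor of `w` with start `i` and length `p + q`, and `y` and `z`
are its first `p` letters and the rest (`Atom.sat_iff`). So each atom is a relation with at most
`n ^ 3` tuples. Factors are compared in constant time by the start of their first occurrence and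
their length, which are tabulated for all factors; the truth of the regular constraints is tabulated
as well, by evaluating each regular expression in postfix notation on a stack of tables.

A join tree of an acyclic query is found by Prim's algorithm for a spanning tree of the atoms, where
the weight of an edge is the number of the variables that its ends share. That this works is
`GT.prim`: a set of atoms from which a join tree can be grown keeps this property if one adds a
heaviest edge that leaves it. Semijoins along the tree edges, to the root and back, then reduce the
relations until every remaining tuple belongs to a solution of the whole query (`reduce_extend`,
`mem_reduce`); a semijoin takes time `O(n ^ 3)`, by marking the cells of the common values. In
particular, there is a result if and only if a reduced relation is not empty.

The results are enumerated in the lexicographic order of the numbers of their entries. To find the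
successor of a result, the program looks for the last entry that can be increased while the entries
before it are kept, increases it as little as possible, and chooses the entries behind it greedily
(`not_lexLt_succ`). For each entry this requires one reduction of the relations in which the
preceding entries are prescribed. Together these are at most `2 * |Ψ|` reductions with
`O(|Ψ|)` semijoins each, which gives the delay `O(|Ψ| ^ 2 * n ^ 3)`.
-/

namespace FC

/-! ### A small imperative language -/

/-- The least `k < B` with `p k`, and `B` if there is none. -/
noncomputable def lb (B : ℕ) (p : ℕ → Prop) : ℕ :=
  open Classical in Nat.find (p := fun k => k = B ∨ p k) ⟨B, .inl rfl⟩

theorem lb_le (B : ℕ) (p : ℕ → Prop) : lb B p ≤ B := by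
  classical
  exact Nat.find_min' _ (.inl rfl)

theorem lb_spec {B : ℕ} {p : ℕ → Prop} (h : lb B p < B) : p (lb B p) := by
  classical
  have := Nat.find_spec (p := fun k => k = B ∨ p k) ⟨B, .inl rfl⟩
  rcases this with h' | h'
  · exact absurd h' h.ne
  · exact h'

theorem not_of_lt_lb {B k : ℕ} {p : ℕ → Prop} (h : k < lb B p) : ¬ p k := by
  classical
  have := Nat.find_min (p := fun k => k = B ∨ p k) ⟨B, .inl rfl⟩ h
  exact fun hp => this (.inr hp)

theorem lb_le_of {B k : ℕ} {p : ℕ → Prop} (h : p k) : lb B p ≤ k := by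
  classical
  exact Nat.find_min' _ (.inr h)

theorem lb_lt_iff {B : ℕ} {p : ℕ → Prop} : lb B p < B ↔ ∃ k < B, p k :=
  ⟨fun h => ⟨_, h, lb_spec h⟩, fun ⟨_, h, hp⟩ => (lb_le_of hp).trans_lt h⟩

theorem lb_eq {B k : ℕ} {p : ℕ → Prop} (h : p k ∨ k = B) (hB : k ≤ B) (h' : ∀ j < k, ¬ p j) :
    lb B p = k := by
  apply le_antisymm
  · rcases h with h | rfl
    · exact lb_le_of h
    · exact lb_le _ _
  · by_contra hlt
    push Not at hlt
    exact h' _ hlt (lb_spec (hlt.trans_le hB))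

theorem lb_congr {B : ℕ} {p q : ℕ → Prop} (h : ∀ k < B, (p k ↔ q k)) : lb B p = lb B q := by
  apply lb_eq
  · rcases (lb_le B q).lt_or_eq with hl | hl
    · exact .inl ((h _ hl).2 (lb_spec hl))
    · exact .inr hl
  · exact lb_le _ _
  · exact fun j hj hp => not_of_lt_lb hj ((h _ (hj.trans_le (lb_le _ _))).1 hp)

/-- The environment of a computation: all values of the language are less than `N`, and `inp i`
is the word at position `i` of the input. -/
structure Ctx where
  N : ℕ
  inp : ℕ → ℕ

/-- A state: scalar variables, arrays whose cells are addressed by lists of indices, and the words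
written so far. -/
structure State where
  reg : ℕ → ℕ
  arr : ℕ → List ℕ → ℕ
  out : List ℕ

/-- Assignment to a scalar variable. -/
def State.set (s : State) (r v : ℕ) : State :=
  { s with reg := Function.update s.reg r v }

/-- Assignment to a cell of an array. -/
def State.put (s : State) (a : ℕ) (l : List ℕ) (v : ℕ) : State :=
  { s with arr := Function.update s.arr a (Function.update (s.arr a) l v) }

/-- Expressions. A value counts as true if it is not zero. Sums and input words saturate at `N - 1`;
`inpEq a b` compares the input words at the positions `a` and `b`; `find x b e` is the least value
`x < b` that makes `e` true, and `b` if there is none. -/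
inductive Expr where
  | const (n : ℕ)
  | reg (r : ℕ)
  | add (a b : Expr)
  | sub (a b : Expr)
  | ite (c a b : Expr)
  | inp (e : Expr)
  | inpEq (a b : Expr)
  | arr (a : ℕ) (e₁ e₂ e₃ e₄ e₅ e₆ : Expr)
  | find (x : ℕ) (b e : Expr)

open Classical in
/-- The value of an expression in a state. -/
noncomputable def Expr.denote (Γ : Ctx) : Expr → State → ℕ
  | .const n, _ => n
  | .reg r, s => s.reg r
  | .add a b, s => min (a.denote Γ s + b.denote Γ s) (Γ.N - 1)
  | .sub a b, s => a.denote Γ s - b.denote Γ s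
  | .ite c a b, s => if c.denote Γ s ≠ 0 then a.denote Γ s else b.denote Γ s
  | .inp e, s => min (Γ.inp (e.denote Γ s)) (Γ.N - 1)
  | .inpEq a b, s => if Γ.inp (a.denote Γ s) = Γ.inp (b.denote Γ s) then 1 else 0
  | .arr a e₁ e₂ e₃ e₄ e₅ e₆, s => s.arr a [e₁.denote Γ s, e₂.denote Γ s, e₃.denote Γ s,
      e₄.denote Γ s, e₅.denote Γ s, e₆.denote Γ s]
  | .find x b e, s => lb (b.denote Γ s) fun k => e.denote Γ (s.set x k) ≠ 0

/-- Commands. The loop `loop x b c` runs `c` for `x = 0, …, b - 1`, where `b` is evaluated once at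
the start; the variable `x` is local to each iteration. -/
inductive Cmd where
  | skip
  | assign (r : ℕ) (e : Expr)
  | store (a : ℕ) (e₁ e₂ e₃ e₄ e₅ e₆ e : Expr)
  | seq (c d : Cmd)
  | ite (e : Expr) (c d : Cmd)
  | loop (x : ℕ) (b : Expr) (c : Cmd)
  | write (e : Expr)

/-- Apply `f 0`, …, `f (n - 1)` in turn. -/
def iter {α : Type*} (f : ℕ → α → α) : ℕ → α → α
  | 0, s => s
  | n + 1, s => f n (iter f n s)

open Classical in
/-- The effect of a command on a state. -/
noncomputable def Cmd.eval (Γ : Ctx) : Cmd → State → State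
  | .skip, s => s
  | .assign r e, s => s.set r (e.denote Γ s)
  | .store a e₁ e₂ e₃ e₄ e₅ e₆ e, s => s.put a [e₁.denote Γ s, e₂.denote Γ s, e₃.denote Γ s,
      e₄.denote Γ s, e₅.denote Γ s, e₆.denote Γ s] (e.denote Γ s)
  | .seq c d, s => d.eval Γ (c.eval Γ s)
  | .ite e c d, s => if e.denote Γ s ≠ 0 then c.eval Γ s else d.eval Γ s
  | .loop x b c, s =>
      iter (fun k s' => (c.eval Γ (s'.set x k)).set x (s'.reg x)) (b.denote Γ s) s
  | .write e, s => { s with out := s.out ++ [e.denote Γ s] }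

/-! ### Static cost bounds -/

/-- A monomial `k * S ^ a * n ^ b`, an upper bound for running times. -/
structure Bd where
  k : ℕ
  a : ℕ
  b : ℕ

/-- The value of the bound for given `S` and `n`. -/
def Bd.val (S n : ℕ) (x : Bd) : ℕ := x.k * S ^ x.a * n ^ x.b

/-- A monomial that bounds a sum of monomials. -/
def Bd.add (x y : Bd) : Bd := ⟨x.k + y.k, max x.a y.a, max x.b y.b⟩

/-- The product of monomials. -/
def Bd.mul (x y : Bd) : Bd := ⟨x.k * y.k, x.a + y.a, x.b + y.b⟩

/-- The constant bound. -/
def Bd.c (k : ℕ) : Bd := ⟨k, 0, 0⟩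

theorem Bd.val_add {S n : ℕ} (hS : 1 ≤ S) (hn : 1 ≤ n) (x y : Bd) :
    x.val S n + y.val S n ≤ (x.add y).val S n := by
  simp only [Bd.val, Bd.add, add_mul]
  gcongr <;> first | exact hS | exact hn | simp

theorem Bd.val_mul {S n : ℕ} (x y : Bd) : (x.mul y).val S n = x.val S n * y.val S n := by
  simp only [Bd.val, Bd.mul, pow_add]; ring

@[simp] theorem Bd.val_c {S n k : ℕ} : (Bd.c k).val S n = k := by simp [Bd.val, Bd.c]

/-- A bound for the value of an expression that is used as a loop bound. The scalar variable `0` is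
bounded by `n`, the variables `1`, `2`, `3` are bounded by `S`. -/
def Expr.bmax : Expr → Bd
  | .const n => Bd.c n
  | .reg 0 => ⟨1, 0, 1⟩
  | .reg _ => ⟨1, 1, 0⟩
  | .sub a _ => a.bmax
  | _ => Bd.c 0

/-- The expressions that are allowed as loop bounds: their values are at most linear in `S` or `n`,
and they do not change during a loop. -/
def Expr.isBound : Expr → Bool
  | .const _ => true
  | .reg r => decide (r < 4)
  | .sub a b => a.isBound && b.isBound
  | _ => false

/-- Well-formed expressions: constants are small, arrays have numbers below `32`, the variables
that serve as loop bounds are not changed. -/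
def Expr.ok : Expr → Bool
  | .const n => decide (n < 8)
  | .reg _ => true
  | .add a b | .sub a b | .inpEq a b => a.ok && b.ok
  | .ite c a b => c.ok && a.ok && b.ok
  | .inp e => e.ok
  | .arr a e₁ e₂ e₃ e₄ e₅ e₆ =>
      decide (a < 32) && e₁.ok && e₂.ok && e₃.ok && e₄.ok && e₅.ok && e₆.ok
  | .find x b e => decide (4 ≤ x) && b.ok && b.isBound && e.ok

/-- Well-formed commands: the variables `0`, …, `3` that bound the loops are never assigned. -/
def Cmd.ok : Cmd → Bool
  | .skip => true
  | .assign r e => decide (4 ≤ r) && e.ok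
  | .store a e₁ e₂ e₃ e₄ e₅ e₆ e =>
      decide (a < 32) && e₁.ok && e₂.ok && e₃.ok && e₄.ok && e₅.ok && e₆.ok && e.ok
  | .seq c d => c.ok && d.ok
  | .ite e c d => e.ok && c.ok && d.ok
  | .loop x b c => decide (4 ≤ x) && b.ok && b.isBound && c.ok
  | .write e => e.ok

/-- The number of machine steps for the code of an expression. A loop costs the product of the bound
for the number of its iterations and the cost of its body. -/
def Expr.cost : Expr → Bd
  | .const _ => Bd.c 1
  | .reg _ => Bd.c 1
  | .add a b => (a.cost.add b.cost).add (Bd.c 3)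
  | .sub a b => (a.cost.add b.cost).add (Bd.c 1)
  | .ite c a b => ((c.cost.add a.cost).add b.cost).add (Bd.c 2)
  | .inp e => e.cost.add (Bd.c 3)
  | .inpEq a b => (a.cost.add b.cost).add (Bd.c 7)
  | .arr _ e₁ e₂ e₃ e₄ e₅ e₆ =>
      ((((((e₁.cost.add e₂.cost).add e₃.cost).add e₄.cost).add e₅.cost).add e₆.cost).add
        (Bd.c 19))
  | .find _ b e => (b.cost.add (Bd.c 6)).add (b.bmax.mul (e.cost.add (Bd.c 7)))

/-- The number of machine steps for the code of a command. -/
def Cmd.cost : Cmd → Bd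
  | .skip => Bd.c 0
  | .assign _ e => e.cost.add (Bd.c 1)
  | .store _ e₁ e₂ e₃ e₄ e₅ e₆ e =>
      (((((((e₁.cost.add e₂.cost).add e₃.cost).add e₄.cost).add e₅.cost).add e₆.cost).add
        (Bd.c 19)).add e.cost).add (Bd.c 1)
  | .seq c d => c.cost.add d.cost
  | .ite e c d => ((e.cost.add c.cost).add d.cost).add (Bd.c 2)
  | .loop _ b c => (b.cost.add (Bd.c 4)).add (b.bmax.mul (c.cost.add (Bd.c 7)))
  | .write e => e.cost.add (Bd.c 1)

/-! ### Compilation -/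

/-- Horner steps for the address of an array cell: multiply the register `2 * t` by the number of
values and add the register `2 * t + 2`. -/
def hornerCode (t : ℕ) : List Instr :=
  [.mul (2 * t) (2 * t) 2, .add (2 * t) (2 * t) (2 * t + 2)]

/-- Code that turns the number of a cell, in register `2 * t`, into its address. -/
def addrCode (a t : ℕ) : List Instr :=
  [.const (2 * t + 2) 32, .mul (2 * t) (2 * t) (2 * t + 2), .const (2 * t + 2) a,
    .add (2 * t) (2 * t) (2 * t + 2), .add (2 * t) (2 * t) 2]

/-- Code that reduces the register `2 * t` to `N - 1`. -/
def clampCode (t : ℕ) : List Instr :=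
  [.sub (2 * t + 2) (2 * t) 0, .sub (2 * t) (2 * t) (2 * t + 2)]

/-- Code for a cell address, from code generators for the indices. -/
def cellCode (a : ℕ) (t : ℕ) : List (ℕ → List Instr) → ℕ → List Instr
  | [], _ => addrCode a t
  | f :: fs, o => f o ++ hornerCode t ++ cellCode a t fs (o + (f o).length + 2)

/-- The code of an expression at position `o` of a program. The variable `r` of the language is the
register `2 * r + 1`. The value goes to the register `2 * t`; the even registers below are kept. -/
def Expr.code : Expr → ℕ → ℕ → List Instr
  | .const n, _, t => [.const (2 * t) n]
  | .reg r, _, t => [.copy (2 * t) (2 * r + 1)]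
  | .add a b, o, t =>
      a.code o t ++ b.code (o + (a.code o t).length) (t + 1) ++
        .add (2 * t) (2 * t) (2 * t + 2) :: clampCode t
  | .sub a b, o, t =>
      a.code o t ++ b.code (o + (a.code o t).length) (t + 1) ++
        [.sub (2 * t) (2 * t) (2 * t + 2)]
  | .ite c a b, o, t =>
      let c₁ := c.code o t
      let c₂ := a.code (o + c₁.length + 1) t
      let o₃ := o + c₁.length + 1 + c₂.length + 1
      let c₃ := b.code o₃ t
      c₁ ++ .jzero (2 * t) o₃ :: c₂ ++ .jump (o₃ + c₃.length) :: c₃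
  | .inp e, o, t => e.code o t ++ .load (2 * t) (2 * t) :: clampCode t
  | .inpEq a b, o, t =>
      a.code o t ++ b.code (o + (a.code o t).length) (t + 1) ++
        [.load (2 * t) (2 * t), .load (2 * t + 2) (2 * t + 2),
          .sub (2 * t + 4) (2 * t) (2 * t + 2), .sub (2 * t) (2 * t + 2) (2 * t),
          .add (2 * t + 2) (2 * t) (2 * t + 4), .const (2 * t) 1,
          .sub (2 * t) (2 * t) (2 * t + 2)]
  | .arr a e₁ e₂ e₃ e₄ e₅ e₆, o, t =>
      .const (2 * t) 0 :: cellCode a t [fun o => e₁.code o (t + 1), fun o => e₂.code o (t + 1),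
        fun o => e₃.code o (t + 1), fun o => e₄.code o (t + 1), fun o => e₅.code o (t + 1),
        fun o => e₆.code o (t + 1)] (o + 1) ++ [.load (2 * t) (2 * t)]
  | .find x b e, o, t =>
      let c₁ := b.code o t
      let o₁ := o + c₁.length + 2
      let c₂ := e.code (o₁ + 2) (t + 2)
      let o₂ := o₁ + 2 + c₂.length + 2
      c₁ ++ .copy (2 * t + 2) (2 * x + 1) :: .const (2 * x + 1) 0 ::
        .sub (2 * t + 4) (2 * t) (2 * x + 1) :: .jzero (2 * t + 4) (o₂ + 3) ::
        c₂ ++ .jzero (2 * t + 4) o₂ :: .jump (o₂ + 3) ::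
        .const (2 * t + 4) 1 :: .add (2 * x + 1) (2 * x + 1) (2 * t + 4) :: .jump o₁ ::
        [.copy (2 * t) (2 * x + 1), .copy (2 * x + 1) (2 * t + 2)]

/-- The code of a command at position `o` of a program. It uses the even registers from `2 * t` on.
-/
def Cmd.code : Cmd → ℕ → ℕ → List Instr
  | .skip, _, _ => []
  | .assign r e, o, t => e.code o t ++ [.copy (2 * r + 1) (2 * t)]
  | .store a e₁ e₂ e₃ e₄ e₅ e₆ e, o, t =>
      let c₁ := .const (2 * t) 0 :: cellCode a t [fun o => e₁.code o (t + 1),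
        fun o => e₂.code o (t + 1), fun o => e₃.code o (t + 1), fun o => e₄.code o (t + 1),
        fun o => e₅.code o (t + 1), fun o => e₆.code o (t + 1)] (o + 1)
      c₁ ++ e.code (o + c₁.length) (t + 1) ++ [.store (2 * t) (2 * t + 2)]
  | .seq c d, o, t => c.code o t ++ d.code (o + (c.code o t).length) t
  | .ite e c d, o, t =>
      let c₁ := e.code o t
      let c₂ := c.code (o + c₁.length + 1) t
      let o₃ := o + c₁.length + 1 + c₂.length + 1
      let c₃ := d.code o₃ t
      c₁ ++ .jzero (2 * t) o₃ :: c₂ ++ .jump (o₃ + c₃.length) :: c₃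
  | .loop x b c, o, t =>
      let c₁ := b.code o t
      let o₁ := o + c₁.length + 2
      let c₂ := c.code (o₁ + 5) (t + 3)
      c₁ ++ .copy (2 * t + 4) (2 * x + 1) :: .const (2 * t + 2) 0 ::
        .sub (2 * t + 6) (2 * t) (2 * t + 2) :: .jzero (2 * t + 6) (o₁ + 5 + c₂.length + 2) ::
        .copy (2 * x + 1) (2 * t + 2) :: .const (2 * t + 6) 1 ::
        .add (2 * t + 2) (2 * t + 2) (2 * t + 6) :: c₂ ++
        [.copy (2 * x + 1) (2 * t + 4), .jump o₁]
  | .write e, o, t => e.code o t ++ [.write (2 * t)]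

/-! ### Simulation -/

/-- The instructions `l` stand at position `o` of the program. -/
def CodeAt (P : Program) : ℕ → List Instr → Prop
  | _, [] => True
  | o, i :: l => P[o]? = some i ∧ CodeAt P (o + 1) l

@[simp] theorem codeAt_nil {P : Program} {o : ℕ} : CodeAt P o [] := trivial

@[simp] theorem codeAt_cons {P : Program} {o : ℕ} {i : Instr} {l : List Instr} :
    CodeAt P o (i :: l) ↔ P[o]? = some i ∧ CodeAt P (o + 1) l := Iff.rfl

@[simp] theorem codeAt_append {P : Program} {o : ℕ} {l₁ l₂ : List Instr} :
    CodeAt P o (l₁ ++ l₂) ↔ CodeAt P o l₁ ∧ CodeAt P (o + l₁.length) l₂ := by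
  induction l₁ generalizing o with
  | nil => simp
  | cons i l ih => simp [ih, and_assoc, add_assoc, add_comm 1]

theorem codeAt_self (A l B : List Instr) : CodeAt (A ++ l ++ B) A.length l := by
  induction l generalizing A with
  | nil => trivial
  | cons i l ih =>
    refine ⟨by simp, ?_⟩
    have := ih (A ++ [i])
    simpa using this

/-- The machine reaches `c'` from `c` in at most `K` steps. -/
def Steps (P : Program) (W K : ℕ) (c c' : Config) : Prop := ∃ k ≤ K, (P.step W)^[k] c = c'

theorem Steps.refl {P : Program} {W : ℕ} (c : Config) : Steps P W 0 c c := ⟨0, le_rfl, rfl⟩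

theorem Steps.mono {P : Program} {W K K' : ℕ} {c c' : Config} (h : Steps P W K c c')
    (hK : K ≤ K') : Steps P W K' c c' :=
  let ⟨k, hk, e⟩ := h
  ⟨k, hk.trans hK, e⟩

theorem Steps.trans {P : Program} {W K₁ K₂ : ℕ} {c₁ c₂ c₃ : Config} (h₁ : Steps P W K₁ c₁ c₂)
    (h₂ : Steps P W K₂ c₂ c₃) : Steps P W (K₁ + K₂) c₁ c₃ := by
  obtain ⟨k₁, hk₁, e₁⟩ := h₁
  obtain ⟨k₂, hk₂, e₂⟩ := h₂
  refine ⟨k₂ + k₁, by omega, ?_⟩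
  rw [Function.iterate_add_apply, e₁, e₂]

theorem step_eq {P : Program} {W : ℕ} {c : Config} {i : Instr} (h : P[c.pc]? = some i) :
    P.step W c = i.exec W c := by
  simp [Program.step, h]

theorem Steps.cons {P : Program} {W K : ℕ} {c c' : Config} {i : Instr} (h : P[c.pc]? = some i)
    (h' : Steps P W K (i.exec W c) c') : Steps P W (K + 1) c c' := by
  have : Steps P W 1 c (i.exec W c) := ⟨1, le_rfl, step_eq h⟩
  exact (this.trans h').mono (by omega)

/-- The number of a cell of an array. -/
def cellNum (N : ℕ) (l : List ℕ) : ℕ := l.foldl (fun acc x => acc * N + x) 0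

/-- The address of a cell of the array `a`. -/
def addr (N a : ℕ) (l : List ℕ) : ℕ := cellNum N l * 32 + a + N

theorem cellNum_inj {N : ℕ} {l l' : List ℕ} (hl : l.length = l'.length)
    (h : ∀ x ∈ l, x < N) (h' : ∀ x ∈ l', x < N) (e : cellNum N l = cellNum N l') : l = l' := by
  induction l using List.reverseRecOn generalizing l' with
  | nil => simpa using hl.symm
  | append_singleton l x ih =>
    rcases List.eq_nil_or_concat l' with rfl | ⟨l', y, rfl⟩
    · simp at hl
    · simp only [cellNum, List.foldl_append, List.foldl_cons, List.foldl_nil,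
        List.concat_eq_append] at e h' hl ⊢
      have hx := h x (by simp)
      have hy := h' y (by simp)
      have h1 : x = y := by
        have := congrArg (· % N) e
        simpa [Nat.add_mod, Nat.mod_eq_of_lt hx, Nat.mod_eq_of_lt hy] using this
      subst h1
      have h2 : cellNum N l = cellNum N l' :=
        Nat.eq_of_mul_eq_mul_right (by omega : 0 < N) (Nat.add_right_cancel e)
      rw [ih (by simpa using hl) (fun z hz => h z (by simp [hz]))
        (fun z hz => h' z (by simp [hz])) h2]

theorem addr_inj {N a a' : ℕ} {l l' : List ℕ} (ha : a < 32) (ha' : a' < 32)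
    (hl : l.length = l'.length) (h : ∀ x ∈ l, x < N) (h' : ∀ x ∈ l', x < N)
    (e : addr N a l = addr N a' l') : a = a' ∧ l = l' := by
  unfold addr at e
  have h1 : a = a' := by omega
  exact ⟨h1, cellNum_inj hl h h' (by omega)⟩

/-- The assumptions on the word size. -/
structure Fits (Γ : Ctx) (W : ℕ) : Prop where
  eight_le : 8 ≤ Γ.N
  big : 64 * Γ.N ^ 6 ≤ 2 ^ W
  inp_lt : ∀ i < Γ.N, Γ.inp i < 2 ^ W

/-- All values are less than `N`. -/
structure State.Bdd (s : State) (N : ℕ) : Prop where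
  reg : ∀ r, s.reg r < N
  arr : ∀ a l, s.arr a l < N

/-- A configuration of the machine represents a state of the language. -/
structure Rel (Γ : Ctx) (s : State) (c : Config) : Prop where
  bdd : s.Bdd Γ.N
  reg : ∀ r, c.reg (2 * r + 1) = s.reg r
  last : c.reg 0 = Γ.N - 1
  size : c.reg 2 = Γ.N
  inp : ∀ i < Γ.N, c.mem i = Γ.inp i
  arr : ∀ a < 32, ∀ l : List ℕ, l.length = 6 → (∀ x ∈ l, x < Γ.N) →
    c.mem (addr Γ.N a l) = s.arr a l
  out : c.buffer = s.out

/-- The scalar variables that serve as loop bounds are bounded. -/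
structure Small (S n : ℕ) (s : State) : Prop where
  reg0 : s.reg 0 ≤ n
  reg1 : s.reg 1 ≤ S
  reg2 : s.reg 2 ≤ S
  reg3 : s.reg 3 ≤ S

theorem Small.set {S n : ℕ} {s : State} (h : Small S n s) {x v : ℕ} (hx : 4 ≤ x) :
    Small S n (s.set x v) := by
  constructor <;> simp only [State.set] <;> rw [Function.update_of_ne (by omega)]
  exacts [h.reg0, h.reg1, h.reg2, h.reg3]

theorem Expr.denote_le_bmax {Γ : Ctx} {S n : ℕ} {s : State} (h : Small S n s) (e : Expr)
    (he : e.isBound) : e.denote Γ s ≤ e.bmax.val S n := by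
  induction e with
  | const k => simp [denote, bmax]
  | reg r =>
    simp only [isBound, decide_eq_true_eq] at he
    have := h.reg0; have := h.reg1; have := h.reg2; have := h.reg3
    interval_cases r <;> simpa [denote, bmax, Bd.val]
  | sub a b iha ihb =>
    simp only [isBound, Bool.and_eq_true] at he
    simp only [denote, bmax]
    have := iha he.1; omega
  | _ => simp [isBound] at he

theorem State.Bdd.set {s : State} {N x v : ℕ} (h : s.Bdd N) (hv : v < N) : (s.set x v).Bdd N := by
  refine ⟨fun r => ?_, h.arr⟩
  simp only [State.set, Function.update_apply]
  split
  · exact hv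
  · exact h.reg r

theorem State.Bdd.put {s : State} {N a v : ℕ} {l : List ℕ} (h : s.Bdd N) (hv : v < N) :
    (s.put a l v).Bdd N := by
  refine ⟨h.reg, fun a' l' => ?_⟩
  simp only [State.put, Function.update_apply]
  split
  · simp only [Function.update_apply]
    split
    · exact hv
    · exact h.arr _ _
  · exact h.arr _ _

theorem Expr.denote_lt {Γ : Ctx} (hN : 8 ≤ Γ.N) (e : Expr) (he : e.ok) {s : State}
    (hs : s.Bdd Γ.N) : e.denote Γ s < Γ.N := by
  induction e generalizing s with
  | const k => simp [ok] at he; simp only [denote]; omega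
  | reg r => exact hs.reg r
  | add a b iha ihb => simp only [denote]; omega
  | sub a b iha ihb => simp [ok] at he; simp only [denote]; have := iha he.1 hs; omega
  | ite c a b ihc iha ihb =>
    simp [ok] at he
    simp only [denote]
    split
    · exact iha he.1.2 hs
    · exact ihb he.2 hs
  | inp e ih => simp only [denote]; omega
  | inpEq a b iha ihb => simp only [denote]; split <;> omega
  | arr a e₁ e₂ e₃ e₄ e₅ e₆ => exact hs.arr _ _
  | find x b e ihb ihe =>
    simp [ok] at he
    exact (lb_le _ _).trans_lt (ihb he.1.1.2 hs)

theorem iter_inv {α : Type*} {f : ℕ → α → α} {n : ℕ} {s : α} (I : ℕ → α → Prop) (h0 : I 0 s)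
    (h : ∀ k < n, ∀ s', I k s' → I (k + 1) (f k s')) : I n (iter f n s) := by
  induction n with
  | zero => exact h0
  | succ n ih => exact h n (by omega) _ (ih fun k hk => h k (by omega))

theorem Cmd.eval_bdd {Γ : Ctx} (hN : 8 ≤ Γ.N) (c : Cmd) (hc : c.ok) {s : State}
    (hs : s.Bdd Γ.N) : (c.eval Γ s).Bdd Γ.N := by
  induction c generalizing s with
  | skip => exact hs
  | assign r e => simp [ok] at hc; exact hs.set (e.denote_lt hN hc.2 hs)
  | store a e₁ e₂ e₃ e₄ e₅ e₆ e => simp [ok] at hc; exact hs.put (e.denote_lt hN hc.2 hs)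
  | seq c d ihc ihd => simp [ok] at hc; exact ihd hc.2 (ihc hc.1 hs)
  | ite e c d ihc ihd =>
    simp [ok] at hc
    simp only [eval]
    split
    · exact ihc hc.1.2 hs
    · exact ihd hc.2 hs
  | loop x b c ih =>
    simp [ok] at hc
    simp only [eval]
    have hb := b.denote_lt hN hc.1.1.2 hs
    refine iter_inv (fun _ (s : State) => s.Bdd Γ.N) hs fun k hk s' hs' => ?_
    exact (ih hc.2 (hs'.set (by omega))).set (hs'.reg _)
  | write e => exact ⟨hs.reg, hs.arr⟩

/-! ### Frames -/

/-- The scalar variables that a command may change. -/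
def Cmd.regs : Cmd → List ℕ
  | .assign r _ => [r]
  | .seq c d | .ite _ c d => c.regs ++ d.regs
  | .loop _ _ c => c.regs
  | _ => []

/-- The arrays that a command may change. -/
def Cmd.arrs : Cmd → List ℕ
  | .store a _ _ _ _ _ _ _ => [a]
  | .seq c d | .ite _ c d => c.arrs ++ d.arrs
  | .loop _ _ c => c.arrs
  | _ => []

/-- The command may write output. -/
def Cmd.writes : Cmd → Bool
  | .write _ => true
  | .seq c d | .ite _ c d => c.writes || d.writes
  | .loop _ _ c => c.writes
  | _ => false

theorem Cmd.eval_reg {Γ : Ctx} (c : Cmd) (s : State) {r : ℕ} (hr : r ∉ c.regs) :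
    (c.eval Γ s).reg r = s.reg r := by
  induction c generalizing s with
  | skip => rfl
  | assign r' e => simp [regs] at hr; simp [eval, State.set, hr]
  | store => rfl
  | seq c d ihc ihd => simp [regs] at hr; simp only [eval]; rw [ihd _ hr.2, ihc _ hr.1]
  | ite e c d ihc ihd =>
    simp [regs] at hr
    simp only [eval]
    split
    · exact ihc _ hr.1
    · exact ihd _ hr.2
  | loop x b c ih =>
    simp only [eval]
    refine iter_inv (fun _ (s' : State) => s'.reg r = s.reg r) rfl fun k hk s' hs' => ?_
    by_cases h : r = x
    · subst h; simpa [State.set] using hs'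
    · simp only [State.set, Function.update_of_ne h]
      have := ih (s'.set x k) hr
      simp only [State.set, Function.update_of_ne h] at this
      rw [this, hs']
  | write e => rfl

theorem Cmd.eval_arr {Γ : Ctx} (c : Cmd) (s : State) {a : ℕ} (ha : a ∉ c.arrs) :
    (c.eval Γ s).arr a = s.arr a := by
  induction c generalizing s with
  | skip => rfl
  | assign r' e => rfl
  | store a' => simp [arrs] at ha; simp [eval, State.put, ha]
  | seq c d ihc ihd => simp [arrs] at ha; simp only [eval]; rw [ihd _ ha.2, ihc _ ha.1]
  | ite e c d ihc ihd =>
    simp [arrs] at ha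
    simp only [eval]
    split
    · exact ihc _ ha.1
    · exact ihd _ ha.2
  | loop x b c ih =>
    simp only [eval]
    refine iter_inv (fun _ (s' : State) => s'.arr a = s.arr a) rfl fun k hk s' hs' => ?_
    exact (ih (s'.set x k) ha).trans hs'
  | write e => rfl

theorem Cmd.eval_out {Γ : Ctx} (c : Cmd) (s : State) (h : c.writes = false) :
    (c.eval Γ s).out = s.out := by
  induction c generalizing s with
  | seq c d ihc ihd => simp [writes] at h; simp only [eval]; rw [ihd _ h.2, ihc _ h.1]
  | ite e c d ihc ihd =>
    simp [writes] at h
    simp only [eval]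
    split
    · exact ihc _ h.1
    · exact ihd _ h.2
  | loop x b c ih =>
    simp only [eval]
    refine iter_inv (fun _ (s' : State) => s'.out = s.out) rfl fun k hk s' hs' => ?_
    exact (ih (s'.set x k) h).trans hs'
  | write e => simp [writes] at h
  | _ => rfl

theorem Cmd.regs_of_ok (c : Cmd) (h : c.ok) : ∀ r ∈ c.regs, 4 ≤ r := by
  induction c with
  | assign r e => simp [ok] at h; simpa [regs] using h.1
  | seq c d ihc ihd =>
    simp [ok] at h
    simp only [regs, List.mem_append]
    rintro r (hr | hr)
    · exact ihc h.1 r hr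
    · exact ihd h.2 r hr
  | ite e c d ihc ihd =>
    simp [ok] at h
    simp only [regs, List.mem_append]
    rintro r (hr | hr)
    · exact ihc h.1.2 r hr
    · exact ihd h.2 r hr
  | loop x b c ih => simp [ok] at h; exact ih h.2
  | _ => simp [regs]

theorem Small.eval {Γ : Ctx} {S n : ℕ} {s : State} (h : Small S n s) {c : Cmd} (hc : c.ok) :
    Small S n (c.eval Γ s) := by
  have key : ∀ r < 4, (c.eval Γ s).reg r = s.reg r := fun r hr =>
    c.eval_reg s fun hm => by have := c.regs_of_ok hc r hm; omega
  constructor <;> rw [key _ (by omega)]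
  exacts [h.reg0, h.reg1, h.reg2, h.reg3]

/-! ### Correctness of the compiled code -/

theorem Rel.set_even {Γ : Ctx} {W : ℕ} {s : State} {c : Config} (h : Rel Γ s c) {d v : ℕ}
    (hd : d % 2 = 0) (h4 : 4 ≤ d) : Rel Γ s (c.set W d v) := by
  refine ⟨h.bdd, fun r => ?_, ?_, ?_, h.inp, h.arr, h.out⟩ <;>
    simp only [Config.set] <;> rw [Function.update_of_ne (by omega)]
  exacts [h.reg r, h.last, h.size]

theorem Rel.set_odd {Γ : Ctx} {W : ℕ} {s : State} {c : Config} (h : Rel Γ s c) {x v : ℕ}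
    (hv : v < Γ.N) (hW : v < 2 ^ W) : Rel Γ (s.set x v) (c.set W (2 * x + 1) v) := by
  refine ⟨h.bdd.set hv, fun r => ?_, ?_, ?_, h.inp, h.arr, h.out⟩ <;>
    simp only [Config.set, State.set, Nat.mod_eq_of_lt hW]
  · by_cases hr : r = x
    · subst hr; simp
    · rw [Function.update_of_ne (by omega), Function.update_of_ne hr, h.reg]
  all_goals rw [Function.update_of_ne (by omega)]
  exacts [h.last, h.size]

theorem Rel.set_pc {Γ : Ctx} {s : State} {c : Config} (h : Rel Γ s c) (p : ℕ) :
    Rel Γ s { c with pc := p } :=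
  ⟨h.bdd, h.reg, h.last, h.size, h.inp, h.arr, h.out⟩

/-- The machine goes from `c` in at most `K` steps to `c'`, which represents the state `s` and
agrees with `c` on the even registers below `2 * t` and on the output; the program counter has
advanced by `l`. -/
structure Ev (Γ : Ctx) (P : Program) (W : ℕ) (s : State) (t : ℕ) (c c' : Config) (K l : ℕ) :
    Prop where
  steps : Steps P W K c c'
  rel : Rel Γ s c'
  pc : c'.pc = c.pc + l
  low : ∀ u < t, c'.reg (2 * u) = c.reg (2 * u)
  em : c'.emitted = c.emitted

theorem Ev.refl {Γ : Ctx} {P : Program} {W t : ℕ} {s : State} {c : Config} (h : Rel Γ s c) :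
    Ev Γ P W s t c c 0 0 := ⟨Steps.refl _, h, rfl, fun _ _ => rfl, rfl⟩

theorem Ev.trans {Γ : Ctx} {P : Program} {W t t' : ℕ} {s s' : State} {c₁ c₂ c₃ : Config}
    {K K' l l' : ℕ} (h : Ev Γ P W s t c₁ c₂ K l) (h' : Ev Γ P W s' t' c₂ c₃ K' l')
    (ht : t ≤ t') : Ev Γ P W s' t c₁ c₃ (K + K') (l + l') :=
  ⟨h.steps.trans h'.steps, h'.rel, by rw [h'.pc, h.pc, add_assoc],
    fun u hu => (h'.low u (hu.trans_le ht)).trans (h.low u hu), h'.em.trans h.em⟩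

theorem Ev.mono {Γ : Ctx} {P : Program} {W t K K' l l' : ℕ} {s : State} {c c' : Config}
    (h : Ev Γ P W s t c c' K l) (hK : K ≤ K') (hl : l = l') : Ev Γ P W s t c c' K' l' :=
  ⟨h.steps.mono hK, h.rel, hl ▸ h.pc, h.low, h.em⟩

/-- An instruction that writes a value to an even register. -/
theorem Ev.temp {Γ : Ctx} {P : Program} {W t K l d v : ℕ} {s : State} {c c₁ : Config} {i : Instr}
    (h : Ev Γ P W s t c c₁ K l) (hP : P[c₁.pc]? = some i) (hi : i.exec W c₁ = c₁.set W d v)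
    (hd : d % 2 = 0) (h4 : 4 ≤ d) (ht : 2 * t ≤ d) (hv : v < 2 ^ W) :
    ∃ c₂, Ev Γ P W s t c c₂ (K + 1) (l + 1) ∧ c₂.reg d = v ∧ (∀ r, r ≠ d → c₂.reg r = c₁.reg r) ∧
      c₂.mem = c₁.mem ∧ c₂.pc = c₁.pc + 1 := by
  refine ⟨c₁.set W d v, ⟨?_, h.rel.set_even hd h4, ?_, ?_, h.em⟩, ?_, ?_, rfl, rfl⟩
  · exact h.steps.trans (hi ▸ Steps.cons hP (Steps.refl _))
  · simp [Config.set, h.pc, add_assoc]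
  · intro u hu
    simp only [Config.set]
    rw [Function.update_of_ne (by omega), h.low u hu]
  · simp [Config.set, Nat.mod_eq_of_lt hv]
  · intro r hr
    simp [Config.set, hr]

/-- An instruction that writes a value to the register of a scalar variable. -/
theorem Ev.user {Γ : Ctx} {P : Program} {W t K l x v : ℕ} {s : State} {c c₁ : Config} {i : Instr}
    (h : Ev Γ P W s t c c₁ K l) (hP : P[c₁.pc]? = some i)
    (hi : i.exec W c₁ = c₁.set W (2 * x + 1) v) (hv : v < Γ.N) (hW : v < 2 ^ W) :
    ∃ c₂, Ev Γ P W (s.set x v) t c c₂ (K + 1) (l + 1) ∧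
      (∀ r, c₂.reg (2 * r) = c₁.reg (2 * r)) ∧ c₂.pc = c₁.pc + 1 := by
  refine ⟨c₁.set W (2 * x + 1) v, ⟨?_, h.rel.set_odd hv hW, ?_, ?_, h.em⟩, ?_, rfl⟩
  · exact h.steps.trans (hi ▸ Steps.cons hP (Steps.refl _))
  · simp [Config.set, h.pc, add_assoc]
  · intro u hu
    simp only [Config.set]
    rw [Function.update_of_ne (by omega), h.low u hu]
  · intro r
    simp only [Config.set]
    rw [Function.update_of_ne (by omega)]

/-- An instruction that only changes the program counter. -/
theorem Ev.goto {Γ : Ctx} {P : Program} {W t K l p : ℕ} {s : State} {c c₁ : Config} {i : Instr}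
    (h : Ev Γ P W s t c c₁ K l) (hP : P[c₁.pc]? = some i)
    (hi : i.exec W c₁ = { c₁ with pc := c.pc + p }) :
    ∃ c₂, Ev Γ P W s t c c₂ (K + 1) p ∧ c₂.reg = c₁.reg ∧ c₂.mem = c₁.mem ∧ c₂.pc = c.pc + p := by
  refine ⟨{ c₁ with pc := c.pc + p }, ⟨?_, h.rel.set_pc _, rfl, h.low, h.em⟩, rfl, rfl, rfl⟩
  exact h.steps.trans (hi ▸ Steps.cons hP (Steps.refl _))

theorem CodeAt.at {P : Program} {o o' : ℕ} {l : List Instr} (h : CodeAt P o l) (e : o' = o) :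
    CodeAt P o' l := e ▸ h

/-- The code `f`, which depends on its position, evaluates to `v`, in at most `K` steps. -/
def Evaluates (Γ : Ctx) (W : ℕ) (s : State) (t : ℕ) (f : ℕ → List Instr) (v K : ℕ) : Prop :=
  ∀ (P : Program) (c : Config), Rel Γ s c → CodeAt P c.pc (f c.pc) →
    ∃ c', Ev Γ P W s t c c' K (f c.pc).length ∧ c'.reg (2 * t) = v

theorem Fits.lt {Γ : Ctx} {W : ℕ} (h : Fits Γ W) : 64 * Γ.N ≤ 2 ^ W := by
  have : Γ.N ^ 1 ≤ Γ.N ^ 6 := Nat.pow_le_pow_right (by have := h.eight_le; omega) (by omega)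
  rw [pow_one] at this
  have := h.big; omega

theorem clamp {Γ : Ctx} {P : Program} {W t K l v : ℕ} {s : State} {c c₁ : Config}
    (hW : Fits Γ W) (ht : 2 ≤ t) (h : Ev Γ P W s t c c₁ K l) (hv : c₁.reg (2 * t) = v)
    (hlt : v < 2 ^ W) (hP : CodeAt P c₁.pc (clampCode t)) :
    ∃ c₂, Ev Γ P W s t c c₂ (K + 2) (l + 2) ∧ c₂.reg (2 * t) = min v (Γ.N - 1) := by
  simp only [clampCode, codeAt_cons] at hP
  have := hW.eight_le
  have h0 := h.rel.last
  obtain ⟨c₂, h₂, e₂, f₂, -, p₂⟩ := h.temp (d := 2 * t + 2) (v := v - (Γ.N - 1)) hP.1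
    (by simp [Instr.exec, hv, h0]) (by omega) (by omega) (by omega) (by omega)
  obtain ⟨c₃, h₃, e₃, -, -, -⟩ := h₂.temp (d := 2 * t) (v := v - (v - (Γ.N - 1))) (by
      rw [p₂]; exact hP.2.1)
    (by simp only [Instr.exec, e₂]; rw [f₂ _ (by omega), hv])
    (by omega) (by omega) (by omega) (by omega)
  exact ⟨c₃, h₃, by rw [e₃]; omega⟩

/-- Horner evaluation of a cell address, from code for the indices. -/
theorem cellCode_spec {Γ : Ctx} {P : Program} {W t a : ℕ} {s : State} (hW : Fits Γ W)
    (ht : 2 ≤ t) (ha : a < 32) {c : Config} (xs : List ((ℕ → List Instr) × ℕ × ℕ))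
    (hv : ∀ x ∈ xs, Evaluates Γ W s (t + 1) x.1 x.2.1 x.2.2)
    (hN : ∀ x ∈ xs, x.2.1 < Γ.N) (acc j : ℕ) (hacc : acc < Γ.N ^ j) (hj : j + xs.length ≤ 6)
    {c₁ : Config} {K l : ℕ} (h : Ev Γ P W s t c c₁ K l) (e : c₁.reg (2 * t) = acc)
    (hP : CodeAt P c₁.pc (cellCode a t (xs.map (·.1)) c₁.pc)) :
    ∃ c₂, Ev Γ P W s t c c₂ (K + ((xs.map (·.2.2)).sum + 2 * xs.length + 5))
        (l + (cellCode a t (xs.map (·.1)) c₁.pc).length) ∧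
      c₂.reg (2 * t) =
        (xs.map (·.2.1)).foldl (fun acc x => acc * Γ.N + x) acc * 32 + a + Γ.N := by
  have h8 := hW.eight_le
  have hbig := hW.big
  have hlt := hW.lt
  induction xs generalizing acc j c₁ K l with
  | nil =>
    have hp : Γ.N ^ j ≤ Γ.N ^ 6 := Nat.pow_le_pow_right (by omega) (by simpa using hj)
    have hp1 : Γ.N ^ 1 ≤ Γ.N ^ 6 := Nat.pow_le_pow_right (by omega) (by omega)
    simp only [List.map_nil, cellCode, addrCode, codeAt_cons] at hP
    obtain ⟨c₂, h₂, e₂, f₂, -, p₂⟩ := h.temp (d := 2 * t + 2) (v := 32) hP.1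
      (by simp [Instr.exec]) (by omega) (by omega) (by omega) (by omega)
    obtain ⟨c₃, h₃, e₃, f₃, -, p₃⟩ := h₂.temp (d := 2 * t) (v := acc * 32)
      (by rw [p₂]; exact hP.2.1)
      (by simp only [Instr.exec, e₂]; rw [f₂ _ (by omega), e])
      (by omega) (by omega) (by omega) (by omega)
    obtain ⟨c₄, h₄, e₄, f₄, -, p₄⟩ := h₃.temp (d := 2 * t + 2) (v := a)
      (by rw [p₃, p₂]; exact hP.2.2.1)
      (by simp only [Instr.exec])
      (by omega) (by omega) (by omega) (by omega)
    obtain ⟨c₅, h₅, e₅, f₅, -, p₅⟩ := h₄.temp (d := 2 * t) (v := acc * 32 + a)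
      (by rw [p₄, p₃, p₂]; exact hP.2.2.2.1)
      (by simp only [Instr.exec, e₄]; rw [f₄ _ (by omega), e₃])
      (by omega) (by omega) (by omega) (by omega)
    obtain ⟨c₆, h₆, e₆, f₆, -, p₆⟩ := h₅.temp (d := 2 * t) (v := acc * 32 + a + Γ.N)
      (by rw [p₅, p₄, p₃, p₂]; exact hP.2.2.2.2.1)
      (by simp only [Instr.exec, e₅, h₅.rel.size])
      (by omega) (by omega) (by omega) (by omega)
    refine ⟨c₆, h₆.mono (by simp) (by simp [cellCode, addrCode]), by simpa using e₆⟩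
  | cons x xs ih =>
    obtain ⟨f, v, k⟩ := x
    have hf : Evaluates Γ W s (t + 1) f v k := hv (f, v, k) (by simp)
    simp only [List.map_cons, cellCode, codeAt_append] at hP
    obtain ⟨c₂, h₂, e₂⟩ := hf P c₁ h.rel hP.1.1
    have hv' := hN (f, v, k) (by simp)
    have hmul : acc * Γ.N + v < Γ.N ^ (j + 1) := by rw [pow_succ]; nlinarith
    have hp : Γ.N ^ (j + 1) ≤ Γ.N ^ 6 :=
      Nat.pow_le_pow_right (by omega) (by simp at hj; omega)
    have p₂ := h₂.pc
    have l₂ := h₂.low t (by omega)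
    have hP1 := hP.1.2.at p₂
    simp only [hornerCode, codeAt_cons] at hP1
    have g₂ := h.trans h₂ (by omega)
    obtain ⟨c₃, h₃, e₃, f₃, -, p₃⟩ := g₂.temp (d := 2 * t) (v := acc * Γ.N) hP1.1
      (by simp only [Instr.exec]; rw [g₂.rel.size, l₂, e])
      (by omega) (by omega) (by omega) (by omega)
    obtain ⟨c₄, h₄, e₄, f₄, -, p₄⟩ := h₃.temp (d := 2 * t) (v := acc * Γ.N + v)
      (by rw [p₃]; exact hP1.2.1)
      (by
        simp only [Instr.exec]
        rw [e₃, f₃ _ (by omega), show 2 * t + 2 = 2 * (t + 1) by ring, e₂])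
      (by omega) (by omega) (by omega) (by omega)
    have q₄ : c₁.pc + (f c₁.pc).length + 2 = c₄.pc := by rw [p₄, p₃, p₂]
    have hP2 := hP.2.at (o' := c₄.pc) (by simp [hornerCode]; omega)
    rw [q₄] at hP2
    obtain ⟨c₅, h₅, e₅⟩ := ih (fun x hx => hv x (by simp [hx]))
      (fun x hx => hN x (by simp [hx])) _ (j + 1) hmul
      (by simp at hj; omega) h₄ e₄ hP2
    refine ⟨c₅, h₅.mono (by simp; omega) ?_, by simpa using e₅⟩
    simp [cellCode, hornerCode, q₄]; omega

/-- The loop of `find`, from an iteration on. -/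
theorem find_loop {Γ : Ctx} {P : Program} {W t x K B : ℕ} {s : State} (hW : Fits Γ W)
    (ht : 2 ≤ t) {e : ℕ → List Instr} {p : ℕ → ℕ} (hB : B < Γ.N)
    (he : ∀ k < B, Evaluates Γ W (s.set x k) (t + 2) e (p k) K) {o o₂ : ℕ}
    (ho₂ : o₂ = o + 2 + (e (o + 2)).length + 2)
    (hP : CodeAt P o (.sub (2 * t + 4) (2 * t) (2 * x + 1) :: .jzero (2 * t + 4) (o₂ + 3) ::
        e (o + 2) ++ .jzero (2 * t + 4) o₂ :: .jump (o₂ + 3) ::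
        [.const (2 * t + 4) 1, .add (2 * x + 1) (2 * x + 1) (2 * t + 4), .jump o]))
    (d k : ℕ) (hd : k + d = B) (hlt : ∀ j < k, p j = 0) {c : Config} (hc : Rel Γ (s.set x k) c)
    (hpc : c.pc = o) (hreg : c.reg (2 * t) = B) :
    ∃ c', Steps P W (d * (K + 7) + 2) c c' ∧ Rel Γ (s.set x (lb B fun k => p k ≠ 0)) c' ∧
      c'.pc = o₂ + 3 ∧ (∀ u < t + 2, c'.reg (2 * u) = c.reg (2 * u)) ∧
      c'.emitted = c.emitted := by
  have h8 := hW.eight_le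
  have hlt' := hW.lt
  have hx : ∀ {k c}, Rel Γ (s.set x k) c → c.reg (2 * x + 1) = k := fun h => by
    rw [h.reg]; simp [State.set]
  induction d generalizing k c with
  | zero =>
    simp only [List.cons_append, codeAt_cons] at hP
    obtain ⟨c₁, h₁, e₁, -, -, p₁⟩ := (Ev.refl (P := P) (W := W) (t := t + 2) hc).temp
      (d := 2 * t + 4) (v := 0) (by rw [hpc]; exact hP.1)
      (by simp only [Instr.exec]; rw [hx hc, hreg]; congr 1; omega) (by omega) (by omega)
      (by omega) (by omega)
    have hkB : k = B := by omega
    obtain ⟨c₂, h₂, -, -, p₂⟩ := h₁.goto (p := 2 + (e (o + 2)).length + 5)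
      (by rw [p₁, hpc]; exact hP.2.1)
      (by simp only [Instr.exec]; rw [e₁]; simp [hpc, ho₂]; omega)
    refine ⟨c₂, h₂.steps.mono (by simp), ?_, by rw [p₂, hpc, ho₂]; omega, h₂.low, h₂.em⟩
    convert h₂.rel
    exact lb_eq (.inr hkB) hkB.le fun j hj => by simpa using hlt j hj
  | succ d ih =>
    have hP0 := hP
    simp only [List.cons_append, codeAt_cons, codeAt_append, add_assoc] at hP
    norm_num at hP
    obtain ⟨q1, q2, q3, q4, q5, q6, q7, q8⟩ := hP
    obtain ⟨c₁, h₁, e₁, -, -, p₁⟩ := (Ev.refl (P := P) (W := W) (t := t + 2) hc).temp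
      (d := 2 * t + 4) (v := B - k) (by rw [hpc]; exact q1)
      (by simp only [Instr.exec]; rw [hx hc, hreg]) (by omega) (by omega)
      (by omega) (by omega)
    obtain ⟨c₂, h₂, -, -, p₂⟩ := h₁.goto (p := 2) (by rw [p₁, hpc]; exact q2)
      (by
        simp only [Instr.exec]
        rw [e₁, if_neg (by omega), p₁])
    have p₂' : c₂.pc = o + 2 := by rw [p₂, hpc]
    obtain ⟨c₃, h₃, e₃⟩ := he k (by omega) P c₂ h₂.rel (by rw [p₂']; exact q3)
    have p₃ := h₃.pc
    rw [p₂'] at p₃ h₃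
    have g₃ := h₂.trans h₃ le_rfl
    have e₃' : c₃.reg (2 * t + 4) = p k := by rw [← e₃]; congr 1
    by_cases hpk : p k = 0
    · obtain ⟨c₄, h₄, -, -, p₄⟩ := g₃.goto (p := 2 + (e (o + 2)).length + 2)
        (by rw [p₃]; convert q4 using 2; omega)
        (by simp only [Instr.exec]; rw [e₃', hpk, if_pos rfl, ho₂, hpc]; congr 1; omega)
      obtain ⟨c₅, h₅, e₅, f₅, -, p₅⟩ := h₄.temp (d := 2 * t + 4) (v := 1)
        (by rw [p₄, hpc]; convert q6 using 2; omega) (by simp [Instr.exec])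
        (by omega) (by omega) (by omega) (by omega)
      obtain ⟨c₆, h₆, f₆, p₆⟩ := h₅.user (x := x) (v := k + 1)
        (by rw [p₅, p₄, hpc]; convert q7 using 2; omega)
        (by simp only [Instr.exec]; rw [hx h₅.rel, e₅])
        (by omega) (by omega)
      obtain ⟨c₇, h₇, -, -, p₇⟩ := h₆.goto (p := 0)
        (by rw [p₆, p₅, p₄, hpc]; convert q8 using 2; omega)
        (by simp [Instr.exec, hpc])
      have hss : (s.set x k).set x (k + 1) = s.set x (k + 1) := by simp [State.set]
      obtain ⟨c', k₁, k₂, k₃, k₄, k₅⟩ := ih (k + 1) (by omega) (fun j hj => by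
        rcases Nat.lt_succ_iff_lt_or_eq.1 hj with h | rfl
        · exact hlt j h
        · exact hpk) (hss ▸ h₇.rel) (by rw [p₇, hpc]; rfl)
        (by rw [h₇.low t (by omega), hreg])
      refine ⟨c', (h₇.steps.trans k₁).mono ?_, k₂, k₃, fun u hu => (k₄ u hu).trans (h₇.low u hu),
        k₅.trans h₇.em⟩
      rw [Nat.succ_mul]; omega
    · obtain ⟨c₄, h₄, f₄, -, p₄⟩ := g₃.goto (p := 2 + (e (o + 2)).length + 1)
        (by rw [p₃]; convert q4 using 2; omega)
        (by simp only [Instr.exec]; rw [e₃', if_neg hpk, p₃, hpc]; congr 1; omega)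
      obtain ⟨c₅, h₅, -, -, p₅⟩ := h₄.goto (p := 2 + (e (o + 2)).length + 5)
        (by rw [p₄, hpc]; convert q5 using 2; omega)
        (by simp only [Instr.exec]; rw [ho₂, hpc]; congr 1; omega)
      refine ⟨c₅, h₅.steps.mono (by rw [Nat.succ_mul]; omega), ?_,
        by rw [p₅, hpc, ho₂]; omega, h₅.low, h₅.em⟩
      convert h₅.rel
      exact lb_eq (.inl hpk) (by omega) fun j hj => by simpa using hlt j hj

theorem Evaluates.seq {Γ : Ctx} {W t v v' K K' : ℕ} {s : State} {f g : ℕ → List Instr}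
    {P : Program} {c : Config} (hf : Evaluates Γ W s t f v K)
    (hg : Evaluates Γ W s (t + 1) g v' K') (hc : Rel Γ s c) (h1 : CodeAt P c.pc (f c.pc))
    (h2 : CodeAt P (c.pc + (f c.pc).length) (g (c.pc + (f c.pc).length))) :
    ∃ c', Ev Γ P W s t c c' (K + K') ((f c.pc).length + (g (c.pc + (f c.pc).length)).length) ∧
      c'.reg (2 * t) = v ∧ c'.reg (2 * t + 2) = v' := by
  obtain ⟨c₁, h₁, e₁⟩ := hf P c hc h1
  rw [← h₁.pc] at h2 ⊢
  obtain ⟨c₂, h₂, e₂⟩ := hg P c₁ h₁.rel h2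
  exact ⟨c₂, h₁.trans h₂ (by omega), (h₂.low t (by omega)).trans e₁, e₂⟩

theorem cell_spec {Γ : Ctx} {W t a : ℕ} {s : State} (hW : Fits Γ W) (ht : 2 ≤ t) (ha : a < 32)
    {f₁ f₂ f₃ f₄ f₅ f₆ : ℕ → List Instr} {v₁ v₂ v₃ v₄ v₅ v₆ k₁ k₂ k₃ k₄ k₅ k₆ : ℕ}
    (h₁ : Evaluates Γ W s (t + 1) f₁ v₁ k₁) (h₂ : Evaluates Γ W s (t + 1) f₂ v₂ k₂)
    (h₃ : Evaluates Γ W s (t + 1) f₃ v₃ k₃) (h₄ : Evaluates Γ W s (t + 1) f₄ v₄ k₄)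
    (h₅ : Evaluates Γ W s (t + 1) f₅ v₅ k₅) (h₆ : Evaluates Γ W s (t + 1) f₆ v₆ k₆)
    (hN : ∀ x ∈ [v₁, v₂, v₃, v₄, v₅, v₆], x < Γ.N) :
    Evaluates Γ W s t
      (fun o => .const (2 * t) 0 :: cellCode a t [f₁, f₂, f₃, f₄, f₅, f₆] (o + 1))
      (addr Γ.N a [v₁, v₂, v₃, v₄, v₅, v₆]) (k₁ + k₂ + k₃ + k₄ + k₅ + k₆ + 18) := by
  intro P c hc hP
  simp only [codeAt_cons] at hP
  have := hW.eight_le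
  have := hW.lt
  obtain ⟨c₁, g₁, e₁, -, -, p₁⟩ := (Ev.refl (P := P) (W := W) (t := t) hc).temp
    (d := 2 * t) (v := 0) hP.1 (by simp [Instr.exec]) (by omega) (by omega) (by omega) (by omega)
  obtain ⟨c₂, g₂, e₂⟩ := cellCode_spec hW ht ha
    [(f₁, v₁, k₁), (f₂, v₂, k₂), (f₃, v₃, k₃), (f₄, v₄, k₄), (f₅, v₅, k₅), (f₆, v₆, k₆)]
    (by simp only [List.forall_mem_cons]; exact ⟨h₁, h₂, h₃, h₄, h₅, h₆, by simp⟩)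
    (by simpa using hN) 0 0 (by simp) (by simp) g₁ e₁ (by rw [p₁]; exact hP.2)
  refine ⟨c₂, g₂.mono (by simp; omega) ?_, e₂⟩
  rw [p₁]; simp [add_comm]

theorem Bd.val_add_le {S n : ℕ} (hS : 1 ≤ S) (hn : 1 ≤ n) {x y : Bd} {k l : ℕ}
    (hk : k ≤ x.val S n) (hl : l ≤ y.val S n) : k + l ≤ (x.add y).val S n :=
  (Nat.add_le_add hk hl).trans (Bd.val_add hS hn x y)

/-- The code of an expression computes its value, within its static cost bound. -/
theorem Expr.evaluates {Γ : Ctx} {W S n : ℕ} (hW : Fits Γ W) (hS : 1 ≤ S) (hn : 1 ≤ n)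
    (e : Expr) (he : e.ok) {s : State} (hs : s.Bdd Γ.N) (hB : Small S n s) {t : ℕ} (ht : 2 ≤ t) :
    Evaluates Γ W s t (fun o => e.code o t) (e.denote Γ s) (e.cost.val S n) := by
  have h8 := hW.eight_le
  have hlt := hW.lt
  have hle {x y : Bd} {k l : ℕ} (hk : k ≤ x.val S n) (hl : l ≤ y.val S n) :
    k + l ≤ (x.add y).val S n := Bd.val_add_le hS hn hk hl
  have hc (k : ℕ) : k ≤ (Bd.c k).val S n := by simp
  induction e generalizing s t with
  | const k =>
    simp only [ok, decide_eq_true_eq] at he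
    intro P c hc hP
    obtain ⟨c₁, h₁, e₁, -⟩ := (Ev.refl (P := P) (W := W) (t := t) hc).temp
      (d := 2 * t) (v := k) hP.1 (by simp [Instr.exec]) (by omega) (by omega) (by omega) (by omega)
    exact ⟨c₁, h₁.mono (by simp [cost]) (by simp [code]), e₁⟩
  | reg r =>
    intro P c hc hP
    have := hs.reg r
    obtain ⟨c₁, h₁, e₁, -⟩ := (Ev.refl (P := P) (W := W) (t := t) hc).temp
      (d := 2 * t) (v := s.reg r) hP.1 (by simp [Instr.exec, hc.reg]) (by omega) (by omega)
      (by omega) (by omega)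
    exact ⟨c₁, h₁.mono (by simp [cost]) (by simp [code]), e₁⟩
  | add a b iha ihb =>
    simp only [ok, Bool.and_eq_true] at he
    intro P c hc' hP
    simp only [code, codeAt_append, codeAt_cons] at hP
    have da := a.denote_lt h8 he.1 hs
    have db := b.denote_lt h8 he.2 hs
    obtain ⟨c₁, h₁, e₁, f₁⟩ := (iha he.1 hs hB ht).seq (ihb he.2 hs hB (by omega)) hc'
      hP.1.1 hP.1.2
    simp only [List.length_append, ← add_assoc] at hP
    have p₁ := h₁.pc
    simp only [← add_assoc] at p₁
    obtain ⟨c₂, h₂, e₂, -, -, p₂⟩ := h₁.temp (d := 2 * t)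
      (v := a.denote Γ s + b.denote Γ s)
      (by rw [p₁]; exact hP.2.1) (by simp [Instr.exec, e₁, f₁])
      (by omega) (by omega) (by omega) (by omega)
    obtain ⟨c₃, h₃, e₃⟩ := clamp hW ht h₂ e₂ (by omega) (by rw [p₂, p₁]; exact hP.2.2)
    refine ⟨c₃, h₃.mono ?_ (by simp [code, clampCode]; ring), e₃⟩
    have := hle (hle (le_refl (a.cost.val S n)) (le_refl (b.cost.val S n))) (hc 3)
    simp only [cost]
    omega
  | sub a b iha ihb =>
    simp only [ok, Bool.and_eq_true] at he
    intro P c hc' hP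
    simp only [code, codeAt_append, codeAt_cons] at hP
    have da := a.denote_lt h8 he.1 hs
    obtain ⟨c₁, h₁, e₁, f₁⟩ := (iha he.1 hs hB ht).seq (ihb he.2 hs hB (by omega)) hc'
      hP.1.1 hP.1.2
    simp only [List.length_append, ← add_assoc] at hP
    have p₁ := h₁.pc
    simp only [← add_assoc] at p₁
    obtain ⟨c₂, h₂, e₂, -, -, p₂⟩ := h₁.temp (d := 2 * t)
      (v := a.denote Γ s - b.denote Γ s)
      (by rw [p₁]; exact hP.2.1) (by simp [Instr.exec, e₁, f₁])
      (by omega) (by omega) (by omega) (by omega)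
    exact ⟨c₂, h₂.mono (hle (hle le_rfl le_rfl) (hc 1)) (by simp [code]; ring), e₂⟩
  | ite c a b ihc iha ihb =>
    simp only [ok, Bool.and_eq_true] at he
    intro P m hm hP
    simp only [code, codeAt_append, codeAt_cons, List.length_append, List.length_cons,
      ← add_assoc] at hP
    obtain ⟨⟨q1, q2, q3⟩, q4, q5⟩ := hP
    rw [add_right_comm] at q4
    replace q5 := q5.at (o' := m.pc + (c.code m.pc t).length + 1 +
      (a.code (m.pc + (c.code m.pc t).length + 1) t).length + 1) (by ring)
    obtain ⟨c₁, h₁, e₁⟩ := ihc he.1.1 hs hB ht P m hm q1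
    have p₁ := h₁.pc
    simp only at p₁
    simp only [denote]
    split
    · rename_i hcv
      obtain ⟨c₂, h₂, f₂, -, p₂⟩ := h₁.goto (p := (c.code m.pc t).length + 1)
        (by rw [p₁]; exact q2)
        (by simp only [Instr.exec]; rw [e₁, if_neg hcv, p₁]; rfl)
      rw [← add_assoc] at p₂
      obtain ⟨c₃, h₃, e₃⟩ := iha he.1.2 hs hB ht P c₂ h₂.rel (by rw [p₂]; exact q3)
      have g₃ := h₂.trans h₃ le_rfl
      have p₃ := h₃.pc
      simp only [p₂] at p₃
      obtain ⟨c₄, h₄, f₄, -, p₄⟩ := g₃.goto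
        (p := ((Expr.ite c a b).code m.pc t).length)
        (by rw [p₃]; exact q4)
        (by simp only [Instr.exec, code]; congr 1; simp; ring)
      refine ⟨c₄, h₄.mono ?_ rfl, by rw [f₄, e₃]⟩
      refine le_trans ?_ (hle (hle (hle le_rfl le_rfl) (Nat.zero_le (b.cost.val S n))) (hc 2))
      omega
    · rename_i hcv
      have hcv : c.denote Γ s = 0 := by simpa using hcv
      obtain ⟨c₂, h₂, f₂, -, p₂⟩ := h₁.goto (p := (c.code m.pc t).length + 1 +
          (a.code (m.pc + (c.code m.pc t).length + 1) t).length + 1)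
        (by rw [p₁]; exact q2)
        (by simp only [Instr.exec]; rw [e₁, if_pos hcv]; simp; ring)
      simp only [← add_assoc] at p₂
      obtain ⟨c₃, h₃, e₃⟩ := ihb he.2 hs hB ht P c₂ h₂.rel (by rw [p₂]; exact q5)
      have g₃ := h₂.trans h₃ le_rfl
      refine ⟨c₃, g₃.mono ?_ (by simp only [p₂, code]; simp; ring), e₃⟩
      refine le_trans ?_ (hle (hle (hle le_rfl (Nat.zero_le (a.cost.val S n))) le_rfl) (hc 2))
      omega
  | inp e ih =>
    simp only [ok] at he
    intro P c hc' hP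
    simp only [code, codeAt_append, codeAt_cons] at hP
    have de := e.denote_lt h8 he hs
    obtain ⟨c₁, h₁, e₁⟩ := ih he hs hB ht P c hc' hP.1
    have p₁ := h₁.pc
    obtain ⟨c₂, h₂, e₂, -, -, p₂⟩ := h₁.temp (d := 2 * t)
      (v := Γ.inp (e.denote Γ s))
      (by rw [p₁]; exact hP.2.1) (by simp [Instr.exec, e₁, h₁.rel.inp _ de])
      (by omega) (by omega) (by omega) (hW.inp_lt _ de)
    obtain ⟨c₃, h₃, e₃⟩ := clamp hW ht h₂ e₂ (hW.inp_lt _ de) (by rw [p₂, p₁]; exact hP.2.2)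
    refine ⟨c₃, h₃.mono ?_ (by simp [code, clampCode]), e₃⟩
    have := hle (le_refl (e.cost.val S n)) (hc 3)
    simp only [cost]
    omega
  | inpEq a b iha ihb =>
    simp only [ok, Bool.and_eq_true] at he
    intro P c hc' hP
    simp only [code, codeAt_append, codeAt_cons] at hP
    have da := a.denote_lt h8 he.1 hs
    have db := b.denote_lt h8 he.2 hs
    have ia := hW.inp_lt _ da
    have ib := hW.inp_lt _ db
    obtain ⟨c₁, h₁, e₁, f₁⟩ := (iha he.1 hs hB ht).seq (ihb he.2 hs hB (by omega)) hc'
      hP.1.1 hP.1.2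
    simp only [List.length_append, ← add_assoc] at hP
    obtain ⟨-, q1, q2, q3, q4, q5, q6, q7, -⟩ := hP
    have p₁ := h₁.pc
    simp only [← add_assoc] at p₁
    rw [← p₁] at q1 q2 q3 q4 q5 q6 q7
    obtain ⟨c₂, h₂, e₂, f₂, m₂, p₂⟩ := h₁.temp (d := 2 * t)
      (v := Γ.inp (a.denote Γ s)) q1 (by simp [Instr.exec, e₁, h₁.rel.inp _ da])
      (by omega) (by omega) (by omega) ia
    obtain ⟨c₃, h₃, e₃, f₃, m₃, p₃⟩ := h₂.temp (d := 2 * t + 2)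
      (v := Γ.inp (b.denote Γ s)) (by rw [p₂]; exact q2)
      (by simp only [Instr.exec]; rw [f₂ _ (by omega), f₁, h₂.rel.inp _ db])
      (by omega) (by omega) (by omega) ib
    obtain ⟨c₄, h₄, e₄, f₄, m₄, p₄⟩ := h₃.temp (d := 2 * t + 4)
      (v := Γ.inp (a.denote Γ s) - Γ.inp (b.denote Γ s)) (by rw [p₃, p₂]; exact q3)
      (by simp only [Instr.exec]; rw [f₃ (2 * t) (by omega), e₂, e₃])
      (by omega) (by omega) (by omega) (by omega)
    obtain ⟨c₅, h₅, e₅, f₅, m₅, p₅⟩ := h₄.temp (d := 2 * t)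
      (v := Γ.inp (b.denote Γ s) - Γ.inp (a.denote Γ s)) (by rw [p₄, p₃, p₂]; exact q4)
      (by
        simp only [Instr.exec]
        rw [f₄ (2 * t) (by omega), f₄ (2 * t + 2) (by omega), f₃ (2 * t) (by omega), e₂, e₃])
      (by omega) (by omega) (by omega) (by omega)
    obtain ⟨c₆, h₆, e₆, f₆, m₆, p₆⟩ := h₅.temp (d := 2 * t + 2)
      (v := (Γ.inp (b.denote Γ s) - Γ.inp (a.denote Γ s)) +
        (Γ.inp (a.denote Γ s) - Γ.inp (b.denote Γ s))) (by rw [p₅, p₄, p₃, p₂]; exact q5)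
      (by simp only [Instr.exec]; rw [e₅, f₅ (2 * t + 4) (by omega), e₄])
      (by omega) (by omega) (by omega) (by omega)
    obtain ⟨c₇, h₇, e₇, f₇, m₇, p₇⟩ := h₆.temp (d := 2 * t)
      (v := 1) (by rw [p₆, p₅, p₄, p₃, p₂]; exact q6)
      (by simp only [Instr.exec])
      (by omega) (by omega) (by omega) (by omega)
    obtain ⟨c₈, h₈, e₈, -, -, -⟩ := h₇.temp (d := 2 * t)
      (v := (Expr.inpEq a b).denote Γ s) (by rw [p₇, p₆, p₅, p₄, p₃, p₂]; exact q7)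
      (by
        simp only [Instr.exec]
        rw [e₇, f₇ (2 * t + 2) (by omega), e₆]
        congr 1
        simp only [denote]
        split <;> omega)
      (by omega) (by omega) (by omega) (by simp only [denote]; split <;> omega)
    refine ⟨c₈, h₈.mono ?_ (by simp [code]; ring), e₈⟩
    have := hle (hle (le_refl (a.cost.val S n)) (le_refl (b.cost.val S n))) (hc 7)
    simp only [cost]
    omega
  | arr a e₁ e₂ e₃ e₄ e₅ e₆ ih₁ ih₂ ih₃ ih₄ ih₅ ih₆ =>
    simp only [ok, Bool.and_eq_true, decide_eq_true_eq] at he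
    obtain ⟨⟨⟨⟨⟨⟨ha, k₁⟩, k₂⟩, k₃⟩, k₄⟩, k₅⟩, k₆⟩ := he
    intro P c hc' hP
    simp only [code, List.cons_append, codeAt_append, codeAt_cons] at hP
    have hN : ∀ x ∈ [e₁.denote Γ s, e₂.denote Γ s, e₃.denote Γ s, e₄.denote Γ s, e₅.denote Γ s,
        e₆.denote Γ s], x < Γ.N := by
      simp only [List.forall_mem_cons]
      exact ⟨e₁.denote_lt h8 k₁ hs, e₂.denote_lt h8 k₂ hs, e₃.denote_lt h8 k₃ hs,
        e₄.denote_lt h8 k₄ hs, e₅.denote_lt h8 k₅ hs, e₆.denote_lt h8 k₆ hs, by simp⟩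
    obtain ⟨c₁, h₁, q₁⟩ := cell_spec hW ht ha (ih₁ k₁ hs hB (by omega)) (ih₂ k₂ hs hB (by omega))
      (ih₃ k₃ hs hB (by omega)) (ih₄ k₄ hs hB (by omega)) (ih₅ k₅ hs hB (by omega))
      (ih₆ k₆ hs hB (by omega)) hN P c hc' ⟨hP.1, hP.2.1⟩
    have p₁ := h₁.pc
    have := hs.arr a [e₁.denote Γ s, e₂.denote Γ s, e₃.denote Γ s, e₄.denote Γ s, e₅.denote Γ s,
        e₆.denote Γ s]
    obtain ⟨c₂, h₂, r₂, -⟩ := h₁.temp (d := 2 * t) (v := s.arr a [e₁.denote Γ s, e₂.denote Γ s,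
        e₃.denote Γ s, e₄.denote Γ s, e₅.denote Γ s, e₆.denote Γ s])
      (by rw [p₁]; convert hP.2.2.1 using 2; simp; ring)
      (by simp only [Instr.exec]; rw [q₁, h₁.rel.arr a ha _ (by simp) hN])
      (by omega) (by omega) (by omega) (by omega)
    refine ⟨c₂, h₂.mono ?_ (by simp [code]), r₂⟩
    have := hle (hle (hle (hle (hle (hle (le_refl (e₁.cost.val S n)) (le_refl (e₂.cost.val S n)))
      (le_refl (e₃.cost.val S n))) (le_refl (e₄.cost.val S n))) (le_refl (e₅.cost.val S n)))
      (le_refl (e₆.cost.val S n))) (hc 19)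
    simp only [cost]
    omega
  | find x b e ihb ihe =>
    simp only [ok, Bool.and_eq_true, decide_eq_true_eq] at he
    obtain ⟨⟨⟨hx, kb⟩, kb'⟩, ke⟩ := he
    intro P c hc' hP
    have db := b.denote_lt h8 kb hs
    simp only [code, codeAt_append, codeAt_cons] at hP
    obtain ⟨⟨q1, q2, q3, q4, q5, q6⟩, q7, q8, q9, q10, q11, q12, q13, -⟩ := hP
    obtain ⟨c₁, h₁, e₁⟩ := ihb kb hs hB ht P c hc' q1
    have p₁ := h₁.pc
    have r1 := h₁.rel.reg x
    have := hs.reg x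
    obtain ⟨c₂, h₂, e₂, f₂, -, p₂⟩ := h₁.temp (d := 2 * t + 2) (v := s.reg x)
      (by rw [p₁]; exact q2) (by simp [Instr.exec, r1]) (by omega) (by omega) (by omega) (by omega)
    obtain ⟨c₃, h₃, f₃, p₃⟩ := h₂.user (x := x) (v := 0)
      (by rw [p₂, p₁]; exact q3) (by simp [Instr.exec]) (by omega) (by omega)
    have p₃' : c₃.pc = c.pc + (b.code c.pc t).length + 2 := by rw [p₃, p₂, p₁]
    obtain ⟨c₄, s₄, r₄, p₄, l₄, m₄⟩ := find_loop (P := P) (x := x) (K := e.cost.val S n) hW ht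
      (e := fun o => e.code o (t + 2)) (p := fun k => e.denote Γ (s.set x k)) db
      (fun k hk => ihe ke (hs.set (by omega)) (hB.set hx) (by omega))
      (o := c.pc + (b.code c.pc t).length + 2) rfl (by
        simp only [List.cons_append, codeAt_append, codeAt_cons, codeAt_nil]
        refine ⟨q4, q5, q6, ?_, ?_, ?_, ?_, ?_, trivial⟩
        · convert q7 using 2; simp; ring
        · convert q8 using 2; simp; ring
        · convert q9 using 2; simp; ring
        · convert q10 using 2; simp; ring
        · convert q11 using 2; simp; ring)
      (b.denote Γ s) 0 (by simp) (by simp) h₃.rel p₃' (by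
        rw [f₃ t, f₂ _ (by omega), e₁])
    have h₄ : Ev Γ P W (s.set x (lb (b.denote Γ s) fun k => e.denote Γ (s.set x k) ≠ 0)) t c c₄
        (b.cost.val S n + 2 + (b.denote Γ s * (e.cost.val S n + 7) + 2))
        ((b.code c.pc t).length + 2 + 2 +
          (e.code (c.pc + (b.code c.pc t).length + 2 + 2) (t + 2)).length + 2 + 3) := by
      refine ⟨h₃.steps.trans s₄, r₄, by rw [p₄]; ring, fun u hu => ?_, m₄.trans h₃.em⟩
      rw [l₄ u (by omega), h₃.low u hu]
    have hreg : c₄.reg (2 * x + 1) = lb (b.denote Γ s) fun k => e.denote Γ (s.set x k) ≠ 0 := by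
      rw [r₄.reg]; simp [State.set]
    have hlb := lb_le (b.denote Γ s) fun k => e.denote Γ (s.set x k) ≠ 0
    obtain ⟨c₅, h₅, e₅, f₅, -, p₅⟩ := h₄.temp (d := 2 * t)
      (v := (Expr.find x b e).denote Γ s)
      (by rw [p₄]; convert q12 using 2; simp; ring)
      (by simp only [Instr.exec]; rw [hreg, denote]) (by omega) (by omega) (by omega)
      (by simp only [denote]; omega)
    obtain ⟨c₆, h₆, f₆, p₆⟩ := h₅.user (x := x) (v := s.reg x)
      (by rw [p₅, p₄]; convert q13 using 2; simp; ring)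
      (by
        simp only [Instr.exec]
        rw [f₅ _ (by omega), show 2 * t + 2 = 2 * (t + 1) by ring, l₄ _ (by omega), f₃]
        congr 1) (by omega) (by omega)
    have hss : (s.set x (lb (b.denote Γ s) fun k => e.denote Γ (s.set x k) ≠ 0)).set x (s.reg x)
        = s := by simp [State.set]
    rw [hss] at h₆
    refine ⟨c₆, h₆.mono ?_ (by simp [code]; ring), by rw [f₆, e₅]⟩
    have hb := b.denote_le_bmax hB kb' (Γ := Γ)
    have h1 := hle (hle (le_refl (b.cost.val S n)) (hc 6)) (x := b.cost.add (Bd.c 6))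
      (y := b.bmax.mul (e.cost.add (Bd.c 7)))
      (l := b.denote Γ s * (e.cost.val S n + 7)) (by
        rw [Bd.val_mul]
        exact Nat.mul_le_mul hb (hle le_rfl (hc 7)))
    simp only [cost]
    omega

/-- The code `f`, which depends on its position, leads from the state `s` to the state `s'` in at
most `K` steps. -/
def Runs (Γ : Ctx) (W : ℕ) (s : State) (t : ℕ) (f : ℕ → List Instr) (s' : State) (K : ℕ) : Prop :=
  ∀ (P : Program) (c : Config), Rel Γ s c → CodeAt P c.pc (f c.pc) →
    ∃ c', Ev Γ P W s' t c c' K (f c.pc).length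

theorem Runs.mono {Γ : Ctx} {W t K K' : ℕ} {s s' : State} {f : ℕ → List Instr}
    (h : Runs Γ W s t f s' K) (hK : K ≤ K') : Runs Γ W s t f s' K' := fun P c hc hP =>
  let ⟨c', h'⟩ := h P c hc hP
  ⟨c', h'.mono hK rfl⟩

theorem Runs.seq {Γ : Ctx} {W t K K' : ℕ} {s s' s'' : State} {f g : ℕ → List Instr}
    (h : Runs Γ W s t f s' K) (h' : Runs Γ W s' t g s'' K') :
    Runs Γ W s t (fun o => f o ++ g (o + (f o).length)) s'' (K + K') := by
  intro P c hc hP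
  simp only [codeAt_append] at hP
  obtain ⟨c₁, h₁⟩ := h P c hc hP.1
  have hP2 := hP.2
  rw [← h₁.pc] at hP2
  obtain ⟨c₂, h₂⟩ := h' P c₁ h₁.rel hP2
  exact ⟨c₂, (h₁.trans h₂ le_rfl).mono le_rfl (by simp [h₁.pc])⟩

theorem Runs.assign {Γ : Ctx} {W t K r : ℕ} {s : State} {e : Expr} (hW : Fits Γ W)
    (he : e.denote Γ s < Γ.N)
    (h : Evaluates Γ W s t (fun o => e.code o t) (e.denote Γ s) K) :
    Runs Γ W s t (fun o => (Cmd.assign r e).code o t) (s.set r (e.denote Γ s)) (K + 1) := by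
  intro P c hc hP
  have := hW.lt
  simp only [Cmd.code, codeAt_append, codeAt_cons] at hP
  obtain ⟨c₁, h₁, e₁⟩ := h P c hc hP.1
  obtain ⟨c₂, h₂, -⟩ := h₁.user (x := r) (v := e.denote Γ s)
    (by rw [h₁.pc]; exact hP.2.1) (by simp [Instr.exec, e₁]) (by omega) (by omega)
  exact ⟨c₂, h₂.mono le_rfl (by simp [Cmd.code])⟩

theorem Rel.store {Γ : Ctx} {W a v : ℕ} {s : State} {c : Config} {l : List ℕ} (h : Rel Γ s c)
    (ha : a < 32) (hl : l.length = 6) (hN : ∀ x ∈ l, x < Γ.N) (hv : v < Γ.N) {d e : ℕ}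
    (hd : c.reg d = addr Γ.N a l) (he : c.reg e = v) :
    Rel Γ (s.put a l v) ((Instr.store d e).exec W c) := by
  refine ⟨h.bdd.put hv, h.reg, h.last, h.size, fun i hi => ?_, fun a' ha' l' hl' hN' => ?_, h.out⟩
  · simp only [Instr.exec, hd]
    rw [Function.update_of_ne (by simp only [addr]; omega), h.inp i hi]
  · simp only [Instr.exec, hd, he, State.put]
    by_cases hal : a' = a ∧ l' = l
    · obtain ⟨rfl, rfl⟩ := hal
      simp
    · rw [Function.update_of_ne, h.arr a' ha' l' hl' hN']
      · simp only [Function.update_apply]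
        split
        · rename_i h1
          rw [Function.update_of_ne (fun h2 => hal ⟨h1, h2⟩), h1]
        · rfl
      · intro h1
        exact hal (addr_inj ha' ha (hl'.trans hl.symm) hN' hN h1)

/-- The code of a command simulates it, within its static cost bound. -/
theorem Cmd.runs {Γ : Ctx} {W S n : ℕ} (hW : Fits Γ W) (hS : 1 ≤ S) (hn : 1 ≤ n)
    (c : Cmd) (hok : c.ok) {s : State} (hs : s.Bdd Γ.N) (hB : Small S n s) {t : ℕ} (ht : 2 ≤ t) :
    Runs Γ W s t (fun o => c.code o t) (c.eval Γ s) (c.cost.val S n) := by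
  have h8 := hW.eight_le
  have hlt := hW.lt
  have hle {x y : Bd} {k l : ℕ} (hk : k ≤ x.val S n) (hl : l ≤ y.val S n) :
    k + l ≤ (x.add y).val S n := Bd.val_add_le hS hn hk hl
  have hc (k : ℕ) : k ≤ (Bd.c k).val S n := by simp
  have hev (e : Expr) (he : e.ok) {s : State} (hs : s.Bdd Γ.N) (hB : Small S n s) {t : ℕ}
      (ht : 2 ≤ t) := e.evaluates hW hS hn he hs hB ht
  induction c generalizing s t with
  | skip => exact fun P m hm _ => ⟨m, (Ev.refl hm).mono (by simp) (by simp [code])⟩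
  | assign r e =>
    simp only [ok, Bool.and_eq_true] at hok
    exact (Runs.assign hW (e.denote_lt h8 hok.2 hs) (hev e hok.2 hs hB ht)).mono
      (hle le_rfl (hc 1))
  | store a e₁ e₂ e₃ e₄ e₅ e₆ e =>
    simp only [ok, Bool.and_eq_true, decide_eq_true_eq] at hok
    obtain ⟨⟨⟨⟨⟨⟨⟨ha, k₁⟩, k₂⟩, k₃⟩, k₄⟩, k₅⟩, k₆⟩, k⟩ := hok
    intro P m hm hP
    have hN : ∀ x ∈ [e₁.denote Γ s, e₂.denote Γ s, e₃.denote Γ s, e₄.denote Γ s, e₅.denote Γ s,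
        e₆.denote Γ s], x < Γ.N := by
      simp only [List.forall_mem_cons]
      exact ⟨e₁.denote_lt h8 k₁ hs, e₂.denote_lt h8 k₂ hs, e₃.denote_lt h8 k₃ hs,
        e₄.denote_lt h8 k₄ hs, e₅.denote_lt h8 k₅ hs, e₆.denote_lt h8 k₆ hs, by simp⟩
    have hcell := cell_spec hW ht ha (hev e₁ k₁ hs hB (by omega)) (hev e₂ k₂ hs hB (by omega))
      (hev e₃ k₃ hs hB (by omega)) (hev e₄ k₄ hs hB (by omega)) (hev e₅ k₅ hs hB (by omega))
      (hev e₆ k₆ hs hB (by omega)) hN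
    simp only [code] at hP
    rw [codeAt_append, codeAt_append] at hP
    obtain ⟨c₁, h₁, q₁, r₁⟩ := hcell.seq (hev e k hs hB (by omega)) hm hP.1.1 hP.1.2
    have hP2 := hP.2.1
    rw [List.length_append, ← h₁.pc] at hP2
    refine ⟨(Instr.store (2 * t) (2 * t + 2)).exec W c₁,
      ⟨(h₁.steps.trans (Steps.cons hP2 (Steps.refl _))).mono ?_,
      h₁.rel.store ha (by simp) hN (e.denote_lt h8 k hs) q₁ r₁, ?_, h₁.low, h₁.em⟩⟩
    · have := hle (hle (hle (hle (hle (hle (hle (hle (le_refl (e₁.cost.val S n))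
        (le_refl (e₂.cost.val S n))) (le_refl (e₃.cost.val S n))) (le_refl (e₄.cost.val S n)))
        (le_refl (e₅.cost.val S n))) (le_refl (e₆.cost.val S n))) (hc 19))
        (le_refl (e.cost.val S n))) (hc 1)
      simp only [cost]
      omega
    · simp only [Instr.exec, h₁.pc, code]
      simp; ring
  | seq c d ihc ihd =>
    simp only [ok, Bool.and_eq_true] at hok
    exact ((ihc hok.1 hs hB ht).seq (ihd hok.2 (c.eval_bdd h8 hok.1 hs) (hB.eval hok.1) ht)).mono
      (hle le_rfl le_rfl)
  | ite c a b iha ihb =>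
    simp only [ok, Bool.and_eq_true] at hok
    intro P m hm hP
    simp only [code, codeAt_append, codeAt_cons, List.length_append, List.length_cons,
      ← add_assoc] at hP
    obtain ⟨⟨q1, q2, q3⟩, q4, q5⟩ := hP
    rw [add_right_comm] at q4
    replace q5 := q5.at (o' := m.pc + (c.code m.pc t).length + 1 +
      (a.code (m.pc + (c.code m.pc t).length + 1) t).length + 1) (by ring)
    obtain ⟨c₁, h₁, e₁⟩ := hev c hok.1.1 hs hB ht P m hm q1
    have p₁ := h₁.pc
    simp only at p₁
    simp only [eval]
    split
    · rename_i hcv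
      obtain ⟨c₂, h₂, f₂, -, p₂⟩ := h₁.goto (p := (c.code m.pc t).length + 1)
        (by rw [p₁]; exact q2)
        (by simp only [Instr.exec]; rw [e₁, if_neg hcv, p₁]; rfl)
      rw [← add_assoc] at p₂
      obtain ⟨c₃, h₃⟩ := iha hok.1.2 hs hB ht P c₂ h₂.rel (by rw [p₂]; exact q3)
      have g₃ := h₂.trans h₃ le_rfl
      have p₃ := h₃.pc
      simp only [p₂] at p₃
      obtain ⟨c₄, h₄, f₄, -, p₄⟩ := g₃.goto
        (p := ((Cmd.ite c a b).code m.pc t).length)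
        (by rw [p₃]; exact q4)
        (by simp only [Instr.exec, code]; congr 1; simp; ring)
      refine ⟨c₄, h₄.mono ?_ rfl⟩
      refine le_trans ?_ (hle (hle (hle le_rfl le_rfl) (Nat.zero_le (b.cost.val S n))) (hc 2))
      omega
    · rename_i hcv
      have hcv : c.denote Γ s = 0 := by simpa using hcv
      obtain ⟨c₂, h₂, f₂, -, p₂⟩ := h₁.goto (p := (c.code m.pc t).length + 1 +
          (a.code (m.pc + (c.code m.pc t).length + 1) t).length + 1)
        (by rw [p₁]; exact q2)
        (by simp only [Instr.exec]; rw [e₁, if_pos hcv]; simp; ring)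
      simp only [← add_assoc] at p₂
      obtain ⟨c₃, h₃⟩ := ihb hok.2 hs hB ht P c₂ h₂.rel (by rw [p₂]; exact q5)
      have g₃ := h₂.trans h₃ le_rfl
      refine ⟨c₃, g₃.mono ?_ (by simp only [p₂, code]; simp; ring)⟩
      refine le_trans ?_ (hle (hle (hle le_rfl (Nat.zero_le (a.cost.val S n))) le_rfl) (hc 2))
      omega
  | loop x b c ih =>
    simp only [ok, Bool.and_eq_true, decide_eq_true_eq] at hok
    obtain ⟨⟨⟨hx, kb⟩, kb'⟩, kc⟩ := hok
    intro P m hm hP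
    have db := b.denote_lt h8 kb hs
    simp only [code, codeAt_append, codeAt_cons] at hP
    obtain ⟨⟨q1, q2, q3, q4, q5, q6, q7, q8, q9⟩, q10, q11, -⟩ := hP
    obtain ⟨c₁, h₁, e₁⟩ := hev b kb hs hB ht P m hm q1
    have p₁ := h₁.pc
    have r1 := h₁.rel.reg x
    have := hs.reg x
    obtain ⟨c₂, h₂, e₂, f₂, -, p₂⟩ := h₁.temp (d := 2 * t + 4) (v := s.reg x)
      (by rw [p₁]; exact q2) (by simp [Instr.exec, r1]) (by omega) (by omega) (by omega) (by omega)
    obtain ⟨c₃, h₃, e₃, f₃, -, p₃⟩ := h₂.temp (d := 2 * t + 2) (v := 0)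
      (by rw [p₂, p₁]; exact q3) (by simp [Instr.exec]) (by omega) (by omega) (by omega) (by omega)
    have p₃' : c₃.pc = m.pc + (b.code m.pc t).length + 2 := by rw [p₃, p₂, p₁]
    set o := m.pc + (b.code m.pc t).length + 2 with ho
    have q4' : P[o]? = _ := q4
    have q5' : P[o + 1]? = _ := q5
    have q6' : P[o + 2]? = _ := q6
    have q7' : P[o + 3]? = _ := q7
    have q8' : P[o + 4]? = _ := q8
    have q9' : CodeAt P (o + 5) _ := q9
    clear q1 q2 q3 q4 q5 q6 q7 q8 q9
    -- the state after `k` iterations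
    set I := fun k => iter (fun k s' => (c.eval Γ (s'.set x k)).set x (s'.reg x)) k s with hI
    have hIx : ∀ k, (I k).reg x = s.reg x := fun k =>
      iter_inv (fun _ (s' : State) => s'.reg x = s.reg x) rfl
        fun k hk s' hs' => by simpa [State.set] using hs'
    have hIB : ∀ k ≤ b.denote Γ s, (I k).Bdd Γ.N ∧ Small S n (I k) := fun k hk =>
      iter_inv (fun _ (s' : State) => s'.Bdd Γ.N ∧ Small S n s') ⟨hs, hB⟩ fun k' hk' s' hs' =>
        ⟨(c.eval_bdd h8 kc (hs'.1.set (by omega))).set (hs'.1.reg _),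
          ((hs'.2.set hx).eval kc).set hx⟩
    have key : ∀ k ≤ b.denote Γ s, ∃ c', Steps P W (k * (c.cost.val S n + 7)) c₃ c' ∧
        Rel Γ (I k) c' ∧ c'.pc = o ∧ c'.reg (2 * t) = b.denote Γ s ∧ c'.reg (2 * t + 2) = k ∧
        c'.reg (2 * t + 4) = s.reg x ∧ (∀ u < t, c'.reg (2 * u) = c₃.reg (2 * u)) ∧
        c'.emitted = c₃.emitted := by
      intro k
      induction k with
      | zero =>
        exact fun _ => ⟨c₃, (Steps.refl _).mono (by simp), h₃.rel, p₃',
          by rw [f₃ _ (by omega), f₂ _ (by omega), e₁], e₃, by rw [f₃ _ (by omega), e₂],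
          fun _ _ => rfl, rfl⟩
      | succ k ihk =>
        intro hk
        obtain ⟨d₀, s₀, r₀, p₀, a₀, b₀, c₀, l₀, m₀⟩ := ihk (by omega)
        obtain ⟨d₁, g₁, a₁, b₁, -, u₁⟩ := (Ev.refl (P := P) (W := W) (t := t) r₀).temp
          (d := 2 * t + 6) (v := b.denote Γ s - k)
          (by rw [p₀]; exact q4')
          (by simp only [Instr.exec]; rw [a₀, b₀]) (by omega) (by omega) (by omega) (by omega)
        obtain ⟨d₂, g₂, a₂, -, u₂⟩ := g₁.goto (p := 2)
          (by rw [u₁, p₀]; exact q5')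
          (by simp only [Instr.exec]; rw [a₁, if_neg (by omega), u₁])
        obtain ⟨d₃, g₃, a₃, u₃⟩ := g₂.user (x := x) (v := k)
          (by rw [u₂, p₀]; exact q6')
          (by simp only [Instr.exec]; rw [a₂, b₁ _ (by omega), b₀]) (by omega) (by omega)
        obtain ⟨d₄, g₄, a₄, b₄, -, u₄⟩ := g₃.temp (d := 2 * t + 6) (v := 1)
          (by rw [u₃, u₂, p₀]; exact q7') (by simp [Instr.exec])
          (by omega) (by omega) (by omega) (by omega)
        have t1 : d₄.reg (2 * t + 2) = k := by
          rw [b₄ _ (by omega), show 2 * t + 2 = 2 * (t + 1) by ring, a₃, a₂,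
            b₁ _ (by omega), ← b₀]; congr 1
        have t2 : d₄.reg (2 * t + 4) = s.reg x := by
          rw [b₄ _ (by omega), show 2 * t + 4 = 2 * (t + 2) by ring, a₃, a₂,
            b₁ _ (by omega), ← c₀]; congr 1
        obtain ⟨d₅, g₅, a₅, b₅, -, u₅⟩ := g₄.temp (d := 2 * t + 2) (v := k + 1)
          (by rw [u₄, u₃, u₂, p₀]; exact q8') (by simp only [Instr.exec]; rw [t1, a₄])
          (by omega) (by omega) (by omega) (by omega)
        have u₅' : d₅.pc = o + 5 := by rw [u₅, u₄, u₃, u₂, p₀]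
        have hBk := hIB k (by omega)
        obtain ⟨d₆, g₆⟩ := ih kc (hBk.1.set (x := x) (v := k) (by omega)) (hBk.2.set hx)
          (t := t + 3) (by omega) P d₅ g₅.rel (by rw [u₅']; exact q9')
        have u₆ := g₆.pc
        rw [u₅'] at u₆
        have g₆' := g₅.trans g₆ (by omega)
        obtain ⟨d₇, g₇, a₇, u₇⟩ := g₆'.user (x := x) (v := s.reg x)
          (by rw [u₆]; convert q10 using 2; simp [ho]; ring)
          (by
            simp only [Instr.exec]
            rw [show 2 * t + 4 = 2 * (t + 2) by ring, g₆.low _ (by omega),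
              show 2 * (t + 2) = 2 * t + 4 by ring, b₅ _ (by omega), t2]) (by omega) (by omega)
        obtain ⟨d₈, g₈, a₈, -, u₈⟩ := g₇.goto (p := 0)
          (by rw [u₇, u₆]; convert q11 using 2; simp [ho]; ring)
          (by simp [Instr.exec, p₀])
        have hrel := g₈.rel
        have hIs : I (k + 1) = (c.eval Γ ((I k).set x k)).set x (s.reg x) := by
          rw [← hIx k]; rfl
        rw [← hIs] at hrel
        refine ⟨d₈, (s₀.trans g₈.steps).mono (by rw [Nat.succ_mul]; omega), hrel, by rw [u₈, p₀],
          ?_, ?_, ?_, fun u hu => by rw [g₈.low u hu, l₀ u hu], g₈.em.trans m₀⟩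
        · rw [a₈, a₇, g₆.low _ (by omega), b₅ _ (by omega), b₄ _ (by omega), a₃, a₂,
            b₁ _ (by omega), a₀]
        · rw [a₈, show 2 * t + 2 = 2 * (t + 1) by ring, a₇, g₆.low _ (by omega), ← a₅]; congr 1
        · rw [a₈, show 2 * t + 4 = 2 * (t + 2) by ring, a₇, g₆.low _ (by omega), ← t2,
            ← b₅ _ (by omega)]; congr 1
    obtain ⟨d₀, s₀, r₀, p₀, a₀, b₀, c₀, l₀, m₀⟩ := key _ le_rfl
    have h₄ : Ev Γ P W (I (b.denote Γ s)) t m d₀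
        (b.cost.val S n + 2 + b.denote Γ s * (c.cost.val S n + 7)) ((b.code m.pc t).length + 2) :=
      ⟨h₃.steps.trans s₀, r₀, by rw [p₀, ho]; ring, fun u hu => by rw [l₀ u hu, h₃.low u hu],
        m₀.trans h₃.em⟩
    obtain ⟨d₁, g₁, a₁, b₁, -, u₁⟩ := h₄.temp (d := 2 * t + 6) (v := 0)
      (by rw [p₀]; exact q4')
      (by simp only [Instr.exec]; rw [a₀, b₀, Nat.sub_self]) (by omega) (by omega) (by omega)
      (by omega)
    obtain ⟨d₂, g₂, a₂, -, u₂⟩ := g₁.goto (p := ((Cmd.loop x b c).code m.pc t).length)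
      (by rw [u₁, p₀]; exact q5')
      (by simp only [Instr.exec]; rw [a₁, if_pos rfl]; congr 1; simp [code, ho]; omega)
    refine ⟨d₂, g₂.mono ?_ rfl⟩
    have hb := b.denote_le_bmax hB kb' (Γ := Γ)
    have h1 := hle (hle (le_refl (b.cost.val S n)) (hc 4)) (x := b.cost.add (Bd.c 4))
      (y := b.bmax.mul (c.cost.add (Bd.c 7)))
      (l := b.denote Γ s * (c.cost.val S n + 7)) (by
        rw [Bd.val_mul]
        exact Nat.mul_le_mul hb (hle le_rfl (hc 7)))
    simp only [cost]
    omega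
  | write e =>
    simp only [ok] at hok
    intro P m hm hP
    simp only [code, codeAt_append, codeAt_cons] at hP
    obtain ⟨c₁, h₁, e₁⟩ := hev e hok hs hB ht P m hm hP.1
    have hP2 := hP.2.1
    have p₁ := h₁.pc
    simp only at p₁
    rw [← p₁] at hP2
    refine ⟨(Instr.write (2 * t)).exec W c₁,
      ⟨(h₁.steps.trans (Steps.cons hP2 (Steps.refl _))).mono (hle le_rfl (hc 1)), ?_, ?_, h₁.low,
        h₁.em⟩⟩
    · obtain ⟨k1, k2, k3, k4, k5, k6, k7⟩ := h₁.rel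
      exact ⟨⟨k1.reg, k1.arr⟩, k2, k3, k4, k5, k6, by simp [Instr.exec, k7, e₁, eval]⟩
    · simp [Instr.exec, p₁, code, add_assoc]

/-! ### Machines for decision and enumeration -/

/-- The environment for an input. The bound for the values is linear in the length of the input, and
large enough for all sums of positions that the program forms. -/
def ctxOf (input : List ℕ) : Ctx where
  N := 8 * (input.length + 1)
  inp := fun i => input.getD i 0

/-- The state with all variables zero. -/
def State.zero : State := ⟨fun _ => 0, fun _ _ => 0, []⟩

/-- Code that puts the numbers `N - 1` and `N` into the registers `0` and `2`. -/
def setupCode : List Instr :=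
  [.const 2 1, .add 2 0 2, .const 0 8, .mul 2 0 2, .const 0 1, .sub 0 2 0]

/-- The cells of the arrays have addresses below `64 * N ^ 6`, and `N` is linear in the length of
the input; so words whose size is `30` times its logarithm suffice. -/
theorem fits_ctxOf {input : List ℕ} {W : ℕ} (h : WordSize 30 W input) : Fits (ctxOf input) W := by
  refine ⟨by simp [ctxOf], le_trans ?_ h.1, fun i _ => ?_⟩
  · simp only [ctxOf]
    have h1 : 8 * (input.length + 1) ≤ (input.length + 2) ^ 4 := by
      have : 2 ^ 3 ≤ (input.length + 2) ^ 3 := Nat.pow_le_pow_left (by omega) 3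
      rw [pow_succ]; nlinarith
    have h2 : 64 ≤ (input.length + 2) ^ 6 := by
      have : 2 ^ 6 ≤ (input.length + 2) ^ 6 := Nat.pow_le_pow_left (by omega) 6
      simpa using this
    calc 64 * (8 * (input.length + 1)) ^ 6
        ≤ (input.length + 2) ^ 6 * ((input.length + 2) ^ 4) ^ 6 :=
          Nat.mul_le_mul h2 (Nat.pow_le_pow_left h1 6)
      _ = (input.length + 2) ^ 30 := by ring
  · simp only [ctxOf]
    rw [List.getD_eq_getElem?_getD]
    cases hi : input[i]? with
    | none => simp
    | some v => exact h.2 v (List.mem_of_getElem? hi)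

theorem setup {input : List ℕ} {W : ℕ} (hW : Fits (ctxOf input) W) {P : Program}
    (hP : CodeAt P 0 setupCode) :
    ∃ c, Steps P W 6 (initial input) c ∧ Rel (ctxOf input) State.zero c ∧ c.pc = 6 ∧
      c.emitted = [] := by
  have hlt := hW.lt
  simp only [setupCode, codeAt_cons] at hP
  obtain ⟨h1, h2, h3, h4, h5, h6, -⟩ := hP
  have hN : (ctxOf input).N = 8 * (input.length + 1) := rfl
  rw [hN] at hlt
  refine ⟨_, Steps.cons h1 (Steps.cons h2 (Steps.cons h3 (Steps.cons h4 (Steps.cons h5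
    (Steps.cons h6 (Steps.refl _)))))), ⟨⟨fun r => ?_, fun a l => ?_⟩, fun r => ?_, ?_, ?_,
    fun i hi => rfl, fun a ha l hl hN' => ?_, rfl⟩, rfl, rfl⟩
  · simp [State.zero, hN]
  · simp [State.zero, hN]
  · simp only [Instr.exec, Config.set, initial, State.zero]
    repeat rw [Function.update_of_ne (by omega)]
  · simp [Instr.exec, Config.set, initial, hN]
    rw [Nat.mod_eq_of_lt (a := 8 * _) (by omega), Nat.mod_eq_of_lt (by omega),
      Nat.mod_eq_of_lt (a := 1) (by omega)]
  · simp [Instr.exec, Config.set, initial, hN]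
    rw [Nat.mod_eq_of_lt (by omega)]
  · simp only [Instr.exec, Config.set, initial, State.zero]
    rw [List.getD_eq_default]
    simp only [addr, hN]; omega

theorem halted_step {P : Program} {W : ℕ} {c : Config} (h : P.Halted c) : P.step W c = c := by
  have : P[c.pc]? = none := List.getElem?_eq_none h
  simp [Program.step, this]

theorem halted_iterate {P : Program} {W : ℕ} {c : Config} (h : P.Halted c) (t : ℕ) :
    (P.step W)^[t] c = c := Function.iterate_fixed (halted_step h) t

theorem Steps.halted {P : Program} {W K T : ℕ} {c c' : Config} (h : Steps P W K c c')
    (hh : P.Halted c') (hT : K ≤ T) : (P.step W)^[T] c = c' := by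
  obtain ⟨k, hk, e⟩ := h
  obtain ⟨d, rfl⟩ := Nat.exists_eq_add_of_le (hk.trans hT)
  rw [add_comm, Function.iterate_add_apply, e, halted_iterate hh]

/-- A program that runs the code `f` and returns the scalar variable `F`. -/
def decider (f : ℕ → List Instr) (F : ℕ) : Program :=
  setupCode ++ f 6 ++ [.copy 0 (2 * F + 1)]

theorem decider_spec {input : List ℕ} {W K T : ℕ} (hW : Fits (ctxOf input) W)
    {f : ℕ → List Instr} {F : ℕ} {s : State} {A : Prop}
    (hf : Runs (ctxOf input) W State.zero 2 f s K) (hT : K + 7 ≤ T)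
    (h1 : A → s.reg F = 1) (h0 : ¬ A → s.reg F = 0) :
    (decider f F).DecidesIn W input T A := by
  have hc1 : CodeAt (decider f F) 0 setupCode := by
    simpa [decider] using codeAt_self [] setupCode (f 6 ++ [.copy 0 (2 * F + 1)])
  have hc2 : CodeAt (decider f F) 6 (f 6) := codeAt_self setupCode (f 6) [.copy 0 (2 * F + 1)]
  have hc3 : CodeAt (decider f F) (6 + (f 6).length) [.copy 0 (2 * F + 1)] := by
    have := codeAt_self (setupCode ++ f 6) [.copy 0 (2 * F + 1)] []
    rw [List.append_nil] at this
    exact this.at (by simp [setupCode]; omega)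
  obtain ⟨c₁, s₁, r₁, p₁, -⟩ := setup hW hc1
  obtain ⟨c₂, h₂⟩ := hf _ c₁ r₁ (by rw [p₁]; exact hc2)
  have p₂ := h₂.pc
  rw [p₁] at p₂
  have s₃ := (s₁.trans h₂.steps).trans (Steps.cons (by rw [p₂]; exact hc3.1) (Steps.refl _))
  have hrun := s₃.halted (T := T) (by
    simp [Program.Halted, Instr.exec, Config.set, p₂, decider, setupCode]; omega) (by omega)
  have hlt := h₂.rel.bdd.reg F
  have := hW.lt
  have hreg : ((Instr.copy 0 (2 * F + 1)).exec W c₂).reg 0 = s.reg F := by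
    simp only [Instr.exec, Config.set, h₂.rel.reg, Function.update_self]
    exact Nat.mod_eq_of_lt (by omega)
  unfold Program.DecidesIn Program.run
  rw [hrun]
  refine ⟨by simp [Program.Halted, Instr.exec, Config.set, p₂, decider, setupCode]; omega, ?_, ?_⟩
  · rw [hreg]; exact h1
  · rw [hreg]; exact h0

/-- From `s`, the code `g` (find the next result) and `h` (write it) produces the list of outputs
in alternation, until the variable `F` becomes zero. -/
inductive EnumRuns (Γ : Ctx) (W K F : ℕ) (g h : ℕ → List Instr) : State → List (List ℕ) → Prop
  | done {s s' : State} : Runs Γ W s 2 g s' K → s'.reg F = 0 → EnumRuns Γ W K F g h s []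
  | next {s s' s'' : State} {L : List (List ℕ)} : Runs Γ W s 2 g s' K → s'.reg F ≠ 0 →
      Runs Γ W s' 2 h s'' K → EnumRuns Γ W K F g h { s'' with out := [] } L →
      EnumRuns Γ W K F g h s (s''.out :: L)

/-- The loop of an enumeration, at position `o`. -/
def enumLoop (F : ℕ) (g h : ℕ → List Instr) (o : ℕ) : List Instr :=
  let o₁ := o + (g o).length + 1
  g o ++ .jzero (2 * F + 1) (o₁ + (h o₁).length + 2) :: h o₁ ++ [.emit, .jump o]

/-- The program that runs the code `f` and then the loop of the enumeration. -/
def enumerator (f g h : ℕ → List Instr) (F : ℕ) : Program :=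
  setupCode ++ f 6 ++ enumLoop F g h (6 + (f 6).length)

/-- Within `D` steps after any time the machine has output another result or is halted. -/
def Delay (P : Program) (W D : ℕ) (c : Config) : Prop :=
  ∀ t, P.Halted ((P.step W)^[t + D] c) ∨
    ((P.step W)^[t] c).emitted.length < ((P.step W)^[t + D] c).emitted.length

theorem emitted_mono {P : Program} {W : ℕ} (c : Config) {t t' : ℕ} (h : t ≤ t') :
    ((P.step W)^[t] c).emitted.length ≤ ((P.step W)^[t'] c).emitted.length := by
  induction h with
  | refl => exact le_rfl
  | step h ih =>
    refine ih.trans ?_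
    rw [Function.iterate_succ_apply']
    generalize (P.step W)^[_] c = c'
    unfold Program.step
    split
    · rename_i i _
      cases i <;> simp [Instr.exec, Config.set]
    · exact le_rfl

theorem Delay.of_halted {P : Program} {W D : ℕ} {c c' : Config} (h : Steps P W D c c')
    (hh : P.Halted c') : Delay P W D c := fun t => .inl (by
  rw [h.halted hh (Nat.le_add_left D t)]; exact hh)

/-- The delay bound is inherited by an earlier configuration `c` if no output happens on the way to
`c'` except in the last step. -/
theorem Delay.of_steps {P : Program} {W D k : ℕ} {c c' : Config} (h : (P.step W)^[k] c = c')
    (hk : k ≤ D) (hlt : ∀ t < k, ((P.step W)^[t] c).emitted.length < c'.emitted.length)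
    (hd : Delay P W D c') : Delay P W D c := by
  intro t
  rcases lt_or_ge t k with ht | ht
  · refine .inr ((hlt t ht).trans_le ?_)
    rw [← h]
    exact emitted_mono c (by omega)
  · obtain ⟨d, rfl⟩ := Nat.exists_eq_add_of_le ht
    have := hd d
    rw [← h, ← Function.iterate_add_apply, ← Function.iterate_add_apply] at this
    rw [show k + d + D = d + D + k by ring, show k + d = d + k by ring]
    exact this

/-- The loop of an enumeration, `k₀` steps after the last output in `c₀`. -/
theorem enumLoop_spec {Γ : Ctx} {W K F : ℕ} {g h : ℕ → List Instr} {P : Program} {o : ℕ}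
    (hP : CodeAt P o (enumLoop F g h o)) (hlen : P.length = o + (enumLoop F g h o).length)
    {s : State} {L : List (List ℕ)} (hs : EnumRuns Γ W K F g h s L) {k₀ D : ℕ}
    (hD : k₀ + 2 * K + 4 ≤ D) (hk₀ : 1 ≤ k₀) {c₀ c : Config} (h₀ : Steps P W k₀ c₀ c)
    (hc : Rel Γ s c) (hpc : c.pc = o) (hem : c.emitted = c₀.emitted) :
    (∃ T, P.Halted ((P.step W)^[T] c₀) ∧ ((P.step W)^[T] c₀).emitted = c₀.emitted ++ L) ∧
      Delay P W D c₀ := by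
  have hP0 := hP
  simp only [enumLoop, codeAt_append, codeAt_cons] at hP
  obtain ⟨⟨q1, q2, q3⟩, q4, q5, -⟩ := hP
  induction hs generalizing c₀ c k₀ with
  | @done s s' hg hF =>
    obtain ⟨c₁, h₁⟩ := hg P c hc (by rw [hpc]; exact q1)
    have p₁ := h₁.pc
    rw [hpc] at p₁
    obtain ⟨c₂, h₂, -, -, p₂⟩ := h₁.goto (p := (enumLoop F g h o).length)
      (by rw [p₁]; exact q2)
      (by
        simp only [Instr.exec]; rw [h₁.rel.reg, if_pos hF]; congr 1
        simp [enumLoop, hpc]; ring)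
    have hh : P.Halted c₂ := by
      simp only [Program.Halted]; rw [p₂, hpc, hlen]
    have hst := h₀.trans h₂.steps
    refine ⟨⟨k₀ + (K + 1), ?_⟩, Delay.of_halted (hst.mono (by omega)) hh⟩
    · rw [hst.halted hh le_rfl]
      exact ⟨hh, by rw [h₂.em, hem]; simp⟩
  | @next s s' s'' L hg hF hh hL ih =>
    obtain ⟨c₁, h₁⟩ := hg P c hc (by rw [hpc]; exact q1)
    have p₁ := h₁.pc
    rw [hpc] at p₁
    obtain ⟨c₂, h₂, -, -, p₂⟩ := h₁.goto (p := (g o).length + 1)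
      (by rw [p₁]; exact q2)
      (by simp only [Instr.exec]; rw [h₁.rel.reg, if_neg hF, p₁, hpc]; rfl)
    rw [hpc, ← add_assoc] at p₂
    obtain ⟨c₃, h₃⟩ := hh P c₂ h₂.rel (by rw [p₂]; exact q3)
    have p₃ := h₃.pc
    rw [p₂] at p₃
    have g₃ := h₂.trans h₃ le_rfl
    obtain ⟨k, hk, e⟩ := h₀.trans g₃.steps
    have q4' : P[c₃.pc]? = some .emit := by
      rw [p₃]; convert q4 using 2; simp; ring
    set c₄ := Instr.emit.exec W c₃ with hc₄
    have e₄ : (P.step W)^[k + 1] c₀ = c₄ := by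
      rw [Function.iterate_succ_apply', e, step_eq q4']
    have p₄ : c₄.pc = c₃.pc + 1 := rfl
    have q5' : P[c₄.pc]? = some (.jump o) := by
      rw [p₄, p₃]; convert q5 using 2; simp; ring
    have em₃ : c₃.emitted = c₀.emitted := g₃.em.trans hem
    have em₄ : c₄.emitted = c₀.emitted ++ [s''.out] := by
      simp [hc₄, Instr.exec, em₃, g₃.rel.out]
    have h₅ : Steps P W 1 c₄ ((Instr.jump o).exec W c₄) := Steps.cons q5' (Steps.refl _)
    have r₅ : Rel Γ { s'' with out := [] } ((Instr.jump o).exec W c₄) := by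
      obtain ⟨k1, k2, k3, k4, k5, k6, k7⟩ := g₃.rel
      exact ⟨⟨k1.reg, k1.arr⟩, k2, k3, k4, k5, k6, rfl⟩
    obtain ⟨⟨T, hT, eT⟩, hdel⟩ := ih (k₀ := 1) (by omega) (by omega) h₅ r₅ rfl rfl
    refine ⟨⟨T + (k + 1), ?_⟩, Delay.of_steps e₄ (by omega) (fun t ht => ?_) hdel⟩
    · rw [Function.iterate_add_apply, e₄]
      exact ⟨hT, by rw [eT, em₄]; simp⟩
    · have := emitted_mono (P := P) (W := W) c₀ (Nat.le_of_lt_succ ht)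
      rw [e, em₃] at this
      rw [em₄]; simp; omega

theorem enumerator_spec {input : List ℕ} {W K₀ K D F : ℕ} (hW : Fits (ctxOf input) W)
    {f g h : ℕ → List Instr} {s : State} {L : List (List ℕ)}
    (hf : Runs (ctxOf input) W State.zero 2 f s K₀)
    (hs : EnumRuns (ctxOf input) W K F g h s L) (hD : K₀ + 2 * K + 10 ≤ D) :
    (∃ T, (enumerator f g h F).Halted ((enumerator f g h F).run W input T) ∧
      ((enumerator f g h F).run W input T).emitted = L) ∧
    ∀ t, (enumerator f g h F).Halted ((enumerator f g h F).run W input (t + D)) ∨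
      ((enumerator f g h F).run W input t).emitted.length <
        ((enumerator f g h F).run W input (t + D)).emitted.length := by
  have hc1 : CodeAt (enumerator f g h F) 0 setupCode := by
    simpa [enumerator] using
      codeAt_self [] setupCode (f 6 ++ enumLoop F g h (6 + (f 6).length))
  have hc2 : CodeAt (enumerator f g h F) 6 (f 6) := codeAt_self setupCode (f 6) _
  have hc3 : CodeAt (enumerator f g h F) (6 + (f 6).length)
      (enumLoop F g h (6 + (f 6).length)) := by
    have := codeAt_self (setupCode ++ f 6) (enumLoop F g h (6 + (f 6).length)) []
    rw [List.append_nil] at this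
    exact this.at (by simp [setupCode]; omega)
  obtain ⟨c₁, s₁, r₁, p₁, m₁⟩ := setup hW hc1
  obtain ⟨c₂, h₂⟩ := hf _ c₁ r₁ (by rw [p₁]; exact hc2)
  have p₂ := h₂.pc
  rw [p₁] at p₂
  have := enumLoop_spec (D := D) hc3 (by simp [enumerator, setupCode]; ring) hs (by omega)
    (by omega) (s₁.trans h₂.steps) h₂.rel p₂ (by rw [h₂.em, m₁]; rfl)
  obtain ⟨⟨T, hT, eT⟩, hd⟩ := this
  exact ⟨⟨T, hT, eT⟩, hd⟩

/-! ### Join trees -/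

/-- `JT vs E A`: the hyperedges `vs i` with `i ∈ A` have a join tree all of whose edges `a b`
satisfy `E a b`. Removing an edge `a b` of a tree leaves two parts; the variables that they share
have to occur in both `a` and `b`. -/
inductive JT {ι : Type*} [DecidableEq ι] (vs : ι → Set ℕ) (E : ι → ι → Prop) : Finset ι → Prop
  | single (i : ι) : JT vs E {i}
  | join {A B : Finset ι} {a b : ι} : JT vs E A → JT vs E B → Disjoint A B → a ∈ A → b ∈ B →
      E a b → (∀ i ∈ A, ∀ j ∈ B, vs i ∩ vs j ⊆ vs a ∩ vs b) → JT vs E (A ∪ B)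

/-- `GT vs S A`: the set `A` arises from its subset `S` by attaching join trees. -/
inductive GT {ι : Type*} [DecidableEq ι] (vs : ι → Set ℕ) (S : Finset ι) : Finset ι → Prop
  | base : GT vs S S
  | attach {A B : Finset ι} {a b : ι} : GT vs S A → JT vs (fun _ _ => True) B → Disjoint A B →
      a ∈ A → b ∈ B → (∀ i ∈ A, ∀ j ∈ B, vs i ∩ vs j ⊆ vs a ∩ vs b) → GT vs S (A ∪ B)

section

variable {ι : Type*} [DecidableEq ι] {vs : ι → Set ℕ}

theorem GT.subset {S A : Finset ι} (h : GT vs S A) : S ⊆ A := by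
  induction h with
  | base => exact subset_rfl
  | attach _ _ _ _ _ _ ih => exact ih.trans Finset.subset_union_left

/-- A join tree can be rooted at any of its nodes. -/
theorem JT.root {A : Finset ι} (h : JT vs (fun _ _ => True) A) {r : ι} (hr : r ∈ A) :
    GT vs {r} A := by
  induction h with
  | single i => obtain rfl : r = i := by simpa using hr
                exact .base
  | @join A B a b hA hB hd ha hb _ hv ihA ihB =>
    rcases Finset.mem_union.1 hr with hr | hr
    · exact (ihA hr).attach hB hd ha hb hv
    · rw [Finset.union_comm]
      exact (ihB hr).attach hA hd.symm hb ha fun i hi j hj x hx => (hv j hj i hi hx.symm).symm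

/-- Every node outside of `S` lies in a join tree that is attached to a node of `S`. -/
theorem GT.split {S A : Finset ι} (h : GT vs S A) {v : ι} (hv : v ∈ A) (hvS : v ∉ S) :
    ∃ (U B : Finset ι) (u b : ι), A = U ∪ B ∧ GT vs S U ∧ JT vs (fun _ _ => True) B ∧
      Disjoint U B ∧ u ∈ S ∧ b ∈ B ∧ v ∈ B ∧
      ∀ i ∈ U, ∀ j ∈ B, vs i ∩ vs j ⊆ vs u ∩ vs b := by
  induction h generalizing v with
  | base => exact absurd hv hvS
  | @attach A C a c hA hC hd ha hc hac ih =>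
    by_cases haS : a ∈ S ∧ v ∈ C
    · exact ⟨A, C, a, c, rfl, hA, hC, hd, haS.1, hc, haS.2, hac⟩
    · -- the part of `A` that contains `v`, or `a` if `v` belongs to `C`
      have hx : ∃ x ∈ A, x ∉ S ∧ (v ∈ A → x = v) ∧ (v ∉ A → x = a ∧ v ∈ C) := by
        by_cases hvA : v ∈ A
        · exact ⟨v, hvA, hvS, fun _ => rfl, fun h => absurd hvA h⟩
        · have hvC := (Finset.mem_union.1 hv).resolve_left hvA
          exact ⟨a, ha, fun h => haS ⟨h, hvC⟩, fun h => absurd h hvA, fun _ => ⟨rfl, hvC⟩⟩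
      obtain ⟨x, hxA, hxS, hx1, hx2⟩ := hx
      obtain ⟨U, B, u, b, rfl, hU, hB, hUB, hu, hb, hxB, hub⟩ := ih hxA hxS
      rw [Finset.disjoint_union_left] at hd
      by_cases haU : a ∈ U
      · have hvA : v ∈ U ∪ B := by
          by_contra hvA
          obtain ⟨rfl, -⟩ := hx2 hvA
          exact Finset.disjoint_left.1 hUB haU hxB
        obtain rfl := hx1 hvA
        refine ⟨U ∪ C, B, u, b, by ac_rfl,
          hU.attach hC hd.1 haU hc fun i hi j hj => hac i (Finset.mem_union_left _ hi) j hj, hB,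
          Finset.disjoint_union_left.2 ⟨hUB, hd.2.symm⟩, hu, hb, hxB, fun i hi j hj y hy => ?_⟩
        rcases Finset.mem_union.1 hi with hi | hi
        · exact hub i hi j hj hy
        · have := hac j (Finset.mem_union_right _ hj) i hi ⟨hy.2, hy.1⟩
          exact hub a haU j hj ⟨this.1, hy.2⟩
      · have haB := (Finset.mem_union.1 ha).resolve_left haU
        refine ⟨U, B ∪ C, u, b, by ac_rfl, hU,
          hB.join hC hd.2 haB hc trivial
            fun i hi j hj => hac i (Finset.mem_union_right _ hi) j hj,
          Finset.disjoint_union_right.2 ⟨hUB, hd.1⟩, hu, Finset.mem_union_left _ hb, ?_,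
          fun i hi j hj y hy => ?_⟩
        · by_cases hvA : v ∈ U ∪ B
          · rw [← hx1 hvA]; exact Finset.mem_union_left _ hxB
          · exact Finset.mem_union_right _ (hx2 hvA).2
        · rcases Finset.mem_union.1 hj with hj | hj
          · exact hub i hi j hj hy
          · have := hac i (Finset.mem_union_left _ hi) j hj hy
            exact hub i hi a haB ⟨hy.1, this.1⟩

/-- A node `v` outside of `U` that shares with `U` only variables of `u ∈ S` can be added to `S`. -/
theorem GT.insert_mem {S U : Finset ι} (h : GT vs S U) {u v : ι} (hu : u ∈ S) (hv : v ∉ U)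
    (huv : ∀ i ∈ U, vs i ∩ vs v ⊆ vs u) : GT vs (insert v S) (insert v U) := by
  induction h with
  | base => exact .base
  | @attach A B a b hA hB hd ha hb hab ih =>
    simp only [Finset.mem_union, not_or] at hv
    have := ih hv.1 fun i hi => huv i (Finset.mem_union_left _ hi)
    rw [← Finset.insert_union]
    refine this.attach hB ?_ (Finset.mem_insert_of_mem ha) hb fun i hi j hj x hx => ?_
    · exact Finset.disjoint_insert_left.2 ⟨hv.2, hd⟩
    · rcases Finset.mem_insert.1 hi with rfl | hi
      · have hxu := huv j (Finset.mem_union_right _ hj) ⟨hx.2, hx.1⟩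
        exact hab u (hA.subset hu) j hj ⟨hxu, hx.2⟩
      · exact hab i hi j hj hx

/-- Attaching at `v` a tree that is rooted at `v`. -/
theorem GT.graft {S U : Finset ι} {v : ι} (hU : GT vs (insert v S) (insert v U))
    {B : Finset ι} (h : GT vs {v} B) (hd : Disjoint U B)
    (hv : ∀ i ∈ U, ∀ j ∈ B, vs i ∩ vs j ⊆ vs v) : GT vs (insert v S) (U ∪ B) := by
  induction h with
  | base => rwa [Finset.union_comm, ← Finset.insert_eq]
  | @attach A C a c hA hC hAC ha hc hac ih =>
    rw [Finset.disjoint_union_right] at hd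
    rw [← Finset.union_assoc]
    refine (ih hd.1 fun i hi j hj => hv i hi j (Finset.mem_union_left _ hj)).attach hC ?_
      (Finset.mem_union_right _ ha) hc fun i hi j hj x hx => ?_
    · exact Finset.disjoint_union_left.2 ⟨hd.2, hAC⟩
    · rcases Finset.mem_union.1 hi with hi | hi
      · have := hv i hi j (Finset.mem_union_right _ hj) hx
        exact hac v (hA.subset (by simp)) j hj ⟨this, hx.2⟩
      · exact hac i hi j hj hx

/-- A step of Prim's algorithm on the intersection graph: a heaviest edge `u v` between `S` and its
complement can be added, because the edge of a join tree that leaves `S` towards `v` carries at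
least the variables shared by `u` and `v`, and no more by maximality. -/
theorem GT.prim {S A : Finset ι} (h : GT vs S A) (hfin : ∀ i, (vs i).Finite) {u v : ι}
    (hu : u ∈ S) (hv : v ∈ A) (hvS : v ∉ S)
    (hmax : ∀ i ∈ S, ∀ j ∈ A, j ∉ S → (vs i ∩ vs j).ncard ≤ (vs u ∩ vs v).ncard) :
    (∀ i ∈ S, vs i ∩ vs v ⊆ vs u) ∧ GT vs (insert v S) A := by
  obtain ⟨U, B, u', b, rfl, hU, hB, hUB, hu', hb, hvB, hub⟩ := h.split hv hvS
  have hbS : b ∉ S := fun hbS => Finset.disjoint_left.1 hUB (hU.subset hbS) hb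
  -- `u' b` is the edge of the join tree between `S` and the part of `v`
  have heq : vs u ∩ vs v = vs u' ∩ vs b :=
    Set.eq_of_subset_of_ncard_le (hub u (hU.subset hu) v hvB)
      (hmax u' hu' b (Finset.mem_union_right _ hb) hbS) ((hfin _).subset Set.inter_subset_left)
  rw [← heq] at hub
  have hvU : v ∉ U := fun hvU => Finset.disjoint_left.1 hUB hvU hvB
  refine ⟨fun i hi x hx => (hub i (hU.subset hi) v hvB hx).1, ?_⟩
  exact (hU.insert_mem hu hvU fun i hi x hx => (hub i hi v hvB hx).1).graft (hB.root hvB) hUB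
    fun i hi j hj x hx => (hub i hi j hj hx).2

theorem JT.insert_leaf {E : ι → ι → Prop} {A : Finset ι} (h : JT vs E A) {u v : ι} (hu : u ∈ A)
    (hv : v ∉ A) (hE : E u v) (huv : ∀ i ∈ A, vs i ∩ vs v ⊆ vs u) :
    JT vs E (insert v A) := by
  rw [Finset.insert_eq, Finset.union_comm]
  refine h.join (.single v) (by simpa using hv) hu (by simp) hE fun i hi j hj x hx => ?_
  obtain rfl : j = v := by simpa using hj
  exact ⟨huv i hi hx, hx.2⟩

/-- If every edge of a join tree is consistent in both directions, then a tuple of one hyperedge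
extends to a global solution. -/
theorem JT.extend {α β : Type*} {R : ι → Set α} {val : ι → α → ℕ → β} {A : Finset ι}
    (h : JT vs (fun a b =>
      (∀ t ∈ R a, ∃ t' ∈ R b, ∀ x ∈ vs a ∩ vs b, val a t x = val b t' x) ∧
      (∀ t ∈ R b, ∃ t' ∈ R a, ∀ x ∈ vs a ∩ vs b, val b t x = val a t' x)) A)
    {v : ι} (hv : v ∈ A) {t : α} (ht : t ∈ R v) :
    ∃ σ : ℕ → β, (∀ x ∈ vs v, σ x = val v t x) ∧
      ∀ i ∈ A, ∃ t' ∈ R i, ∀ x ∈ vs i, σ x = val i t' x := by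
  classical
  induction h generalizing v t with
  | single i =>
    obtain rfl : v = i := by simpa using hv
    exact ⟨val v t, fun _ _ => rfl, fun j hj => by
      obtain rfl : j = v := by simpa using hj
      exact ⟨t, ht, fun _ _ => rfl⟩⟩
  | @join A B a b hA hB hd ha hb hE hab ihA ihB =>
    -- a solution on the part of `v` determines a tuple at its end of the edge
    have merge : ∀ {C D : Finset ι} {c d : ι} {σ ρ : ℕ → β}, c ∈ C → d ∈ D →
        (∀ i ∈ C, ∀ j ∈ D, vs i ∩ vs j ⊆ vs c ∩ vs d) → (∀ x ∈ vs c ∩ vs d, σ x = ρ x) →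
        (∀ i ∈ C, ∃ t' ∈ R i, ∀ x ∈ vs i, σ x = val i t' x) →
        (∀ i ∈ D, ∃ t' ∈ R i, ∀ x ∈ vs i, ρ x = val i t' x) → v ∈ C →
        (∀ x ∈ vs v, σ x = val v t x) →
        ∃ τ : ℕ → β, (∀ x ∈ vs v, τ x = val v t x) ∧
          ∀ i ∈ C ∪ D, ∃ t' ∈ R i, ∀ x ∈ vs i, τ x = val i t' x := by
      intro C D c d σ ρ hc hd hcd hσρ hσ hρ hvC hvt
      have h1 : ∀ i ∈ C, ∀ x ∈ vs i, (if ∃ i ∈ C, x ∈ vs i then σ x else ρ x) = σ x :=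
        fun i hi x hx => if_pos ⟨i, hi, hx⟩
      refine ⟨fun x => if ∃ i ∈ C, x ∈ vs i then σ x else ρ x,
        fun x hx => (h1 v hvC x hx).trans (hvt x hx), fun i hi => ?_⟩
      rcases Finset.mem_union.1 hi with hi | hi
      · obtain ⟨t', ht', e⟩ := hσ i hi
        exact ⟨t', ht', fun x hx => (h1 i hi x hx).trans (e x hx)⟩
      · obtain ⟨t', ht', e⟩ := hρ i hi
        refine ⟨t', ht', fun x hx => ?_⟩
        rw [← e x hx]
        dsimp only
        split_ifs with hex
        · obtain ⟨j, hj, hxj⟩ := hex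
          exact hσρ x (hcd j hj i hi ⟨hxj, hx⟩)
        · rfl
    rcases Finset.mem_union.1 hv with hv | hv
    · obtain ⟨σ, hσv, hσ⟩ := ihA hv ht
      obtain ⟨ta, hta, ea⟩ := hσ a ha
      obtain ⟨tb, htb, eb⟩ := hE.1 ta hta
      obtain ⟨ρ, hρb, hρ⟩ := ihB hb htb
      exact merge ha hb hab (fun x hx => by rw [ea x hx.1, eb x hx, hρb x hx.2]) hσ hρ hv hσv
    · obtain ⟨σ, hσv, hσ⟩ := ihB hv ht
      obtain ⟨tb, htb, eb⟩ := hσ b hb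
      obtain ⟨ta, hta, ea⟩ := hE.2 tb htb
      obtain ⟨ρ, hρa, hρ⟩ := ihA ha hta
      rw [Finset.union_comm]
      exact merge hb ha (fun i hi j hj x hx => (hab j hj i hi hx.symm).symm)
        (fun x hx => by rw [eb x hx.1, ea x hx.symm, hρa x hx.2]) hσ hρ hv hσv

end

theorem JT.map {ι κ : Type*} [DecidableEq ι] [DecidableEq κ] {vs : κ → Set ℕ} {E : κ → κ → Prop}
    (f : ι ↪ κ) {A : Finset ι} (h : JT (fun i => vs (f i)) (fun a b => E (f a) (f b)) A) :
    JT vs E (A.map f) := by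
  induction h with
  | single i => rw [Finset.map_singleton]; exact .single _
  | join _ _ hd ha hb hE hab ihA ihB =>
    rw [Finset.map_union]
    refine ihA.join ihB ((Finset.disjoint_map f).2 hd) (Finset.mem_map_of_mem f ha)
      (Finset.mem_map_of_mem f hb) hE ?_
    simpa [Finset.mem_map] using hab

/-- A join tree in the sense of graphs gives one in the sense of `JT`. -/
theorem JT.of_graph {V : Type*} [Fintype V] [DecidableEq V] {vs : V → Set ℕ} {T : SimpleGraph V}
    (hT : T.Connected)
    (hp : ∀ (a b : V) (p : T.Walk a b), p.IsPath → ∀ x, x ∈ vs a → x ∈ vs b →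
      ∀ c ∈ p.support, x ∈ vs c) : JT vs (fun _ _ => True) Finset.univ := by
  induction hn : Fintype.card V generalizing V with
  | zero =>
    have := hT.nonempty
    exact absurd hn Fintype.card_ne_zero
  | succ n ih =>
    rcases subsingleton_or_nontrivial V with hV | hV
    · obtain ⟨v⟩ := hT.nonempty
      have : (Finset.univ : Finset V) = {v} := by ext x; simp [Subsingleton.elim x v]
      rw [this]
      exact .single v
    · obtain ⟨v, hv⟩ := hT.exists_connected_induce_compl_singleton_of_finite_nontrivial
      obtain ⟨b, hb⟩ := hT.preconnected.exists_adj_of_nontrivial v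
      have hmapPath : ∀ {a c : ({v}ᶜ : Set V)} (p : (T.induce {v}ᶜ).Walk a c), p.IsPath →
          ∃ q : T.Walk a.1 c.1, q.IsPath ∧ q.support = p.support.map Subtype.val := fun p h =>
        ⟨p.map (SimpleGraph.Embedding.induce _).toHom, h.map Subtype.val_injective,
          SimpleGraph.Walk.support_map _ _⟩
      have h1 := (ih (vs := fun i => vs i.1) hv (fun a c p h x ha hc d hd => by
        obtain ⟨q, hq, e⟩ := hmapPath p h
        exact hp a.1 c.1 q hq x ha hc d.1 (e ▸ List.mem_map_of_mem hd)) (by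
            rw [Fintype.card_compl_set, hn]; simp)).map (vs := vs) (E := fun _ _ => True)
              (Function.Embedding.subtype _)
      have h2 := h1.insert_leaf (u := b) (v := v) (by simpa using hb.ne') (by simp) trivial
        fun i hi x hx => by
          have hiv : i ≠ v := by simpa using hi
          obtain ⟨p, hpp⟩ := hv.preconnected.exists_isPath ⟨b, by simpa using hb.ne'⟩ ⟨i, by simpa⟩
          obtain ⟨q, hq, e⟩ := hmapPath p hpp
          -- the edge from `v` to `b`, followed by the path to `i` outside of `v`
          refine hp _ _ (SimpleGraph.Walk.cons hb q) ?_ x hx.2 hx.1 b (by simp)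
          rw [SimpleGraph.Walk.cons_isPath_iff]
          refine ⟨hq, fun hmem => ?_⟩
          rw [e] at hmem
          obtain ⟨y, -, hy⟩ := List.mem_map.1 hmem
          exact y.2 hy
      convert h2
      ext x
      by_cases hx : x = v <;> simp [hx]

/-- Adding copies of hyperedges that are there already does not destroy the join tree. -/
theorem JT.add_copies {ι : Type*} [DecidableEq ι] {vs : ι → Set ℕ} {A : Finset ι}
    (h : JT vs (fun _ _ => True) A) (B : Finset ι) (hB : ∀ i ∈ B, ∃ j ∈ A, vs i = vs j) :
    JT vs (fun _ _ => True) (A ∪ B) := by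
  induction B using Finset.induction_on with
  | empty => simpa using h
  | insert i B hi ih =>
    have h1 := ih fun j hj => hB j (Finset.mem_insert_of_mem hj)
    rw [Finset.union_insert]
    by_cases hm : i ∈ A ∪ B
    · rwa [Finset.insert_eq_of_mem hm]
    · obtain ⟨j, hj, e⟩ := hB i (Finset.mem_insert_self _ _)
      exact h1.insert_leaf (Finset.mem_union_left _ hj) hm trivial fun k _ x hx => e ▸ hx.2

/-- The atoms of an acyclic query, numbered by their positions, have a join tree. -/
theorem RegCQ.IsAcyclic.jt {k : ℕ} {Ψ : RegCQ k} (h : Ψ.IsAcyclic) :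
    JT (fun i : ℕ => {x | ∃ χ, Ψ.body[i]? = some χ ∧ x ∈ χ.vars}) (fun _ _ => True)
      (Finset.range Ψ.body.length) := by
  classical
  obtain ⟨T, hT, hp⟩ := h
  have : Finite {χ : Atom k // χ ∈ Ψ.body} := Ψ.body.finite_toSet
  have := Fintype.ofFinite {χ : Atom k // χ ∈ Ψ.body}
  have h1 := JT.of_graph (vs := fun χ => χ.1.vars) hT.connected hp
  choose f hf using fun χ : {χ : Atom k // χ ∈ Ψ.body} => List.mem_iff_getElem?.1 χ.2
  have hinj : Function.Injective f := fun a b e => by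
    have := (hf a).symm.trans (e ▸ hf b)
    exact Subtype.ext (Option.some.inj this)
  have hvs : ∀ χ, {x | ∃ χ', Ψ.body[f χ]? = some χ' ∧ x ∈ χ'.vars} = χ.1.vars := fun χ => by
    ext x; simp [hf χ]
  have h2 := JT.map (vs := fun i : ℕ => {x | ∃ χ, Ψ.body[i]? = some χ ∧ x ∈ χ.vars})
    (E := fun _ _ => True) ⟨f, hinj⟩ (by simpa only [Function.Embedding.coeFn_mk, hvs] using h1)
  have h3 := h2.add_copies (Finset.range Ψ.body.length) fun i hi => by
    have hi := Finset.mem_range.1 hi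
    refine ⟨f ⟨_, Ψ.body.getElem_mem hi⟩, by simp, ?_⟩
    rw [hvs, List.getElem?_eq_getElem hi]
    ext x; simp
  rwa [Finset.union_eq_right.2] at h3
  intro i hi
  obtain ⟨χ, -, rfl⟩ := Finset.mem_map.1 hi
  rw [Finset.mem_range]
  exact (List.getElem?_eq_some_iff.1 (hf χ)).1

/-! ### Full reduction by semijoins -/

/-- The tree edges `par e, ord e` for `e < M` build a join tree of the hyperedges `0, …, M`, one
node after the other, starting with the node `0`. -/
structure TreeOrder (vs : ℕ → Set ℕ) (M : ℕ) (ord par : ℕ → ℕ) : Prop where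
  ord_ne : ∀ e < M, ord e ≠ 0
  ord_le : ∀ e < M, ord e ≤ M
  inj : ∀ e < M, ∀ e' < M, ord e = ord e' → e = e'
  parent : ∀ e < M, par e = 0 ∨ ∃ e' < e, par e = ord e'
  rip : ∀ e < M, ∀ i, (i = 0 ∨ ∃ e' < e, i = ord e') → vs i ∩ vs (ord e) ⊆ vs (par e)
  cover : ∀ c ≤ M, c = 0 ∨ ∃ e < M, c = ord e

section

variable {α β : Type*} {vs : ℕ → Set ℕ} {val : ℕ → α → ℕ → β} {M : ℕ} {ord par : ℕ → ℕ}

/-- The tuples `t` of `a` and `t'` of `b` agree on the common variables. -/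
def Compat (vs : ℕ → Set ℕ) (val : ℕ → α → ℕ → β) (a b : ℕ) (t t' : α) : Prop :=
  ∀ x ∈ vs a ∩ vs b, val a t x = val b t' x

/-- Every tuple of `a` has a partner in `b`. -/
def Supported (vs : ℕ → Set ℕ) (val : ℕ → α → ℕ → β) (R : ℕ → Set α) (a b : ℕ) : Prop :=
  ∀ t ∈ R a, ∃ t' ∈ R b, Compat vs val a b t t'

/-- The semijoin of `a` with `b`: keep the tuples of `a` that have a partner in `b`. -/
def semijoin (vs : ℕ → Set ℕ) (val : ℕ → α → ℕ → β) (a b : ℕ) (R : ℕ → Set α) : ℕ → Set α :=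
  Function.update R a {t | t ∈ R a ∧ ∃ t' ∈ R b, Compat vs val a b t t'}

/-- Semijoins along all tree edges, towards the root and back. -/
def reduce (vs : ℕ → Set ℕ) (val : ℕ → α → ℕ → β) (M : ℕ) (ord par : ℕ → ℕ)
    (R : ℕ → Set α) : ℕ → Set α :=
  iter (fun e => semijoin vs val (ord e) (par e)) M
    (iter (fun k => semijoin vs val (par (M - 1 - k)) (ord (M - 1 - k))) M R)

theorem semijoin_subset (a b : ℕ) (R : ℕ → Set α) (c : ℕ) : semijoin vs val a b R c ⊆ R c := by
  unfold semijoin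
  by_cases h : c = a
  · subst h; rw [Function.update_self]; exact fun t ht => ht.1
  · rw [Function.update_of_ne h]

theorem semijoin_of_ne {a b c : ℕ} (R : ℕ → Set α) (h : c ≠ a) :
    semijoin vs val a b R c = R c := by
  rw [semijoin, Function.update_of_ne h]

theorem mem_semijoin_self {a b : ℕ} {R : ℕ → Set α} {t : α} :
    t ∈ semijoin vs val a b R a ↔ t ∈ R a ∧ ∃ t' ∈ R b, Compat vs val a b t t' := by
  rw [semijoin, Function.update_self]; rfl

theorem Compat.symm {a b : ℕ} {t t' : α} (h : Compat vs val a b t t') : Compat vs val b a t' t :=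
  fun x hx => (h x hx.symm).symm

theorem Supported.semijoin {a b c d : ℕ} {R : ℕ → Set α} (h : Supported vs val R c d)
    (hd : d ≠ a) : Supported vs val (semijoin vs val a b R) c d := by
  intro t ht
  obtain ⟨t', ht', e⟩ := h t (semijoin_subset a b R c ht)
  exact ⟨t', by rwa [semijoin_of_ne R hd], e⟩

theorem TreeOrder.par_ne (h : TreeOrder vs M ord par) {e e' : ℕ} (he' : e' < M) (hle : e ≤ e') :
    par e ≠ ord e' := by
  rcases h.parent e (by omega) with h0 | ⟨e'', h1, h2⟩
  · rw [h0]; exact (h.ord_ne e' he').symm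
  · rw [h2]; intro h3
    have := h.inj e'' (by omega) e' he' h3
    omega

/-- The tree order gives a join tree, whose edges have any property that the tree edges have. -/
theorem TreeOrder.jt (h : TreeOrder vs M ord par) {E : ℕ → ℕ → Prop}
    (hE : ∀ e < M, E (par e) (ord e)) : JT vs E (Finset.range (M + 1)) := by
  have key : ∀ j ≤ M, JT vs E (insert 0 ((Finset.range j).image ord)) := by
    intro j
    induction j with
    | zero => intro _; simpa using JT.single 0
    | succ j ih =>
      intro hj
      rw [Finset.range_add_one, Finset.image_insert, Finset.insert_comm]
      refine (ih (by omega)).insert_leaf (u := par j) ?_ ?_ (hE j (by omega)) fun i hi => ?_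
      · simp only [Finset.mem_insert, Finset.mem_image, Finset.mem_range]
        rcases h.parent j (by omega) with h | ⟨e', h1, h2⟩
        · exact .inl h
        · exact .inr ⟨e', h1, h2.symm⟩
      · simp only [Finset.mem_insert, Finset.mem_image, Finset.mem_range, not_or, not_exists,
          not_and]
        refine ⟨h.ord_ne j (by omega), fun e he heq => ?_⟩
        have := h.inj e (by omega) j (by omega) heq
        omega
      · refine h.rip j (by omega) i ?_
        simp only [Finset.mem_insert, Finset.mem_image, Finset.mem_range] at hi
        rcases hi with h | ⟨e', h1, h2⟩
        · exact .inl h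
        · exact .inr ⟨e', h1, h2.symm⟩
  convert key M le_rfl
  ext c
  simp only [Finset.mem_range, Finset.mem_insert, Finset.mem_image]
  constructor
  · intro hc
    rcases h.cover c (by omega) with h | ⟨e', h1, h2⟩
    · exact .inl h
    · exact .inr ⟨e', h1, h2.symm⟩
  · rintro (rfl | ⟨e, he, rfl⟩)
    · omega
    · have := h.ord_le e he; omega

/-- After the reduction all tree edges are consistent in both directions. -/
theorem reduce_supported (h : TreeOrder vs M ord par) (R : ℕ → Set α) :
    ∀ e < M, Supported vs val (reduce vs val M ord par R) (par e) (ord e) ∧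
      Supported vs val (reduce vs val M ord par R) (ord e) (par e) := by
  -- towards the root: the tuples of a parent get partners in the child
  have up : ∀ e < M, Supported vs val
      (iter (fun k => semijoin vs val (par (M - 1 - k)) (ord (M - 1 - k))) M R)
      (par e) (ord e) := by
    have := iter_inv (f := fun k => semijoin vs val (par (M - 1 - k)) (ord (M - 1 - k)))
      (n := M) (s := R)
      (fun k (R : ℕ → Set α) => ∀ e < M, M - k ≤ e → Supported vs val R (par e) (ord e))
      (fun e he h => by omega) fun k hk R' ih e he hke => ?_
    · exact fun e he => this e he (by omega)
    · by_cases heq : e = M - 1 - k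
      · subst heq
        intro t ht
        obtain ⟨-, t', ht', e'⟩ := mem_semijoin_self.1 ht
        exact ⟨t', by rwa [semijoin_of_ne R' (h.par_ne he le_rfl).symm], e'⟩
      · exact (ih e he (by omega)).semijoin (h.par_ne he (by omega)).symm
  -- back to the leaves: the tuples of a child get partners in the parent, and the parent, which
  -- is reduced already, keeps its partners
  have := iter_inv (f := fun e => semijoin vs val (ord e) (par e)) (n := M)
    (s := iter (fun k => semijoin vs val (par (M - 1 - k)) (ord (M - 1 - k))) M R)
    (fun k (R : ℕ → Set α) => ∀ e < M, Supported vs val R (par e) (ord e) ∧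
      (e < k → Supported vs val R (ord e) (par e)))
    (fun e he => ⟨up e he, fun h => by omega⟩) fun k hk R' ih e he => ?_
  · exact fun e he => ⟨(this e he).1, (this e he).2 he⟩
  · by_cases hek : e = k
    · subst hek
      refine ⟨fun t ht => ?_, fun _ t ht => ?_⟩
      · rw [semijoin_of_ne R' (h.par_ne hk le_rfl)] at ht
        obtain ⟨t', ht', hc⟩ := (ih e he).1 t ht
        exact ⟨t', mem_semijoin_self.2 ⟨ht', t, ht, hc.symm⟩, hc⟩
      · obtain ⟨-, t', ht', hc⟩ := mem_semijoin_self.1 ht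
        exact ⟨t', by rwa [semijoin_of_ne R' (h.par_ne hk le_rfl)], hc⟩
    · refine ⟨(ih e he).1.semijoin fun h' => hek (h.inj e he k hk h'), fun hlt => ?_⟩
      exact ((ih e he).2 (by omega)).semijoin (h.par_ne hk (by omega))

theorem reduce_subset (R : ℕ → Set α) (c : ℕ) : reduce vs val M ord par R c ⊆ R c := by
  refine iter_inv (fun _ (R' : ℕ → Set α) => R' c ⊆ R c) ?_
    fun k hk R' h => (semijoin_subset _ _ _ _).trans h
  exact iter_inv (fun _ (R' : ℕ → Set α) => R' c ⊆ R c) subset_rfl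
    fun k hk R' h => (semijoin_subset _ _ _ _).trans h

/-- After the reduction every tuple is part of a global solution. -/
theorem reduce_extend (h : TreeOrder vs M ord par) {R : ℕ → Set α} {c : ℕ} (hc : c ≤ M) {t : α}
    (ht : t ∈ reduce vs val M ord par R c) :
    ∃ σ : ℕ → β, (∀ x ∈ vs c, σ x = val c t x) ∧
      ∀ i ≤ M, ∃ t' ∈ R i, ∀ x ∈ vs i, σ x = val i t' x := by
  have hE := reduce_supported (val := val) h R
  obtain ⟨σ, h1, h2⟩ := (h.jt (E := fun a b =>
      (∀ t ∈ reduce vs val M ord par R a, ∃ t' ∈ reduce vs val M ord par R b,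
        ∀ x ∈ vs a ∩ vs b, val a t x = val b t' x) ∧
      (∀ t ∈ reduce vs val M ord par R b, ∃ t' ∈ reduce vs val M ord par R a,
        ∀ x ∈ vs a ∩ vs b, val b t x = val a t' x)) fun e he =>
        ⟨(hE e he).1, fun t ht => by
          obtain ⟨t', ht', hc⟩ := (hE e he).2 t ht
          exact ⟨t', ht', fun x hx => hc x hx.symm⟩⟩).extend (v := c) (by simpa [Nat.lt_succ_iff])
              ht
  refine ⟨σ, h1, fun i hi => ?_⟩
  obtain ⟨t', ht', e⟩ := h2 i (by simpa [Nat.lt_succ_iff])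
  exact ⟨t', reduce_subset R i ht', e⟩

/-- The reduction keeps the tuples of global solutions. -/
theorem mem_reduce (h : TreeOrder vs M ord par) {R : ℕ → Set α} {σ : ℕ → β} {f : ℕ → α}
    (hf : ∀ i ≤ M, f i ∈ R i ∧ ∀ x ∈ vs i, σ x = val i (f i) x) {c : ℕ} (hc : c ≤ M) :
    f c ∈ reduce vs val M ord par R c := by
  have step : ∀ (a b : ℕ) (R' : ℕ → Set α), b ≤ M → (∀ i ≤ M, f i ∈ R' i) →
      ∀ i ≤ M, f i ∈ semijoin vs val a b R' i := by
    intro a b R' hb h i hi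
    by_cases hia : i = a
    · subst hia
      exact mem_semijoin_self.2 ⟨h i hi, f b, h b hb, fun x hx => by
        rw [← (hf i hi).2 x hx.1, ← (hf b hb).2 x hx.2]⟩
    · rw [semijoin_of_ne R' hia]; exact h i hi
  have hpar : ∀ e < M, par e ≤ M := fun e he => by
    rcases h.parent e he with h0 | ⟨e', h1, h2⟩
    · omega
    · rw [h2]; exact h.ord_le e' (by omega)
  refine iter_inv (fun _ (R' : ℕ → Set α) => ∀ i ≤ M, f i ∈ R' i) ?_
    (fun k hk R' hR' => step _ _ R' (hpar k hk) hR') c hc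
  exact iter_inv (fun _ (R' : ℕ → Set α) => ∀ i ≤ M, f i ∈ R' i) (fun i hi => (hf i hi).1)
    fun k hk R' hR' => step _ _ R' (h.ord_le _ (by omega)) hR'

end

/-! ### Lexicographic enumeration -/

/-- The lexicographic order on the first `r` entries. -/
def LexLt {α : Type*} [LinearOrder α] (r : ℕ) (f g : ℕ → α) : Prop :=
  ∃ d < r, (∀ h < d, f h = g h) ∧ f d < g d

section

variable {α : Type*} [LinearOrder α] {r : ℕ}

theorem LexLt.trans {f g h : ℕ → α} (h₁ : LexLt r f g) (h₂ : LexLt r g h) : LexLt r f h := by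
  obtain ⟨d, hd, e, l⟩ := h₁
  obtain ⟨d', hd', e', l'⟩ := h₂
  rcases lt_trichotomy d d' with hlt | rfl | hlt
  · exact ⟨d, hd, fun i hi => (e i hi).trans (e' i (by omega)), (e' d hlt) ▸ l⟩
  · exact ⟨d, hd, fun i hi => (e i hi).trans (e' i hi), l.trans l'⟩
  · exact ⟨d', hd', fun i hi => (e i (by omega)).trans (e' i hi), (e d' hlt) ▸ l'⟩

theorem LexLt.irrefl {f g : ℕ → α} (h : ∀ i < r, f i = g i) : ¬ LexLt r f g := by
  rintro ⟨d, hd, -, l⟩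
  exact l.ne (h d hd)

theorem LexLt.eq_of_not {f g : ℕ → α} (h₁ : ¬ LexLt r f g) (h₂ : ¬ LexLt r g f) :
    ∀ i < r, f i = g i := by
  intro i
  induction i using Nat.strong_induction_on with
  | _ i ih =>
    intro hi
    rcases lt_trichotomy (f i) (g i) with hlt | h | hlt
    · exact absurd ⟨i, hi, fun j hj => ih j hj (by omega), hlt⟩ h₁
    · exact h
    · exact absurd ⟨i, hi, fun j hj => (ih j hj (by omega)).symm, hlt⟩ h₂

/-- If `g` agrees with `f` up to a position after which `f` has been chosen greedily, then `g` is
not smaller than `f`. -/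
theorem not_lexLt_of_greedy {K : Set (ℕ → α)} {f g : ℕ → α} {d : ℕ} (hg : g ∈ K)
    (hfg : ∀ h < d, g h = f h)
    (hmin : ∀ h, d ≤ h → h < r → ∀ g ∈ K, (∀ i < h, g i = f i) → f h ≤ g h) :
    ¬ LexLt r g f := by
  rintro ⟨d', hd', e, l⟩
  rcases lt_or_ge d' d with h | h
  · exact l.ne (hfg d' h)
  · exact absurd (hmin d' h hd' g hg e) (not_le.2 l)

/-- The successor of `f`: increase the last entry that can be increased, as little as possible,
and choose the entries behind it greedily. -/
theorem not_lexLt_succ {K : Set (ℕ → α)} {f f' g : ℕ → α} {d : ℕ}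
    (hpre : ∀ h < d, f' h = f h)
    (hd : ∀ g ∈ K, (∀ i < d, g i = f i) → f d < g d → f' d ≤ g d) (hlt : f d < f' d)
    (hlast : ∀ d', d < d' → d' < r → ∀ g ∈ K, (∀ i < d', g i = f i) → ¬ f d' < g d')
    (hmin : ∀ h, d < h → h < r → ∀ g ∈ K, (∀ i < h, g i = f' i) → f' h ≤ g h)
    (hg : g ∈ K) (hfg : LexLt r f g) : ¬ LexLt r g f' := by
  obtain ⟨c, hc, e, l⟩ := hfg
  rcases lt_trichotomy c d with h | rfl | h
  · rintro ⟨c', hc', e', l'⟩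
    rcases lt_trichotomy c' c with h' | rfl | h'
    · rw [hpre c' (by omega), e c' h'] at l'
      exact l'.ne rfl
    · rw [hpre c' h] at l'
      exact l'.not_gt l
    · have := e' c h'
      rw [hpre c h] at this
      exact l.ne this.symm
  · rintro ⟨c', hc', e', l'⟩
    rcases lt_trichotomy c' c with h' | rfl | h'
    · rw [hpre c' h', e c' h'] at l'
      exact l'.ne rfl
    · exact absurd (hd g hg (fun i hi => (e i hi).symm) l) (not_le.2 l')
    · exact absurd (hmin c' h' hc' g hg e') (not_le.2 l')
  · exact absurd l (hlast c h hc g hg fun i hi => (e i hi).symm)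

end

/-! ### Atoms as sets of triples of positions -/

/-- The factor of `w` with start `u.1` and length `u.2`. -/
def wd {k : ℕ} (w : Word k) (u : ℕ × ℕ) : Word k := (w.drop u.1).take u.2

/-- A triple `(i, p, q)` stands for a factor with start `i` and length `p + q`, cut into factors of
the lengths `p` and `q`. These three factors are the values of the three slots of a word equation:
the left side and the two symbols of the right side. -/
def span (s : ℕ) (t : ℕ × ℕ × ℕ) : ℕ × ℕ :=
  if s = 0 then (t.1, t.2.1 + t.2.2) else if s = 1 then (t.1, t.2.1) else (t.1 + t.2.1, t.2.2)

/-- The variable in a slot of an atom, and the universe variable if there is none. -/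
def Atom.sv {k : ℕ} : Atom k → ℕ → Variable
  | .eqn x _, 0 => x
  | .eqn _ α, s + 1 => match α[s]? with
    | some (.var y) => y
    | _ => 0
  | .mem x _, 0 => x
  | .mem _ _, _ + 1 => 0

/-- A factor of `w` as a value of an optional symbol, up to the choice of the variables. -/
def SymOk {k : ℕ} (w : Word k) : Option (Sym k) → ℕ × ℕ → Prop
  | none, u => u.2 = 0
  | some (.letter a), u => wd w u = [a]
  | some (.var y), u => y = 0 → u.2 = w.length

/-- The triple satisfies the conditions of the atom that involve no other variable than the universe
variable, and it assigns only one value to each variable. -/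
def Atom.Base {k : ℕ} (w : Word k) (χ : Atom k) (t : ℕ × ℕ × ℕ) : Prop :=
  t.1 + t.2.1 + t.2.2 ≤ w.length ∧
  (match χ with
    | .eqn _ α => SymOk w α[0]? (span 1 t) ∧ SymOk w α[1]? (span 2 t)
    | .mem _ γ => t.2.2 = 0 ∧ wd w (span 1 t) ∈ γ.matches') ∧
  (χ.sv 0 = 0 → t.2.1 + t.2.2 = w.length) ∧
  ∀ s < 3, ∀ s' < 3, χ.sv s = χ.sv s' → χ.sv s ≠ 0 → wd w (span s t) = wd w (span s' t)

/-- The value of the variable `x` of the atom under a triple. -/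
noncomputable def Atom.val {k : ℕ} (w : Word k) (χ : Atom k) (t : ℕ × ℕ × ℕ) (x : ℕ) : Word k :=
  wd w (span (lb 3 fun s => χ.sv s = x) t)

/-- The right side of a word equation has at most two symbols. -/
def Atom.IsBinary {k : ℕ} : Atom k → Prop
  | .eqn _ α => α.length ≤ 2
  | .mem _ _ => True

theorem wd_append {k : ℕ} (w : Word k) (i p q : ℕ) :
    wd w (i, p + q) = wd w (i, p) ++ wd w (i + p, q) := by
  simp only [wd]
  rw [List.take_add, List.drop_drop]

theorem wd_length {k : ℕ} {w : Word k} {u : ℕ × ℕ} (h : u.1 + u.2 ≤ w.length) :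
    (wd w u).length = u.2 := by
  simp [wd]; omega

theorem wd_infix {k : ℕ} (w : Word k) (u : ℕ × ℕ) : wd w u <:+: w :=
  (List.take_prefix _ _).isInfix.trans (List.drop_suffix _ _).isInfix

theorem exists_wd {k : ℕ} {u w : Word k} (h : u <:+: w) :
    ∃ i, i + u.length ≤ w.length ∧ wd w (i, u.length) = u := by
  obtain ⟨l, r, rfl⟩ := h
  exact ⟨l.length, by simp, by simp [wd, List.append_assoc]⟩

theorem wd_full {k : ℕ} {w : Word k} {u : ℕ × ℕ} (h : u.1 + u.2 ≤ w.length)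
    (h' : u.2 = w.length) : wd w u = w := by
  have : u.1 = 0 := by omega
  simp [wd, this, h']

theorem Atom.vars_eq {k : ℕ} {χ : Atom k} (h : χ.IsBinary) :
    χ.vars = {x | x ≠ 0 ∧ ∃ s < 3, χ.sv s = x} := by
  ext x
  cases χ with
  | eqn y α =>
    simp only [vars, Set.mem_ofPred_eq, univVar, and_congr_right_iff]
    intro hx
    constructor
    · rintro (rfl | hm)
      · exact ⟨0, by omega, rfl⟩
      · obtain ⟨j, hj⟩ := List.mem_iff_getElem?.1 hm
        have : j < α.length := (List.getElem?_eq_some_iff.1 hj).1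
        simp only [IsBinary] at h
        exact ⟨j + 1, by omega, by simp [sv, hj]⟩
    · rintro ⟨s, hs, e⟩
      cases s with
      | zero => exact .inl e.symm
      | succ s =>
        right
        simp only [sv] at e
        split at e
        · rename_i z hz
          subst e
          exact List.mem_of_getElem? hz
        · exact absurd e.symm hx
  | mem y γ =>
    simp only [vars, Set.mem_ofPred_eq, univVar, and_congr_right_iff]
    intro hx
    constructor
    · rintro rfl
      exact ⟨0, by omega, rfl⟩
    · rintro ⟨s, hs, e⟩
      cases s with
      | zero => exact e.symm
      | succ s => exact absurd e.symm hx

theorem Atom.val_sv {k : ℕ} {w : Word k} {χ : Atom k} {t : ℕ × ℕ × ℕ} (h : χ.Base w t) {s : ℕ}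
    (hs : s < 3) (h0 : χ.sv s ≠ 0) : χ.val w t (χ.sv s) = wd w (span s t) := by
  have hlt : (lb 3 fun s' => χ.sv s' = χ.sv s) < 3 := lb_lt_iff.2 ⟨s, hs, rfl⟩
  have hsp := lb_spec hlt
  exact h.2.2.2 _ hlt s hs hsp (by rw [hsp]; exact h0)

/-- The value of an optional symbol. -/
def optVal {k : ℕ} (σ : Subst k) : Option (Sym k) → Word k
  | none => []
  | some (.letter a) => [a]
  | some (.var y) => σ y

theorem apply_eq {k : ℕ} (σ : Subst k) {α : List (Sym k)} (h : α.length ≤ 2) :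
    σ.apply α = optVal σ α[0]? ++ optVal σ α[1]? := by
  match α, h with
  | [], _ => rfl
  | [.letter a], _ => simp [Subst.apply, optVal]
  | [.var x], _ => simp [Subst.apply, optVal]
  | [.letter a, .letter b], _ => simp [Subst.apply, optVal]
  | [.letter a, .var y], _ => simp [Subst.apply, optVal]
  | [.var x, .letter b], _ => simp [Subst.apply, optVal]
  | [.var x, .var y], _ => simp [Subst.apply, optVal]

theorem span_le {k : ℕ} {w : Word k} {t : ℕ × ℕ × ℕ} (h : t.1 + t.2.1 + t.2.2 ≤ w.length)
    (s : ℕ) : (span s t).1 + (span s t).2 ≤ w.length := by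
  unfold span
  split_ifs <;> simp <;> omega

theorem symOk_of_eq {k : ℕ} {w : Word k} {σ : Subst k} (hw : σ 0 = w) {o : Option (Sym k)}
    {u : ℕ × ℕ} (hu : u.1 + u.2 ≤ w.length) (h : optVal σ o = wd w u) : SymOk w o u := by
  have hl := wd_length hu
  match o with
  | none => simp only [SymOk]; rw [← hl, ← h]; rfl
  | some (.letter a) => exact h.symm
  | some (.var y) =>
    rintro rfl
    rw [← hl, ← h]
    simp [optVal, hw]

theorem eq_of_symOk {k : ℕ} {w : Word k} {σ : Subst k} (hw : σ 0 = w) {o : Option (Sym k)}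
    {u : ℕ × ℕ} (hu : u.1 + u.2 ≤ w.length) (h : SymOk w o u)
    (hv : ∀ y, o = some (.var y) → y ≠ 0 → σ y = wd w u) : optVal σ o = wd w u := by
  match o with
  | none =>
    have := wd_length hu
    rw [show u.2 = 0 from h] at this
    exact (List.length_eq_zero_iff.1 this).symm
  | some (.letter a) => exact h.symm
  | some (.var y) =>
    by_cases hy : y = 0
    · subst hy
      rw [wd_full hu (h rfl)]
      exact hw
    · exact hv y rfl hy

/-- An atom is satisfied if and only if the values of its variables are given by a triple. -/
theorem Atom.sat_iff {k : ℕ} {w : Word k} {χ : Atom k} (hb : χ.IsBinary) {σ : Subst k}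
    (hw : σ 0 = w) :
    χ.Sat σ ↔ ∃ t, χ.Base w t ∧ ∀ s < 3, χ.sv s ≠ 0 → σ (χ.sv s) = wd w (span s t) := by
  constructor
  · rintro ⟨h1, h2⟩
    have hfac : ∃ i, i + (σ (χ.sv 0)).length ≤ w.length ∧
        wd w (i, (σ (χ.sv 0)).length) = σ (χ.sv 0) := by
      apply exists_wd
      by_cases h0 : χ.sv 0 = 0
      · rw [h0, hw]
      · rw [← hw]
        exact h2 _ (by rw [vars_eq hb]; exact ⟨h0, 0, by omega, rfl⟩)
    obtain ⟨i, hi, e⟩ := hfac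
    have huniv : χ.sv 0 = 0 → (σ (χ.sv 0)).length = w.length := fun h => by rw [h, hw]
    cases χ with
    | eqn x α =>
      simp only [IsBinary] at hb
      simp only [sv] at e hi huniv
      simp only [apply_eq σ hb] at h1
      set u := optVal σ α[0]? with hu
      set v := optVal σ α[1]? with hv
      have hlen : (σ x).length = u.length + v.length := by rw [h1]; simp
      rw [hlen] at e hi huniv
      have e0 := e
      rw [wd_append, h1] at e
      have hl1 : (wd w (i, u.length)).length = u.length := wd_length (by simp; omega)
      obtain ⟨e1, e2⟩ := List.append_inj e hl1
      have hval : ∀ s < 3, (Atom.eqn x α).sv s ≠ 0 →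
          σ ((Atom.eqn x α).sv s) = wd w (span s (i, u.length, v.length)) := by
        intro s hs h0
        match s, hs with
        | 0, _ => exact e0.symm
        | 1, _ =>
          simp only [sv] at h0 ⊢
          simp only [span]
          split at h0
          · rename_i y hy
            have : u = σ y := by rw [hu, hy]; rfl
            rw [← this]; simpa using e1.symm
          · exact absurd rfl h0
        | 2, _ =>
          simp only [sv] at h0 ⊢
          simp only [span]
          split at h0
          · rename_i y hy
            have : v = σ y := by rw [hv, hy]; rfl
            rw [← this]; simpa using e2.symm
          · exact absurd rfl h0
      refine ⟨(i, u.length, v.length), ⟨by simpa [add_assoc] using hi, ⟨?_, ?_⟩, huniv, ?_⟩, hval⟩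
      · exact symOk_of_eq hw (by simp [span]; omega) (by rw [← hu]; simpa [span] using e1.symm)
      · exact symOk_of_eq hw (by simp [span]; omega) (by rw [← hv]; simpa [span] using e2.symm)
      · intro s hs s' hs' he h0
        rw [← hval s hs h0, ← hval s' hs' (he ▸ h0), he]
    | mem x γ =>
      simp only [sv] at e hi huniv
      refine ⟨(i, (σ x).length, 0), ⟨by simpa using hi, ⟨rfl, ?_⟩, by simpa [sv] using huniv,
          ?_⟩, ?_⟩
      · simpa [span, e] using h1
      · intro s hs s' hs' he h0
        match s, s' with
        | 0, 0 => rfl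
        | 0, _ + 1 => exact absurd he h0
        | _ + 1, _ => exact absurd rfl h0
      · intro s hs h0
        match s with
        | 0 => simpa [span, sv] using e.symm
        | _ + 1 => exact absurd rfl h0
  · rintro ⟨t, ⟨hlen, hkind, huniv, hdup⟩, hval⟩
    have h0 : σ (χ.sv 0) = wd w (span 0 t) := by
      by_cases h : χ.sv 0 = 0
      · rw [h, hw, wd_full (span_le hlen 0)]
        simpa [span] using huniv h
      · exact hval 0 (by omega) h
    refine ⟨?_, fun y hy => ?_⟩
    · cases χ with
      | eqn x α =>
        simp only [sv] at h0
        simp only [IsBinary] at hb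
        simp only
        rw [apply_eq σ hb, h0,
          eq_of_symOk hw (span_le hlen 1) hkind.1 fun y hy hy0 => by
            have := hval 1 (by omega)
            simp only [sv, hy] at this
            exact this hy0,
          eq_of_symOk hw (span_le hlen 2) hkind.2 fun y hy hy0 => by
            have := hval 2 (by omega)
            simp only [sv, hy] at this
            exact this hy0]
        exact wd_append w _ _ _
      | mem x γ =>
        simp only [sv] at h0
        simp only
        rw [h0]
        have := hkind.2
        simpa [span, hkind.1] using this
    · rw [vars_eq hb] at hy
      obtain ⟨hy0, s, hs, rfl⟩ := hy
      rw [hval s hs hy0, univVar, hw]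
      exact wd_infix _ _

theorem RegCQ.mem_results {k : ℕ} {Ψ : RegCQ k} {w : Word k} {t : List (Word k)} :
    t ∈ Ψ.results w ↔ ∃ σ : Subst k, σ 0 = w ∧ (∀ χ ∈ Ψ.body, χ.Sat σ) ∧ t = Ψ.head.map σ := by
  constructor
  · rintro ⟨σ, hw, ⟨τ, h1, h2⟩, rfl⟩
    refine ⟨τ, ?_, h2, ?_⟩
    · rw [← hw]
      by_contra hne
      obtain ⟨-, ⟨χ, -, hv⟩, -⟩ := h1 0 hne
      cases χ <;> exact hv.1 rfl
    · refine List.map_congr_left fun x hx => ?_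
      by_contra hne
      exact (h1 x (Ne.symm hne)).1 hx
  · rintro ⟨σ, hw, h, rfl⟩
    exact ⟨σ, hw, ⟨σ, fun y hy => absurd rfl hy, h⟩, rfl⟩

/-! ### Arrays computed by nested loops -/

/-- The arrays that an expression reads. -/
def Expr.reads : Expr → List ℕ
  | .add a b | .sub a b | .inpEq a b => a.reads ++ b.reads
  | .ite c a b => c.reads ++ (a.reads ++ b.reads)
  | .inp e => e.reads
  | .arr a e₁ e₂ e₃ e₄ e₅ e₆ =>
      a :: (e₁.reads ++ (e₂.reads ++ (e₃.reads ++ (e₄.reads ++ (e₅.reads ++ e₆.reads)))))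
  | .find _ b e => b.reads ++ e.reads
  | _ => []

/-- The value of an expression depends on the scalar variables and the arrays that it reads. -/
theorem Expr.denote_congr {Γ : Ctx} (e : Expr) {s s' : State} (hr : s.reg = s'.reg)
    (ha : ∀ a ∈ e.reads, s.arr a = s'.arr a) : e.denote Γ s = e.denote Γ s' := by
  induction e generalizing s s' with
  | const n => rfl
  | reg r => simp [denote, hr]
  | add a b iha ihb | sub a b iha ihb | inpEq a b iha ihb =>
    simp only [reads, List.mem_append] at ha
    simp only [denote, iha hr fun a h => ha a (.inl h), ihb hr fun a h => ha a (.inr h)]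
  | ite c a b ihc iha ihb =>
    simp only [reads, List.mem_append] at ha
    simp only [denote, ihc hr fun a h => ha a (.inl h), iha hr fun a h => ha a (.inr (.inl h)),
      ihb hr fun a h => ha a (.inr (.inr h))]
  | inp e ih => simp only [denote, ih hr ha]
  | arr a e₁ e₂ e₃ e₄ e₅ e₆ h₁ h₂ h₃ h₄ h₅ h₆ =>
    simp only [reads, List.mem_cons, List.mem_append] at ha
    simp only [denote, h₁ hr fun a h => ha a (by tauto), h₂ hr fun a h => ha a (by tauto),
      h₃ hr fun a h => ha a (by tauto), h₄ hr fun a h => ha a (by tauto),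
      h₅ hr fun a h => ha a (by tauto), h₆ hr fun a h => ha a (by tauto), ha a (by tauto)]
  | find x b e ihb ihe =>
    simp only [reads, List.mem_append] at ha
    simp only [denote, ihb hr fun a h => ha a (.inl h)]
    refine lb_congr fun k _ => ?_
    rw [ihe (s := s.set x k) (s' := s'.set x k) (by simp [State.set, hr])
      fun a h => ha a (.inr h)]

theorem Expr.denote_isBound {Γ : Ctx} (e : Expr) (he : e.isBound) {s s' : State}
    (hr : ∀ r < 4, s.reg r = s'.reg r) : e.denote Γ s = e.denote Γ s' := by
  induction e with
  | const k => rfl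
  | reg r => exact hr r (by simpa [isBound] using he)
  | sub a b iha ihb =>
    simp only [isBound, Bool.and_eq_true] at he
    simp only [denote, iha he.1, ihb he.2]
  | _ => simp [isBound] at he

/-- Set several scalar variables. -/
def State.sets : State → List ℕ → List ℕ → State
  | s, x :: xs, k :: ks => (s.set x k).sets xs ks
  | s, _, _ => s

/-- Replace an array. -/
def State.withArr (s : State) (a : ℕ) (A : List ℕ → ℕ) : State :=
  { s with arr := Function.update s.arr a A }

/-- Nested loops. -/
def Cmd.loops : List (ℕ × Expr) → Cmd → Cmd
  | [], c => c
  | (x, b) :: L, c => .loop x b (loops L c)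

/-- The tuples of numbers below the given bounds, in lexicographic order. -/
def tuples : List ℕ → List (List ℕ)
  | [] => [[]]
  | b :: bs => (List.range b).flatMap fun k => (tuples bs).map (k :: ·)

@[simp] theorem mem_tuples_nil {l : List ℕ} : l ∈ tuples [] ↔ l = [] := by simp [tuples]

@[simp] theorem mem_tuples_cons {b : ℕ} {bs l : List ℕ} :
    l ∈ tuples (b :: bs) ↔ ∃ k < b, ∃ l' ∈ tuples bs, l = k :: l' := by
  simp [tuples, eq_comm]

theorem nodup_tuples (bs : List ℕ) : (tuples bs).Nodup := by
  induction bs with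
  | nil => simp [tuples]
  | cons b bs ih =>
    refine List.nodup_flatMap.2 ⟨fun k _ => ih.map (List.cons_injective), ?_⟩
    refine List.nodup_range.imp_of_mem fun {k k'} _ _ hne => ?_
    simp only [Function.onFun, List.disjoint_left, List.mem_map]
    rintro l ⟨l₁, -, rfl⟩ ⟨l₂, -, e⟩
    exact hne (List.cons_eq_cons.1 e).1.symm

/-- The first entries of the tuples are increasing. -/
theorem pairwise_tuples (bs : List ℕ) :
    (tuples bs).Pairwise fun l l' => l.headD 0 ≤ l'.headD 0 := by
  cases bs with
  | nil => simp [tuples]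
  | cons b bs =>
    refine List.pairwise_flatMap.2 ⟨fun k _ => ?_, ?_⟩
    · rw [List.pairwise_map]
      exact List.pairwise_of_forall (by simp)
    · refine List.pairwise_lt_range.imp fun {k k'} hlt => ?_
      simp only [List.mem_map]
      rintro l ⟨l₁, -, rfl⟩ l' ⟨l₂, -, rfl⟩
      exact hlt.le

theorem iter_eq_foldl {α : Type*} (f : ℕ → α → α) (n : ℕ) (s : α) :
    iter f n s = (List.range n).foldl (fun s k => f k s) s := by
  induction n with
  | zero => rfl
  | succ n ih => rw [iter, ih, List.range_succ, List.foldl_append]; rfl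

@[simp] theorem State.withArr_self (s : State) (a : ℕ) : s.withArr a (s.arr a) = s := by
  simp [withArr]

@[simp] theorem State.withArr_withArr (s : State) (a : ℕ) (A B : List ℕ → ℕ) :
    (s.withArr a A).withArr a B = s.withArr a B := by
  simp [withArr]

/-- The loop variables of nested loops are no loop bounds, and the bounds are constant. -/
def LoopsOk (L : List (ℕ × Expr)) : Prop := ∀ p ∈ L, 4 ≤ p.1 ∧ p.2.isBound = true

/-- The effect of nested loops around a single assignment to an array cell. -/
theorem eval_loops_store {Γ : Ctx} (L : List (ℕ × Expr)) (hL : LoopsOk L) (a : ℕ)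
    (e₁ e₂ e₃ e₄ e₅ e₆ e : Expr) (s : State) :
    (Cmd.loops L (.store a e₁ e₂ e₃ e₄ e₅ e₆ e)).eval Γ s =
      s.withArr a ((tuples (L.map fun p => p.2.denote Γ s)).foldl (fun A ks =>
        let s' := (s.withArr a A).sets (L.map Prod.fst) ks
        Function.update A [e₁.denote Γ s', e₂.denote Γ s', e₃.denote Γ s', e₄.denote Γ s',
          e₅.denote Γ s', e₆.denote Γ s'] (e.denote Γ s')) (s.arr a)) := by
  induction L generalizing s with
  | nil => simp [Cmd.loops, tuples, Cmd.eval, State.sets, State.put, State.withArr]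
  | cons p L ih =>
    obtain ⟨x, b⟩ := p
    have hx : 4 ≤ x := (hL (x, b) (by simp)).1
    have hL' : LoopsOk L := fun q hq => hL q (by simp [hq])
    have hb : ∀ (A : List ℕ → ℕ) (k : ℕ), (L.map fun p => p.2.denote Γ ((s.withArr a A).set x k)) =
        L.map fun p => p.2.denote Γ s := fun A k => List.map_congr_left fun q hq =>
      q.2.denote_isBound (hL' q hq).2 fun r hr => by
        simp only [State.set, State.withArr]
        rw [Function.update_of_ne (by omega)]
    simp only [Cmd.loops, Cmd.eval, List.map_cons, tuples, List.foldl_flatMap, iter_eq_foldl,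
      List.foldl_map]
    generalize b.denote Γ s = n
    induction n with
    | zero => simp
    | succ n ihn =>
      rw [List.range_succ, List.foldl_append, List.foldl_append, ihn]
      simp only [List.foldl_cons, List.foldl_nil]
      rw [ih hL', hb]
      simp [State.set, State.withArr, State.sets]

section

variable {A₀ : List ℕ → ℕ} {l : List (List ℕ)} {f g : (List ℕ → ℕ) → List ℕ → ℕ}
  {key : (List ℕ → ℕ) → List ℕ → List ℕ} {κ : List ℕ → List ℕ} {v : List ℕ → ℕ}

theorem foldl_update_of_ne (hk : ∀ ks ∈ l, ∀ A, key A ks = κ ks) (c : List ℕ)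
    (hc : ∀ ks ∈ l, c ≠ κ ks) :
    (l.foldl (fun A ks => Function.update A (key A ks) (f A ks)) A₀) c = A₀ c := by
  induction l generalizing A₀ with
  | nil => rfl
  | cons ks l ih =>
    rw [List.foldl_cons, ih (fun ks h => hk ks (by simp [h])) fun ks h => hc ks (by simp [h]),
      hk ks (by simp), Function.update_of_ne (hc ks (by simp))]

/-- Assignments whose values may depend on cells written before. -/
theorem foldl_update_rec (hk : ∀ ks ∈ l, ∀ A, key A ks = κ ks)
    (hκ : ∀ ks ∈ l, ∀ ks' ∈ l, κ ks = κ ks' → ks = ks') (hnd : l.Nodup)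
    {ρ : List ℕ → ℕ} (hp : l.Pairwise fun ks ks' => ρ ks ≤ ρ ks') {R : List ℕ → ℕ → Prop}
    (h : ∀ ks ∈ l, ∀ A, (∀ ks' ∈ l, ρ ks' < ρ ks → R ks' (A (κ ks'))) →
      (∀ c, (∀ ks' ∈ l, c ≠ κ ks') → A c = A₀ c) → A (κ ks) = A₀ (κ ks) → R ks (f A ks)) :
    ∀ ks ∈ l, R ks ((l.foldl (fun A ks => Function.update A (key A ks) (f A ks)) A₀) (κ ks)) := by
  induction l using List.reverseRecOn with
  | nil => simp
  | append_singleton l ks₀ ih =>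
    have hk' : ∀ ks ∈ l, ∀ A, key A ks = κ ks := fun ks h => hk ks (by simp [h])
    rw [List.nodup_append] at hnd
    rw [List.pairwise_append] at hp
    have ih' := ih hk' (fun ks h ks' h' => hκ ks (by simp [h]) ks' (by simp [h'])) hnd.1 hp.1
      fun ks hks A hA1 hA2 hA3 => h ks (by simp [hks]) A (fun ks' hks' hlt => ?_) (fun c hc =>
        hA2 c fun ks' h' => hc ks' (by simp [h'])) hA3
    · rw [List.foldl_append, List.foldl_cons, List.foldl_nil, hk ks₀ (by simp)]
      intro ks hks
      rw [List.mem_append, List.mem_singleton] at hks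
      rcases hks with hks | rfl
      · rw [Function.update_of_ne]
        · exact ih' ks hks
        · intro e
          exact hnd.2.2 ks hks ks₀ (by simp) (hκ ks (by simp [hks]) ks₀ (by simp) e)
      · rw [Function.update_self]
        have hne : ∀ ks' ∈ l, κ ks ≠ κ ks' := fun ks' h' e =>
          hnd.2.2 ks' h' ks (by simp) (hκ ks (by simp) ks' (by simp [h']) e).symm
        refine h ks (by simp) _ (fun ks' hks' hlt => ?_) (fun c hc => ?_) ?_
        · rw [List.mem_append, List.mem_singleton] at hks'
          rcases hks' with hks' | rfl
          · exact ih' ks' hks'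
          · exact absurd hlt (lt_irrefl _)
        · exact foldl_update_of_ne hk' c fun ks' h' => hc ks' (by simp [h'])
        · exact foldl_update_of_ne hk' _ hne
    · rw [List.mem_append, List.mem_singleton] at hks'
      rcases hks' with hks' | rfl
      · exact hA1 ks' hks' hlt
      · have := hp.2.2 ks hks ks' (by simp)
        omega

theorem foldl_update_congr (hk : ∀ ks ∈ l, ∀ A, key A ks = κ ks)
    (hf : ∀ ks ∈ l, ∀ A, f A ks = v ks) (hv : ∀ ks ∈ l, ∀ ks' ∈ l, κ ks = κ ks' → v ks = v ks') :
    ∀ ks ∈ l, (l.foldl (fun A ks => Function.update A (key A ks) (f A ks)) A₀) (κ ks) = v ks := by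
  induction l using List.reverseRecOn with
  | nil => simp
  | append_singleton l ks₀ ih =>
    have ih' := ih (fun ks h => hk ks (by simp [h])) (fun ks h => hf ks (by simp [h]))
      fun ks h ks' h' => hv ks (by simp [h]) ks' (by simp [h'])
    intro ks hks
    rw [List.foldl_append, List.foldl_cons, List.foldl_nil, hk ks₀ (by simp), hf ks₀ (by simp)]
    by_cases e : κ ks = κ ks₀
    · rw [e, Function.update_self]
      exact (hv ks hks ks₀ (by simp) e).symm
    · rw [Function.update_of_ne e]
      rw [List.mem_append, List.mem_singleton] at hks
      rcases hks with hks | rfl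
      · exact ih' ks hks
      · exact absurd rfl e

/-- Marking cells: each assignment makes a cell true or leaves it unchanged. -/
theorem foldl_update_or (hk : ∀ ks ∈ l, ∀ A, key A ks = κ ks) {g : List ℕ → Prop}
    (hf : ∀ ks ∈ l, ∀ A, f A ks ≠ 0 ↔ g ks ∨ A (κ ks) ≠ 0) (c : List ℕ) :
    (l.foldl (fun A ks => Function.update A (key A ks) (f A ks)) A₀) c ≠ 0 ↔
      A₀ c ≠ 0 ∨ ∃ ks ∈ l, κ ks = c ∧ g ks := by
  induction l using List.reverseRecOn with
  | nil => simp
  | append_singleton l ks₀ ih =>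
    have ih' := ih (fun ks h => hk ks (by simp [h])) (fun ks h => hf ks (by simp [h]))
    rw [List.foldl_append, List.foldl_cons, List.foldl_nil, hk ks₀ (by simp)]
    by_cases e : c = κ ks₀
    · subst e
      rw [Function.update_self, hf ks₀ (by simp), ih']
      constructor
      · rintro (h | h | ⟨ks, h, e, h'⟩)
        · exact .inr ⟨ks₀, by simp, rfl, h⟩
        · exact .inl h
        · exact .inr ⟨ks, by simp [h], e, h'⟩
      · rintro (h | ⟨ks, h, e, h'⟩)
        · exact .inr (.inl h)
        · rw [List.mem_append, List.mem_singleton] at h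
          rcases h with h | rfl
          · exact .inr (.inr ⟨ks, h, e, h'⟩)
          · exact .inl h'
    · rw [Function.update_of_ne e, ih']
      constructor
      · rintro (h | ⟨ks, h, e, h'⟩)
        · exact .inl h
        · exact .inr ⟨ks, by simp [h], e, h'⟩
      · rintro (h | ⟨ks, h, e', h'⟩)
        · exact .inl h
        · rw [List.mem_append, List.mem_singleton] at h
          rcases h with h | rfl
          · exact .inr ⟨ks, h, e', h'⟩
          · exact absurd e'.symm e

end

/-- The indices of an array cell. -/
noncomputable def cell (Γ : Ctx) (e₁ e₂ e₃ e₄ e₅ e₆ : Expr) (s : State) : List ℕ :=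
  [e₁.denote Γ s, e₂.denote Γ s, e₃.denote Γ s, e₄.denote Γ s, e₅.denote Γ s, e₆.denote Γ s]

/-- None of the expressions reads the array `a`. -/
def Free (a : ℕ) (l : List Expr) : Prop := ∀ e ∈ l, a ∉ e.reads

instance (a : ℕ) (l : List Expr) : Decidable (Free a l) :=
  inferInstanceAs (Decidable (∀ e ∈ l, a ∉ e.reads))

theorem State.sets_withArr (s : State) (a : ℕ) (A : List ℕ → ℕ) (xs ks : List ℕ) :
    (s.withArr a A).sets xs ks = (s.sets xs ks).withArr a A := by
  induction xs generalizing s ks with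
  | nil => rfl
  | cons x xs ih =>
    cases ks with
    | nil => rfl
    | cons k ks => exact ih (s.set x k) ks

theorem Expr.denote_withArr {Γ : Ctx} (e : Expr) (s : State) {a : ℕ} (A : List ℕ → ℕ)
    (h : a ∉ e.reads) : e.denote Γ (s.withArr a A) = e.denote Γ s :=
  e.denote_congr rfl fun a' ha' => by
    have : a' ≠ a := fun e => h (e ▸ ha')
    simp [State.withArr, this]

theorem cell_withArr {Γ : Ctx} {e₁ e₂ e₃ e₄ e₅ e₆ : Expr} {a : ℕ}
    (h : Free a [e₁, e₂, e₃, e₄, e₅, e₆]) (s : State) (A : List ℕ → ℕ) :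
    cell Γ e₁ e₂ e₃ e₄ e₅ e₆ (s.withArr a A) = cell Γ e₁ e₂ e₃ e₄ e₅ e₆ s := by
  simp only [cell, e₁.denote_withArr s A (h e₁ (by simp)), e₂.denote_withArr s A (h e₂ (by simp)),
    e₃.denote_withArr s A (h e₃ (by simp)), e₄.denote_withArr s A (h e₄ (by simp)),
    e₅.denote_withArr s A (h e₅ (by simp)), e₆.denote_withArr s A (h e₆ (by simp))]

/-- Nested loops that fill a part of an array from other data. -/
theorem eval_fill {Γ : Ctx} {L : List (ℕ × Expr)} (hL : LoopsOk L) {a : ℕ}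
    {e₁ e₂ e₃ e₄ e₅ e₆ e : Expr} (hk : Free a [e₁, e₂, e₃, e₄, e₅, e₆]) (he : a ∉ e.reads)
    (s : State) {bs : List ℕ} (hbs : L.map (fun p => p.2.denote Γ s) = bs)
    (hv : ∀ ks ∈ tuples bs, ∀ ks' ∈ tuples bs,
      cell Γ e₁ e₂ e₃ e₄ e₅ e₆ (s.sets (L.map Prod.fst) ks) =
        cell Γ e₁ e₂ e₃ e₄ e₅ e₆ (s.sets (L.map Prod.fst) ks') →
      e.denote Γ (s.sets (L.map Prod.fst) ks) = e.denote Γ (s.sets (L.map Prod.fst) ks')) :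
    ∃ A, (Cmd.loops L (.store a e₁ e₂ e₃ e₄ e₅ e₆ e)).eval Γ s = s.withArr a A ∧
      (∀ ks ∈ tuples bs, A (cell Γ e₁ e₂ e₃ e₄ e₅ e₆ (s.sets (L.map Prod.fst) ks)) =
        e.denote Γ (s.sets (L.map Prod.fst) ks)) ∧
      ∀ c, (∀ ks ∈ tuples bs, c ≠ cell Γ e₁ e₂ e₃ e₄ e₅ e₆ (s.sets (L.map Prod.fst) ks)) →
        A c = s.arr a c := by
  subst hbs
  rw [eval_loops_store L hL]
  refine ⟨_, rfl, ?_, fun c hc => ?_⟩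
  · refine foldl_update_congr (key := fun A ks => cell Γ e₁ e₂ e₃ e₄ e₅ e₆
      ((s.withArr a A).sets (L.map Prod.fst) ks)) (fun ks hks A => ?_) (fun ks hks A => ?_) hv
    · rw [State.sets_withArr, cell_withArr hk]
    · rw [State.sets_withArr, e.denote_withArr _ _ he]
  · refine foldl_update_of_ne (key := fun A ks => cell Γ e₁ e₂ e₃ e₄ e₅ e₆
      ((s.withArr a A).sets (L.map Prod.fst) ks)) (fun ks hks A => ?_) c hc
    rw [State.sets_withArr, cell_withArr hk]

/-- Nested loops that fill a part of an array, where an entry may depend on entries with a smaller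
first loop variable. -/
theorem eval_fill_rec {Γ : Ctx} {L : List (ℕ × Expr)} (hL : LoopsOk L) {a : ℕ}
    {e₁ e₂ e₃ e₄ e₅ e₆ e : Expr} (hk : Free a [e₁, e₂, e₃, e₄, e₅, e₆])
    (s : State) {bs : List ℕ} (hbs : L.map (fun p => p.2.denote Γ s) = bs)
    (hκ : ∀ ks ∈ tuples bs, ∀ ks' ∈ tuples bs,
      cell Γ e₁ e₂ e₃ e₄ e₅ e₆ (s.sets (L.map Prod.fst) ks) =
        cell Γ e₁ e₂ e₃ e₄ e₅ e₆ (s.sets (L.map Prod.fst) ks') → ks = ks')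
    {R : List ℕ → ℕ → Prop}
    (h : ∀ ks ∈ tuples bs, ∀ A : List ℕ → ℕ,
      (∀ ks' ∈ tuples bs, ks'.headD 0 < ks.headD 0 →
        R ks' (A (cell Γ e₁ e₂ e₃ e₄ e₅ e₆ (s.sets (L.map Prod.fst) ks')))) →
      A (cell Γ e₁ e₂ e₃ e₄ e₅ e₆ (s.sets (L.map Prod.fst) ks)) =
        s.arr a (cell Γ e₁ e₂ e₃ e₄ e₅ e₆ (s.sets (L.map Prod.fst) ks)) →
      R ks (e.denote Γ ((s.sets (L.map Prod.fst) ks).withArr a A))) :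
    ∃ A, (Cmd.loops L (.store a e₁ e₂ e₃ e₄ e₅ e₆ e)).eval Γ s = s.withArr a A ∧
      (∀ ks ∈ tuples bs, R ks (A (cell Γ e₁ e₂ e₃ e₄ e₅ e₆ (s.sets (L.map Prod.fst) ks)))) ∧
      ∀ c, (∀ ks ∈ tuples bs, c ≠ cell Γ e₁ e₂ e₃ e₄ e₅ e₆ (s.sets (L.map Prod.fst) ks)) →
        A c = s.arr a c := by
  subst hbs
  rw [eval_loops_store L hL]
  have hkey : ∀ (A : List ℕ → ℕ) ks, cell Γ e₁ e₂ e₃ e₄ e₅ e₆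
      ((s.withArr a A).sets (L.map Prod.fst) ks) =
      cell Γ e₁ e₂ e₃ e₄ e₅ e₆ (s.sets (L.map Prod.fst) ks) := fun A ks => by
    rw [State.sets_withArr, cell_withArr hk]
  refine ⟨_, rfl, ?_, fun c hc => ?_⟩
  · refine foldl_update_rec (key := fun A ks => cell Γ e₁ e₂ e₃ e₄ e₅ e₆
      ((s.withArr a A).sets (L.map Prod.fst) ks)) (fun ks hks A => hkey A ks) hκ (nodup_tuples _)
      (pairwise_tuples _) fun ks hks A h1 h2 h3 => ?_
    rw [State.sets_withArr]
    exact h ks hks A h1 h3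
  · exact foldl_update_of_ne (key := fun A ks => cell Γ e₁ e₂ e₃ e₄ e₅ e₆
      ((s.withArr a A).sets (L.map Prod.fst) ks)) (fun ks hks A => hkey A ks) c hc

/-- Nested loops that mark cells. -/
theorem eval_mark {Γ : Ctx} {L : List (ℕ × Expr)} (hL : LoopsOk L) {a : ℕ}
    {e₁ e₂ e₃ e₄ e₅ e₆ g : Expr} (hk : Free a [e₁, e₂, e₃, e₄, e₅, e₆]) (hg : a ∉ g.reads)
    (s : State) {bs : List ℕ} (hbs : L.map (fun p => p.2.denote Γ s) = bs) :
    ∃ A, (Cmd.loops L (.store a e₁ e₂ e₃ e₄ e₅ e₆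
        (.ite g (.const 1) (.arr a e₁ e₂ e₃ e₄ e₅ e₆)))).eval Γ s = s.withArr a A ∧
      ∀ c, A c ≠ 0 ↔ s.arr a c ≠ 0 ∨ ∃ ks ∈ tuples bs,
        cell Γ e₁ e₂ e₃ e₄ e₅ e₆ (s.sets (L.map Prod.fst) ks) = c ∧
        g.denote Γ (s.sets (L.map Prod.fst) ks) ≠ 0 := by
  subst hbs
  rw [eval_loops_store L hL]
  have hkey : ∀ (A : List ℕ → ℕ) ks, cell Γ e₁ e₂ e₃ e₄ e₅ e₆
      ((s.withArr a A).sets (L.map Prod.fst) ks) =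
      cell Γ e₁ e₂ e₃ e₄ e₅ e₆ (s.sets (L.map Prod.fst) ks) := fun A ks => by
    rw [State.sets_withArr, cell_withArr hk]
  refine ⟨_, rfl, fun c => ?_⟩
  refine foldl_update_or (key := fun A ks => cell Γ e₁ e₂ e₃ e₄ e₅ e₆
      ((s.withArr a A).sets (L.map Prod.fst) ks)) (fun ks hks A => hkey A ks)
      (fun ks hks A => ?_) c
  have := hkey A ks
  simp only [cell] at this
  simp only [Expr.denote, this, cell]
  rw [State.sets_withArr, g.denote_withArr _ _ hg]
  have hA : ((s.sets (L.map Prod.fst) ks).withArr a A).arr a = A := by simp [State.withArr]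
  rw [hA]
  split <;> simp_all

/-! ### The program -/

namespace Expr

/-- Conjunction. -/
def and (a b : Expr) : Expr := .ite a b (.const 0)

/-- Disjunction. -/
def or (a b : Expr) : Expr := .ite a (.const 1) b

/-- Negation. -/
def not (a : Expr) : Expr := .ite a (.const 0) (.const 1)

/-- `a < b`. -/
def lt (a b : Expr) : Expr := .sub b a

/-- `a ≤ b`. -/
def le (a b : Expr) : Expr := (lt b a).not

/-- `a = b`. -/
def eq (a b : Expr) : Expr := (le a b).and (le b a)

/-- Some `x < b` makes `e` true. -/
def any (x : ℕ) (b e : Expr) : Expr := (find x b e).lt b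

/-- Arrays with fewer than six indices: the others are zero. -/
def arr1 (a : ℕ) (e : Expr) : Expr :=
  .arr a e (.const 0) (.const 0) (.const 0) (.const 0) (.const 0)

def arr2 (a : ℕ) (e f : Expr) : Expr := .arr a e f (.const 0) (.const 0) (.const 0) (.const 0)

def arr3 (a : ℕ) (e f g : Expr) : Expr := .arr a e f g (.const 0) (.const 0) (.const 0)

def arr4 (a : ℕ) (e f g h : Expr) : Expr := .arr a e f g h (.const 0) (.const 0)

end Expr

namespace Cmd

/-- Stores into arrays with fewer than six indices. -/
def store1 (a : ℕ) (e v : Expr) : Cmd :=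
  .store a e (.const 0) (.const 0) (.const 0) (.const 0) (.const 0) v

def store2 (a : ℕ) (e f v : Expr) : Cmd :=
  .store a e f (.const 0) (.const 0) (.const 0) (.const 0) v

def store3 (a : ℕ) (e f g v : Expr) : Cmd :=
  .store a e f g (.const 0) (.const 0) (.const 0) v

def store4 (a : ℕ) (e f g h v : Expr) : Cmd :=
  .store a e f g h (.const 0) (.const 0) v

/-- Run several commands one after the other. -/
def block : List Cmd → Cmd
  | [] => .skip
  | [c] => c
  | c :: l => .seq c (block l)

end Cmd

open FC.Expr

/-- The number of the positions of the word, its length plus one. -/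
abbrev vN : Expr := .reg 0
/-- The number of atoms. -/
abbrev vM : Expr := .reg 1
/-- The length of the head. -/
abbrev vR : Expr := .reg 2
/-- The length of the query in the input. -/
abbrev vQ : Expr := .reg 3
/-- The position of the first letter of the word in the input. -/
abbrev vW : Expr := .reg 4
abbrev k0 : Expr := .const 0
abbrev k1 : Expr := .const 1

/-- Position of an atom in the input. -/
abbrev aPos (c : Expr) : Expr := arr1 0 c

/-- Variable in a slot of an atom. -/
abbrev aVar (c s : Expr) : Expr := arr2 1 c s

/-- Start of the first occurrence of a factor, given by length and start. -/
abbrev aCan (l i : Expr) : Expr := arr2 2 l i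

/-- Truth of a regular constraint for a factor, given by length and start. -/
abbrev aReg (c l i : Expr) : Expr := arr3 3 c l i

/-- Position in the head of the variable in a slot of an atom. -/
abbrev aHead (c s : Expr) : Expr := arr2 4 c s

/-- Variable in the head. -/
abbrev aHVar (h : Expr) : Expr := arr1 5 h

/-- The node that the tree edge `e` adds to the join tree. -/
abbrev aOrd (e : Expr) : Expr := arr1 6 e
/-- The node to which the tree edge `e` attaches the new node. -/
abbrev aPar (e : Expr) : Expr := arr1 7 e

/-- Table of the triples of an atom. -/
abbrev aTab (c i p q : Expr) : Expr := arr4 8 c i p q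

/-- Start of the stored value of the variable of the head with the number `h`. -/
abbrev aCI (h : Expr) : Expr := arr1 11 h
/-- Length of the stored value of the variable of the head with the number `h`. -/
abbrev aCL (h : Expr) : Expr := arr1 12 h
/-- The atom is a node of the tree (Prim's algorithm). -/
abbrev aIn (c : Expr) : Expr := arr1 15 c
/-- The largest number of variables that the atom shares with a node of the tree. -/
abbrev aBw (c : Expr) : Expr := arr1 16 c
/-- A node of the tree with which the atom shares the largest number of variables. -/
abbrev aBp (c : Expr) : Expr := arr1 17 c

/-- The length of the right side of an atom whose position is given. -/
def lenE (p : Expr) : Expr := .inp (.add p (.const 2))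

/-- Find the positions of the atoms in the input. An atom has a tag, a variable and a length,
followed by the code of the right side, with two words per symbol, or of the regular expression. -/
def parseLoop : Cmd :=
  .seq (.assign 5 (.add vR (.const 2)))
    (.loop 10 vM (.seq (.store1 0 (.reg 10) (.reg 5))
      (.assign 5 (.add (.reg 5) (.add (.const 3)
        (.ite (.inp (.reg 5)) (lenE (.reg 5)) (.add (lenE (.reg 5)) (lenE (.reg 5)))))))))

/-- A number for the variable at a position of the input: zero for the universe variable, otherwise
determined by the first occurrence. -/
def codeE (q : Expr) : Expr :=
  .ite (.inp q) (.add k1 (.find 11 vQ (.inpEq (.reg 11) q))) k0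

/-- The number of the variable in the right side of the atom `c` at position `j`; the symbol is
encoded at offset `k`. Zero if there is no such variable. -/
def slotE (c : Expr) (j k : ℕ) : Expr :=
  .ite ((Expr.inp (aPos c)).not.and ((lt (.const j) (lenE (aPos c))).and
    (.inp (.add (aPos c) (.const k))))) (codeE (.add k1 (.add (aPos c) (.const k)))) k0

/-- Store the numbers of the variables in the slots of the atoms. -/
def varsC : Cmd := .block [
  .loops [(10, vM)] (.store2 1 (.reg 10) k0 (codeE (.add (aPos (.reg 10)) k1))),
  .loops [(10, vM)] (.store2 1 (.reg 10) k1 (slotE (.reg 10) 0 3)),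
  .loops [(10, vM)] (.store2 1 (.reg 10) (.const 2) (slotE (.reg 10) 1 5))]

/-- Compute the starts of first occurrences by recursion on the length: the first occurrence of a
factor is the first place where its prefix without the last letter and its last letter occur. -/
def canC : Cmd :=
  .loops [(10, vN), (11, vN)] (.store2 2 (.reg 10) (.reg 11) (.ite (.reg 10)
    (.find 12 vN ((eq (aCan (.sub (.reg 10) k1) (.reg 12)) (aCan (.sub (.reg 10) k1) (.reg 11))).and
      (.inpEq (.add vW (.add (.reg 12) (.sub (.reg 10) k1)))
        (.add vW (.add (.reg 11) (.sub (.reg 10) k1)))))) k0))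

/-- Stack of the regular expressions that have been read: truth for length `l` and start `i`. -/
abbrev aStk (t l i : Expr) : Expr := arr3 13 t l i
/-- The table of the regular expression that is being read. -/
abbrev aTmp (l i : Expr) : Expr := arr2 14 l i

/-- The symbol of a regular expression that is read. -/
abbrev opE : Expr := .inp (.reg 7)
/-- The entry below the top of the stack. -/
abbrev top2 : Expr := .sub (.reg 6) (.const 2)
/-- The top of the stack. -/
abbrev top1 : Expr := .sub (.reg 6) k1

/-- Truth of the regular expression whose operator is read, for the factor whose length and start
are the scalar variables `12` and `13`, from the tables on the stack. For an iteration, a factor is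
split into a nonempty first part and a shorter rest, for which the table is known already. -/
def regexE : Expr :=
  .ite (eq opE k0) k0 <|
  .ite (eq opE k1) (.not (.reg 12)) <|
  .ite (eq opE (.const 2))
    ((eq (.reg 12) k1).and (.inpEq (.add (.reg 7) k1) (.add vW (.reg 13)))) <|
  .ite (eq opE (.const 3))
    ((aStk top2 (.reg 12) (.reg 13)).or (aStk top1 (.reg 12) (.reg 13))) <|
  .ite (eq opE (.const 4))
    (.any 14 vN ((le (.reg 14) (.reg 12)).and ((aStk top2 (.reg 14) (.reg 13)).and
      (aStk top1 (.sub (.reg 12) (.reg 14)) (.add (.reg 13) (.reg 14))))))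
    ((Expr.not (.reg 12)).or (.any 14 vN ((Expr.reg 14).and ((le (.reg 14) (.reg 12)).and
      ((aStk top1 (.reg 14) (.reg 13)).and
        (aTmp (.sub (.reg 12) (.reg 14)) (.add (.reg 13) (.reg 14))))))))

/-- Read one symbol of a regular expression in postfix notation and replace the tables of the
operands on the stack by the table of the result. -/
def regexStep : Cmd := .block [
  .assign 9 (.ite (lt opE (.const 3)) (.reg 6) (.ite (lt opE (.const 5)) top2 top1)),
  .loops [(12, vN), (13, vN)] (.store2 14 (.reg 12) (.reg 13) regexE),
  .loops [(12, vN), (13, vN)] (.store3 13 (.reg 9) (.reg 12) (.reg 13) (aTmp (.reg 12) (.reg 13))),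
  .assign 6 (.add (.reg 9) k1),
  .assign 7 (.add (.reg 7) (.ite (eq opE (.const 2)) (.const 2) k1))]

/-- Evaluate the regular expression of an atom. -/
def regexBody : Cmd := .block [
  .assign 7 (.add (aPos (.reg 10)) (.const 3)),
  .assign 8 (.add (aPos (.reg 10)) (.add (.const 3) (lenE (aPos (.reg 10))))),
  .assign 6 k0,
  .loop 11 vQ (.ite (lt (.reg 7) (.reg 8)) regexStep .skip),
  .loops [(12, vN), (13, vN)]
    (.store3 3 (.reg 10) (.reg 12) (.reg 13) (aStk k0 (.reg 12) (.reg 13)))]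

/-- Evaluate all regular constraints. -/
def regexC : Cmd := .loop 10 vM (.ite (.inp (aPos (.reg 10))) regexBody .skip)

/-- Store the numbers of the variables of the head, and the places in the head of the variables of
the atoms. -/
def headC : Cmd := .block [
  .loops [(10, vR)] (.store1 5 (.reg 10) (codeE (.add k1 (.reg 10)))),
  .loops [(10, vM), (11, .const 3)] (.store2 4 (.reg 10) (.reg 11)
    (.ite (aVar (.reg 10) (.reg 11))
      (.find 12 vR (eq (aHVar (.reg 12)) (aVar (.reg 10) (.reg 11)))) vR))]

/-- The contribution of the slot `s` of `v` to the number of the common variables of `u` and `v`: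
one if it has a variable that occurs in `u` but not in the slots `l` of `v`. -/
def wtSlot (u v : Expr) (s : ℕ) (l : List ℕ) : Expr :=
  .ite ((aVar v (.const s)).and ((any 13 (.const 3) (eq (aVar u (.reg 13)) (aVar v (.const s)))).and
    (l.foldr (fun s' e => (eq (aVar v (.const s')) (aVar v (.const s))).not.and e) k1))) k1 k0

/-- The number of the common variables of two atoms. -/
def wtE (u v : Expr) : Expr :=
  .add (.add (wtSlot u v 0 []) (wtSlot u v 1 [0])) (wtSlot u v 2 [0, 1])

/-- The first atom outside the tree whose best weight is `g`, and `d` if there is none. -/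
def selE (g : ℕ) (d : Expr) : Expr :=
  .ite (any 12 vM ((aIn (.reg 12)).not.and (eq (aBw (.reg 12)) (.const g))))
    (.find 12 vM ((aIn (.reg 12)).not.and (eq (aBw (.reg 12)) (.const g)))) d

/-- A step of Prim's algorithm: add the outside atom that shares most variables with a node of the
tree, and update the best nodes of the other atoms. Weights are at most `3`. -/
def primStep : Cmd := .block [
  .assign 6 (selE 3 (selE 2 (selE 1 (selE 0 k0)))),
  .store1 6 (.reg 11) (.reg 6),
  .store1 7 (.reg 11) (aBp (.reg 6)),
  .store1 15 (.reg 6) k1,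
  .loops [(12, vM)] (.store1 17 (.reg 12)
    (.ite (lt (aBw (.reg 12)) (wtE (.reg 6) (.reg 12))) (.reg 6) (aBp (.reg 12)))),
  .loops [(12, vM)] (.store1 16 (.reg 12)
    (.ite (lt (aBw (.reg 12)) (wtE (.reg 6) (.reg 12))) (wtE (.reg 6) (.reg 12)) (aBw (.reg 12))))]

/-- Prim's algorithm for a spanning tree of the atoms with the largest total number of shared
variables, starting with the atom `0`. -/
def primC : Cmd := .block [
  .loops [(12, vM)] (.store1 16 (.reg 12) (wtE k0 (.reg 12))),
  .loops [(12, vM)] (.store1 17 (.reg 12) k0),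
  .loops [(12, vM)] (.store1 15 (.reg 12) (.not (.reg 12))),
  .loop 11 (.sub vM k1) primStep]

/-- The span of the triple in the scalar variables `x`, `x + 1`, `x + 2` in the slot `s`: identity
(start of the first occurrence) and length. Zero if `s` is not a slot. -/
def spanCan (s : Expr) (x : ℕ) : Expr :=
  .ite (eq s k0) (aCan (.add (.reg (x + 1)) (.reg (x + 2))) (.reg x)) <|
  .ite (eq s k1) (aCan (.reg (x + 1)) (.reg x)) <|
  .ite (eq s (.const 2)) (aCan (.reg (x + 2)) (.add (.reg x) (.reg (x + 1)))) k0

/-- The length of the span in the slot `s`. -/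
def spanLen (s : Expr) (x : ℕ) : Expr :=
  .ite (eq s k0) (.add (.reg (x + 1)) (.reg (x + 2))) <|
  .ite (eq s k1) (.reg (x + 1)) <|
  .ite (eq s (.const 2)) (.reg (x + 2)) k0

/-- The condition that a symbol of the right side imposes on its span. -/
def symE (c : Expr) (j k : ℕ) (i l : Expr) : Expr :=
  .ite (lt (.const j) (lenE (aPos c)))
    (.ite (.inp (.add (aPos c) (.const k)))
      ((Expr.inp (.add k1 (.add (aPos c) (.const k)))).or (eq (.add l k1) vN))
      ((eq l k1).and (.inpEq (.add k1 (.add (aPos c) (.const k))) (.add vW i))))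
    (eq l k0)

/-- Two slots with the same variable have the same value. -/
def dupE (c : Expr) (s s' : ℕ) : Expr :=
  ((aVar c (.const s)).and (eq (aVar c (.const s)) (aVar c (.const s')))).not.or
    ((eq (spanCan (.const s) 11) (spanCan (.const s') 11)).and
      (eq (spanLen (.const s) 11) (spanLen (.const s') 11)))

/-- If the variable in the slot `s` is among the first variables of the head, whose number is the
scalar variable `20`, then it has the prescribed value. -/
def fixE (c : Expr) (s : ℕ) : Expr :=
  (lt (aHead c (.const s)) (.reg 20)).not.or
    ((eq (spanCan (.const s) 11) (aCI (aHead c (.const s)))).and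
      (eq (spanLen (.const s) 11) (aCL (aHead c (.const s)))))

/-- Conjunction of several conditions. -/
def conj : List Expr → Expr
  | [] => k1
  | e :: l => e.and (conj l)

/-- The condition on the triple in the scalar variables `11`, `12`, `13` to belong to the table of
the atom in the scalar variable `10`. -/
def baseE : Expr :=
  conj [lt (.add (.reg 11) (.add (.reg 12) (.reg 13))) vN,
    .ite (.inp (aPos (.reg 10))) ((Expr.reg 13).not.and (aReg (.reg 10) (.reg 12) (.reg 11)))
      ((symE (.reg 10) 0 3 (.reg 11) (.reg 12)).and
        (symE (.reg 10) 1 5 (.add (.reg 11) (.reg 12)) (.reg 13))),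
    (aVar (.reg 10) k0).or (eq (.add (.add (.reg 12) (.reg 13)) k1) vN),
    dupE (.reg 10) 0 1, dupE (.reg 10) 0 2, dupE (.reg 10) 1 2,
    fixE (.reg 10) 0, fixE (.reg 10) 1, fixE (.reg 10) 2]

/-- Compute the tables of all atoms. -/
def initC : Cmd :=
  .loops [(10, vM), (11, vN), (12, vN), (13, vN)]
    (.store4 8 (.reg 10) (.reg 11) (.reg 12) (.reg 13) baseE)

/-- The slot of the atom `x` that has the variable in the slot `s` of `a`, if this is a variable of
`b` and of `x`, and `3` otherwise. -/
def sharedSlot (a b x : Expr) (s : ℕ) : Expr :=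
  .ite ((aVar a (.const s)).and (any 13 (.const 3) (eq (aVar b (.reg 13)) (aVar a (.const s)))))
    (.find 13 (.const 3) (eq (aVar x (.reg 13)) (aVar a (.const s)))) (.const 3)

/-- Store into the array of marks, at the cell of the common values of a triple, for the slots in
the scalar variables `r`, `r + 1`, `r + 2`. -/
def markArr (r : ℕ) : Expr :=
  .arr 9 (spanCan (.reg r) 10) (spanLen (.reg r) 10) (spanCan (.reg (r + 1)) 10)
    (spanLen (.reg (r + 1)) 10) (spanCan (.reg (r + 2)) 10) (spanLen (.reg (r + 2)) 10)

/-- The marks as the target of an assignment. -/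
def markStore (r : ℕ) (e : Expr) : Cmd :=
  .store 9 (spanCan (.reg r) 10) (spanLen (.reg r) 10) (spanCan (.reg (r + 1)) 10)
    (spanLen (.reg (r + 1)) 10) (spanCan (.reg (r + 2)) 10) (spanLen (.reg (r + 2)) 10) e

/-- Loops over all triples. -/
abbrev loops3 : List (ℕ × Expr) := [(10, vN), (11, vN), (12, vN)]

/-- The semijoin of the atom in the scalar variable `6` with the atom in the scalar variable `7`. -/
def semijoinC : Cmd := .block [
  .assign 30 (sharedSlot (.reg 6) (.reg 7) (.reg 6) 0),
  .assign 31 (sharedSlot (.reg 6) (.reg 7) (.reg 6) 1),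
  .assign 32 (sharedSlot (.reg 6) (.reg 7) (.reg 6) 2),
  .assign 33 (sharedSlot (.reg 6) (.reg 7) (.reg 7) 0),
  .assign 34 (sharedSlot (.reg 6) (.reg 7) (.reg 7) 1),
  .assign 35 (sharedSlot (.reg 6) (.reg 7) (.reg 7) 2),
  .loops loops3 (markStore 30 k0),
  .loops loops3 (markStore 33 (.ite (aTab (.reg 7) (.reg 10) (.reg 11) (.reg 12)) k1 (markArr 33))),
  .loops loops3 (.store4 8 (.reg 6) (.reg 10) (.reg 11) (.reg 12)
    ((markArr 30).and (aTab (.reg 6) (.reg 10) (.reg 11) (.reg 12))))]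

/-- Semijoins of the parents with their children, from the leaves to the root. -/
def upC : Cmd :=
  .loop 14 (.sub vM k1) (.block [
    .assign 6 (aPar (.sub (.sub (.sub vM k1) k1) (.reg 14))),
    .assign 7 (aOrd (.sub (.sub (.sub vM k1) k1) (.reg 14))), semijoinC])

/-- Semijoins of the children with their parents, from the root to the leaves. -/
def downC : Cmd :=
  .loop 14 (.sub vM k1) (.block [.assign 6 (aOrd (.reg 14)), .assign 7 (aPar (.reg 14)), semijoinC])

/-- Compute the reduced tables when the first variables of the head are fixed. -/
def solveC : Cmd := .block [initC, upC, downC]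

/-- The pair `i`, `l` is a value of the variable that is considered. -/
abbrev aVal (i l : Expr) : Expr := arr2 10 i l

/-- The pair `i`, `l` is a value of the next variable of the head; if the scalar variable `28` is
true, a value behind the present one. -/
def candE (i l : Expr) : Expr :=
  (aVal i l).and ((Expr.reg 28).not.or ((lt (aCI (.reg 20)) i).or
    ((eq (aCI (.reg 20)) i).and (lt (aCL (.reg 20)) l))))

/-- Find the least value of the variable of the head whose number is the scalar variable `20`. -/
def valuesC : Cmd := .block [
  .assign 24 (.find 10 vM (any 11 (.const 3) (eq (aVar (.reg 10) (.reg 11)) (aHVar (.reg 20))))),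
  .assign 25 (.find 11 (.const 3) (eq (aVar (.reg 24) (.reg 11)) (aHVar (.reg 20)))),
  .loops [(10, vN), (11, vN)] (.store2 10 (.reg 10) (.reg 11) k0),
  .loops loops3 (.store2 10 (spanCan (.reg 25) 10) (spanLen (.reg 25) 10)
    (.ite (aTab (.reg 24) (.reg 10) (.reg 11) (.reg 12)) k1
      (aVal (spanCan (.reg 25) 10) (spanLen (.reg 25) 10)))),
  .assign 26 (.find 10 vN (any 11 vN (candE (.reg 10) (.reg 11)))),
  .assign 27 (.find 11 vN (candE (.reg 26) (.reg 11)))]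

/-- Store the value that has been found. -/
def keepC : Cmd := .block [.store1 11 (.reg 20) (.reg 26), .store1 12 (.reg 20) (.reg 27)]

/-- The table of the atom `0` is not empty. -/
def existsE : Expr :=
  any 10 vN (any 11 vN (any 12 vN (aTab k0 (.reg 10) (.reg 11) (.reg 12))))

/-- Solve without fixed values; the scalar variable `21` tells whether there is a result. -/
def firstC : Cmd := .block [
  .assign 20 k0, solveC, .assign 21 (.ite existsE k1 k0), .assign 22 k0, .assign 23 k1]

/-- Look for the last variable of the head that can get a larger value. -/
def backC : Cmd := .block [
  .assign 21 k0,
  .assign 28 k1,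
  .loop 15 vR (.ite (.reg 21) .skip (.block [
    .assign 20 (.sub (.sub vR k1) (.reg 15)), solveC, valuesC,
    .ite (lt (.reg 26) vN) (.block [keepC, .assign 21 k1, .assign 22 (.add (.reg 20) k1)]) .skip]))]

/-- Choose the least values for the variables of the head from number `22` on. -/
def fillC : Cmd := .block [
  .assign 28 k0,
  .loop 15 vR (.ite (le (.reg 22) (.reg 15))
    (.block [.assign 20 (.reg 15), solveC, valuesC, keepC]) .skip)]

/-- Find the next result: the first one at the beginning, the successor of the stored one later. The
scalar variable `23` tells whether a result has been sought before, and `21` whether one is found.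
-/
def nextC : Cmd := .seq (.ite (.reg 23) backC firstC) (.ite (.reg 21) fillC .skip)

/-- Write the spans of the stored tuple; positions are counted from one. -/
def outC : Cmd :=
  .loop 15 vR (.seq (.write (.add (aCI (.reg 15)) k1))
    (.write (.add (.add (aCI (.reg 15)) (aCL (.reg 15))) k1)))

/-- Compute everything that does not change during the enumeration. -/
def prepC : Cmd := .block [varsC, canC, regexC, headC, primC]

theorem parseLoop_ok : parseLoop.ok = true := by decide
theorem prepC_ok : prepC.ok = true := by decide
theorem firstC_ok : firstC.ok = true := by decide
theorem nextC_ok : nextC.ok = true := by decide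
theorem outC_ok : outC.ok = true := by decide
theorem parseLoop_cost : parseLoop.cost.a ≤ 2 ∧ parseLoop.cost.b ≤ 3 := by decide
theorem prepC_cost : prepC.cost.a ≤ 2 ∧ prepC.cost.b ≤ 3 := by decide +kernel
theorem firstC_cost : firstC.cost.a ≤ 2 ∧ firstC.cost.b ≤ 3 := by decide +kernel
theorem nextC_cost : nextC.cost.a ≤ 2 ∧ nextC.cost.b ≤ 3 := by decide +kernel
theorem outC_cost : outC.cost.a ≤ 2 ∧ outC.cost.b ≤ 3 := by decide +kernel

open FC.Expr

/-! ### Evaluation of expressions -/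

/-- The value of the expression is true. -/
def Expr.holds (Γ : Ctx) (e : Expr) (s : State) : Prop := e.denote Γ s ≠ 0

section

variable {Γ : Ctx} {s : State} {a b c e : Expr}

@[simp] theorem denote_const {n : ℕ} : (Expr.const n).denote Γ s = n := rfl
@[simp] theorem denote_reg {r : ℕ} : (Expr.reg r).denote Γ s = s.reg r := rfl
@[simp] theorem denote_add : (Expr.add a b).denote Γ s =
    min (a.denote Γ s + b.denote Γ s) (Γ.N - 1) := rfl
@[simp] theorem denote_sub : (Expr.sub a b).denote Γ s = a.denote Γ s - b.denote Γ s := rfl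
@[simp] theorem denote_inp : (Expr.inp a).denote Γ s = min (Γ.inp (a.denote Γ s)) (Γ.N - 1) := rfl

open Classical in
@[simp] theorem denote_ite : (Expr.ite c a b).denote Γ s =
    if c.holds Γ s then a.denote Γ s else b.denote Γ s := by
  simp only [Expr.denote, Expr.holds]
  congr

@[simp] theorem denote_find {x : ℕ} : (Expr.find x b e).denote Γ s =
    lb (b.denote Γ s) fun k => e.holds Γ (s.set x k) := rfl

@[simp] theorem denote_arr1 {n : ℕ} :
    (arr1 n a).denote Γ s = s.arr n [a.denote Γ s, 0, 0, 0, 0, 0] := rfl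
@[simp] theorem denote_arr2 {n : ℕ} :
    (arr2 n a b).denote Γ s = s.arr n [a.denote Γ s, b.denote Γ s, 0, 0, 0, 0] := rfl
@[simp] theorem denote_arr3 {n : ℕ} : (arr3 n a b c).denote Γ s =
    s.arr n [a.denote Γ s, b.denote Γ s, c.denote Γ s, 0, 0, 0] := rfl
@[simp] theorem denote_arr4 {n : ℕ} : (arr4 n a b c e).denote Γ s =
    s.arr n [a.denote Γ s, b.denote Γ s, c.denote Γ s, e.denote Γ s, 0, 0] := rfl

@[simp] theorem holds_const {n : ℕ} : (Expr.const n).holds Γ s ↔ n ≠ 0 := Iff.rfl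
@[simp] theorem holds_reg {r : ℕ} : (Expr.reg r).holds Γ s ↔ s.reg r ≠ 0 := Iff.rfl
@[simp] theorem holds_arr1 {n : ℕ} :
    (arr1 n a).holds Γ s ↔ s.arr n [a.denote Γ s, 0, 0, 0, 0, 0] ≠ 0 := Iff.rfl
@[simp] theorem holds_arr2 {n : ℕ} :
    (arr2 n a b).holds Γ s ↔ s.arr n [a.denote Γ s, b.denote Γ s, 0, 0, 0, 0] ≠ 0 := Iff.rfl
@[simp] theorem holds_arr3 {n : ℕ} : (arr3 n a b c).holds Γ s ↔
    s.arr n [a.denote Γ s, b.denote Γ s, c.denote Γ s, 0, 0, 0] ≠ 0 := Iff.rfl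
@[simp] theorem holds_arr4 {n : ℕ} : (arr4 n a b c e).holds Γ s ↔
    s.arr n [a.denote Γ s, b.denote Γ s, c.denote Γ s, e.denote Γ s, 0, 0] ≠ 0 := Iff.rfl

@[simp] theorem holds_ite : (Expr.ite c a b).holds Γ s ↔
    (c.holds Γ s → a.holds Γ s) ∧ (¬ c.holds Γ s → b.holds Γ s) := by
  classical
  unfold Expr.holds
  rw [denote_ite]
  unfold Expr.holds
  split <;> simp_all

@[simp] theorem holds_and : (a.and b).holds Γ s ↔ a.holds Γ s ∧ b.holds Γ s := by
  rw [Expr.and, holds_ite, holds_const]; tauto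

@[simp] theorem holds_or : (a.or b).holds Γ s ↔ a.holds Γ s ∨ b.holds Γ s := by
  rw [Expr.or, holds_ite, holds_const]; tauto

@[simp] theorem holds_not : a.not.holds Γ s ↔ ¬ a.holds Γ s := by
  rw [Expr.not, holds_ite, holds_const, holds_const]; tauto

@[simp] theorem holds_lt : (Expr.lt a b).holds Γ s ↔ a.denote Γ s < b.denote Γ s := by
  rw [Expr.lt, Expr.holds, denote_sub]; omega

@[simp] theorem holds_le : (Expr.le a b).holds Γ s ↔ a.denote Γ s ≤ b.denote Γ s := by
  rw [Expr.le, holds_not, holds_lt]; omega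

@[simp] theorem holds_eq : (Expr.eq a b).holds Γ s ↔ a.denote Γ s = b.denote Γ s := by
  rw [Expr.eq, holds_and, holds_le, holds_le]; omega

@[simp] theorem holds_inpEq : (Expr.inpEq a b).holds Γ s ↔
    Γ.inp (a.denote Γ s) = Γ.inp (b.denote Γ s) := by
  simp [Expr.holds, Expr.denote]

theorem holds_inp (hN : 8 ≤ Γ.N) : (Expr.inp a).holds Γ s ↔ Γ.inp (a.denote Γ s) ≠ 0 := by
  rw [Expr.holds, denote_inp]; omega

@[simp] theorem holds_any {x : ℕ} : (any x b e).holds Γ s ↔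
    ∃ k < b.denote Γ s, e.holds Γ (s.set x k) := by
  rw [any, holds_lt, denote_find, lb_lt_iff]

@[simp] theorem set_reg {x k r : ℕ} : (s.set x k).reg r = if r = x then k else s.reg r := by
  simp only [State.set, Function.update_apply]

@[simp] theorem set_arr {x k : ℕ} : (s.set x k).arr = s.arr := rfl

@[simp] theorem withArr_reg {n : ℕ} {A : List ℕ → ℕ} : (s.withArr n A).reg = s.reg := rfl

@[simp] theorem withArr_arr {n m : ℕ} {A : List ℕ → ℕ} :
    (s.withArr n A).arr m = if m = n then A else s.arr m := by
  simp only [State.withArr, Function.update_apply]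

@[simp] theorem sets_cons {x k : ℕ} {xs ks : List ℕ} :
    s.sets (x :: xs) (k :: ks) = (s.set x k).sets xs ks := rfl

@[simp] theorem sets_nil {ks : List ℕ} : s.sets [] ks = s := rfl

end

theorem eval_seq {Γ : Ctx} {c d : Cmd} {s : State} :
    (Cmd.seq c d).eval Γ s = d.eval Γ (c.eval Γ s) := rfl

theorem eval_assign {Γ : Ctx} {r : ℕ} {e : Expr} {s : State} :
    (Cmd.assign r e).eval Γ s = s.set r (e.denote Γ s) := rfl

theorem eval_loop {Γ : Ctx} {x : ℕ} {b : Expr} {c : Cmd} {s : State} :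
    (Cmd.loop x b c).eval Γ s =
      iter (fun k s' => (c.eval Γ (s'.set x k)).set x (s'.reg x)) (b.denote Γ s) s := rfl

open Classical in
theorem eval_ite {Γ : Ctx} {e : Expr} {c d : Cmd} {s : State} :
    (Cmd.ite e c d).eval Γ s = if e.holds Γ s then c.eval Γ s else d.eval Γ s := by
  simp only [Cmd.eval, Expr.holds]
  congr

theorem block_cons {Γ : Ctx} {c d : Cmd} {l : List Cmd} {s : State} :
    (Cmd.block (c :: d :: l)).eval Γ s = (Cmd.block (d :: l)).eval Γ (c.eval Γ s) := rfl

theorem block_single {Γ : Ctx} {c : Cmd} {s : State} :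
    (Cmd.block [c]).eval Γ s = c.eval Γ s := rfl

/-! ### The layout of the input -/

section

variable {k : ℕ}

/-- The position of an atom in the input. -/
def atomPos (Ψ : RegCQ k) (c : ℕ) : ℕ :=
  2 + Ψ.head.length + ((Ψ.body.take c).flatMap encodeAtom).length

/-- The length of the query in the input. -/
def queryLen (Ψ : RegCQ k) : ℕ := atomPos Ψ Ψ.body.length

/-- The environment for a query and a word. -/
def ctx (Ψ : RegCQ k) (w : Word k) : Ctx := ctxOf (encode Ψ w)

variable {Ψ : RegCQ k} {w : Word k}

theorem getD_append_mid (A B C : List ℕ) {i j : ℕ} (hi : i = A.length + j) (hj : j < B.length) :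
    (A ++ B ++ C).getD i 0 = B.getD j 0 := by
  subst hi
  simp [List.getD_eq_getElem?_getD, List.getElem?_append, hj]

theorem atomPos_succ {c : ℕ} {χ : Atom k} (h : Ψ.body[c]? = some χ) :
    atomPos Ψ (c + 1) = atomPos Ψ c + (encodeAtom χ).length := by
  simp only [atomPos, List.take_add_one, h, List.flatMap_append, List.length_append]
  simp
  ring

theorem atomPos_mono {c d : ℕ} (h : c ≤ d) : atomPos Ψ c ≤ atomPos Ψ d := by
  have : Ψ.body.take c <+: Ψ.body.take d := List.take_prefix_take_left h
  obtain ⟨l, hl⟩ := this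
  simp only [atomPos, ← hl, List.flatMap_append, List.length_append]
  omega

theorem encode_eq : encode Ψ w = [Ψ.head.length] ++ Ψ.head ++ [Ψ.body.length] ++
    Ψ.body.flatMap encodeAtom ++ [w.length] ++ w.map Fin.val := by
  simp [encode, List.map_eq_flatMap]

theorem encode_length : (encode Ψ w).length = queryLen Ψ + 1 + w.length := by
  simp only [encode_eq, queryLen, atomPos, List.take_length, List.length_append, List.length_cons,
    List.length_nil, List.length_map]
  ring

theorem ctx_N : (ctx Ψ w).N = 8 * (queryLen Ψ + 2 + w.length) := by
  simp only [ctx, ctxOf, encode_length]; ring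

theorem eight_le_ctx_N : 8 ≤ (ctx Ψ w).N := by
  rw [ctx_N]; omega

theorem inp_zero : (ctx Ψ w).inp 0 = Ψ.head.length := by
  simp [ctx, ctxOf, encode_eq]

theorem inp_head {h : ℕ} (hh : h < Ψ.head.length) : (ctx Ψ w).inp (1 + h) = Ψ.head[h] := by
  have := getD_append_mid [Ψ.head.length] Ψ.head ([Ψ.body.length] ++ Ψ.body.flatMap encodeAtom ++
    [w.length] ++ w.map Fin.val) (i := 1 + h) rfl hh
  simp only [ctx, ctxOf, encode_eq, List.append_assoc] at this ⊢
  rw [this]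
  simp [hh]

theorem inp_body : (ctx Ψ w).inp (1 + Ψ.head.length) = Ψ.body.length := by
  have := getD_append_mid ([Ψ.head.length] ++ Ψ.head) [Ψ.body.length] (Ψ.body.flatMap encodeAtom ++
    [w.length] ++ w.map Fin.val) (i := 1 + Ψ.head.length) (j := 0)
    (by simp [add_comm]) (by simp)
  simp only [ctx, ctxOf, encode_eq, List.append_assoc] at this ⊢
  rw [this]
  rfl

theorem inp_atom {c j : ℕ} {χ : Atom k} (h : Ψ.body[c]? = some χ) (hj : j < (encodeAtom χ).length) :
    (ctx Ψ w).inp (atomPos Ψ c + j) = (encodeAtom χ).getD j 0 := by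
  have hb : Ψ.body = Ψ.body.take c ++ [χ] ++ Ψ.body.drop (c + 1) := by
    obtain ⟨hc, rfl⟩ := List.getElem?_eq_some_iff.1 h
    simp
  have := getD_append_mid ([Ψ.head.length] ++ Ψ.head ++ [Ψ.body.length] ++
    (Ψ.body.take c).flatMap encodeAtom) (encodeAtom χ) ((Ψ.body.drop (c + 1)).flatMap encodeAtom ++
    [w.length] ++ w.map Fin.val) (i := atomPos Ψ c + j) (j := j)
    (by simp [atomPos]; ring) hj
  rw [← this]
  have e : encode Ψ w = [Ψ.head.length] ++ Ψ.head ++ [Ψ.body.length] ++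
      (Ψ.body.take c ++ [χ] ++ Ψ.body.drop (c + 1)).flatMap encodeAtom ++
      [w.length] ++ w.map Fin.val := by rw [← hb, encode_eq]
  simp only [ctx, ctxOf, e]
  simp [List.append_assoc]

theorem inp_len : (ctx Ψ w).inp (queryLen Ψ) = w.length := by
  have := getD_append_mid ([Ψ.head.length] ++ Ψ.head ++ [Ψ.body.length] ++
    Ψ.body.flatMap encodeAtom) [w.length] (w.map Fin.val) (i := queryLen Ψ) (j := 0)
    (by simp [queryLen, atomPos]; ring) (by simp)
  simp only [ctx, ctxOf, encode_eq] at this ⊢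
  rw [this]
  rfl

theorem inp_word {i : ℕ} (hi : i < w.length) :
    (ctx Ψ w).inp (queryLen Ψ + 1 + i) = (w[i] : ℕ) := by
  have := getD_append_mid ([Ψ.head.length] ++ Ψ.head ++ [Ψ.body.length] ++
    Ψ.body.flatMap encodeAtom ++ [w.length]) (w.map Fin.val) []
    (i := queryLen Ψ + 1 + i) (j := i) (by simp [queryLen, atomPos]; ring) (by simpa)
  simp only [ctx, ctxOf, encode_eq, List.append_nil] at this ⊢
  rw [this]
  simp [hi]

theorem encodeAtom_pos (χ : Atom k) : 3 ≤ (encodeAtom χ).length := by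
  cases χ <;> simp [encodeAtom]

theorem atomPos_add_le {c : ℕ} {χ : Atom k} (h : Ψ.body[c]? = some χ) :
    atomPos Ψ c + (encodeAtom χ).length ≤ queryLen Ψ := by
  rw [← atomPos_succ h]
  exact atomPos_mono (List.getElem?_eq_some_iff.1 h).1

theorem length_head_add_two_le : Ψ.head.length + 2 ≤ queryLen Ψ := by
  simp only [queryLen, atomPos]; omega

theorem length_body_le : Ψ.body.length ≤ queryLen Ψ := by
  have : ∀ l : List (Atom k), l.length ≤ (l.flatMap encodeAtom).length := by
    intro l
    induction l with
    | nil => simp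
    | cons χ l ih =>
      have := encodeAtom_pos χ
      simp only [List.flatMap_cons, List.length_append, List.length_cons]
      omega
  have := this Ψ.body
  simp only [queryLen, atomPos, List.take_length]
  omega

/-- The tag of an atom in the input: `0` for a word equation, `1` for a regular constraint. -/
def Atom.tag : Atom k → ℕ
  | .eqn _ _ => 0
  | .mem _ _ => 1

/-- The length of the right side of an atom in the input. -/
def Atom.rlen : Atom k → ℕ
  | .eqn _ α => α.length
  | .mem _ γ => (encodeRegex γ).length

theorem inp_tag {c : ℕ} {χ : Atom k} (h : Ψ.body[c]? = some χ) :
    (ctx Ψ w).inp (atomPos Ψ c) = χ.tag := by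
  have := inp_atom (w := w) h (j := 0) (by have := encodeAtom_pos χ; omega)
  rw [add_zero] at this
  rw [this]
  cases χ <;> rfl

theorem inp_sv {c : ℕ} {χ : Atom k} (h : Ψ.body[c]? = some χ) :
    (ctx Ψ w).inp (atomPos Ψ c + 1) = χ.sv 0 := by
  rw [inp_atom (w := w) h (j := 1) (by have := encodeAtom_pos χ; omega)]
  cases χ <;> rfl

theorem inp_rlen {c : ℕ} {χ : Atom k} (h : Ψ.body[c]? = some χ) :
    (ctx Ψ w).inp (atomPos Ψ c + 2) = χ.rlen := by
  rw [inp_atom (w := w) h (j := 2) (by have := encodeAtom_pos χ; omega)]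
  cases χ <;> rfl

theorem encodeAtom_length_eq (χ : Atom k) : (encodeAtom χ).length =
    3 + (if χ.tag ≠ 0 then χ.rlen else χ.rlen + χ.rlen) := by
  have h : ∀ α : List (Sym k), (α.flatMap encodeSym).length = α.length + α.length := by
    intro α
    induction α with
    | nil => rfl
    | cons a α ih =>
      simp only [List.flatMap_cons, List.length_append, ih, List.length_cons]
      cases a <;> simp [encodeSym] <;> ring
  cases χ <;> simp [encodeAtom, Atom.tag, Atom.rlen, h] <;> ring

end

/-! ### Reading the query -/

section

variable {k : ℕ}

/-- The scalar variables and the positions of the atoms have been read from the input. -/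
structure Parsed (Ψ : RegCQ k) (w : Word k) (s : State) : Prop where
  n : s.reg 0 = w.length + 1
  m : s.reg 1 = Ψ.body.length
  r : s.reg 2 = Ψ.head.length
  q : s.reg 3 = queryLen Ψ
  wp : s.reg 4 = queryLen Ψ + 1
  pos : ∀ c < Ψ.body.length, s.arr 0 [c, 0, 0, 0, 0, 0] = atomPos Ψ c

variable {Ψ : RegCQ k} {w : Word k}

theorem Parsed.of_eq {s s' : State} (h : Parsed Ψ w s) (hr : ∀ r < 5, s'.reg r = s.reg r)
    (ha : s'.arr 0 = s.arr 0) : Parsed Ψ w s' :=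
  ⟨by rw [hr 0 (by omega), h.n], by rw [hr 1 (by omega), h.m], by rw [hr 2 (by omega), h.r],
    by rw [hr 3 (by omega), h.q], by rw [hr 4 (by omega), h.wp], by rw [ha]; exact h.pos⟩

theorem Parsed.eval {Γ : Ctx} {s : State} (h : Parsed Ψ w s) (c : Cmd)
    (hc : (∀ r < 5, r ∉ c.regs) ∧ 0 ∉ c.arrs) : Parsed Ψ w (c.eval Γ s) :=
  h.of_eq (fun r hr => c.eval_reg s (hc.1 r hr)) (c.eval_arr s hc.2)

theorem eval_parseLoop {s : State} (h1 : s.reg 1 = Ψ.body.length) (h2 : s.reg 2 = Ψ.head.length) :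
    (parseLoop.eval (ctx Ψ w) s).reg 5 = queryLen Ψ ∧
      ∀ c < Ψ.body.length, (parseLoop.eval (ctx Ψ w) s).arr 0 [c, 0, 0, 0, 0, 0] = atomPos Ψ c := by
  have hN := ctx_N (Ψ := Ψ) (w := w)
  have hr := length_head_add_two_le (Ψ := Ψ)
  rw [parseLoop, eval_seq, eval_assign, eval_loop]
  rw [show vM.denote (ctx Ψ w) _ = Ψ.body.length from by
    simp [denote_reg, set_reg, h1]]
  refine iter_inv (fun c (s' : State) => s'.reg 5 = atomPos Ψ c ∧
    ∀ c' < c, s'.arr 0 [c', 0, 0, 0, 0, 0] = atomPos Ψ c') ⟨?_, by simp⟩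
        fun c hc s' ⟨ih1, ih2⟩ => ?_
  · simp only [set_reg, denote_add, denote_reg, denote_const, h2, if_true]
    simp only [atomPos, List.take_zero, List.flatMap_nil, List.length_nil]
    omega
  · obtain ⟨χ, hχ⟩ : ∃ χ, Ψ.body[c]? = some χ := ⟨Ψ.body[c], by simp [hc]⟩
    have hle := atomPos_add_le hχ
    have hl := encodeAtom_length_eq χ
    have hN8 := eight_le_ctx_N (Ψ := Ψ) (w := w)
    constructor
    · simp only [Cmd.store1, Cmd.eval, set_reg, if_true, reduceIte,
        denote_add, denote_reg, denote_const, denote_ite, holds_inp hN8, lenE, denote_inp,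
        State.put, ih1, inp_tag hχ, Nat.reduceEqDiff]
      rw [min_eq_left (a := atomPos Ψ c + 2) (by omega), inp_rlen hχ, atomPos_succ hχ, hl]
      split_ifs at hl ⊢ <;> omega
    · intro c' hc'
      simp only [Cmd.store1, Cmd.eval, set_arr, State.put,
        Function.update_self, denote_reg, denote_const, set_reg, if_true]
      by_cases e : c' = c
      · subst e
        simpa [Function.update_apply] using ih1
      · rw [Function.update_of_ne (by simpa using e)]
        exact ih2 c' (by omega)

end

/-! ### Variables as numbers -/

section

variable {k : ℕ}

/-- The tag of a symbol in the input: `0` for a letter, `1` for a variable. -/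
def Sym.tag : Sym k → ℕ
  | .letter _ => 0
  | .var _ => 1

/-- The value of a symbol in the input. -/
def Sym.num : Sym k → ℕ
  | .letter a => a
  | .var x => x

/-- The number of a variable in the program: zero for the universe variable, otherwise the position
of the first occurrence plus one. -/
noncomputable def varCode (Ψ : RegCQ k) (w : Word k) (x : ℕ) : ℕ :=
  open Classical in if x = 0 then 0 else 1 + lb (queryLen Ψ) fun q => (ctx Ψ w).inp q = x

variable {Ψ : RegCQ k} {w : Word k}

theorem varCode_eq_zero {x : ℕ} : varCode Ψ w x = 0 ↔ x = 0 := by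
  unfold varCode
  split <;> simp_all

theorem varCode_inj {x y : ℕ} (hx : x ≠ 0 → ∃ q < queryLen Ψ, (ctx Ψ w).inp q = x) :
    varCode Ψ w x = varCode Ψ w y ↔ x = y := by
  refine ⟨fun h => ?_, fun h => h ▸ rfl⟩
  by_cases hx0 : x = 0
  · rw [hx0, varCode_eq_zero.2 rfl, eq_comm, varCode_eq_zero] at h
    rw [hx0, h]
  · by_cases hy0 : y = 0
    · rw [hy0, varCode_eq_zero.2 rfl, varCode_eq_zero] at h
      exact absurd h hx0
    · simp only [varCode, if_neg hx0, if_neg hy0, add_right_inj] at h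
      have h1 := lb_lt_iff.2 (hx hx0)
      have e1 := lb_spec h1
      rw [h] at h1 e1
      exact e1.symm.trans (lb_spec h1)

theorem flatMap_encodeSym {α : List (Sym k)} {t : ℕ} {a : Sym k} (h : α[t]? = some a)
    (l : List ℕ) : (l ++ α.flatMap encodeSym).getD (l.length + 2 * t) 0 = a.tag ∧
      (l ++ α.flatMap encodeSym).getD (l.length + (2 * t + 1)) 0 = a.num := by
  induction α generalizing t l with
  | nil => simp at h
  | cons b α ih =>
    cases t with
    | zero =>
      obtain rfl : b = a := by simpa using h
      cases b <;> simp [encodeSym, Sym.tag, Sym.num, List.getD_eq_getElem?_getD]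
    | succ t =>
      have := ih (t := t) (by simpa using h) (l ++ encodeSym b)
      have hl : (encodeSym b).length = 2 := by cases b <;> rfl
      simp only [List.length_append, hl, List.append_assoc] at this
      rw [List.flatMap_cons]
      constructor
      · rw [← this.1]; congr 1; ring
      · rw [← this.2]; congr 1; ring

theorem encodeAtom_eqn_length {x : ℕ} {α : List (Sym k)} :
    (encodeAtom (.eqn x α)).length = 3 + (α.length + α.length) := by
  rw [encodeAtom_length_eq]; simp [Atom.tag, Atom.rlen]

theorem inp_sym {c x t : ℕ} {α : List (Sym k)} (h : Ψ.body[c]? = some (.eqn x α)) {a : Sym k}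
    (ha : α[t]? = some a) : (ctx Ψ w).inp (atomPos Ψ c + (3 + 2 * t)) = a.tag ∧
      (ctx Ψ w).inp (atomPos Ψ c + (3 + (2 * t + 1))) = a.num := by
  have ht : t < α.length := (List.getElem?_eq_some_iff.1 ha).1
  have hl := encodeAtom_eqn_length (x := x) (α := α)
  rw [inp_atom h (by omega), inp_atom h (by omega)]
  exact flatMap_encodeSym ha [0, x, α.length]

/-- The variables of the atoms occur in the input. -/
theorem exists_inp_sv {c t : ℕ} {χ : Atom k} (h : Ψ.body[c]? = some χ) (h0 : χ.sv t ≠ 0) :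
    ∃ q < queryLen Ψ, (ctx Ψ w).inp q = χ.sv t := by
  have hle := atomPos_add_le h
  have h3 := encodeAtom_pos χ
  cases t with
  | zero => exact ⟨_, by omega, inp_sv h⟩
  | succ t =>
    cases χ with
    | eqn x α =>
      simp only [Atom.sv] at h0 ⊢
      split at h0
      · rename_i y hy
        have ht : t < α.length := (List.getElem?_eq_some_iff.1 hy).1
        have hl := encodeAtom_eqn_length (x := x) (α := α)
        exact ⟨_, by omega, (inp_sym h hy).2⟩
      · exact absurd rfl h0
    | mem x γ => exact absurd rfl h0

theorem varCode_sv_inj {c t y : ℕ} {χ : Atom k} (h : Ψ.body[c]? = some χ) :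
    varCode Ψ w (χ.sv t) = varCode Ψ w y ↔ χ.sv t = y :=
  varCode_inj fun h0 => exists_inp_sv h h0

theorem denote_codeE {e : Expr} {s : State} {q : ℕ} (hs : s.reg 3 = queryLen Ψ)
    (he : e.denote (ctx Ψ w) s = q) (he' : ∀ k, e.denote (ctx Ψ w) (s.set 11 k) = q) :
    (codeE e).denote (ctx Ψ w) s = varCode Ψ w ((ctx Ψ w).inp q) := by
  have hN := ctx_N (Ψ := Ψ) (w := w)
  have hl := lb_le (queryLen Ψ) fun q' => (ctx Ψ w).inp q' = (ctx Ψ w).inp q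
  simp only [codeE, denote_ite, holds_inp eight_le_ctx_N, he, denote_add, denote_const,
    denote_find, denote_reg, hs, holds_inpEq, he', set_reg, if_true, varCode, ite_not]
  split
  · rfl
  · omega

theorem denote_lenE {e : Expr} {s : State} {c : ℕ} {χ : Atom k} (h : Ψ.body[c]? = some χ)
    (he : e.denote (ctx Ψ w) s = atomPos Ψ c) : (lenE e).denote (ctx Ψ w) s = χ.rlen := by
  have hN := ctx_N (Ψ := Ψ) (w := w)
  have hle := atomPos_add_le h
  have hl := encodeAtom_length_eq χ
  simp only [lenE, denote_inp, denote_add, he, denote_const]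
  rw [min_eq_left (a := _ + 2) (by split_ifs at hl <;> omega), inp_rlen h,
    min_eq_left (by split_ifs at hl <;> omega)]

/-- The numbers of the variables in the slots of the atoms are stored. -/
def HasVars (Ψ : RegCQ k) (w : Word k) (s : State) : Prop :=
  ∀ c χ, Ψ.body[c]? = some χ → ∀ t < 3, s.arr 1 [c, t, 0, 0, 0, 0] = varCode Ψ w (χ.sv t)

theorem denote_slotE {s : State} {c t : ℕ} {χ : Atom k} (hP : Parsed Ψ w s)
    (h : Ψ.body[c]? = some χ) :
    (slotE (.reg 10) t (3 + 2 * t)).denote (ctx Ψ w) (s.set 10 c) =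
      varCode Ψ w (χ.sv (t + 1)) := by
  have hc : c < Ψ.body.length := (List.getElem?_eq_some_iff.1 h).1
  have hN := ctx_N (Ψ := Ψ) (w := w)
  have hle := atomPos_add_le h
  have hpos : ∀ s' : State, s'.reg 10 = c → s'.arr = s.arr →
      (aPos (.reg 10)).denote (ctx Ψ w) s' = atomPos Ψ c := fun s' h1 h2 => by
    simp only [denote_arr1, denote_reg, h1, h2, hP.pos c hc]
  have hq := hpos (s.set 10 c) rfl rfl
  simp only [slotE, denote_ite, holds_and, holds_not, holds_inp eight_le_ctx_N, holds_lt, hq,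
    denote_lenE h hq, denote_const, inp_tag h, denote_add]
  cases χ with
  | mem x γ =>
    simp [Atom.tag, Atom.sv, varCode_eq_zero.2]
  | eqn x α =>
    have hl := encodeAtom_eqn_length (x := x) (α := α)
    simp only [Atom.tag, Atom.rlen, Atom.sv]
    by_cases ht : t < α.length
    · obtain ⟨a, ha⟩ : ∃ a, α[t]? = some a := ⟨α[t], by simp [ht]⟩
      rw [min_eq_left (by omega), (inp_sym h ha).1, ha]
      cases a with
      | letter a => simp [Sym.tag, varCode_eq_zero.2]
      | var y =>
        simp only [Sym.tag, ht, ne_eq, not_true_eq_false, not_false_eq_true, one_ne_zero, and_self,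
          if_true]
        rw [denote_codeE (q := atomPos Ψ c + (3 + (2 * t + 1))) (by simp [set_reg, hP.q]),
          (inp_sym h ha).2]
        · rfl
        · simp only [denote_add, hq, denote_const]; omega
        · intro k'
          simp only [denote_add, hpos ((s.set 10 c).set 11 k') rfl rfl, denote_const]; omega
    · have : α[t]? = none := by simpa using ht
      simp [ht, varCode_eq_zero.2]

theorem loopsOk_iff {L : List (ℕ × Expr)} :
    LoopsOk L ↔ L.all (fun p => decide (4 ≤ p.1) && p.2.isBound) = true := by
  simp [LoopsOk]

theorem eval_varsC {s : State} (hP : Parsed Ψ w s) : HasVars Ψ w (varsC.eval (ctx Ψ w) s) := by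
  have key : ∀ (t : ℕ) (e : Expr), 1 ∉ e.reads → ∀ s : State, Parsed Ψ w s →
      ∃ A, (Cmd.loops [(10, vM)] (.store2 1 (.reg 10) (.const t) e)).eval (ctx Ψ w) s =
        s.withArr 1 A ∧
      (∀ c < Ψ.body.length, A [c, t, 0, 0, 0, 0] = e.denote (ctx Ψ w) (s.set 10 c)) ∧
      ∀ c t', t' ≠ t → A [c, t', 0, 0, 0, 0] = s.arr 1 [c, t', 0, 0, 0, 0] := by
    intro t e he s hP
    obtain ⟨A, hA, h1, h2⟩ := eval_fill (Γ := ctx Ψ w) (L := [(10, vM)])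
      (e₁ := .reg 10) (e₂ := .const t) (e₃ := k0) (e₄ := k0) (e₅ := k0) (e₆ := k0)
      (loopsOk_iff.2 rfl) (a := 1)
      (by simp [Free, Expr.reads]) he s
      (bs := [Ψ.body.length]) (by simp [denote_reg, hP.m]) (by
        simp only [mem_tuples_cons, mem_tuples_nil]
        rintro _ ⟨c, -, _, rfl, rfl⟩ _ ⟨c', -, _, rfl, rfl⟩ h
        obtain rfl : c = c' := by
          simpa [cell, sets_cons, sets_nil, denote_reg, set_reg, denote_const] using h
        rfl)
    refine ⟨A, hA, fun c hc => ?_, fun c t' ht => h2 _ (by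
      simp [cell, denote_reg, denote_const, ht])⟩
    exact h1 [c] (by simp [hc])
  obtain ⟨A₀, e₀, h₀, g₀⟩ := key 0 (codeE (.add (aPos (.reg 10)) k1)) (by decide) s hP
  have P₀ := hP.eval (Γ := ctx Ψ w)
    (.loops [(10, vM)] (.store2 1 (.reg 10) k0 (codeE (.add (aPos (.reg 10)) k1)))) (by decide)
  rw [e₀] at P₀
  obtain ⟨A₁, e₁, h₁, g₁⟩ := key 1 (slotE (.reg 10) 0 3) (by decide) _ P₀
  have P₁ := P₀.eval (Γ := ctx Ψ w)
    (.loops [(10, vM)] (.store2 1 (.reg 10) k1 (slotE (.reg 10) 0 3))) (by decide)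
  rw [e₁] at P₁
  obtain ⟨A₂, e₂, h₂, g₂⟩ := key 2 (slotE (.reg 10) 1 5) (by decide) _ P₁
  rw [varsC, block_cons, block_cons, block_single, e₀, e₁, e₂]
  intro c χ hχ t ht
  have hc : c < Ψ.body.length := (List.getElem?_eq_some_iff.1 hχ).1
  simp only [withArr_arr, if_true] at g₁ g₂ ⊢
  interval_cases t
  · rw [g₂ c 0 (by omega), g₁ c 0 (by omega), h₀ c hc]
    have hN := ctx_N (Ψ := Ψ) (w := w)
    have hle := atomPos_add_le hχ
    rw [denote_codeE (q := atomPos Ψ c + 1) (by simp [set_reg, hP.q]), inp_sv hχ]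
    · simp only [denote_add, denote_arr1, denote_reg, set_reg, set_arr, hP.pos c hc, if_true,
        denote_const]
      omega
    · intro k'
      simp only [denote_add, denote_arr1, denote_reg, set_reg, set_arr, hP.pos c hc, if_true,
        denote_const, Nat.reduceEqDiff, if_false]
      omega
  · rw [g₂ c 1 (by omega), h₁ c hc]
    exact denote_slotE P₀ hχ
  · rw [h₂ c hc]
    exact denote_slotE P₁ hχ

end

/-! ### Factors as numbers -/

section

variable {k : ℕ}

/-- The start of the first occurrence of a factor. -/
noncomputable def start (w u : Word k) : ℕ :=
  lb (w.length + 1) fun i => i + u.length ≤ w.length ∧ wd w (i, u.length) = u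

theorem start_le {w : Word k} {i l : ℕ} (h : i + l ≤ w.length) : start w (wd w (i, l)) ≤ i := by
  have hl : (wd w (i, l)).length = l := wd_length h
  exact lb_le_of ⟨by rw [hl]; exact h, by rw [hl]⟩

theorem wd_start {w : Word k} {i l : ℕ} (h : i + l ≤ w.length) :
    wd w (start w (wd w (i, l)), l) = wd w (i, l) := by
  have hl : (wd w (i, l)).length = l := wd_length h
  have := lb_spec (p := fun i' => i' + (wd w (i, l)).length ≤ w.length ∧
    wd w (i', (wd w (i, l)).length) = wd w (i, l))
        (B := w.length + 1) (lt_of_le_of_lt (start_le h) (by omega))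
  rw [hl] at this
  simpa only [start, hl] using this.2

theorem start_inj {w : Word k} {i i' l : ℕ} (h : i + l ≤ w.length) (h' : i' + l ≤ w.length) :
    start w (wd w (i, l)) = start w (wd w (i', l)) ↔ wd w (i, l) = wd w (i', l) :=
  ⟨fun e => by rw [← wd_start h, e, wd_start h'], fun e => by rw [e]⟩

theorem wd_one {w : Word k} {i : ℕ} (h : i < w.length) : wd w (i, 1) = [w[i]] := by
  simp [wd, List.take_one, h]

theorem wd_succ {w : Word k} {i l : ℕ} (h : i + l < w.length) :
    wd w (i, l + 1) = wd w (i, l) ++ [w[i + l]] := by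
  rw [wd_append, wd_one h]

theorem wd_zero (w : Word k) (i : ℕ) : wd w (i, 0) = [] := by simp [wd]

variable {Ψ : RegCQ k} {w : Word k}

/-- The starts of the first occurrences are stored. -/
def HasCan (w : Word k) (s : State) : Prop :=
  ∀ l i, i + l ≤ w.length → s.arr 2 [l, i, 0, 0, 0, 0] = start w (wd w (i, l))

theorem eval_canC {s : State} (hP : Parsed Ψ w s) : HasCan w (canC.eval (ctx Ψ w) s) := by
  have hN := ctx_N (Ψ := Ψ) (w := w)
  obtain ⟨A, hA, h1, -⟩ := eval_fill_rec (Γ := ctx Ψ w) (L := [(10, vN), (11, vN)])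
    (e₁ := .reg 10) (e₂ := .reg 11) (e₃ := k0) (e₄ := k0) (e₅ := k0) (e₆ := k0)
    (e := .ite (.reg 10)
      (.find 12 vN ((eq (aCan (.sub (.reg 10) k1) (.reg 12))
        (aCan (.sub (.reg 10) k1) (.reg 11))).and
        (.inpEq (.add vW (.add (.reg 12) (.sub (.reg 10) k1)))
          (.add vW (.add (.reg 11) (.sub (.reg 10) k1)))))) k0)
    (loopsOk_iff.2 rfl) (a := 2) (by decide) s (bs := [w.length + 1, w.length + 1])
    (by simp [denote_reg, hP.n]) (by
      simp only [mem_tuples_cons, mem_tuples_nil]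
      rintro _ ⟨l, -, _, ⟨i, -, _, rfl, rfl⟩, rfl⟩ _ ⟨l', -, _, ⟨i', -, _, rfl, rfl⟩, rfl⟩ h
      simpa [cell, sets_cons, sets_nil, denote_reg, set_reg, denote_const] using h)
    (R := fun ks v => ∀ l i, ks = [l, i] → i + l ≤ w.length → v = start w (wd w (i, l))) (by
      simp only [mem_tuples_cons, mem_tuples_nil]
      rintro _ ⟨l, hl, _, ⟨i, hi, _, rfl, rfl⟩, rfl⟩ B hB - _ _ e hil
      obtain ⟨rfl, rfl⟩ : _ ∧ _ := by simpa using e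
      simp only [List.map_cons, List.map_nil, denote_ite, holds_reg, sets_cons, sets_nil,
        withArr_reg, set_reg, denote_find, denote_reg, holds_and, holds_eq, holds_inpEq,
        denote_arr2, set_arr, withArr_arr, denote_add, denote_sub, denote_const, Nat.reduceEqDiff,
        if_true, if_false, hP.n, hP.wp]
      cases l with
      | zero => simpa [wd_zero] using (Nat.le_zero.1 ((start_le (w := w) (i := 0) (l := 0)
          (by omega)))).symm
      | succ l =>
        rw [if_pos (by omega)]
        have hBl : ∀ i', i' + l ≤ w.length → B [l, i', 0, 0, 0, 0] = start w (wd w (i', l)) :=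
          fun i' hi' => by
            have := hB [l, i'] ⟨l, by omega, _, ⟨i', by omega, _, rfl, rfl⟩, rfl⟩ (by simp)
              l i' rfl hi'
            simpa [cell, sets_cons, sets_nil, denote_reg, set_reg, denote_const] using this
        have hiff : ∀ i' ≤ i, (B [l + 1 - 1, i', 0, 0, 0, 0] = B [l + 1 - 1, i, 0, 0, 0, 0] ∧
            (ctx Ψ w).inp (min (queryLen Ψ + 1 + min (i' + (l + 1 - 1)) ((ctx Ψ w).N - 1))
              ((ctx Ψ w).N - 1)) =
            (ctx Ψ w).inp (min (queryLen Ψ + 1 + min (i + (l + 1 - 1)) ((ctx Ψ w).N - 1))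
              ((ctx Ψ w).N - 1))) ↔ wd w (i', l + 1) = wd w (i, l + 1) := by
          intro i' hi'
          simp only [Nat.add_sub_cancel]
          rw [hBl i' (by omega), hBl i (by omega), start_inj (by omega) (by omega),
            wd_succ (by omega), wd_succ (by omega),
            show min (queryLen Ψ + 1 + min (i' + l) ((ctx Ψ w).N - 1)) ((ctx Ψ w).N - 1) =
              queryLen Ψ + 1 + (i' + l) by omega,
            show min (queryLen Ψ + 1 + min (i + l) ((ctx Ψ w).N - 1)) ((ctx Ψ w).N - 1) =
              queryLen Ψ + 1 + (i + l) by omega, inp_word (by omega), inp_word (by omega)]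
          rw [List.append_singleton_inj, Fin.val_inj]
        have hle := start_le hil
        refine lb_eq (.inl ?_) (by omega) fun j hj => ?_
        · exact (hiff _ hle).2 (wd_start hil)
        · rw [hiff j (by omega)]
          intro e
          have := not_of_lt_lb hj
          rw [wd_length (by simpa using hil)] at this
          exact this ⟨by simp; omega, e⟩)
  intro l i hil
  have := h1 [l, i] (by simp; omega) l i rfl hil
  have e : canC.eval (ctx Ψ w) s = s.withArr 2 A := hA
  rw [e, withArr_arr, if_pos rfl]
  simpa [cell, sets_cons, sets_nil, denote_reg, set_reg, denote_const] using this

end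

/-! ### Regular constraints -/

section

variable {k : ℕ} {w : Word k}

theorem mem_mul_wd {L M : Language (Fin k)} {i l : ℕ} (h : i + l ≤ w.length) :
    wd w (i, l) ∈ L * M ↔ ∃ l' ≤ l, wd w (i, l') ∈ L ∧ wd w (i + l', l - l') ∈ M := by
  rw [Language.mem_mul]
  constructor
  · rintro ⟨a, ha, b, hb, e⟩
    have hl := congrArg List.length e
    rw [List.length_append, wd_length h] at hl
    simp only at hl
    have hsplit := wd_append w i a.length b.length
    rw [hl, ← e] at hsplit
    obtain ⟨e1, e2⟩ := List.append_inj hsplit (wd_length (u := (i, a.length)) (by simp; omega)).symm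
    exact ⟨a.length, by omega, by rwa [← e1], by
      rwa [show l - a.length = b.length by omega, ← e2]⟩
  · rintro ⟨l', hl, h1, h2⟩
    exact ⟨_, h1, _, h2, by rw [← wd_append, Nat.add_sub_cancel' hl]⟩

theorem mem_kstar_wd {L : Language (Fin k)} {i l : ℕ} (h : i + l ≤ w.length) :
    wd w (i, l) ∈ KStar.kstar L ↔ l = 0 ∨ ∃ l', l' ≠ 0 ∧ l' ≤ l ∧ wd w (i, l') ∈ L ∧
      wd w (i + l', l - l') ∈ KStar.kstar L := by
  constructor
  · intro hm
    obtain ⟨S, e, hS⟩ := Language.mem_kstar_iff_exists_nonempty.1 hm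
    cases S with
    | nil =>
      left
      have := congrArg List.length e
      rw [wd_length h] at this
      simpa using this
    | cons a S =>
      right
      have ha := hS a (by simp)
      have hl := congrArg List.length e
      rw [List.flatten_cons, List.length_append, wd_length h] at hl
      simp only at hl
      have hsplit := wd_append w i a.length S.flatten.length
      rw [← hl, e, List.flatten_cons] at hsplit
      obtain ⟨e1, e2⟩ := List.append_inj hsplit
        (wd_length (u := (i, a.length)) (by simp; omega)).symm
      refine ⟨a.length, fun h0 => ha.2 (List.length_eq_zero_iff.1 h0), by omega, ?_, ?_⟩
      · rw [← e1]; exact ha.1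
      · rw [show l - a.length = S.flatten.length by omega, ← e2]
        exact Language.mem_kstar_iff_exists_nonempty.2 ⟨S, rfl, fun y hy => hS y (by simp [hy])⟩
  · rintro (rfl | ⟨l', -, hl, h1, h2⟩)
    · rw [wd_zero]; exact Language.nil_mem_kstar L
    · rw [← Nat.add_sub_cancel' hl, wd_append]
      rw [← Language.one_add_self_mul_kstar_eq_kstar L]
      exact .inr (Language.append_mem_mul h1 h2)

variable {Ψ : RegCQ k}

theorem holds_regexE {s : State} (hP : Parsed Ψ w s) {l i : ℕ} (hl : s.reg 12 = l)
    (hi : s.reg 13 = i) (hil : i + l ≤ w.length) (ho : s.reg 7 < queryLen Ψ) :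
    (regexE.holds (ctx Ψ w) s ↔ match (ctx Ψ w).inp (s.reg 7) with
      | 0 => False
      | 1 => l = 0
      | 2 => l = 1 ∧ (ctx Ψ w).inp (s.reg 7 + 1) = (ctx Ψ w).inp (queryLen Ψ + 1 + i)
      | 3 => s.arr 13 [s.reg 6 - 2, l, i, 0, 0, 0] ≠ 0 ∨ s.arr 13 [s.reg 6 - 1, l, i, 0, 0, 0] ≠ 0
      | 4 => ∃ l' ≤ l, s.arr 13 [s.reg 6 - 2, l', i, 0, 0, 0] ≠ 0 ∧
          s.arr 13 [s.reg 6 - 1, l - l', i + l', 0, 0, 0] ≠ 0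
      | _ => l = 0 ∨ ∃ l', l' ≠ 0 ∧ l' ≤ l ∧ s.arr 13 [s.reg 6 - 1, l', i, 0, 0, 0] ≠ 0 ∧
          s.arr 14 [l - l', i + l', 0, 0, 0, 0] ≠ 0) := by
  have hN := ctx_N (Ψ := Ψ) (w := w)
  have hmin : ∀ l' ≤ l, min (i + l') ((ctx Ψ w).N - 1) = i + l' := fun l' h => by omega
  rcases hop : (ctx Ψ w).inp (s.reg 7) with _ | _ | _ | _ | _ | op
  all_goals
    have hop' : opE.denote (ctx Ψ w) s = min ((ctx Ψ w).inp (s.reg 7)) ((ctx Ψ w).N - 1) := rfl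
    rw [hop] at hop'
  · rw [regexE, holds_ite, holds_eq, hop']
    simp
  · rw [regexE, holds_ite, holds_eq, hop']
    simp only [denote_const, holds_ite, holds_eq, hop']
    rw [min_eq_left (by omega)]
    simp [hl]
  · rw [regexE, holds_ite, holds_eq, hop']
    simp only [denote_const, holds_ite, holds_eq, hop']
    rw [min_eq_left (by omega)]
    simp [hl, hi, hP.wp]
    rw [min_eq_left (by omega), min_eq_left (by omega)]
    exact fun _ => Iff.rfl
  · rw [regexE, holds_ite, holds_eq, hop']
    simp only [denote_const, holds_ite, holds_eq, hop']
    rw [min_eq_left (by omega)]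
    simp [hl, hi]
  · rw [regexE, holds_ite, holds_eq, hop']
    simp only [denote_const, holds_ite, holds_eq, hop']
    rw [min_eq_left (by omega)]
    simp [hl, hi, hP.n]
    constructor
    · rintro ⟨l', h1, h2, h3, h4⟩
      rw [hmin l' h2] at h4
      exact ⟨l', h2, h3, h4⟩
    · rintro ⟨l', h2, h3, h4⟩
      refine ⟨l', by omega, h2, h3, ?_⟩
      rwa [hmin l' h2]
  · rw [regexE, holds_ite, holds_eq, hop']
    simp only [denote_const, holds_ite, holds_eq, hop']
    have h5 : 5 ≤ min (op + 1 + 1 + 1 + 1 + 1) ((ctx Ψ w).N - 1) := by omega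
    generalize min (op + 1 + 1 + 1 + 1 + 1) ((ctx Ψ w).N - 1) = v at h5
    have e0 : v ≠ 0 := by omega
    have e1 : v ≠ 1 := by omega
    have e2 : v ≠ 2 := by omega
    have e3 : v ≠ 3 := by omega
    have e4 : v ≠ 4 := by omega
    simp only [e0, e1, e2, e3, e4, false_implies, true_and, not_false_eq_true, true_implies,
      holds_or, holds_not, holds_reg, hl, not_not, holds_any, denote_reg, hP.n, holds_and, holds_le,
      holds_arr2, holds_arr3, denote_sub, denote_add, denote_const, set_reg, set_arr,
      Nat.reduceEqDiff, if_true, if_false, hi]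
    refine or_congr Iff.rfl ?_
    constructor
    · rintro ⟨l', h1, h0, h2, h3, h4⟩
      rw [hmin l' h2] at h4
      exact ⟨l', h0, h2, h3, h4⟩
    · rintro ⟨l', h0, h2, h3, h4⟩
      refine ⟨l', by omega, h0, h2, h3, ?_⟩
      rwa [hmin l' h2]

end

section

variable {k : ℕ} {w : Word k} {Ψ : RegCQ k}

set_option maxHeartbeats 400000 in
theorem eval_regexStep {s : State} (hP : Parsed Ψ w s) {op top : ℕ} (h7 : s.reg 7 < queryLen Ψ)
    (h6 : s.reg 6 ≤ queryLen Ψ) (hop : (ctx Ψ w).inp (s.reg 7) = op) (hop5 : op ≤ 5)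
    (htop : top = if op < 3 then s.reg 6 else if op < 5 then s.reg 6 - 2 else s.reg 6 - 1)
    {D : ℕ → ℕ → Prop}
    (hD : ∀ l i, i + l ≤ w.length → ∀ s', Parsed Ψ w s' → s'.reg 12 = l → s'.reg 13 = i →
      s'.reg 7 = s.reg 7 → s'.reg 6 = s.reg 6 → s'.arr 13 = s.arr 13 →
      (∀ l' < l, ∀ i', i' + l' ≤ w.length → (s'.arr 14 [l', i', 0, 0, 0, 0] ≠ 0 ↔ D l' i')) →
      (regexE.holds (ctx Ψ w) s' ↔ D l i)) :
    (regexStep.eval (ctx Ψ w) s).reg 6 = top + 1 ∧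
    (regexStep.eval (ctx Ψ w) s).reg 7 = s.reg 7 + (if op = 2 then 2 else 1) ∧
    (∀ l i, i + l ≤ w.length →
      ((regexStep.eval (ctx Ψ w) s).arr 13 [top, l, i, 0, 0, 0] ≠ 0 ↔ D l i)) ∧
    ∀ t ≠ top, ∀ l i,
      (regexStep.eval (ctx Ψ w) s).arr 13 [t, l, i, 0, 0, 0] = s.arr 13 [t, l, i, 0, 0, 0] := by
  have hN := ctx_N (Ψ := Ψ) (w := w)
  have hopd : ∀ s' : State, s'.reg 7 = s.reg 7 → opE.denote (ctx Ψ w) s' = op := fun s' h => by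
    simp only [denote_inp, denote_reg, h, hop]; omega
  set s₀ := s.set 9 top with hs₀
  have P₀ : Parsed Ψ w s₀ := hP.of_eq (fun r hr => by
    rw [hs₀, set_reg, if_neg (by omega)]) rfl
  have e₀ : (Cmd.assign 9 (.ite (lt opE (.const 3)) (.reg 6)
      (.ite (lt opE (.const 5)) top2 top1))).eval (ctx Ψ w) s = s₀ := by
    rw [eval_assign]
    simp only [denote_ite, holds_lt, hopd s rfl, denote_const, denote_reg, denote_sub, hs₀, htop]
  obtain ⟨A, hA, h1, -⟩ := eval_fill_rec (Γ := ctx Ψ w) (L := [(12, vN), (13, vN)])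
    (e₁ := .reg 12) (e₂ := .reg 13) (e₃ := k0) (e₄ := k0) (e₅ := k0) (e₆ := k0)
    (e := regexE) (loopsOk_iff.2 rfl) (a := 14) (by decide) s₀ (bs := [w.length + 1, w.length + 1])
    (by simp [denote_reg, P₀.n]) (by
      simp only [mem_tuples_cons, mem_tuples_nil]
      rintro _ ⟨l, -, _, ⟨i, -, _, rfl, rfl⟩, rfl⟩ _ ⟨l', -, _, ⟨i', -, _, rfl, rfl⟩, rfl⟩ h
      simpa [cell] using h)
    (R := fun ks v => ∀ l i, ks = [l, i] → i + l ≤ w.length → (v ≠ 0 ↔ D l i)) (by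
      simp only [mem_tuples_cons, mem_tuples_nil]
      rintro _ ⟨l, hl, _, ⟨i, hi, _, rfl, rfl⟩, rfl⟩ B hB - _ _ e hil
      obtain ⟨rfl, rfl⟩ : _ ∧ _ := by simpa using e
      refine hD l i hil _ (P₀.of_eq (fun r hr => ?_) ?_) ?_ ?_ ?_ ?_ ?_ fun l' hl' i' hi' => ?_
      · simp only [List.map_cons, List.map_nil, sets_cons, sets_nil, withArr_reg, set_reg]
        rw [if_neg (by omega), if_neg (by omega)]
      · simp [sets_cons, sets_nil]
      · simp
      · simp
      · simp [hs₀]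
      · simp [hs₀]
      · simp [hs₀]
      · have := hB [l', i'] ⟨l', by omega, _, ⟨i', by omega, _, rfl, rfl⟩, rfl⟩ (by simpa)
              l' i' rfl hi'
        simpa [cell] using this)
  obtain ⟨B, hB, g1, g2⟩ := eval_fill (Γ := ctx Ψ w) (L := [(12, vN), (13, vN)])
    (e₁ := .reg 9) (e₂ := .reg 12) (e₃ := .reg 13) (e₄ := k0) (e₅ := k0) (e₆ := k0)
    (e := aTmp (.reg 12) (.reg 13)) (loopsOk_iff.2 rfl) (a := 13) (by decide) (by decide)
    (s₀.withArr 14 A) (bs := [w.length + 1, w.length + 1])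
    (by simp [denote_reg, P₀.n]) (by
      simp only [mem_tuples_cons, mem_tuples_nil]
      rintro _ ⟨l, -, _, ⟨i, -, _, rfl, rfl⟩, rfl⟩ _ ⟨l', -, _, ⟨i', -, _, rfl, rfl⟩, rfl⟩ h
      obtain ⟨rfl, rfl⟩ : l = l' ∧ i = i' := by simpa [cell] using h
      rfl)
  have e : regexStep.eval (ctx Ψ w) s =
      (((s₀.withArr 14 A).withArr 13 B).set 6 (top + 1)).set 7
        (s.reg 7 + (if op = 2 then 2 else 1)) := by
    rw [regexStep, block_cons, block_cons, block_cons, block_cons, block_single, e₀]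
    rw [show (Cmd.loops [(12, vN), (13, vN)] (.store2 14 (.reg 12) (.reg 13) regexE)).eval
      (ctx Ψ w) s₀ = _ from hA]
    rw [show (Cmd.loops [(12, vN), (13, vN)] (.store3 13 (.reg 9) (.reg 12) (.reg 13)
      (aTmp (.reg 12) (.reg 13)))).eval (ctx Ψ w) (s₀.withArr 14 A) = _ from hB]
    rw [eval_assign, eval_assign]
    have hle : top ≤ queryLen Ψ := by split_ifs at htop <;> omega
    congr 1
    · congr 1
      simp [hs₀]
      omega
    · simp only [denote_add, denote_reg, denote_ite, holds_eq, set_reg, withArr_reg, denote_const]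
      rw [hopd _ (by simp [hs₀])]
      simp [hs₀]
      split_ifs <;> omega
  rw [e]
  refine ⟨by simp [set_reg], by simp [set_reg], fun l i hil => ?_, fun t ht l i => ?_⟩
  · have hg := g1 [l, i] (by simp; omega)
    have hh := h1 [l, i] (by simp; omega) l i rfl hil
    simp [cell, hs₀] at hg hh
    simp [hg, hh]
  · have hg := g2 [t, l, i, 0, 0, 0] (by
      simp only [mem_tuples_cons, mem_tuples_nil]
      rintro _ ⟨l', -, _, ⟨i', -, _, rfl, rfl⟩, rfl⟩
      simp [cell, hs₀, ht])
    simpa [hs₀] using hg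

/-- The iterations of the machine that evaluates a regular expression. -/
noncomputable def regexLoop (Γ : Ctx) (t : ℕ) (s : State) : State :=
  ((Cmd.ite (lt (.reg 7) (.reg 8)) regexStep .skip).eval Γ (s.set 11 t)).set 11 (s.reg 11)

theorem regexLoop_of_le {Γ : Ctx} {t : ℕ} {s : State} (h : s.reg 8 ≤ s.reg 7) :
    regexLoop Γ t s = s := by
  have : ¬ (lt (.reg 7) (.reg 8)).holds Γ (s.set 11 t) := by simpa using h
  rw [regexLoop, eval_ite, if_neg this]
  simp [Cmd.eval, State.set]

/-- The entry `t` of the stack is the table of the regular expression `γ`. -/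
def Entry (w : Word k) (s : State) (t : ℕ) (γ : RegularExpression (Fin k)) : Prop :=
  ∀ l i, i + l ≤ w.length → (s.arr 13 [t, l, i, 0, 0, 0] ≠ 0 ↔ wd w (i, l) ∈ γ.matches')

/-- The states before and after the evaluation of an expression whose code ends at `o'`: the table
of the expression is pushed on the stack. -/
structure Pushed (Ψ : RegCQ k) (w : Word k) (s s' : State) (o' : ℕ)
    (γ : RegularExpression (Fin k)) : Prop where
  parsed : Parsed Ψ w s'
  reg6 : s'.reg 6 = s.reg 6 + 1
  reg7 : s'.reg 7 = o'
  reg8 : s'.reg 8 = s.reg 8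
  below : ∀ t < s.reg 6, ∀ l i, s'.arr 13 [t, l, i, 0, 0, 0] = s.arr 13 [t, l, i, 0, 0, 0]
  entry : Entry w s' (s.reg 6) γ

theorem regexLoop_step {s : State} (hP : Parsed Ψ w s) {t op top : ℕ} (h7 : s.reg 7 < queryLen Ψ)
    (h8 : s.reg 7 < s.reg 8)
    (h6 : s.reg 6 ≤ queryLen Ψ) (hop : (ctx Ψ w).inp (s.reg 7) = op) (hop5 : op ≤ 5)
    (htop : top = if op < 3 then s.reg 6 else if op < 5 then s.reg 6 - 2 else s.reg 6 - 1)
    {γ : RegularExpression (Fin k)}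
    (hD : ∀ l i, i + l ≤ w.length → ∀ s', Parsed Ψ w s' → s'.reg 12 = l → s'.reg 13 = i →
      s'.reg 7 = s.reg 7 → s'.reg 6 = s.reg 6 → s'.arr 13 = s.arr 13 →
      (∀ l' < l, ∀ i', i' + l' ≤ w.length →
        (s'.arr 14 [l', i', 0, 0, 0, 0] ≠ 0 ↔ wd w (i', l') ∈ γ.matches')) →
      (regexE.holds (ctx Ψ w) s' ↔ wd w (i, l) ∈ γ.matches')) :
    Parsed Ψ w (regexLoop (ctx Ψ w) t s) ∧
    (regexLoop (ctx Ψ w) t s).reg 6 = top + 1 ∧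
    (regexLoop (ctx Ψ w) t s).reg 7 = s.reg 7 + (if op = 2 then 2 else 1) ∧
    (regexLoop (ctx Ψ w) t s).reg 8 = s.reg 8 ∧
    Entry w (regexLoop (ctx Ψ w) t s) top γ ∧
    ∀ t' < top, ∀ l i, (regexLoop (ctx Ψ w) t s).arr 13 [t', l, i, 0, 0, 0] =
      s.arr 13 [t', l, i, 0, 0, 0] := by
  have hP' : Parsed Ψ w (s.set 11 t) := hP.of_eq (fun r hr => by
    rw [set_reg, if_neg (by omega)]) rfl
  have hc : (lt (.reg 7) (.reg 8)).holds (ctx Ψ w) (s.set 11 t) := by simpa using h8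
  have he : regexLoop (ctx Ψ w) t s =
      (regexStep.eval (ctx Ψ w) (s.set 11 t)).set 11 (s.reg 11) := by
    rw [regexLoop, eval_ite, if_pos hc]
  obtain ⟨a1, a2, a3, a4⟩ := eval_regexStep hP' (op := op) (top := top)
    (by simpa using h7) (by simpa using h6) (by simpa using hop) hop5 (by simpa using htop)
    (D := fun l i => wd w (i, l) ∈ γ.matches') (by simpa using hD)
  rw [he]
  refine ⟨?_, ?_, ?_, ?_, ?_, ?_⟩
  · exact (hP'.eval regexStep (by decide)).of_eq (fun r hr => by
      rw [set_reg, if_neg (by omega)]) rfl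
  · simpa using a1
  · simpa using a2
  · have := regexStep.eval_reg (Γ := ctx Ψ w) (s.set 11 t) (r := 8) (by decide)
    simpa using this
  · exact a3
  · exact fun t' ht' => a4 t' ht'.ne

theorem encodeRegex_pos (γ : RegularExpression (Fin k)) : 1 ≤ (encodeRegex γ).length := by
  cases γ <;> simp [encodeRegex] <;> omega

theorem getD_append_left' {A B : List ℕ} {j : ℕ} (h : j < A.length) :
    (A ++ B).getD j 0 = A.getD j 0 := by
  simp [List.getD_eq_getElem?_getD, List.getElem?_append, h]

theorem getD_append_right' {A B : List ℕ} {i j : ℕ} (h : i = A.length + j) :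
    (A ++ B).getD i 0 = B.getD j 0 := by
  subst h
  rw [List.getD_eq_getElem?_getD, List.getElem?_append_right (by omega), Nat.add_sub_cancel_left,
    List.getD_eq_getElem?_getD]

/-- Evaluation of a regular expression in postfix notation: after at most as many iterations as the
code of `γ` has symbols, the table of `γ` is on the top of the stack. -/
theorem regexLoop_spec (γ : RegularExpression (Fin k)) (s₀ : State) (t : ℕ) {s : State}
    (hs : iter (regexLoop (ctx Ψ w)) t s₀ = s) (hP : Parsed Ψ w s) (h6 : s.reg 6 ≤ s.reg 7)
    (h8 : s.reg 7 + (encodeRegex γ).length ≤ s.reg 8) (hQ : s.reg 8 ≤ queryLen Ψ)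
    (hin : ∀ j < (encodeRegex γ).length,
      (ctx Ψ w).inp (s.reg 7 + j) = (encodeRegex γ).getD j 0) :
    ∃ j ≤ (encodeRegex γ).length,
      Pushed Ψ w s (iter (regexLoop (ctx Ψ w)) (t + j) s₀)
        (s.reg 7 + (encodeRegex γ).length) γ := by
  have hz : (ctx Ψ w).inp (s.reg 7) = (encodeRegex γ).getD 0 0 :=
    hin 0 (by have := encodeRegex_pos γ; omega)
  induction γ generalizing t s with
  | zero =>
    simp only [encodeRegex, List.length_cons, List.length_nil] at *
    obtain ⟨a1, a2, a3, a4, a5, a6⟩ := regexLoop_step hP (t := t) (op := 0) (by omega) (by omega)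
      (by omega) (by simpa using hz) (by omega) rfl (γ := .zero)
      fun l i hil s' hP' h12 h13 e7 e6 e13 h14 => by
        rw [holds_regexE hP' h12 h13 hil (by omega), e7, hz]
        exact Iff.rfl
    refine ⟨1, le_rfl, ?_⟩
    rw [iter, hs]
    exact ⟨a1, by simpa using a2, by simpa using a3, a4, by simpa using a6, by simpa using a5⟩
  | epsilon =>
    simp only [encodeRegex, List.length_cons, List.length_nil] at *
    obtain ⟨a1, a2, a3, a4, a5, a6⟩ := regexLoop_step hP (t := t) (op := 1) (by omega) (by omega)
      (by omega) (by simpa using hz) (by omega) rfl (γ := .epsilon)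
      fun l i hil s' hP' h12 h13 e7 e6 e13 h14 => by
        rw [holds_regexE hP' h12 h13 hil (by omega), e7, hz]
        have hl := wd_length (w := w) (u := (i, l)) hil
        simp only at hl
        show l = 0 ↔ wd w (i, l) ∈ (1 : Language (Fin k))
        rw [Language.mem_one, ← List.length_eq_zero_iff, hl]
    refine ⟨1, le_rfl, ?_⟩
    rw [iter, hs]
    exact ⟨a1, by simpa using a2, by simpa using a3, a4, by simpa using a6, by simpa using a5⟩
  | char a =>
    simp only [encodeRegex, List.length_cons, List.length_nil] at *
    have hz1 := hin 1 (by omega)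
    obtain ⟨a1, a2, a3, a4, a5, a6⟩ := regexLoop_step hP (t := t) (op := 2) (by omega) (by omega)
      (by omega) (by simpa using hz) (by omega) rfl (γ := .char a)
      fun l i hil s' hP' h12 h13 e7 e6 e13 h14 => by
        rw [holds_regexE hP' h12 h13 hil (by omega), e7, hz]
        show l = 1 ∧ _ ↔ wd w (i, l) = [a]
        rw [hz1]
        have hl := wd_length (w := w) (u := (i, l)) hil
        simp only at hl
        constructor
        · rintro ⟨rfl, h⟩
          rw [inp_word (by omega)] at h
          rw [wd_one (by omega)]
          have : w[i] = a := Fin.ext (by simpa using h.symm)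
          rw [this]
        · intro h
          rw [h] at hl
          obtain rfl : 1 = l := by simpa using hl
          refine ⟨rfl, ?_⟩
          rw [wd_one (by omega)] at h
          rw [inp_word (by omega)]
          have : w[i] = a := by simpa using h
          simp [this]
    refine ⟨1, by omega, ?_⟩
    rw [iter, hs]
    exact ⟨a1, by simpa using a2, by simpa using a3, a4, by simpa using a6, by simpa using a5⟩
  | plus γ δ ihγ ihδ =>
    simp only [encodeRegex, List.length_append, List.length_cons, List.length_nil] at *
    have p1 := encodeRegex_pos γ
    have p2 := encodeRegex_pos δ
    obtain ⟨j₁, hj₁, q₁⟩ := ihγ t hs hP h6 (by omega) hQ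
      (fun j hj => by
        rw [hin j (by omega), getD_append_left' (by simp; omega), getD_append_left' hj])
      (by rw [hz, getD_append_left' (by simp; omega), getD_append_left' (by omega)])
    have hin₂ : ∀ j < (encodeRegex δ).length, (ctx Ψ w).inp
        ((iter (regexLoop (ctx Ψ w)) (t + j₁) s₀).reg 7 + j) = (encodeRegex δ).getD j 0 :=
      fun j hj => by
        rw [q₁.reg7, add_assoc, hin _ (by omega), getD_append_left' (by simp; omega),
          getD_append_right' rfl]
    obtain ⟨j₂, hj₂, q₂⟩ := ihδ (t + j₁) rfl q₁.parsed (by rw [q₁.reg6, q₁.reg7]; omega)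
      (by rw [q₁.reg7, q₁.reg8]; omega) (by rw [q₁.reg8]; exact hQ) hin₂ (hin₂ 0 (by omega))
    set s₂ := iter (regexLoop (ctx Ψ w)) (t + j₁ + j₂) s₀ with hs₂
    have r6 := q₂.reg6
    have r7 := q₂.reg7
    have r8 := q₂.reg8
    rw [q₁.reg6] at r6
    rw [q₁.reg7] at r7
    rw [q₁.reg8] at r8
    have hop : (ctx Ψ w).inp (s₂.reg 7) = 3 := by
      rw [r7, add_assoc, hin _ (by omega), getD_append_right' (j := 0) (by simp)]
      rfl
    obtain ⟨a1, a2, a3, a4, a5, a6⟩ := regexLoop_step q₂.parsed (t := t + j₁ + j₂) (op := 3)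
      (by omega) (by omega) (by omega) hop (by omega) rfl (γ := .plus γ δ)
      fun l i hil s' hP' h12 h13 e7 e6 e13 h14 => by
        rw [holds_regexE hP' h12 h13 hil (by omega), e7, hop]
        simp only
        rw [e13, e6, r6, show s.reg 6 + 1 + 1 - 2 = s.reg 6 by omega,
          show s.reg 6 + 1 + 1 - 1 = s.reg 6 + 1 by omega,
          q₂.below _ (by rw [q₁.reg6]; omega), q₁.entry l i hil, ← q₁.reg6, q₂.entry l i hil]
        exact Iff.rfl
    have htop : (if 3 < 3 then s₂.reg 6 else if 3 < 5 then s₂.reg 6 - 2 else s₂.reg 6 - 1) =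
        s.reg 6 := by
      rw [if_neg (by omega), if_pos (by omega)]; omega
    rw [htop] at a2 a5 a6
    refine ⟨j₁ + j₂ + 1, by omega, ?_⟩
    rw [show t + (j₁ + j₂ + 1) = (t + j₁ + j₂) + 1 by ring, iter, ← hs₂]
    refine ⟨a1, a2, by rw [a3, r7, if_neg (by omega)]; omega, by rw [a4, r8],
      fun t' ht' l i => ?_, a5⟩
    rw [a6 t' ht', q₂.below t' (by rw [q₁.reg6]; omega), q₁.below t' ht']
  | comp γ δ ihγ ihδ =>
    simp only [encodeRegex, List.length_append, List.length_cons, List.length_nil] at *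
    have p1 := encodeRegex_pos γ
    have p2 := encodeRegex_pos δ
    obtain ⟨j₁, hj₁, q₁⟩ := ihγ t hs hP h6 (by omega) hQ
      (fun j hj => by
        rw [hin j (by omega), getD_append_left' (by simp; omega), getD_append_left' hj])
      (by rw [hz, getD_append_left' (by simp; omega), getD_append_left' (by omega)])
    have hin₂ : ∀ j < (encodeRegex δ).length, (ctx Ψ w).inp
        ((iter (regexLoop (ctx Ψ w)) (t + j₁) s₀).reg 7 + j) = (encodeRegex δ).getD j 0 :=
      fun j hj => by
        rw [q₁.reg7, add_assoc, hin _ (by omega), getD_append_left' (by simp; omega),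
          getD_append_right' rfl]
    obtain ⟨j₂, hj₂, q₂⟩ := ihδ (t + j₁) rfl q₁.parsed (by rw [q₁.reg6, q₁.reg7]; omega)
      (by rw [q₁.reg7, q₁.reg8]; omega) (by rw [q₁.reg8]; exact hQ) hin₂ (hin₂ 0 (by omega))
    set s₂ := iter (regexLoop (ctx Ψ w)) (t + j₁ + j₂) s₀ with hs₂
    have r6 := q₂.reg6
    have r7 := q₂.reg7
    have r8 := q₂.reg8
    rw [q₁.reg6] at r6
    rw [q₁.reg7] at r7
    rw [q₁.reg8] at r8
    have hop : (ctx Ψ w).inp (s₂.reg 7) = 4 := by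
      rw [r7, add_assoc, hin _ (by omega), getD_append_right' (j := 0) (by simp)]
      rfl
    obtain ⟨a1, a2, a3, a4, a5, a6⟩ := regexLoop_step q₂.parsed (t := t + j₁ + j₂) (op := 4)
      (by omega) (by omega) (by omega) hop (by omega) rfl (γ := .comp γ δ)
      fun l i hil s' hP' h12 h13 e7 e6 e13 h14 => by
        rw [holds_regexE hP' h12 h13 hil (by omega), e7, hop]
        show _ ↔ wd w (i, l) ∈ γ.matches' * δ.matches'
        rw [mem_mul_wd hil]
        simp only
        refine exists_congr fun l' => and_congr_right fun hl' => ?_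
        rw [e13, e6, r6, show s.reg 6 + 1 + 1 - 2 = s.reg 6 by omega,
          show s.reg 6 + 1 + 1 - 1 = s.reg 6 + 1 by omega,
          q₂.below _ (by rw [q₁.reg6]; omega), q₁.entry l' i (by omega), ← q₁.reg6,
          q₂.entry _ _ (by omega)]
    have htop : (if 4 < 3 then s₂.reg 6 else if 4 < 5 then s₂.reg 6 - 2 else s₂.reg 6 - 1) =
        s.reg 6 := by
      rw [if_neg (by omega), if_pos (by omega)]; omega
    rw [htop] at a2 a5 a6
    refine ⟨j₁ + j₂ + 1, by omega, ?_⟩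
    rw [show t + (j₁ + j₂ + 1) = (t + j₁ + j₂) + 1 by ring, iter, ← hs₂]
    refine ⟨a1, a2, by rw [a3, r7, if_neg (by omega)]; omega, by rw [a4, r8],
      fun t' ht' l i => ?_, a5⟩
    rw [a6 t' ht', q₂.below t' (by rw [q₁.reg6]; omega), q₁.below t' ht']
  | star γ ih =>
    simp only [encodeRegex, List.length_append, List.length_cons, List.length_nil] at *
    have p1 := encodeRegex_pos γ
    obtain ⟨j₁, hj₁, q₁⟩ := ih t hs hP h6 (by omega) hQ
      (fun j hj => by rw [hin j (by omega), getD_append_left' hj])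
      (by rw [hz, getD_append_left' (by omega)])
    set s₂ := iter (regexLoop (ctx Ψ w)) (t + j₁) s₀ with hs₂
    have r6 := q₁.reg6
    have r7 := q₁.reg7
    have r8 := q₁.reg8
    have hop : (ctx Ψ w).inp (s₂.reg 7) = 5 := by
      rw [r7, hin _ (by omega), getD_append_right' (j := 0) (by simp)]
      rfl
    obtain ⟨a1, a2, a3, a4, a5, a6⟩ := regexLoop_step q₁.parsed (t := t + j₁) (op := 5)
      (by omega) (by omega) (by omega) hop (by omega) rfl (γ := .star γ)
      fun l i hil s' hP' h12 h13 e7 e6 e13 h14 => by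
        rw [holds_regexE hP' h12 h13 hil (by omega), e7, hop]
        show _ ↔ wd w (i, l) ∈ KStar.kstar γ.matches'
        -- the first part is looked up on the stack, the shorter rest in the table under construction
        rw [mem_kstar_wd hil]
        simp only
        refine or_congr Iff.rfl (exists_congr fun l' => and_congr_right fun h0 =>
          and_congr_right fun hl' => ?_)
        rw [e13, e6, r6, Nat.add_sub_cancel, q₁.entry l' i (by omega),
          h14 (l - l') (by omega) _ (by omega)]
        exact Iff.rfl
    have htop : (if 5 < 3 then s₂.reg 6 else if 5 < 5 then s₂.reg 6 - 2 else s₂.reg 6 - 1) =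
        s.reg 6 := by
      rw [if_neg (by omega), if_neg (by omega)]; omega
    rw [htop] at a2 a5 a6
    refine ⟨j₁ + 1, by omega, ?_⟩
    rw [show t + (j₁ + 1) = (t + j₁) + 1 by ring, iter, ← hs₂]
    refine ⟨a1, a2, by rw [a3, r7, if_neg (by omega)]; omega, by rw [a4, r8],
      fun t' ht' l i => ?_, a5⟩
    rw [a6 t' ht', q₁.below t' ht']

end

section

variable {k : ℕ} {w : Word k} {Ψ : RegCQ k}

/-- The tables of the regular constraints are stored. -/
def HasReg (Ψ : RegCQ k) (w : Word k) (s : State) : Prop :=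
  ∀ c x γ, Ψ.body[c]? = some (.mem x γ) → ∀ l i, i + l ≤ w.length →
    (s.arr 3 [c, l, i, 0, 0, 0] ≠ 0 ↔ wd w (i, l) ∈ γ.matches')

theorem iter_regexLoop_of_le {Γ : Ctx} {t : ℕ} {s : State}
    (h : (iter (regexLoop Γ) t s).reg 8 ≤ (iter (regexLoop Γ) t s).reg 7) (d : ℕ) :
    iter (regexLoop Γ) (t + d) s = iter (regexLoop Γ) t s := by
  induction d with
  | zero => rfl
  | succ d ih => rw [← add_assoc, iter, ih, regexLoop_of_le h]

theorem eval_regexBody {s : State} (hP : Parsed Ψ w s) {c x : ℕ} {γ : RegularExpression (Fin k)}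
    (hχ : Ψ.body[c]? = some (.mem x γ)) (h10 : s.reg 10 = c) :
    (∀ l i, i + l ≤ w.length → ((regexBody.eval (ctx Ψ w) s).arr 3 [c, l, i, 0, 0, 0] ≠ 0 ↔
      wd w (i, l) ∈ γ.matches')) ∧
    ∀ c' ≠ c, ∀ l i, (regexBody.eval (ctx Ψ w) s).arr 3 [c', l, i, 0, 0, 0] =
      s.arr 3 [c', l, i, 0, 0, 0] := by
  have hc : c < Ψ.body.length := (List.getElem?_eq_some_iff.1 hχ).1
  have hN := ctx_N (Ψ := Ψ) (w := w)
  have hle := atomPos_add_le hχ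
  have hlen : (encodeAtom (.mem x γ)).length = 3 + (encodeRegex γ).length := by
    rw [encodeAtom_length_eq]; simp [Atom.tag, Atom.rlen]
  set s₁ := ((s.set 7 (atomPos Ψ c + 3)).set 8 (atomPos Ψ c + 3 + (encodeRegex γ).length)).set 6 0
    with hs₁
  have P₁ : Parsed Ψ w s₁ := hP.of_eq (fun r hr => by
    simp only [hs₁, set_reg]; rw [if_neg (by omega), if_neg (by omega), if_neg (by omega)]) rfl
  obtain ⟨j, hj, q⟩ := regexLoop_spec (Ψ := Ψ) (w := w) (s := s₁) γ s₁ 0 rfl P₁ (by simp [hs₁])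
    (by simp [hs₁]) (by simp [hs₁]; omega) (fun j hj => by
      have := inp_atom (w := w) hχ (j := 3 + j) (by omega)
      simp only [hs₁, set_reg, Nat.reduceEqDiff, if_false, if_true, add_assoc]
      rw [this, encodeAtom, getD_append_right' (j := j) (by simp)])
  rw [zero_add] at q
  set s₂ := iter (regexLoop (ctx Ψ w)) j s₁ with hs₂
  have hend : s₂.reg 8 ≤ s₂.reg 7 := by rw [q.reg7, q.reg8]; simp [hs₁]
  have hiter : iter (regexLoop (ctx Ψ w)) (queryLen Ψ) s₁ = s₂ := by
    rw [show queryLen Ψ = j + (queryLen Ψ - j) by omega]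
    exact iter_regexLoop_of_le hend _
  have h10' : s₂.reg 10 = c := by
    rw [hs₂]
    refine iter_inv (fun _ (s : State) => s.reg 10 = c) (by simp [hs₁, h10]) fun t _ s' hs' => ?_
    have := Cmd.eval_reg (Γ := ctx Ψ w) (.ite (lt (.reg 7) (.reg 8)) regexStep .skip) (s'.set 11 t)
      (r := 10) (by decide)
    simp [regexLoop, set_reg, this, hs']
  have h3 : s₂.arr 3 = s.arr 3 := by
    rw [hs₂]
    refine iter_inv (fun _ (s' : State) => s'.arr 3 = s.arr 3) (by simp [hs₁]) fun t _ s' hs' => ?_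
    have := Cmd.eval_arr (Γ := ctx Ψ w) (.ite (lt (.reg 7) (.reg 8)) regexStep .skip) (s'.set 11 t)
      (a := 3) (by decide)
    simp [regexLoop, this, hs']
  obtain ⟨B, hB, g1, g2⟩ := eval_fill (Γ := ctx Ψ w) (L := [(12, vN), (13, vN)])
    (e₁ := .reg 10) (e₂ := .reg 12) (e₃ := .reg 13) (e₄ := k0) (e₅ := k0) (e₆ := k0)
    (e := aStk k0 (.reg 12) (.reg 13)) (loopsOk_iff.2 rfl) (a := 3) (by decide) (by decide)
    s₂ (bs := [w.length + 1, w.length + 1])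
    (by simp [denote_reg, q.parsed.n]) (by
      simp only [mem_tuples_cons, mem_tuples_nil]
      rintro _ ⟨l, -, _, ⟨i, -, _, rfl, rfl⟩, rfl⟩ _ ⟨l', -, _, ⟨i', -, _, rfl, rfl⟩, rfl⟩ h
      obtain ⟨rfl, rfl⟩ : l = l' ∧ i = i' := by simpa [cell] using h
      rfl)
  have e : regexBody.eval (ctx Ψ w) s = s₂.withArr 3 B := by
    rw [regexBody, block_cons, block_cons, block_cons, block_cons, block_single]
    have hp : ∀ s' : State, s'.reg 10 = c → s'.arr = s.arr →
        (aPos (.reg 10)).denote (ctx Ψ w) s' = atomPos Ψ c := fun s' h1 h2 => by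
      simp only [denote_arr1, denote_reg, h1, h2, hP.pos c hc]
    have a₁ : (Cmd.assign 7 (.add (aPos (.reg 10)) (.const 3))).eval (ctx Ψ w) s =
        s.set 7 (atomPos Ψ c + 3) := by
      rw [eval_assign, denote_add, hp s h10 rfl, denote_const, min_eq_left (by omega)]
    have a₂ : (Cmd.assign 8 (.add (aPos (.reg 10)) (.add (.const 3)
        (lenE (aPos (.reg 10)))))).eval (ctx Ψ w) (s.set 7 (atomPos Ψ c + 3)) =
        (s.set 7 (atomPos Ψ c + 3)).set 8 (atomPos Ψ c + 3 + (encodeRegex γ).length) := by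
      have h8 := hp (s.set 7 (atomPos Ψ c + 3)) (by simpa using h10) rfl
      rw [eval_assign, denote_add, h8, denote_add, denote_lenE hχ h8, denote_const, Atom.rlen,
        min_eq_left (a := 3 + _) (by omega), min_eq_left (by omega), add_assoc]
    have a₃ : (Cmd.assign 6 k0).eval (ctx Ψ w)
        ((s.set 7 (atomPos Ψ c + 3)).set 8 (atomPos Ψ c + 3 + (encodeRegex γ).length)) = s₁ := rfl
    rw [a₁, a₂, a₃]
    have e₂ : (Cmd.loop 11 vQ (.ite (lt (.reg 7) (.reg 8)) regexStep .skip)).eval (ctx Ψ w) s₁ =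
        s₂ := by
      rw [eval_loop, ← hiter, denote_reg, P₁.q]
      rfl
    rw [e₂]
    exact hB
  rw [e]
  refine ⟨fun l i hil => ?_, fun c' hc' l i => ?_⟩
  · have := g1 [l, i] (by simp; omega)
    simp [cell, h10'] at this
    have h6 : s₁.reg 6 = 0 := rfl
    have hen := q.entry l i hil
    simp only [h6] at hen
    simp [this, ← hen]
  · have hg := g2 [c', l, i, 0, 0, 0] (by
      simp only [mem_tuples_cons, mem_tuples_nil]
      rintro _ ⟨l', -, _, ⟨i', -, _, rfl, rfl⟩, rfl⟩
      simp [cell, h10', hc'])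
    simpa [h3] using hg

theorem eval_regexC {s : State} (hP : Parsed Ψ w s) : HasReg Ψ w (regexC.eval (ctx Ψ w) s) := by
  rw [regexC, eval_loop, denote_reg, hP.m]
  have := iter_inv (n := Ψ.body.length) (s := s) (f := fun k s' => ((Cmd.ite
      (.inp (aPos (.reg 10))) regexBody .skip).eval (ctx Ψ w) (s'.set 10 k)).set 10 (s'.reg 10))
    (fun m (s' : State) => Parsed Ψ w s' ∧
      ∀ c < m, ∀ x γ, Ψ.body[c]? = some (.mem x γ) → ∀ l i, i + l ≤ w.length →
        (s'.arr 3 [c, l, i, 0, 0, 0] ≠ 0 ↔ wd w (i, l) ∈ γ.matches')) ⟨hP, by simp⟩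
    fun c hc s' ⟨P', ih⟩ => ?_
  · intro c x γ hχ
    exact this.2 c (List.getElem?_eq_some_iff.1 hχ).1 x γ hχ
  · have P'' : Parsed Ψ w (s'.set 10 c) := P'.of_eq (fun r hr => by
      rw [set_reg, if_neg (by omega)]) rfl
    refine ⟨(P''.eval (Γ := ctx Ψ w) (.ite (.inp (aPos (.reg 10))) regexBody .skip)
      (by decide)).of_eq (fun r hr => by rw [set_reg, if_neg (by omega)]) rfl, ?_⟩
    obtain ⟨χ, hχ⟩ : ∃ χ, Ψ.body[c]? = some χ := ⟨Ψ.body[c], by simp [hc]⟩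
    have htag : (Expr.inp (aPos (.reg 10))).holds (ctx Ψ w) (s'.set 10 c) ↔ χ.tag ≠ 0 := by
      rw [holds_inp eight_le_ctx_N, ← inp_tag (w := w) hχ]
      simp [P'.pos c hc]
    intro c' hc' x γ hχ' l i hil
    rw [set_arr, eval_ite]
    by_cases hcc : c' = c
    · subst hcc
      obtain rfl : χ = .mem x γ := by rw [hχ] at hχ'; exact Option.some_injective _ hχ'
      rw [if_pos (htag.2 (by simp [Atom.tag]))]
      exact (eval_regexBody P'' hχ (by simp)).1 l i hil
    · split
      · rename_i hh
        cases χ with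
        | eqn y α => exact absurd rfl (htag.1 hh)
        | mem y δ =>
          rw [(eval_regexBody P'' hχ (by simp)).2 c' hcc]
          exact ih c' (by omega) x γ hχ' l i hil
      · exact ih c' (by omega) x γ hχ' l i hil

/-! ### The head -/

/-- The variables of the head, and their places in the head, are stored. -/
structure HasHead (Ψ : RegCQ k) (w : Word k) (s : State) : Prop where
  var : ∀ h (hh : h < Ψ.head.length), s.arr 5 [h, 0, 0, 0, 0, 0] = varCode Ψ w Ψ.head[h]
  place : ∀ c χ, Ψ.body[c]? = some χ → ∀ t < 3, ∀ h < Ψ.head.length,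
    (s.arr 4 [c, t, 0, 0, 0, 0] = h ↔ Ψ.head[h]? = some (χ.sv t))

theorem head_ne_zero {x : ℕ} (h : x ∈ Ψ.head) : x ≠ 0 := by
  obtain ⟨χ, -, hx⟩ := Ψ.head_free x h
  cases χ <;> exact hx.1

theorem eval_headC {s : State} (hP : Parsed Ψ w s) (hV : HasVars Ψ w s) :
    HasHead Ψ w (headC.eval (ctx Ψ w) s) := by
  have hN := ctx_N (Ψ := Ψ) (w := w)
  have hQ := length_head_add_two_le (Ψ := Ψ)
  obtain ⟨A, hA, h1, -⟩ := eval_fill (Γ := ctx Ψ w) (L := [(10, vR)])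
    (e₁ := .reg 10) (e₂ := k0) (e₃ := k0) (e₄ := k0) (e₅ := k0) (e₆ := k0)
    (e := codeE (.add k1 (.reg 10))) (loopsOk_iff.2 rfl) (a := 5) (by decide) (by decide)
    s (bs := [Ψ.head.length]) (by simp [hP.r]) (by
      simp only [mem_tuples_cons, mem_tuples_nil]
      rintro _ ⟨l, -, _, rfl, rfl⟩ _ ⟨l', -, _, rfl, rfl⟩ h
      obtain rfl : l = l' := by simpa [cell] using h
      rfl)
  set s₁ := s.withArr 5 A with hs₁
  have hvar : ∀ h (hh : h < Ψ.head.length), s₁.arr 5 [h, 0, 0, 0, 0, 0] =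
      varCode Ψ w Ψ.head[h] := fun h hh => by
    have := h1 [h] (by simpa using hh)
    simp only [List.map_cons, List.map_nil, sets_cons, sets_nil] at this
    rw [denote_codeE (q := 1 + h) (by simp [hP.q]) (by simp; omega) (by simp; omega),
      inp_head hh] at this
    simpa [cell, hs₁] using this
  obtain ⟨B, hB, g1, -⟩ := eval_fill (Γ := ctx Ψ w) (L := [(10, vM), (11, .const 3)])
    (e₁ := .reg 10) (e₂ := .reg 11) (e₃ := k0) (e₄ := k0) (e₅ := k0) (e₆ := k0)
    (e := .ite (aVar (.reg 10) (.reg 11))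
      (.find 12 vR (eq (aHVar (.reg 12)) (aVar (.reg 10) (.reg 11)))) vR)
    (loopsOk_iff.2 rfl) (a := 4) (by decide) (by decide)
    s₁ (bs := [Ψ.body.length, 3]) (by simp [hs₁, hP.m]) (by
      simp only [mem_tuples_cons, mem_tuples_nil]
      rintro _ ⟨l, -, _, ⟨i, -, _, rfl, rfl⟩, rfl⟩ _ ⟨l', -, _, ⟨i', -, _, rfl, rfl⟩, rfl⟩ h
      obtain ⟨rfl, rfl⟩ : l = l' ∧ i = i' := by simpa [cell] using h
      rfl)
  have e : headC.eval (ctx Ψ w) s = s₁.withArr 4 B := by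
    rw [headC, block_cons, block_single]
    rw [show (Cmd.loops [(10, vR)] (.store1 5 (.reg 10) (codeE (.add k1 (.reg 10))))).eval
      (ctx Ψ w) s = s₁ from hA]
    exact hB
  rw [e]
  refine ⟨fun h hh => by simpa using hvar h hh, fun c χ hχ t ht h hh => ?_⟩
  have hc : c < Ψ.body.length := (List.getElem?_eq_some_iff.1 hχ).1
  have := g1 [c, t] (by simp; omega)
  have hV' : s₁.arr 1 [c, t, 0, 0, 0, 0] = varCode Ψ w (χ.sv t) := by
    simpa [hs₁] using hV c χ hχ t ht
  have hr : s₁.reg 2 = Ψ.head.length := by simp [hs₁, hP.r]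
  simp [cell, hV', varCode_eq_zero, hr] at this
  simp only [withArr_arr, if_true]
  rw [this]
  split
  · rename_i h0
    constructor
    · intro e; omega
    · intro e
      exact absurd h0 (head_ne_zero (List.mem_of_getElem? e))
  · have heq : ∀ h' (hh' : h' < Ψ.head.length), s₁.arr 5 [h', 0, 0, 0, 0, 0] =
        varCode Ψ w (χ.sv t) ↔ Ψ.head[h'] = χ.sv t := fun h' hh' => by
      rw [hvar h' hh', eq_comm, varCode_sv_inj hχ, eq_comm]
    constructor
    · intro e
      have := lb_spec (e.trans_lt hh)
      rw [e, heq h hh] at this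
      rw [List.getElem?_eq_getElem hh, this]
    · intro e
      rw [List.getElem?_eq_getElem hh] at e
      have e := Option.some_injective _ e
      refine lb_eq (.inl ((heq h hh).2 e)) hh.le fun h' hh' => ?_
      rw [heq h' (by omega), ← e]
      intro e'
      have := (List.Nodup.getElem_inj_iff Ψ.head_nodup).1 e'
      omega

end

/-! ### A join tree by Prim's algorithm -/

/-- The number of the elements of a set of values in a list of three values, from indicators of
the first occurrences. -/
theorem ncard_three (f : ℕ → ℕ) (p : ℕ → Prop) [DecidablePred p] :
    {x | p x ∧ ∃ t < 3, f t = x}.ncard =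
      (if p (f 0) then 1 else 0) + (if p (f 1) ∧ f 0 ≠ f 1 then 1 else 0) +
        (if p (f 2) ∧ f 0 ≠ f 2 ∧ f 1 ≠ f 2 then 1 else 0) := by
  have h : {x | p x ∧ ∃ t < 3, f t = x} = (({f 0, f 1, f 2} : Finset ℕ).filter p : Set ℕ) := by
    ext x
    simp only [Set.mem_ofPred_eq, Finset.coe_filter, Finset.mem_insert, Finset.mem_singleton]
    constructor
    · rintro ⟨hp, t, ht, rfl⟩
      interval_cases t <;> simp [hp]
    · rintro ⟨rfl | rfl | rfl, hp⟩
      exacts [⟨hp, 0, by omega, rfl⟩, ⟨hp, 1, by omega, rfl⟩, ⟨hp, 2, by omega, rfl⟩]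
  rw [h, Set.ncard_coe_finset]
  by_cases h01 : f 0 = f 1 <;> by_cases h02 : f 0 = f 2 <;> by_cases h12 : f 1 = f 2 <;>
    by_cases p0 : p (f 0) <;> by_cases p1 : p (f 1) <;> by_cases p2 : p (f 2) <;>
    simp_all [Finset.filter_insert, Finset.filter_singleton]

section

variable {k : ℕ} {w : Word k} {Ψ : RegCQ k}

/-- The variables of the atoms, by number. -/
def atomVars (Ψ : RegCQ k) (c : ℕ) : Set ℕ := {x | ∃ χ, Ψ.body[c]? = some χ ∧ x ∈ χ.vars}

theorem mem_atomVars (hb : Ψ.IsBinary) {c : ℕ} {χ : Atom k} (h : Ψ.body[c]? = some χ) {x : ℕ} :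
    x ∈ atomVars Ψ c ↔ x ≠ 0 ∧ ∃ t < 3, χ.sv t = x := by
  have hχ : χ.IsBinary := by
    cases χ with
    | eqn y α => exact hb y α (List.mem_of_getElem? h)
    | mem y γ => trivial
  simp only [atomVars, Set.mem_ofPred_eq, h, Option.some.injEq, exists_eq_left', Atom.vars_eq hχ]

theorem holds_shared {s : State} (hV : HasVars Ψ w s) {c t d : ℕ} {χ δ : Atom k}
    (hχ : Ψ.body[c]? = some χ) (hδ : Ψ.body[d]? = some δ) (ht : t < 3) :
    (∃ t' < 3, s.arr 1 [d, t', 0, 0, 0, 0] = s.arr 1 [c, t, 0, 0, 0, 0]) ↔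
      ∃ t' < 3, δ.sv t' = χ.sv t := by
  refine exists_congr fun t' => and_congr_right fun ht' => ?_
  rw [hV c χ hχ t ht, hV d δ hδ t' ht', varCode_sv_inj hδ]

theorem denote_wtE (hb : Ψ.IsBinary) {s : State} (hV : HasVars Ψ w s) {c d : ℕ}
    (hc : c < Ψ.body.length) (hd : d < Ψ.body.length) {u v : Expr}
    (hu : ∀ k', u.denote (ctx Ψ w) (s.set 13 k') = d) (hv : v.denote (ctx Ψ w) s = c)
    (hv' : ∀ k', v.denote (ctx Ψ w) (s.set 13 k') = c) :
    (wtE u v).denote (ctx Ψ w) s = (atomVars Ψ d ∩ atomVars Ψ c).ncard := by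
  classical
  obtain ⟨χ, hχ⟩ : ∃ χ, Ψ.body[c]? = some χ := ⟨Ψ.body[c], by simp [hc]⟩
  obtain ⟨δ, hδ⟩ : ∃ δ, Ψ.body[d]? = some δ := ⟨Ψ.body[d], by simp [hd]⟩
  have hset : atomVars Ψ d ∩ atomVars Ψ c =
      {x | (x ≠ 0 ∧ ∃ t < 3, δ.sv t = x) ∧ ∃ t < 3, χ.sv t = x} := by
    ext x
    rw [Set.mem_inter_iff, mem_atomVars hb hχ, mem_atomVars hb hδ, Set.mem_ofPred_eq]
    tauto
  rw [hset, ncard_three χ.sv fun x => x ≠ 0 ∧ ∃ t < 3, δ.sv t = x]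
  have hs : ∀ t < 3, ∀ l : List ℕ, (∀ t' ∈ l, t' < 3) →
      (wtSlot u v t l).denote (ctx Ψ w) s =
      if (χ.sv t ≠ 0 ∧ ∃ t' < 3, δ.sv t' = χ.sv t) ∧ ∀ t' ∈ l, χ.sv t' ≠ χ.sv t
        then 1 else 0 := by
    intro t ht l hl
    rw [wtSlot, denote_ite, denote_const, denote_const]
    suffices hiff : ((aVar v (.const t)).and ((any 13 (.const 3)
        (eq (aVar u (.reg 13)) (aVar v (.const t)))).and (l.foldr (fun s' e =>
          (eq (aVar v (.const s')) (aVar v (.const t))).not.and e) k1))).holds (ctx Ψ w) s ↔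
        (χ.sv t ≠ 0 ∧ ∃ t' < 3, δ.sv t' = χ.sv t) ∧ ∀ t' ∈ l, χ.sv t' ≠ χ.sv t by
      by_cases hh : (χ.sv t ≠ 0 ∧ ∃ t' < 3, δ.sv t' = χ.sv t) ∧ ∀ t' ∈ l, χ.sv t' ≠ χ.sv t
      · rw [if_pos hh, if_pos (hiff.2 hh)]
      · rw [if_neg hh, if_neg (mt hiff.1 hh)]
    have h3 : (l.foldr (fun s' e => (eq (aVar v (.const s')) (aVar v (.const t))).not.and e)
        k1).holds (ctx Ψ w) s ↔ ∀ t' ∈ l, χ.sv t' ≠ χ.sv t := by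
      induction l with
      | nil => simp
      | cons a l ih =>
        rw [List.foldr_cons, holds_and, ih fun t' h' => hl t' (by simp [h'])]
        simp only [holds_not, holds_eq, denote_arr2, hv, denote_const, List.forall_mem_cons]
        rw [hV c χ hχ a (hl a (by simp)), hV c χ hχ t ht, varCode_sv_inj hχ]
    rw [holds_and, holds_and, h3]
    simp only [holds_arr2, hv, denote_const, hV c χ hχ t ht, ne_eq, varCode_eq_zero, holds_any,
      holds_eq, denote_arr2, denote_reg, hv', hu, set_arr, set_reg, if_true]
    have := holds_shared hV hχ hδ ht
    rw [hV c χ hχ t ht] at this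
    rw [this]
    tauto
  have hN := eight_le_ctx_N (Ψ := Ψ) (w := w)
  rw [wtE, denote_add, denote_add, hs 0 (by omega) [] (by simp), hs 1 (by omega) [0] (by simp),
    hs 2 (by omega) [0, 1] (by simp)]
  simp only [List.forall_mem_cons, List.not_mem_nil, false_implies, implies_true, and_true]
  split_ifs <;> omega

/-- The sequence of the tree edges: the new nodes, and their parents. -/
def ordF (s : State) (e : ℕ) : ℕ := s.arr 6 [e, 0, 0, 0, 0, 0]

/-- The parent in the tree edge with the number `e`. -/
def parF (s : State) (e : ℕ) : ℕ := s.arr 7 [e, 0, 0, 0, 0, 0]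

/-- The nodes of the tree after the first `e` edges. -/
def treeNodes (s : State) (e : ℕ) : Finset ℕ := insert 0 ((Finset.range e).image (ordF s))

theorem mem_treeNodes {s : State} {e c : ℕ} :
    c ∈ treeNodes s e ↔ c = 0 ∨ ∃ e' < e, c = ordF s e' := by
  simp [treeNodes, eq_comm]

/-- The number of the common variables of two atoms. -/
noncomputable def weight (Ψ : RegCQ k) (u v : ℕ) : ℕ := (atomVars Ψ u ∩ atomVars Ψ v).ncard

/-- The invariant of Prim's algorithm: each node outside of the tree knows a node of the tree with
which it has the largest number of common variables. -/
structure PrimInv (Ψ : RegCQ k) (w : Word k) (e : ℕ) (s : State) : Prop where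
  parsed : Parsed Ψ w s
  vars : HasVars Ψ w s
  ord_ne : ∀ e' < e, ordF s e' ≠ 0
  ord_lt : ∀ e' < e, ordF s e' < Ψ.body.length
  inj : ∀ e₁ < e, ∀ e₂ < e, ordF s e₁ = ordF s e₂ → e₁ = e₂
  parent : ∀ e' < e, parF s e' = 0 ∨ ∃ e'' < e', parF s e' = ordF s e''
  rip : ∀ e' < e, ∀ i ∈ treeNodes s e',
    atomVars Ψ i ∩ atomVars Ψ (ordF s e') ⊆ atomVars Ψ (parF s e')
  gt : GT (atomVars Ψ) (treeNodes s e) (Finset.range Ψ.body.length)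
  mark : ∀ c < Ψ.body.length, s.arr 15 [c, 0, 0, 0, 0, 0] ≠ 0 ↔ c ∈ treeNodes s e
  best : ∀ c < Ψ.body.length, c ∉ treeNodes s e → s.arr 17 [c, 0, 0, 0, 0, 0] ∈ treeNodes s e ∧
    s.arr 16 [c, 0, 0, 0, 0, 0] = weight Ψ (s.arr 17 [c, 0, 0, 0, 0, 0]) c ∧
    ∀ i ∈ treeNodes s e, weight Ψ i c ≤ s.arr 16 [c, 0, 0, 0, 0, 0]

theorem weight_le (hb : Ψ.IsBinary) {u v : ℕ} (hv : v < Ψ.body.length) : weight Ψ u v ≤ 3 := by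
  classical
  obtain ⟨χ, hχ⟩ : ∃ χ, Ψ.body[v]? = some χ := ⟨Ψ.body[v], by simp [hv]⟩
  have hset : atomVars Ψ u ∩ atomVars Ψ v =
      {x | (x ∈ atomVars Ψ u ∧ x ≠ 0) ∧ ∃ t < 3, χ.sv t = x} := by
    ext x
    rw [Set.mem_inter_iff, mem_atomVars hb hχ, Set.mem_ofPred_eq]
    tauto
  rw [weight, hset, ncard_three]
  split_ifs <;> omega

theorem treeNodes_card {s : State} {e : ℕ} (h0 : ∀ e' < e, ordF s e' ≠ 0)
    (hi : ∀ e₁ < e, ∀ e₂ < e, ordF s e₁ = ordF s e₂ → e₁ = e₂) :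
    (treeNodes s e).card = e + 1 := by
  rw [treeNodes, Finset.card_insert_of_notMem, Finset.card_image_of_injOn, Finset.card_range]
  · intro a ha b hb h
    exact hi a (by simpa using ha) b (by simpa using hb) h
  · simp only [Finset.mem_image, Finset.mem_range, not_exists, not_and]
    exact fun e' he' => h0 e' he'

theorem PrimInv.exists_outside {e : ℕ} {s : State} (h : PrimInv Ψ w e s)
    (he : e < Ψ.body.length - 1) : ∃ c < Ψ.body.length, c ∉ treeNodes s e := by
  by_contra! hc
  have h1 : Finset.range Ψ.body.length ⊆ treeNodes s e := fun c hc' => hc c (by simpa using hc')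
  have h2 := Finset.card_le_card h1
  rw [treeNodes_card h.ord_ne h.inj, Finset.card_range] at h2
  omega

theorem PrimInv.treeOrder {s : State} (h : PrimInv Ψ w (Ψ.body.length - 1) s)
    (hm : 0 < Ψ.body.length) :
    TreeOrder (atomVars Ψ) (Ψ.body.length - 1) (ordF s) (parF s) where
  ord_ne := h.ord_ne
  ord_le e he := by have := h.ord_lt e he; omega
  inj := h.inj
  parent := h.parent
  rip e he i hi := h.rip e he i (mem_treeNodes.2 hi)
  cover c hc := by
    have h1 : treeNodes s (Ψ.body.length - 1) ⊆ Finset.range Ψ.body.length := h.gt.subset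
    have h2 := Finset.eq_of_subset_of_card_le h1 (by
      rw [treeNodes_card h.ord_ne h.inj, Finset.card_range]; omega)
    exact mem_treeNodes.1 (h2 ▸ Finset.mem_range.2 (by omega))

/-- The choice of the best node outside of the tree. -/
theorem denote_selE (hb : Ψ.IsBinary) {e : ℕ} {s : State} (h : PrimInv Ψ w e s)
    (he : e < Ψ.body.length - 1) {v : ℕ}
    (hv : (selE 3 (selE 2 (selE 1 (selE 0 k0)))).denote (ctx Ψ w) s = v) :
    v < Ψ.body.length ∧ v ∉ treeNodes s e ∧ ∀ c < Ψ.body.length, c ∉ treeNodes s e →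
      s.arr 16 [c, 0, 0, 0, 0, 0] ≤ s.arr 16 [v, 0, 0, 0, 0, 0] := by
  have key : ∀ g d, (∃ c < Ψ.body.length, c ∉ treeNodes s e ∧ s.arr 16 [c, 0, 0, 0, 0, 0] = g) ∧
        (selE g d).denote (ctx Ψ w) s < Ψ.body.length ∧
        (selE g d).denote (ctx Ψ w) s ∉ treeNodes s e ∧
        s.arr 16 [(selE g d).denote (ctx Ψ w) s, 0, 0, 0, 0, 0] = g ∨
      (∀ c < Ψ.body.length, c ∉ treeNodes s e → s.arr 16 [c, 0, 0, 0, 0, 0] ≠ g) ∧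
        (selE g d).denote (ctx Ψ w) s = d.denote (ctx Ψ w) s := by
    intro g d
    have hiff : ∀ c < Ψ.body.length, (((aIn (.reg 12)).not.and
        (eq (aBw (.reg 12)) (.const g))).holds (ctx Ψ w) (s.set 12 c) ↔
        c ∉ treeNodes s e ∧ s.arr 16 [c, 0, 0, 0, 0, 0] = g) := by
      intro c hc
      simp only [holds_and, holds_not, holds_arr1, denote_reg, set_reg, if_true, set_arr,
          h.mark c hc,
        holds_eq, denote_arr1, denote_const]
    rw [selE, denote_ite, denote_find]
    by_cases hex : ∃ c < Ψ.body.length, c ∉ treeNodes s e ∧ s.arr 16 [c, 0, 0, 0, 0, 0] = g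
    · left
      refine ⟨hex, ?_⟩
      have hany : (any 12 vM ((aIn (.reg 12)).not.and (eq (aBw (.reg 12)) (.const g)))).holds
          (ctx Ψ w) s := by
        rw [holds_any, denote_reg, h.parsed.m]
        obtain ⟨c, hc, hc'⟩ := hex
        exact ⟨c, hc, (hiff c hc).2 hc'⟩
      rw [if_pos hany, denote_reg, h.parsed.m]
      have hlt := hany
      rw [holds_any, denote_reg, h.parsed.m, ← lb_lt_iff] at hlt
      exact ⟨hlt, (hiff _ hlt).1 (lb_spec hlt)⟩
    · right
      push Not at hex
      refine ⟨hex, if_neg ?_⟩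
      rw [holds_any, denote_reg, h.parsed.m]
      rintro ⟨c, hc, hh⟩
      have := (hiff c hc).1 hh
      exact hex c hc this.1 this.2
  obtain ⟨c₀, hc₀, hn₀⟩ := h.exists_outside he
  have h3 : ∀ c < Ψ.body.length, c ∉ treeNodes s e → s.arr 16 [c, 0, 0, 0, 0, 0] ≤ 3 :=
    fun c hc hn => by rw [(h.best c hc hn).2.1]; exact weight_le hb hc
  subst hv
  rcases key 3 (selE 2 (selE 1 (selE 0 k0))) with ⟨-, a, b, e3⟩ | ⟨n3, e3⟩
  · exact ⟨a, b, fun c hc hn => by rw [e3]; exact h3 c hc hn⟩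
  rw [e3]
  rcases key 2 (selE 1 (selE 0 k0)) with ⟨-, a, b, e2⟩ | ⟨n2, e2⟩
  · exact ⟨a, b, fun c hc hn => by
      rw [e2]; have := h3 c hc hn; have := n3 c hc hn; omega⟩
  rw [e2]
  rcases key 1 (selE 0 k0) with ⟨-, a, b, e1⟩ | ⟨n1, e1⟩
  · exact ⟨a, b, fun c hc hn => by
      rw [e1]; have := h3 c hc hn; have := n3 c hc hn; have := n2 c hc hn; omega⟩
  rw [e1]
  rcases key 0 k0 with ⟨-, a, b, e0⟩ | ⟨n0, e0⟩
  · exact ⟨a, b, fun c hc hn => by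
      rw [e0]; have := h3 c hc hn; have := n3 c hc hn; have := n2 c hc hn
      have := n1 c hc hn; omega⟩
  · have := h3 c₀ hc₀ hn₀; have := n3 c₀ hc₀ hn₀; have := n2 c₀ hc₀ hn₀
    have := n1 c₀ hc₀ hn₀; have := n0 c₀ hc₀ hn₀; omega

end

section

variable {k : ℕ} {w : Word k} {Ψ : RegCQ k}

/-- A loop that fills an array with one index; an entry may depend on its old value. -/
theorem eval_fill_one {Γ : Ctx} {a n : ℕ} {e : Expr} {s : State} (hn : s.reg 1 = n)
    {v : ℕ → ℕ} (h : ∀ c < n, ∀ A : List ℕ → ℕ,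
      A [c, 0, 0, 0, 0, 0] = s.arr a [c, 0, 0, 0, 0, 0] →
      e.denote Γ ((s.set 12 c).withArr a A) = v c) :
    ∃ A, (Cmd.loops [(12, vM)] (.store1 a (.reg 12) e)).eval Γ s = s.withArr a A ∧
      ∀ c < n, A [c, 0, 0, 0, 0, 0] = v c := by
  obtain ⟨A, hA, h1, -⟩ := eval_fill_rec (Γ := Γ) (L := [(12, vM)])
    (e₁ := .reg 12) (e₂ := k0) (e₃ := k0) (e₄ := k0) (e₅ := k0) (e₆ := k0)
    (e := e) (loopsOk_iff.2 rfl) (a := a) (by simp [Free, Expr.reads]) s (bs := [n]) (by simp [hn])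
    (by
      simp only [mem_tuples_cons, mem_tuples_nil]
      rintro _ ⟨l, -, _, rfl, rfl⟩ _ ⟨l', -, _, rfl, rfl⟩ h
      simpa [cell] using h)
    (R := fun ks x => ∀ c, ks = [c] → x = v c) (by
      simp only [mem_tuples_cons, mem_tuples_nil]
      rintro _ ⟨l, hl, _, rfl, rfl⟩ A - hA c e
      obtain rfl : l = c := by simpa using e
      exact h l hl A (by simpa [cell] using hA))
  refine ⟨A, hA, fun c hc => ?_⟩
  have := h1 [c] (by simpa using hc) c rfl
  simpa [cell] using this

/-- A step of Prim's algorithm keeps the invariant. -/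
theorem eval_primStep (hb : Ψ.IsBinary) {e : ℕ} {s : State} (h : PrimInv Ψ w e s)
    (he : e < Ψ.body.length - 1) (h11 : s.reg 11 = e) :
    PrimInv Ψ w (e + 1) (primStep.eval (ctx Ψ w) s) := by
  obtain ⟨v, hv⟩ : ∃ v, (selE 3 (selE 2 (selE 1 (selE 0 k0)))).denote (ctx Ψ w) s = v := ⟨_, rfl⟩
  obtain ⟨hvm, hvS, hmax⟩ := denote_selE hb h he hv
  obtain ⟨hpS, hpw, hpb⟩ := h.best v hvm hvS
  set p := s.arr 17 [v, 0, 0, 0, 0, 0] with hp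
  have hpm : p < Ψ.body.length := by simpa using h.gt.subset hpS
  -- the state when the edge from `p` to `v` is stored
  set s₁ := (((s.set 6 v).put 6 [e, 0, 0, 0, 0, 0] v).put 7 [e, 0, 0, 0, 0, 0] p).put 15
    [v, 0, 0, 0, 0, 0] 1 with hs₁
  have r₁ : ∀ r, s₁.reg r = if r = 6 then v else s.reg r := fun r => set_reg
  have a₁ : ∀ a, a ≠ 6 → a ≠ 7 → a ≠ 15 → s₁.arr a = s.arr a := fun a h1 h2 h3 => by
    simp [hs₁, State.put, State.set, Function.update_of_ne, h1, h2, h3]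
  have V₁ : HasVars Ψ w s₁ := by
    intro c χ hχ t ht
    rw [a₁ 1 (by omega) (by omega) (by omega)]
    exact h.vars c χ hχ t ht
  have wt₁ : ∀ c < Ψ.body.length, ∀ a A, a ≠ 1 → (wtE (.reg 6) (.reg 12)).denote (ctx Ψ w)
      ((s₁.set 12 c).withArr a A) = weight Ψ v c := by
    intro c hc a A ha
    refine denote_wtE hb (fun c χ hχ t ht => ?_) hc hvm (by simp [r₁]) (by simp) (by simp)
    rw [withArr_arr, if_neg ha.symm]
    exact V₁ c χ hχ t ht
  obtain ⟨A, hA, h1⟩ := eval_fill_one (Γ := ctx Ψ w) (a := 17) (s := s₁)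
    (n := Ψ.body.length) (e := .ite (lt (aBw (.reg 12)) (wtE (.reg 6) (.reg 12))) (.reg 6)
      (aBp (.reg 12))) (by simp [r₁, h.parsed.m])
    (v := fun c => if s.arr 16 [c, 0, 0, 0, 0, 0] < weight Ψ v c then v else
      s.arr 17 [c, 0, 0, 0, 0, 0]) (by
      intro c hc A hA
      rw [denote_ite]
      simp only [holds_lt, wt₁ c hc 17 A (by omega)]
      simp only [denote_arr1, denote_reg, withArr_reg, set_reg, withArr_arr, set_arr, if_true,
        Nat.reduceEqDiff, if_false, r₁, a₁ 16 (by omega) (by omega) (by omega), hA,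
        a₁ 17 (by omega) (by omega) (by omega)])
  obtain ⟨B, hB, g1⟩ := eval_fill_one (Γ := ctx Ψ w) (a := 16) (s := s₁.withArr 17 A)
    (n := Ψ.body.length) (e := .ite (lt (aBw (.reg 12)) (wtE (.reg 6) (.reg 12)))
      (wtE (.reg 6) (.reg 12)) (aBw (.reg 12))) (by simp [r₁, h.parsed.m])
    (v := fun c => if s.arr 16 [c, 0, 0, 0, 0, 0] < weight Ψ v c then weight Ψ v c else
      s.arr 16 [c, 0, 0, 0, 0, 0]) (by
      intro c hc B hB
      have hw : (wtE (.reg 6) (.reg 12)).denote (ctx Ψ w)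
          (((s₁.withArr 17 A).set 12 c).withArr 16 B) = weight Ψ v c := by
        refine denote_wtE hb (fun c χ hχ t ht => ?_) hc hvm (by simp [r₁]) (by simp) (by simp)
        simpa using V₁ c χ hχ t ht
      rw [denote_ite]
      simp only [holds_lt, hw]
      simp only [denote_arr1, denote_reg, withArr_reg, set_reg, withArr_arr, set_arr, if_true,
        hB, Nat.reduceEqDiff, if_false, a₁ 16 (by omega) (by omega) (by omega)])
  have e' : primStep.eval (ctx Ψ w) s = (s₁.withArr 17 A).withArr 16 B := by
    rw [primStep, block_cons, block_cons, block_cons, block_cons, block_cons, block_single]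
    have b₁ : (Cmd.assign 6 (selE 3 (selE 2 (selE 1 (selE 0 k0))))).eval (ctx Ψ w) s =
        s.set 6 v := by rw [eval_assign, hv]
    have b₂ : (Cmd.store1 6 (.reg 11) (.reg 6)).eval (ctx Ψ w) (s.set 6 v) =
        (s.set 6 v).put 6 [e, 0, 0, 0, 0, 0] v := by
      simp [Cmd.store1, Cmd.eval, h11]
    have b₃ : (Cmd.store1 7 (.reg 11) (aBp (.reg 6))).eval (ctx Ψ w)
        ((s.set 6 v).put 6 [e, 0, 0, 0, 0, 0] v) =
        ((s.set 6 v).put 6 [e, 0, 0, 0, 0, 0] v).put 7 [e, 0, 0, 0, 0, 0] p := by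
      have : (s.set 6 v).reg 11 = e := by simp [h11]
      simp [Cmd.store1, Cmd.eval, State.put, State.set, h11, hp]
    have b₄ : (Cmd.store1 15 (.reg 6) k1).eval (ctx Ψ w)
        (((s.set 6 v).put 6 [e, 0, 0, 0, 0, 0] v).put 7 [e, 0, 0, 0, 0, 0] p) = s₁ := by
      simp [Cmd.store1, Cmd.eval, State.put, State.set, hs₁]
    rw [b₁, b₂, b₃, b₄, hA, hB]
  have o' : ∀ i, ordF (primStep.eval (ctx Ψ w) s) i = if i = e then v else ordF s i := by
    intro i
    rw [e']
    simp only [ordF, withArr_arr, Nat.reduceEqDiff, if_false, hs₁, State.put, State.set]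
    simp [Function.update_apply]
  have p' : ∀ i, parF (primStep.eval (ctx Ψ w) s) i = if i = e then p else parF s i := by
    intro i
    rw [e']
    simp only [parF, withArr_arr, Nat.reduceEqDiff, if_false, hs₁, State.put, State.set]
    simp [Function.update_apply]
  have in' : ∀ c, (primStep.eval (ctx Ψ w) s).arr 15 [c, 0, 0, 0, 0, 0] =
      if c = v then 1 else s.arr 15 [c, 0, 0, 0, 0, 0] := by
    intro i
    rw [e']
    simp only [withArr_arr, Nat.reduceEqDiff, if_false, hs₁, State.put, State.set]
    simp [Function.update_apply]
  have bp' : ∀ c < Ψ.body.length, (primStep.eval (ctx Ψ w) s).arr 17 [c, 0, 0, 0, 0, 0] =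
      if s.arr 16 [c, 0, 0, 0, 0, 0] < weight Ψ v c then v else s.arr 17 [c, 0, 0, 0, 0, 0] :=
    fun c hc => by rw [e']; simpa using h1 c hc
  have bw' : ∀ c < Ψ.body.length, (primStep.eval (ctx Ψ w) s).arr 16 [c, 0, 0, 0, 0, 0] =
      if s.arr 16 [c, 0, 0, 0, 0, 0] < weight Ψ v c then weight Ψ v c else
        s.arr 16 [c, 0, 0, 0, 0, 0] :=
    fun c hc => by rw [e']; simpa using g1 c hc
  have P' := h.parsed.eval (Γ := ctx Ψ w) primStep (by decide)
  have V' : HasVars Ψ w (primStep.eval (ctx Ψ w) s) := by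
    intro c χ hχ t ht
    rw [primStep.eval_arr s (by decide)]
    exact h.vars c χ hχ t ht
  set s' := primStep.eval (ctx Ψ w) s with hs'
  have nodes : ∀ i ≤ e, treeNodes s' i = treeNodes s i := by
    intro i hi
    ext c
    simp only [mem_treeNodes]
    refine or_congr Iff.rfl (exists_congr fun e₁ => and_congr_right fun h₁ => ?_)
    rw [o', if_neg (by omega)]
  have nodes' : treeNodes s' (e + 1) = insert v (treeNodes s e) := by
    rw [← nodes e le_rfl]
    ext c
    simp only [mem_treeNodes, Finset.mem_insert]
    constructor
    · rintro (h0 | ⟨e₁, h₁, rfl⟩)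
      · exact .inr (.inl h0)
      · by_cases h₂ : e₁ = e
        · left; rw [o', if_pos h₂]
        · exact .inr (.inr ⟨e₁, by omega, rfl⟩)
    · rintro (rfl | h0 | ⟨e₁, h₁, rfl⟩)
      · exact .inr ⟨e, by omega, by rw [o', if_pos rfl]⟩
      · exact .inl h0
      · exact .inr ⟨e₁, by omega, rfl⟩
  have hfin : ∀ i, (atomVars Ψ i).Finite := by
    intro i
    by_cases hi : i < Ψ.body.length
    · have hχ : Ψ.body[i]? = some Ψ.body[i] := by simp [hi]
      refine (Set.finite_mem_finset ((Finset.range 3).image Ψ.body[i].sv)).subset fun x hx => ?_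
      obtain ⟨-, t, ht, rfl⟩ := (mem_atomVars hb hχ).1 hx
      exact Finset.mem_image.2 ⟨t, Finset.mem_range.2 ht, rfl⟩
    · have : atomVars Ψ i = ∅ := by
        ext x
        simp [atomVars, List.getElem?_eq_none (not_lt.1 hi)]
      rw [this]; exact Set.finite_empty
  -- the chosen edge is a heaviest edge that leaves the tree
  obtain ⟨hrip, hgt⟩ := h.gt.prim hfin hpS (by simpa using hvm) hvS fun i hi j hj hjS => by
    have hj' : j < Ψ.body.length := by simpa using hj
    exact ((h.best j hj' hjS).2.2 i hi).trans ((hmax j hj' hjS).trans hpw.le)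
  have hv0 : v ≠ 0 := fun h0 => hvS (mem_treeNodes.2 (.inl h0))
  refine ⟨P', V', fun i hi => ?_, fun i hi => ?_, fun i hi j hj hij => ?_, fun i hi => ?_,
    fun i hi j hj => ?_, by rw [nodes']; exact hgt, fun c hc => ?_, fun c hc hcS => ?_⟩
  · rw [o']; split
    · exact hv0
    · exact h.ord_ne i (by omega)
  · rw [o']; split
    · exact hvm
    · exact h.ord_lt i (by omega)
  · rw [o', o'] at hij
    have hne : ∀ i < e, ordF s i ≠ v := fun i hi h' => hvS (mem_treeNodes.2 (.inr ⟨i, hi, h'.symm⟩))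
    split_ifs at hij with h₁ h₂ h₂
    · omega
    · exact absurd hij.symm (hne j (by omega))
    · exact absurd hij (hne i (by omega))
    · exact h.inj i (by omega) j (by omega) hij
  · rw [p']
    split
    · rename_i h₁
      rcases mem_treeNodes.1 hpS with h0 | ⟨e₁, h₂, h₃⟩
      · exact .inl h0
      · exact .inr ⟨e₁, by omega, by rw [o', if_neg (by omega), h₃]⟩
    · rcases h.parent i (by omega) with h0 | ⟨e₁, h₂, h₃⟩
      · exact .inl h0
      · exact .inr ⟨e₁, by omega, by rw [o', if_neg (by omega), h₃]⟩
  · rw [nodes i (by omega)] at hj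
    rw [o', p']
    by_cases h₁ : i = e
    · subst h₁
      rw [if_pos rfl, if_pos rfl]
      exact hrip j hj
    · rw [if_neg h₁, if_neg h₁]
      exact h.rip i (by omega) j hj
  · rw [in', nodes', Finset.mem_insert]
    by_cases h₁ : c = v
    · simp [h₁]
    · rw [if_neg h₁, h.mark c hc]; simp [h₁]
  · rw [nodes', Finset.mem_insert, not_or] at hcS
    obtain ⟨b1, b2, b3⟩ := h.best c hc hcS.2
    rw [bp' c hc, bw' c hc, nodes']
    split
    · rename_i hlt
      refine ⟨Finset.mem_insert_self _ _, rfl, fun i hi => ?_⟩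
      rcases Finset.mem_insert.1 hi with rfl | hi
      · exact le_rfl
      · exact (b3 i hi).trans hlt.le
    · rename_i hlt
      refine ⟨Finset.mem_insert_of_mem b1, b2, fun i hi => ?_⟩
      rcases Finset.mem_insert.1 hi with rfl | hi
      · exact not_lt.1 hlt
      · exact b3 i hi

theorem PrimInv.of_eq {e : ℕ} {s s' : State} (h : PrimInv Ψ w e s)
    (hr : ∀ r < 5, s'.reg r = s.reg r) (ha : s'.arr = s.arr) : PrimInv Ψ w e s' := by
  have ho : ordF s' = ordF s := by funext i; simp [ordF, ha]
  have hp : parF s' = parF s := by funext i; simp [parF, ha]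
  have hn : ∀ i, treeNodes s' i = treeNodes s i := fun i => by simp [treeNodes, ho]
  refine ⟨h.parsed.of_eq hr (by rw [ha]), fun c χ hχ t ht => by rw [ha]; exact h.vars c χ hχ t ht,
    ?_, ?_, ?_, ?_, ?_, ?_, ?_, ?_⟩ <;> simp only [ho, hp, hn, ha]
  exacts [h.ord_ne, h.ord_lt, h.inj, h.parent, h.rip, h.gt, h.mark, h.best]

/-- Prim's algorithm finds a join tree of an acyclic query. -/
theorem eval_primC (hb : Ψ.IsBinary) (ha : Ψ.IsAcyclic) {s : State} (hP : Parsed Ψ w s)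
    (hV : HasVars Ψ w s) (hm : 0 < Ψ.body.length) :
    TreeOrder (atomVars Ψ) (Ψ.body.length - 1) (ordF (primC.eval (ctx Ψ w) s))
      (parF (primC.eval (ctx Ψ w) s)) := by
  obtain ⟨A, hA, h1⟩ := eval_fill_one (Γ := ctx Ψ w) (a := 16) (s := s) (n := Ψ.body.length)
    (e := wtE k0 (.reg 12)) hP.m (v := weight Ψ 0) (by
      intro c hc A hA
      refine denote_wtE hb (fun c χ hχ t ht => ?_) hc hm (by simp) (by simp) (by simp)
      simpa using hV c χ hχ t ht)
  obtain ⟨B, hB, h2⟩ := eval_fill_one (Γ := ctx Ψ w) (a := 17) (s := s.withArr 16 A)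
    (n := Ψ.body.length) (e := k0) hP.m (v := fun _ => 0) (by simp)
  obtain ⟨C, hC, h3⟩ := eval_fill_one (Γ := ctx Ψ w) (a := 15) (s := (s.withArr 16 A).withArr 17 B)
    (n := Ψ.body.length) (e := .not (.reg 12)) hP.m (v := fun c => if c = 0 then 1 else 0) (by
      intro c hc A hA
      simp [Expr.not])
  set s₁ := ((s.withArr 16 A).withArr 17 B).withArr 15 C with hs₁
  have hn : treeNodes s₁ 0 = {0} := by ext c; simp [mem_treeNodes]
  have hI : PrimInv Ψ w 0 s₁ := by
    refine ⟨hP.of_eq (fun r _ => rfl) (by simp [hs₁]), fun c χ hχ t ht => by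
      simpa [hs₁] using hV c χ hχ t ht, by simp, by simp, by simp, by simp, by simp, ?_,
      fun c hc => ?_, fun c hc hcS => ?_⟩
    · rw [hn]
      exact JT.root ha.jt (by simpa using hm)
    · rw [hn]
      simp [hs₁, h3 c hc]
    · have a1 : s₁.arr 17 [c, 0, 0, 0, 0, 0] = 0 := by simp [hs₁, h2 c hc]
      have a2 : s₁.arr 16 [c, 0, 0, 0, 0, 0] = weight Ψ 0 c := by simp [hs₁, h1 c hc]
      rw [a1, a2, hn]
      refine ⟨by simp, rfl, fun i hi => ?_⟩
      rw [Finset.mem_singleton.1 hi]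
  have e : primC.eval (ctx Ψ w) s = (Cmd.loop 11 (.sub vM k1) primStep).eval (ctx Ψ w) s₁ := by
    rw [primC, block_cons, block_cons, block_cons, block_single, hA, hB, hC]
  rw [e, eval_loop]
  have hb' : (Expr.sub vM k1).denote (ctx Ψ w) s₁ = Ψ.body.length - 1 := by
    simp [hs₁, hP.m]
  rw [hb']
  refine PrimInv.treeOrder (w := w) (iter_inv (fun e s => PrimInv Ψ w e s) hI
      fun e he s' hs' => ?_) hm
  refine (eval_primStep hb (hs'.of_eq (s' := s'.set 11 e) (fun r hr => ?_) rfl) he (by simp)).of_eq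
    (fun r hr => ?_) rfl
  · rw [set_reg, if_neg (by omega)]
  · rw [set_reg, if_neg (by omega)]

end

/-! ### The tables of the atoms -/

section

variable {k : ℕ} {w : Word k} {Ψ : RegCQ k}

/-- The results of the preparation. -/
structure Prepared (Ψ : RegCQ k) (w : Word k) (s : State) : Prop where
  parsed : Parsed Ψ w s
  vars : HasVars Ψ w s
  can : HasCan w s
  reg : HasReg Ψ w s
  head : HasHead Ψ w s
  tree : TreeOrder (atomVars Ψ) (Ψ.body.length - 1) (ordF s) (parF s)

theorem Prepared.of_eq {s s' : State} (h : Prepared Ψ w s) (hr : ∀ r < 5, s'.reg r = s.reg r)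
    (ha : ∀ a < 8, s'.arr a = s.arr a) : Prepared Ψ w s' := by
  have ho : ordF s' = ordF s := by funext i; simp [ordF, ha 6]
  have hp : parF s' = parF s := by funext i; simp [parF, ha 7]
  refine ⟨h.parsed.of_eq hr (ha 0 (by omega)), ?_, ?_, ?_, ⟨?_, ?_⟩, by rw [ho, hp]; exact h.tree⟩
  · unfold HasVars; rw [ha 1 (by omega)]; exact h.vars
  · unfold HasCan; rw [ha 2 (by omega)]; exact h.can
  · unfold HasReg; rw [ha 3 (by omega)]; exact h.reg
  · rw [ha 5 (by omega)]; exact h.head.var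
  · rw [ha 4 (by omega)]; exact h.head.place

theorem Prepared.eval {Γ : Ctx} {s : State} (h : Prepared Ψ w s) (c : Cmd)
    (hc : (∀ r < 5, r ∉ c.regs) ∧ ∀ a < 8, a ∉ c.arrs) : Prepared Ψ w (c.eval Γ s) :=
  h.of_eq (fun r hr => c.eval_reg s (hc.1 r hr)) fun a ha => c.eval_arr s (hc.2 a ha)

theorem eval_prepC (hb : Ψ.IsBinary) (hac : Ψ.IsAcyclic) (hm : 0 < Ψ.body.length) {s : State}
    (hP : Parsed Ψ w s) : Prepared Ψ w (prepC.eval (ctx Ψ w) s) := by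
  rw [prepC, block_cons, block_cons, block_cons, block_cons, block_single]
  have V₁ := eval_varsC hP
  have P₁ := hP.eval (Γ := ctx Ψ w) varsC (by decide)
  set s₁ := varsC.eval (ctx Ψ w) s
  have C₂ := eval_canC P₁
  have P₂ := P₁.eval (Γ := ctx Ψ w) canC (by decide)
  have f₂ : (canC.eval (ctx Ψ w) s₁).arr 1 = s₁.arr 1 := canC.eval_arr s₁ (by decide)
  set s₂ := canC.eval (ctx Ψ w) s₁
  have R₃ := eval_regexC P₂
  have P₃ := P₂.eval (Γ := ctx Ψ w) regexC (by decide)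
  have f₃ : ∀ a, a = 1 ∨ a = 2 → (regexC.eval (ctx Ψ w) s₂).arr a = s₂.arr a := by
    rintro a (rfl | rfl) <;> exact regexC.eval_arr s₂ (by decide)
  set s₃ := regexC.eval (ctx Ψ w) s₂
  have V₃ : HasVars Ψ w s₃ := by
    unfold HasVars; rw [f₃ 1 (by simp), f₂]; exact V₁
  have H₄ := eval_headC P₃ V₃
  have P₄ := P₃.eval (Γ := ctx Ψ w) headC (by decide)
  have f₄ : ∀ a, a = 1 ∨ a = 2 ∨ a = 3 → (headC.eval (ctx Ψ w) s₃).arr a = s₃.arr a := by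
    rintro a (rfl | rfl | rfl) <;> exact headC.eval_arr s₃ (by decide)
  set s₄ := headC.eval (ctx Ψ w) s₃
  have V₄ : HasVars Ψ w s₄ := by
    unfold HasVars; rw [f₄ 1 (by simp)]; exact V₃
  have f₅ : ∀ a < 6, (primC.eval (ctx Ψ w) s₄).arr a = s₄.arr a := fun a ha =>
    primC.eval_arr s₄ (by revert a; decide)
  refine ⟨P₄.eval (Γ := ctx Ψ w) primC (by decide), ?_, ?_, ?_, ⟨?_, ?_⟩,
      eval_primC hb hac P₄ V₄ hm⟩
  · unfold HasVars; rw [f₅ 1 (by omega)]; exact V₄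
  · unfold HasCan; rw [f₅ 2 (by omega), f₄ 2 (by simp), f₃ 2 (by simp)]; exact C₂
  · unfold HasReg; rw [f₅ 3 (by omega), f₄ 3 (by simp)]; exact R₃
  · rw [f₅ 5 (by omega)]; exact H₄.var
  · rw [f₅ 4 (by omega)]; exact H₄.place

/-- The number of a factor: the start of its first occurrence, and its length. -/
noncomputable def code (w : Word k) (u : Word k) : ℕ × ℕ := (start w u, u.length)

theorem code_wd {u : ℕ × ℕ} (h : u.1 + u.2 ≤ w.length) :
    code w (wd w u) = (start w (wd w u), u.2) := by
  rw [code, wd_length h]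

theorem code_inj {u v : ℕ × ℕ} (hu : u.1 + u.2 ≤ w.length) (hv : v.1 + v.2 ≤ w.length) :
    code w (wd w u) = code w (wd w v) ↔ wd w u = wd w v := by
  refine ⟨fun h => ?_, fun h => by rw [h]⟩
  rw [code_wd hu, code_wd hv, Prod.mk.injEq] at h
  obtain ⟨i, l⟩ := u
  obtain ⟨i', l'⟩ := v
  obtain ⟨h1, rfl⟩ := h
  exact (start_inj hu hv).1 h1

theorem wd_code {u : ℕ × ℕ} (h : u.1 + u.2 ≤ w.length) : wd w (code w (wd w u)) = wd w u := by
  rw [code_wd h]; exact wd_start h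

theorem code_le {u : ℕ × ℕ} (h : u.1 + u.2 ≤ w.length) :
    (code w (wd w u)).1 + (code w (wd w u)).2 ≤ w.length := by
  obtain ⟨i, l⟩ := u
  have := start_le (w := w) (i := i) (l := l) h
  rw [code_wd h]
  simp only at h ⊢
  omega

/-- A triple of positions fits into the word. -/
def Fit (w : Word k) (t : ℕ × ℕ × ℕ) : Prop := t.1 + t.2.1 + t.2.2 ≤ w.length

section

variable {s : State} {e : Expr} {x j : ℕ} {t : ℕ × ℕ × ℕ}

theorem denote_spanCan (hC : HasCan w s) (ht : Fit w t) (h0 : s.reg x = t.1)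
    (h1 : s.reg (x + 1) = t.2.1) (h2 : s.reg (x + 2) = t.2.2) (he : e.denote (ctx Ψ w) s = j)
    (hj : j < 3) : (spanCan e x).denote (ctx Ψ w) s = (code w (wd w (span j t))).1 := by
  have hN := ctx_N (Ψ := Ψ) (w := w)
  obtain ⟨i, p, q⟩ := t
  simp only [Fit] at ht
  simp only [spanCan, denote_ite, holds_eq, he, denote_const, denote_arr2, denote_add, denote_reg,
    h0, h1, h2]
  interval_cases j
  · rw [if_pos rfl, min_eq_left (by omega), hC _ _ (by omega)]; rfl
  · rw [if_neg (by omega), if_pos rfl, hC _ _ (by omega)]; rfl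
  · rw [if_neg (by omega), if_neg (by omega), if_pos rfl, min_eq_left (by omega), hC _ _ (by omega)]
    rfl

theorem denote_spanLen (ht : Fit w t)
    (h1 : s.reg (x + 1) = t.2.1) (h2 : s.reg (x + 2) = t.2.2) (he : e.denote (ctx Ψ w) s = j)
    (hj : j < 3) : (spanLen e x).denote (ctx Ψ w) s = (code w (wd w (span j t))).2 := by
  have hN := ctx_N (Ψ := Ψ) (w := w)
  rw [code_wd (span_le ht j)]
  obtain ⟨i, p, q⟩ := t
  simp only [Fit] at ht
  simp only [spanLen, denote_ite, holds_eq, he, denote_const, denote_add, denote_reg, h1, h2]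
  interval_cases j
  · rw [if_pos rfl, min_eq_left (by omega)]; rfl
  · rw [if_neg (by omega), if_pos rfl]; rfl
  · rw [if_neg (by omega), if_neg (by omega), if_pos rfl]; rfl

end

/-- The triples of an atom when the first `D` variables of the head have the values with the
numbers `g`. -/
def tableSet (Ψ : RegCQ k) (w : Word k) (D : ℕ) (g : ℕ → ℕ × ℕ) (c : ℕ) : Set (ℕ × ℕ × ℕ) :=
  {t | ∃ χ, Ψ.body[c]? = some χ ∧ χ.Base w t ∧
    ∀ j < 3, ∀ h < D, Ψ.head[h]? = some (χ.sv j) → code w (wd w (span j t)) = g h}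

theorem holds_symE {s : State} {c j : ℕ} {x : ℕ} {α : List (Sym k)} (hP : Parsed Ψ w s)
    (hχ : Ψ.body[c]? = some (.eqn x α)) (h10 : s.reg 10 = c) {ei el : Expr} {i l : ℕ}
    (hi : ei.denote (ctx Ψ w) s = i) (hl : el.denote (ctx Ψ w) s = l) (hil : i + l ≤ w.length) :
    (symE (.reg 10) j (3 + 2 * j) ei el).holds (ctx Ψ w) s ↔ SymOk w α[j]? (i, l) := by
  have hc : c < Ψ.body.length := (List.getElem?_eq_some_iff.1 hχ).1
  have hN := ctx_N (Ψ := Ψ) (w := w)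
  have hle := atomPos_add_le hχ
  have hlen := encodeAtom_eqn_length (x := x) (α := α)
  have hpos : (aPos (.reg 10)).denote (ctx Ψ w) s = atomPos Ψ c := by
    simp only [denote_arr1, denote_reg, h10, hP.pos c hc]
  rw [symE, holds_ite, holds_lt, denote_lenE hχ hpos]
  simp only [denote_const, Atom.rlen, holds_ite, holds_inp eight_le_ctx_N, denote_add, hpos,
    holds_or, holds_and, holds_eq, hl, hi, holds_inpEq, denote_reg, hP.wp, hP.n]
  by_cases hj : j < α.length
  · obtain ⟨a, ha⟩ : ∃ a, α[j]? = some a := ⟨α[j], by simp [hj]⟩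
    obtain ⟨h1, h2⟩ := inp_sym (w := w) hχ ha
    have e1 : min (atomPos Ψ c + (3 + 2 * j)) ((ctx Ψ w).N - 1) = atomPos Ψ c + (3 + 2 * j) := by
      omega
    have e2 : min (1 + (atomPos Ψ c + (3 + 2 * j))) ((ctx Ψ w).N - 1) =
        atomPos Ψ c + (3 + (2 * j + 1)) := by omega
    have e3 : min (l + 1) ((ctx Ψ w).N - 1) = l + 1 := by omega
    have e4 : min (queryLen Ψ + 1 + i) ((ctx Ψ w).N - 1) = queryLen Ψ + 1 + i := by omega
    rw [e1, e2, e3, e4, h1, h2, ha]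
    cases a with
    | letter a =>
      simp only [hj, Sym.tag, Sym.num, ne_eq, not_true_eq_false, false_implies, true_and,
        not_false_eq_true, true_implies, and_true, SymOk]
      have hwl := wd_length (w := w) (u := (i, l)) hil
      simp only at hwl
      constructor
      · rintro ⟨rfl, h⟩
        rw [inp_word (by omega)] at h
        rw [wd_one (by omega)]
        have : w[i] = a := Fin.ext h.symm
        rw [this]
      · intro h
        rw [h] at hwl
        obtain rfl : 1 = l := by simpa using hwl
        refine ⟨rfl, ?_⟩
        rw [wd_one (by omega)] at h
        rw [inp_word (by omega)]
        have : w[i] = a := by simpa using h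
        rw [this]
    | var y =>
      simp only [hj, Sym.tag, Sym.num, SymOk]
      simp
      tauto
  · have : α[j]? = none := by simpa using hj
    simp [hj, SymOk]

theorem holds_conj_cons {Γ : Ctx} {e : Expr} {l : List Expr} {s : State} :
    (conj (e :: l)).holds Γ s ↔ e.holds Γ s ∧ (conj l).holds Γ s := holds_and

theorem holds_conj_nil {Γ : Ctx} {s : State} : (conj []).holds Γ s ↔ True := by
  simp [conj]

theorem code_span_eq {j j' : ℕ} {t : ℕ × ℕ × ℕ} (ht : Fit w t) :
    ((code w (wd w (span j t))).1 = (code w (wd w (span j' t))).1 ∧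
      (code w (wd w (span j t))).2 = (code w (wd w (span j' t))).2) ↔
    wd w (span j t) = wd w (span j' t) := by
  rw [← Prod.ext_iff, code_inj (span_le ht j) (span_le ht j')]

theorem holds_dupE {s : State} {c j j' : ℕ} {χ : Atom k} {t : ℕ × ℕ × ℕ} (h : Prepared Ψ w s)
    (hχ : Ψ.body[c]? = some χ) (h10 : s.reg 10 = c) (ht : Fit w t) (h11 : s.reg 11 = t.1)
    (h12 : s.reg 12 = t.2.1) (h13 : s.reg 13 = t.2.2) (hj : j < 3) (hj' : j' < 3) :
    (dupE (.reg 10) j j').holds (ctx Ψ w) s ↔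
      (χ.sv j = χ.sv j' → χ.sv j ≠ 0 → wd w (span j t) = wd w (span j' t)) := by
  simp only [dupE, holds_or, holds_not, holds_and, holds_arr2, denote_reg, h10, denote_const,
    h.vars c χ hχ j hj, h.vars c χ hχ j' hj', holds_eq, denote_arr2, ne_eq, varCode_eq_zero,
    varCode_sv_inj hχ, denote_spanCan h.can ht h11 h12 h13 (denote_const (n := j)) hj,
    denote_spanCan h.can ht h11 h12 h13 (denote_const (n := j')) hj',
    denote_spanLen ht h12 h13 (denote_const (n := j)) hj,
    denote_spanLen ht h12 h13 (denote_const (n := j')) hj', code_span_eq ht]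
  tauto

theorem holds_fixE {s : State} {c j D : ℕ} {g : ℕ → ℕ × ℕ} {χ : Atom k} {t : ℕ × ℕ × ℕ}
    (h : Prepared Ψ w s)
    (hχ : Ψ.body[c]? = some χ) (h10 : s.reg 10 = c) (ht : Fit w t) (h11 : s.reg 11 = t.1)
    (h12 : s.reg 12 = t.2.1) (h13 : s.reg 13 = t.2.2) (hj : j < 3) (hD : s.reg 20 = D)
    (hDr : D ≤ Ψ.head.length) (hg1 : ∀ h < D, s.arr 11 [h, 0, 0, 0, 0, 0] = (g h).1)
    (hg2 : ∀ h < D, s.arr 12 [h, 0, 0, 0, 0, 0] = (g h).2) :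
    (fixE (.reg 10) j).holds (ctx Ψ w) s ↔
      ∀ h < D, Ψ.head[h]? = some (χ.sv j) → code w (wd w (span j t)) = g h := by
  simp only [fixE, holds_or, holds_not, holds_and, holds_lt, holds_eq, denote_arr1, denote_arr2,
    denote_reg, h10, denote_const, hD,
    denote_spanCan h.can ht h11 h12 h13 (denote_const (n := j)) hj,
    denote_spanLen ht h12 h13 (denote_const (n := j)) hj]
  have hplace := h.head.place c χ hχ j hj
  generalize s.arr 4 [c, j, 0, 0, 0, 0] = H at hplace ⊢
  constructor
  · intro hh h' hh' he
    obtain rfl := (hplace h' (by omega)).2 he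
    rcases hh with hh | ⟨e1, e2⟩
    · exact absurd hh' hh
    · exact Prod.ext (e1.trans (hg1 _ hh')) (e2.trans (hg2 _ hh'))
  · intro hh
    by_cases hlt : H < D
    · right
      have := hh H hlt ((hplace H (by omega)).1 rfl)
      rw [this]
      exact ⟨(hg1 _ hlt).symm, (hg2 _ hlt).symm⟩
    · exact .inl hlt

theorem holds_kindE {s : State} {c : ℕ} {t : ℕ × ℕ × ℕ} {χ : Atom k}
    (h : Prepared Ψ w s) (hχ : Ψ.body[c]? = some χ) (h10 : s.reg 10 = c) (h11 : s.reg 11 = t.1)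
    (h12 : s.reg 12 = t.2.1) (h13 : s.reg 13 = t.2.2) (ht : Fit w t) :
    (Expr.ite (.inp (aPos (.reg 10)))
      ((Expr.reg 13).not.and (aReg (.reg 10) (.reg 12) (.reg 11)))
      ((symE (.reg 10) 0 3 (.reg 11) (.reg 12)).and
        (symE (.reg 10) 1 5 (.add (.reg 11) (.reg 12)) (.reg 13)))).holds (ctx Ψ w) s ↔
      (match (generalizing := false) χ with
        | .eqn _ α => SymOk w α[0]? (span 1 t) ∧ SymOk w α[1]? (span 2 t)
        | .mem _ γ => t.2.2 = 0 ∧ wd w (span 1 t) ∈ γ.matches') := by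
  have hN := ctx_N (Ψ := Ψ) (w := w)
  have hc : c < Ψ.body.length := (List.getElem?_eq_some_iff.1 hχ).1
  have hpos : (aPos (.reg 10)).denote (ctx Ψ w) s = atomPos Ψ c := by
    simp only [denote_arr1, denote_reg, h10, h.parsed.pos c hc]
  have htag : (Expr.inp (aPos (.reg 10))).holds (ctx Ψ w) s ↔ χ.tag ≠ 0 := by
    rw [holds_inp eight_le_ctx_N, hpos, inp_tag hχ]
  simp only [Fit] at ht
  rw [holds_ite, htag]
  cases χ with
  | eqn x α =>
    have e1 := holds_symE (j := 0) h.parsed hχ h10 (ei := .reg 11) (el := .reg 12)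
      (i := t.1) (l := t.2.1) (by simp [h11]) (by simp [h12]) (by omega)
    have e2 := holds_symE (j := 1) h.parsed hχ h10 (ei := .add (.reg 11) (.reg 12))
      (el := .reg 13) (i := t.1 + t.2.1) (l := t.2.2) (by simp [h11, h12]; omega)
      (by simp [h13]) (by omega)
    simp only [Atom.tag, ne_eq, not_true_eq_false, false_implies, true_and, not_false_eq_true,
      true_implies, holds_and]
    exact and_congr e1 e2
  | mem x γ =>
    have := h.reg c x γ hχ t.2.1 t.1 (by omega)
    simp only [Atom.tag, ne_eq, one_ne_zero, not_false_eq_true, true_implies, not_true_eq_false,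
      false_implies, and_true, holds_and, holds_not, holds_reg, h13, not_not, holds_arr3,
      denote_reg, h10, h12, h11] at this ⊢
    rw [this]
    exact Iff.rfl

theorem holds_baseE {s : State} {c D : ℕ} {g : ℕ → ℕ × ℕ} {t : ℕ × ℕ × ℕ}
    (h : Prepared Ψ w s) (hc : c < Ψ.body.length) (h10 : s.reg 10 = c) (h11 : s.reg 11 = t.1)
    (h12 : s.reg 12 = t.2.1) (h13 : s.reg 13 = t.2.2) (hD : s.reg 20 = D)
    (hDr : D ≤ Ψ.head.length) (hg1 : ∀ h < D, s.arr 11 [h, 0, 0, 0, 0, 0] = (g h).1)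
    (hg2 : ∀ h < D, s.arr 12 [h, 0, 0, 0, 0, 0] = (g h).2) :
    baseE.holds (ctx Ψ w) s ↔ t ∈ tableSet Ψ w D g c := by
  have hN := ctx_N (Ψ := Ψ) (w := w)
  obtain ⟨χ, hχ⟩ : ∃ χ, Ψ.body[c]? = some χ := ⟨Ψ.body[c], by simp [hc]⟩
  have hmem : t ∈ tableSet Ψ w D g c ↔ χ.Base w t ∧
      ∀ j < 3, ∀ h < D, Ψ.head[h]? = some (χ.sv j) → code w (wd w (span j t)) = g h := by
    simp [tableSet, hχ]
  rw [hmem, baseE, holds_conj_cons]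
  have hfit : (lt (.add (.reg 11) (.add (.reg 12) (.reg 13))) vN).holds (ctx Ψ w) s ↔ Fit w t := by
    simp only [holds_lt, denote_add, denote_reg, h11, h12, h13, h.parsed.n, Fit]
    omega
  rw [hfit]
  by_cases ht : Fit w t
  swap
  · exact ⟨fun h => absurd h.1 ht, fun h => absurd h.1.1 ht⟩
  have hkind := holds_kindE h hχ h10 h11 h12 h13 ht
  have huniv : ((aVar (.reg 10) k0).or (eq (.add (.add (.reg 12) (.reg 13)) k1) vN)).holds
      (ctx Ψ w) s ↔ (χ.sv 0 = 0 → t.2.1 + t.2.2 = w.length) := by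
    simp only [Fit] at ht
    simp only [holds_or, holds_arr2, denote_reg, denote_const, h10, h.vars c χ hχ 0 (by omega),
        ne_eq,
      varCode_eq_zero, holds_eq, denote_add, h12, h13, h.parsed.n]
    rw [min_eq_left (a := t.2.1 + t.2.2) (by omega), min_eq_left (by omega)]
    by_cases h0 : χ.sv 0 = 0 <;> simp [h0]
  simp only [holds_conj_cons, holds_conj_nil, hkind, huniv,
    holds_dupE h hχ h10 ht h11 h12 h13 (j := 0) (j' := 1) (by omega) (by omega),
    holds_dupE h hχ h10 ht h11 h12 h13 (j := 0) (j' := 2) (by omega) (by omega),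
    holds_dupE h hχ h10 ht h11 h12 h13 (j := 1) (j' := 2) (by omega) (by omega),
    holds_fixE h hχ h10 ht h11 h12 h13 (j := 0) (by omega) hD hDr hg1 hg2,
    holds_fixE h hχ h10 ht h11 h12 h13 (j := 1) (by omega) hD hDr hg1 hg2,
    holds_fixE h hχ h10 ht h11 h12 h13 (j := 2) (by omega) hD hDr hg1 hg2]
  constructor
  · rintro ⟨-, a2, a3, d01, d02, d12, f0, f1, f2, -⟩
    refine ⟨⟨ht, a2, a3, fun j hj j' hj' => ?_⟩, fun j hj => ?_⟩
    · interval_cases j <;> interval_cases j' <;> intro e h0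
      · rfl
      · exact d01 e h0
      · exact d02 e h0
      · exact (d01 e.symm (e ▸ h0)).symm
      · rfl
      · exact d12 e h0
      · exact (d02 e.symm (e ▸ h0)).symm
      · exact (d12 e.symm (e ▸ h0)).symm
      · rfl
    · interval_cases j
      exacts [f0, f1, f2]
  · rintro ⟨⟨-, a2, a3, d⟩, f⟩
    exact ⟨ht, a2, a3, d 0 (by omega) 1 (by omega), d 0 (by omega) 2 (by omega),
      d 1 (by omega) 2 (by omega), f 0 (by omega), f 1 (by omega), f 2 (by omega), trivial⟩

end

/-! ### Computing the reduced tables -/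

section

variable {k : ℕ} {w : Word k} {Ψ : RegCQ k}

/-- The tables in the array `8` represent the sets `R` of triples. -/
def HasTab (Ψ : RegCQ k) (w : Word k) (R : ℕ → Set (ℕ × ℕ × ℕ)) (s : State) : Prop :=
  ∀ c < Ψ.body.length, ∀ i < w.length + 1, ∀ p < w.length + 1, ∀ q < w.length + 1,
    (s.arr 8 [c, i, p, q, 0, 0] ≠ 0 ↔ (i, p, q) ∈ R c)

/-- The value of a variable of the atom with the number `c` under a triple. -/
noncomputable def tval (Ψ : RegCQ k) (w : Word k) (c : ℕ) (t : ℕ × ℕ × ℕ) (x : ℕ) : Word k :=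
  match Ψ.body[c]? with
  | some χ => χ.val w t x
  | none => []

/-- The first variables of the head, whose number is the scalar variable `20`, have the values with
the numbers `g`. -/
structure Fixed (Ψ : RegCQ k) (D : ℕ) (g : ℕ → ℕ × ℕ) (s : State) : Prop where
  reg : s.reg 20 = D
  le : D ≤ Ψ.head.length
  fst : ∀ h < D, s.arr 11 [h, 0, 0, 0, 0, 0] = (g h).1
  snd : ∀ h < D, s.arr 12 [h, 0, 0, 0, 0, 0] = (g h).2

theorem tableSet_fit {D c : ℕ} {g : ℕ → ℕ × ℕ} {t : ℕ × ℕ × ℕ} (h : t ∈ tableSet Ψ w D g c) :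
    Fit w t := by
  obtain ⟨χ, -, h, -⟩ := h
  exact h.1

theorem eval_initC {s : State} {D : ℕ} {g : ℕ → ℕ × ℕ} (h : Prepared Ψ w s) (hD : Fixed Ψ D g s) :
    HasTab Ψ w (tableSet Ψ w D g) (initC.eval (ctx Ψ w) s) := by
  obtain ⟨A, hA, h1, -⟩ := eval_fill (Γ := ctx Ψ w) (L := [(10, vM), (11, vN), (12, vN), (13, vN)])
    (a := 8) (e₁ := .reg 10) (e₂ := .reg 11) (e₃ := .reg 12) (e₄ := .reg 13) (e₅ := k0) (e₆ := k0)
    (e := baseE) (loopsOk_iff.2 rfl) (by decide) (by decide) s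
    (bs := [Ψ.body.length, w.length + 1, w.length + 1, w.length + 1])
    (by simp [h.parsed.m, h.parsed.n]) (by
      simp only [mem_tuples_cons, mem_tuples_nil]
      rintro _ ⟨c, -, _, ⟨i, -, _, ⟨p, -, _, ⟨q, -, _, rfl, rfl⟩, rfl⟩, rfl⟩, rfl⟩
        _ ⟨c', -, _, ⟨i', -, _, ⟨p', -, _, ⟨q', -, _, rfl, rfl⟩, rfl⟩, rfl⟩, rfl⟩ e
      obtain ⟨rfl, rfl, rfl, rfl⟩ : c = c' ∧ i = i' ∧ p = p' ∧ q = q' := by simpa [cell] using e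
      rfl)
  intro c hc i hi p hp q hq
  have e : initC.eval (ctx Ψ w) s = s.withArr 8 A := hA
  have := h1 [c, i, p, q] (by simp; omega)
  simp only [cell, List.map_cons, List.map_nil, sets_cons, sets_nil, denote_reg, set_reg,
    Nat.reduceEqDiff, if_true, if_false, denote_const] at this
  rw [e, withArr_arr, if_pos rfl, this]
  refine holds_baseE (t := (i, p, q)) (h.of_eq (fun r hr => ?_) fun a _ => rfl) hc ?_ ?_ ?_ ?_ ?_
    hD.le hD.fst hD.snd
  · simp only [set_reg]
    rw [if_neg (by omega), if_neg (by omega), if_neg (by omega), if_neg (by omega)]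
  all_goals simp [hD.reg]

/-- The slot that provides the value of the variable in the slot `j` of `χ`, if this is a common
variable of `χ` and `δ`, in one of these atoms; `3` otherwise. -/
noncomputable def keySlot (χ δ ξ : Atom k) (j : ℕ) : ℕ :=
  open Classical in
  if χ.sv j ≠ 0 ∧ ∃ t < 3, δ.sv t = χ.sv j then lb 3 fun t => ξ.sv t = χ.sv j else 3

theorem denote_sharedSlot {s : State} (hV : HasVars Ψ w s) {a b c j : ℕ} {x : Expr} {χ δ ξ : Atom k}
    (ha : Ψ.body[a]? = some χ) (hb : Ψ.body[b]? = some δ) (hξ : Ψ.body[c]? = some ξ)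
    (h6 : s.reg 6 = a) (h7 : s.reg 7 = b) (hx : ∀ i, x.denote (ctx Ψ w) (s.set 13 i) = c)
    (hj : j < 3) :
    (sharedSlot (.reg 6) (.reg 7) x j).denote (ctx Ψ w) s = keySlot χ δ ξ j := by
  have e : ∀ i d (ε : Atom k), Ψ.body[d]? = some ε → i < 3 → (s.arr 1 [d, i, 0, 0, 0, 0] =
      s.arr 1 [a, j, 0, 0, 0, 0] ↔ ε.sv i = χ.sv j) := fun i d ε hd hi => by
    rw [hV _ _ ha j hj, hV _ _ hd i hi, varCode_sv_inj hd]
  have hc : ((aVar (.reg 6) (.const j)).and (any 13 (.const 3)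
      (eq (aVar (.reg 7) (.reg 13)) (aVar (.reg 6) (.const j))))).holds (ctx Ψ w) s ↔
      χ.sv j ≠ 0 ∧ ∃ t < 3, δ.sv t = χ.sv j := by
    simp only [holds_and, holds_arr2, denote_reg, h6, h7, denote_const, ne_eq, holds_any, holds_eq,
      denote_arr2, set_reg, set_arr, reduceIte, Nat.reduceEqDiff]
    refine and_congr ?_ (exists_congr fun i => and_congr_right fun hi => e i b δ hb hi)
    rw [hV _ _ ha j hj, varCode_eq_zero]
  rw [sharedSlot, denote_ite, keySlot]
  by_cases h : χ.sv j ≠ 0 ∧ ∃ t < 3, δ.sv t = χ.sv j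
  · rw [if_pos (hc.2 h), if_pos h]
    simp only [denote_find, holds_eq, denote_arr2, denote_reg, set_reg, set_arr, reduceIte,
      Nat.reduceEqDiff, h6, denote_const, hx]
    exact lb_congr fun i hi => e i c ξ hξ hi
  · rw [if_neg fun h' => h (hc.1 h'), if_neg h, denote_const]

/-- The number of the value in a slot, and a default value for the slot `3`. -/
noncomputable def key (w : Word k) (j : ℕ) (t : ℕ × ℕ × ℕ) : ℕ × ℕ :=
  if j < 3 then code w (wd w (span j t)) else (0, 0)

theorem denote_key {s : State} (hC : HasCan w s) {e : Expr} {x j : ℕ} {t : ℕ × ℕ × ℕ} (ht : Fit w t)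
    (h0 : s.reg x = t.1) (h1 : s.reg (x + 1) = t.2.1) (h2 : s.reg (x + 2) = t.2.2)
    (he : e.denote (ctx Ψ w) s = j) :
    (spanCan e x).denote (ctx Ψ w) s = (key w j t).1 ∧
      (spanLen e x).denote (ctx Ψ w) s = (key w j t).2 := by
  unfold key
  split
  · rename_i hj
    exact ⟨denote_spanCan hC ht h0 h1 h2 he hj, denote_spanLen ht h1 h2 he hj⟩
  · simp only [spanCan, spanLen, denote_ite, holds_eq, he, denote_const]
    rw [if_neg (by omega), if_neg (by omega), if_neg (by omega), if_neg (by omega),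
      if_neg (by omega), if_neg (by omega)]
    simp

theorem tval_eq {c x : ℕ} {χ : Atom k} {t : ℕ × ℕ × ℕ} (h : Ψ.body[c]? = some χ) :
    tval Ψ w c t x = χ.val w t x := by simp [tval, h]

/-- Triples are compatible if and only if the numbers of the values of their common variables
agree. -/
theorem key_eq_iff (hb : Ψ.IsBinary) {a b : ℕ} {χ δ : Atom k} {t t' : ℕ × ℕ × ℕ}
    (ha : Ψ.body[a]? = some χ) (hδ : Ψ.body[b]? = some δ) (ht : Fit w t) (ht' : Fit w t') :
    (∀ j < 3, key w (keySlot χ δ χ j) t = key w (keySlot χ δ δ j) t') ↔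
      Compat (atomVars Ψ) (tval Ψ w) a b t t' := by
  have main : ∀ j < 3, χ.sv j ≠ 0 → (∃ i < 3, δ.sv i = χ.sv j) →
      (key w (keySlot χ δ χ j) t = key w (keySlot χ δ δ j) t' ↔
        χ.val w t (χ.sv j) = δ.val w t' (χ.sv j)) := by
    intro j hj h0 hd
    have l1 : (lb 3 fun t => χ.sv t = χ.sv j) < 3 := lb_lt_iff.2 ⟨j, hj, rfl⟩
    have l2 : (lb 3 fun t => δ.sv t = χ.sv j) < 3 := lb_lt_iff.2 hd
    simp only [keySlot]
    rw [if_pos ⟨h0, hd⟩, if_pos ⟨h0, hd⟩, key, key, if_pos l1, if_pos l2,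
      code_inj (span_le ht _) (span_le ht' _)]
    rfl
  constructor
  · rintro h x ⟨hx, hx'⟩
    obtain ⟨h0, j, hj, rfl⟩ := (mem_atomVars hb ha).1 hx
    rw [tval_eq ha, tval_eq hδ]
    exact (main j hj h0 ((mem_atomVars hb hδ).1 hx').2).1 (h j hj)
  · intro h j hj
    by_cases hs : χ.sv j ≠ 0 ∧ ∃ i < 3, δ.sv i = χ.sv j
    · refine (main j hj hs.1 hs.2).2 ?_
      have := h (χ.sv j) ⟨(mem_atomVars hb ha).2 ⟨hs.1, j, hj, rfl⟩, (mem_atomVars hb hδ).2 hs⟩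
      rwa [tval_eq ha, tval_eq hδ] at this
    · rw [keySlot, keySlot, if_neg hs, if_neg hs]
      rfl

/-- The cell of the marks for a triple, if the slots are in the scalar variables from `r` on. -/
theorem cell_mark {s : State} (hC : HasCan w s) {r : ℕ} (hr : 13 ≤ r) {u : ℕ → ℕ}
    (hu : ∀ j < 3, s.reg (r + j) = u j) {i p q : ℕ} (ht : Fit w (i, p, q)) :
    cell (ctx Ψ w) (spanCan (.reg r) 10) (spanLen (.reg r) 10) (spanCan (.reg (r + 1)) 10)
      (spanLen (.reg (r + 1)) 10) (spanCan (.reg (r + 2)) 10) (spanLen (.reg (r + 2)) 10)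
      (s.sets [10, 11, 12] [i, p, q]) =
    [(key w (u 0) (i, p, q)).1, (key w (u 0) (i, p, q)).2, (key w (u 1) (i, p, q)).1,
      (key w (u 1) (i, p, q)).2, (key w (u 2) (i, p, q)).1, (key w (u 2) (i, p, q)).2] := by
  have hk : ∀ j < 3, (spanCan (.reg (r + j)) 10).denote (ctx Ψ w) (s.sets [10, 11, 12] [i, p, q]) =
      (key w (u j) (i, p, q)).1 ∧ (spanLen (.reg (r + j)) 10).denote (ctx Ψ w)
        (s.sets [10, 11, 12] [i, p, q]) = (key w (u j) (i, p, q)).2 := fun j hj =>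
    denote_key (s := s.sets [10, 11, 12] [i, p, q]) (x := 10) hC ht
        (by simp) (by simp) (by simp) (by
      simp only [denote_reg, sets_cons, sets_nil, set_reg]
      rw [if_neg (by omega), if_neg (by omega), if_neg (by omega), hu j hj])
  have h0 := hk 0 (by omega)
  have h1 := hk 1 (by omega)
  have h2 := hk 2 (by omega)
  rw [add_zero] at h0
  simp only [cell, h0, h1, h2]

theorem cell_mark_eq {w : Word k} {u v : ℕ → ℕ} {t t' : ℕ × ℕ × ℕ} :
    [(key w (u 0) t).1, (key w (u 0) t).2, (key w (u 1) t).1, (key w (u 1) t).2,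
      (key w (u 2) t).1, (key w (u 2) t).2] = [(key w (v 0) t').1, (key w (v 0) t').2,
      (key w (v 1) t').1, (key w (v 1) t').2, (key w (v 2) t').1, (key w (v 2) t').2] ↔
    ∀ j < 3, key w (u j) t = key w (v j) t' := by
  simp only [List.cons.injEq, and_true]
  constructor
  · rintro ⟨h1, h2, h3, h4, h5, h6⟩ j hj
    interval_cases j
    exacts [Prod.ext h1 h2, Prod.ext h3 h4, Prod.ext h5 h6]
  · intro h
    rw [h 0 (by omega), h 1 (by omega), h 2 (by omega)]
    simp

/-- The semijoin is computed by marking the cells of the common values of all triples of `b`, and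
looking up the cells of the triples of `a`. -/
theorem eval_semijoinC (hb : Ψ.IsBinary) {s : State} {R : ℕ → Set (ℕ × ℕ × ℕ)} {a b : ℕ}
    (h : Prepared Ψ w s) (hT : HasTab Ψ w R s) (hR : ∀ c, ∀ t ∈ R c, Fit w t)
    (ha : a < Ψ.body.length) (hbm : b < Ψ.body.length) (h6 : s.reg 6 = a) (h7 : s.reg 7 = b) :
    HasTab Ψ w (semijoin (atomVars Ψ) (tval Ψ w) a b R) (semijoinC.eval (ctx Ψ w) s) := by
  obtain ⟨χ, hχ⟩ : ∃ χ, Ψ.body[a]? = some χ := ⟨Ψ.body[a], by simp [ha]⟩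
  obtain ⟨δ, hδ⟩ : ∃ δ, Ψ.body[b]? = some δ := ⟨Ψ.body[b], by simp [hbm]⟩
  set s₁ := (((((s.set 30 (keySlot χ δ χ 0)).set 31 (keySlot χ δ χ 1)).set 32
    (keySlot χ δ χ 2)).set 33 (keySlot χ δ δ 0)).set 34 (keySlot χ δ δ 1)).set 35
    (keySlot χ δ δ 2) with hs₁
  have r₁ : ∀ r < 30, s₁.reg r = s.reg r := by
    intro r hr
    simp only [hs₁, set_reg]
    repeat rw [if_neg (by omega)]
  have a₁ : s₁.arr = s.arr := rfl
  have ua : ∀ j < 3, s₁.reg (30 + j) = keySlot χ δ χ j := by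
    intro j hj; interval_cases j <;> simp [hs₁]
  have ub : ∀ j < 3, s₁.reg (33 + j) = keySlot χ δ δ j := by
    intro j hj; interval_cases j <;> simp [hs₁]
  have hbs : ∀ s', s'.reg 0 = s₁.reg 0 → loops3.map (fun p => p.2.denote (ctx Ψ w) s') =
      [w.length + 1, w.length + 1, w.length + 1] := by
    intro s' e
    simp [e, r₁ 0, h.parsed.n]
  obtain ⟨A, hA, hA1, -⟩ := eval_fill (Γ := ctx Ψ w) (L := loops3) (a := 9)
    (e₁ := spanCan (.reg 30) 10) (e₂ := spanLen (.reg 30) 10) (e₃ := spanCan (.reg (30 + 1)) 10)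
    (e₄ := spanLen (.reg (30 + 1)) 10) (e₅ := spanCan (.reg (30 + 2)) 10)
    (e₆ := spanLen (.reg (30 + 2)) 10) (e := k0) (loopsOk_iff.2 rfl) (by decide) (by decide) s₁
    (hbs _ rfl) (fun _ _ _ _ _ => rfl)
  obtain ⟨B, hB, hB1⟩ := eval_mark (Γ := ctx Ψ w) (L := loops3) (a := 9)
    (e₁ := spanCan (.reg 33) 10) (e₂ := spanLen (.reg 33) 10) (e₃ := spanCan (.reg (33 + 1)) 10)
    (e₄ := spanLen (.reg (33 + 1)) 10) (e₅ := spanCan (.reg (33 + 2)) 10)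
    (e₆ := spanLen (.reg (33 + 2)) 10) (g := aTab (.reg 7) (.reg 10) (.reg 11) (.reg 12))
    (loopsOk_iff.2 rfl) (by decide) (by decide) (s₁.withArr 9 A) (hbs _ rfl)
  set s₃ := s₁.withArr 9 B with hs₃
  -- the marks at the cell of a triple of `a`
  have mark : ∀ i < w.length + 1, ∀ p < w.length + 1, ∀ q < w.length + 1, (i, p, q) ∈ R a →
      (B (cell (ctx Ψ w) (spanCan (.reg 30) 10) (spanLen (.reg 30) 10) (spanCan (.reg (30 + 1)) 10)
        (spanLen (.reg (30 + 1)) 10) (spanCan (.reg (30 + 2)) 10) (spanLen (.reg (30 + 2)) 10)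
        (s₁.sets [10, 11, 12] [i, p, q])) ≠ 0 ↔
      ∃ t' ∈ R b, Compat (atomVars Ψ) (tval Ψ w) a b (i, p, q) t') := by
    intro i hi p hp q hq ht
    have h0 := hA1 [i, p, q] (by simp; omega)
    rw [hB1]
    simp only [withArr_arr, if_true, List.map_cons, List.map_nil] at h0 ⊢
    rw [h0]
    simp only [denote_const, ne_eq, not_true_eq_false, false_or, mem_tuples_cons, mem_tuples_nil]
    have tb : ∀ i < w.length + 1, ∀ p < w.length + 1, ∀ q < w.length + 1,
        ((aTab (.reg 7) (.reg 10) (.reg 11) (.reg 12)).denote (ctx Ψ w)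
          ((s₁.withArr 9 A).sets [10, 11, 12] [i, p, q]) ≠ 0 ↔ (i, p, q) ∈ R b) := by
      intro i hi p hp q hq
      rw [← hT b hbm i hi p hp q hq]
      simp [r₁ 7, h7, a₁]
    constructor
    · rintro ⟨_, ⟨i', hi', _, ⟨p', hp', _, ⟨q', hq', _, rfl, rfl⟩, rfl⟩, rfl⟩, e, hb'⟩
      have ht' := (tb i' hi' p' hp' q' hq').1 hb'
      refine ⟨_, ht', (key_eq_iff hb hχ hδ (hR _ _ ht) (hR _ _ ht')).1 ?_⟩
      rw [cell_mark (s := s₁) (u := keySlot χ δ χ) h.can (by omega) ua (hR _ _ ht),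
        cell_mark (s := s₁.withArr 9 A) (r := 33) (u := keySlot χ δ δ) h.can (by omega) ub
          (hR _ _ ht')] at e
      exact cell_mark_eq.1 e.symm
    · rintro ⟨⟨i', p', q'⟩, ht', hc⟩
      have hf := hR _ _ ht'
      simp only [Fit] at hf
      refine ⟨_, ⟨i', by omega, _, ⟨p', by omega, _, ⟨q', by omega, _, rfl, rfl⟩, rfl⟩, rfl⟩, ?_,
        (tb i' (by omega) p' (by omega) q' (by omega)).2 ht'⟩
      rw [cell_mark (s := s₁) (u := keySlot χ δ χ) h.can (by omega) ua (hR _ _ ht),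
        cell_mark (s := s₁.withArr 9 A) (r := 33) (u := keySlot χ δ δ) h.can (by omega) ub
          (hR _ _ ht')]
      exact (cell_mark_eq.2 ((key_eq_iff hb hχ hδ (hR _ _ ht) (hR _ _ ht')).2 hc)).symm
  obtain ⟨C, hC, hC1, hC2⟩ := eval_fill_rec (Γ := ctx Ψ w) (L := loops3) (a := 8)
    (e₁ := .reg 6) (e₂ := .reg 10) (e₃ := .reg 11) (e₄ := .reg 12) (e₅ := k0) (e₆ := k0)
    (e := (markArr 30).and (aTab (.reg 6) (.reg 10) (.reg 11) (.reg 12))) (loopsOk_iff.2 rfl)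
    (by decide) s₃ (hbs _ rfl) (by
      simp only [mem_tuples_cons, mem_tuples_nil]
      rintro _ ⟨i, -, _, ⟨p, -, _, ⟨q, -, _, rfl, rfl⟩, rfl⟩, rfl⟩
        _ ⟨i', -, _, ⟨p', -, _, ⟨q', -, _, rfl, rfl⟩, rfl⟩, rfl⟩ e
      obtain ⟨rfl, rfl, rfl⟩ : i = i' ∧ p = p' ∧ q = q' := by simpa [cell] using e
      rfl)
    (R := fun ks v => ∀ i p q, ks = [i, p, q] →
      (v ≠ 0 ↔ (i, p, q) ∈ semijoin (atomVars Ψ) (tval Ψ w) a b R a)) (by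
      simp only [mem_tuples_cons, mem_tuples_nil]
      rintro _ ⟨i, hi, _, ⟨p, hp, _, ⟨q, hq, _, rfl, rfl⟩, rfl⟩, rfl⟩ C - hC i' p' q' e
      obtain ⟨rfl, rfl, rfl⟩ : i = i' ∧ p = p' ∧ q = q' := by simpa using e
      have hC' : C [a, i, p, q, 0, 0] = s.arr 8 [a, i, p, q, 0, 0] := by
        simpa [cell, hs₃, r₁ 6, h6, a₁] using hC
      rw [mem_semijoin_self]
      change (Expr.and _ _).holds _ _ ↔ _
      rw [holds_and, and_comm]
      have t1 : (aTab (.reg 6) (.reg 10) (.reg 11) (.reg 12)).holds (ctx Ψ w)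
          ((s₃.sets (loops3.map Prod.fst) [i, p, q]).withArr 8 C) ↔ (i, p, q) ∈ R a := by
        rw [← hT a ha i hi p hp q hq, ← hC']
        simp [hs₃, r₁ 6, h6]
      rw [t1]
      refine and_congr_right fun ht => ?_
      rw [← mark i hi p hp q hq ht, Expr.holds, Expr.denote_withArr _ _ _ (by decide),
        hs₃, State.sets_withArr]
      have : cell (ctx Ψ w) (spanCan (.reg 30) 10) (spanLen (.reg 30) 10)
          (spanCan (.reg (30 + 1)) 10) (spanLen (.reg (30 + 1)) 10) (spanCan (.reg (30 + 2)) 10)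
          (spanLen (.reg (30 + 2)) 10) (s₁.sets [10, 11, 12] [i, p, q]) =
          cell (ctx Ψ w) (spanCan (.reg 30) 10) (spanLen (.reg 30) 10)
          (spanCan (.reg (30 + 1)) 10) (spanLen (.reg (30 + 1)) 10) (spanCan (.reg (30 + 2)) 10)
          (spanLen (.reg (30 + 2)) 10) ((s₁.sets [10, 11, 12] [i, p, q]).withArr 9 B) :=
        (cell_withArr (by decide) _ _).symm
      rw [this]
      simp [markArr, Expr.denote, cell, State.withArr])
  have e : semijoinC.eval (ctx Ψ w) s = s₃.withArr 8 C := by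
    have d : ∀ j < 3, ∀ s' : State, s'.arr = s.arr → s'.reg 6 = s.reg 6 → s'.reg 7 = s.reg 7 →
        (sharedSlot (.reg 6) (.reg 7) (.reg 6) j).denote (ctx Ψ w) s' = keySlot χ δ χ j ∧
        (sharedSlot (.reg 6) (.reg 7) (.reg 7) j).denote (ctx Ψ w) s' = keySlot χ δ δ j := by
      intro j hj s' e1 e2 e3
      have hV : HasVars Ψ w s' := by unfold HasVars; rw [e1]; exact h.vars
      exact ⟨denote_sharedSlot hV hχ hδ hχ (e2.trans h6) (e3.trans h7) (by simp [e2, h6]) hj,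
        denote_sharedSlot hV hχ hδ hδ (e2.trans h6) (e3.trans h7) (by simp [e3, h7]) hj⟩
    rw [semijoinC]
    simp only [block_cons, block_single, eval_assign]
    rw [(d 0 (by omega) s rfl rfl rfl).1, (d 1 (by omega) (s.set 30 _) rfl rfl rfl).1,
      (d 2 (by omega) ((s.set 30 _).set 31 _) rfl rfl rfl).1,
      (d 0 (by omega) (((s.set 30 _).set 31 _).set 32 _) rfl rfl rfl).2,
      (d 1 (by omega) ((((s.set 30 _).set 31 _).set 32 _).set 33 _) rfl rfl rfl).2,
      (d 2 (by omega) (((((s.set 30 _).set 31 _).set 32 _).set 33 _).set 34 _) rfl rfl rfl).2,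
      ← hs₁]
    have e1 : (Cmd.loops loops3 (markStore 30 k0)).eval (ctx Ψ w) s₁ = s₁.withArr 9 A := hA
    have e2 : (Cmd.loops loops3 (markStore 33 (.ite (aTab (.reg 7) (.reg 10) (.reg 11) (.reg 12))
        k1 (markArr 33)))).eval (ctx Ψ w) (s₁.withArr 9 A) = s₃ := by
      rw [hs₃, ← State.withArr_withArr s₁ 9 A B]; exact hB
    rw [e1, e2]
    exact hC
  intro c hc i hi p hp q hq
  rw [e, withArr_arr, if_pos rfl]
  by_cases hca : c = a
  · subst hca
    rw [← hC1 [i, p, q] (by simp; omega) i p q rfl]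
    simp [cell, hs₃, r₁ 6, h6]
  · rw [semijoin_of_ne R hca, hC2, ← hT c hc i hi p hp q hq]
    · simp [hs₃, a₁]
    · simp only [mem_tuples_cons, mem_tuples_nil]
      rintro _ ⟨i', -, _, ⟨p', -, _, ⟨q', -, _, rfl, rfl⟩, rfl⟩, rfl⟩ e
      simp [cell, hs₃, r₁ 6, h6] at e
      exact hca e.1

theorem fit_semijoin {R : ℕ → Set (ℕ × ℕ × ℕ)} (hR : ∀ c, ∀ t ∈ R c, Fit w t) (a b : ℕ) :
    ∀ c, ∀ t ∈ semijoin (atomVars Ψ) (tval Ψ w) a b R c, Fit w t :=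
  fun c _ ht => hR c _ (semijoin_subset a b R c ht)

theorem TreeOrder.par_le {vs : ℕ → Set ℕ} {M : ℕ} {ord par : ℕ → ℕ} (h : TreeOrder vs M ord par)
    {e : ℕ} (he : e < M) : par e ≤ M := by
  rcases h.parent e he with h0 | ⟨e', h1, h2⟩
  · omega
  · rw [h2]; exact h.ord_le e' (by omega)

/-- A loop of semijoins. -/
theorem eval_semijoins (hb : Ψ.IsBinary) {s : State} {R : ℕ → Set (ℕ × ℕ × ℕ)}
    (h : Prepared Ψ w s) (hT : HasTab Ψ w R s) (hR : ∀ c, ∀ t ∈ R c, Fit w t)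
    {a b : ℕ → ℕ} {ea eb : Expr} {d : Cmd}
    (hd : d = .loop 14 (.sub vM k1) (.block [.assign 6 ea, .assign 7 eb, semijoinC]))
    (hab : ∀ e < Ψ.body.length - 1, a e < Ψ.body.length ∧ b e < Ψ.body.length)
    (hea : ∀ e < Ψ.body.length - 1, ∀ s', Prepared Ψ w s' → ordF s' = ordF s → parF s' = parF s →
      s'.reg 14 = e → ea.denote (ctx Ψ w) s' = a e ∧ eb.denote (ctx Ψ w) (s'.set 6 (a e)) = b e) :
    Prepared Ψ w (d.eval (ctx Ψ w) s) ∧ HasTab Ψ w (iter (fun e =>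
      semijoin (atomVars Ψ) (tval Ψ w) (a e) (b e)) (Ψ.body.length - 1) R) (d.eval (ctx Ψ w) s) ∧
    (∀ c, ∀ t ∈ iter (fun e => semijoin (atomVars Ψ) (tval Ψ w) (a e) (b e))
      (Ψ.body.length - 1) R c, Fit w t) ∧
    ordF (d.eval (ctx Ψ w) s) = ordF s ∧ parF (d.eval (ctx Ψ w) s) = parF s := by
  subst hd
  rw [eval_loop, show (Expr.sub vM k1).denote (ctx Ψ w) s = Ψ.body.length - 1 by
    simp [h.parsed.m]]
  refine iter_inv (fun e s' => Prepared Ψ w s' ∧ HasTab Ψ w (iter (fun e =>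
      semijoin (atomVars Ψ) (tval Ψ w) (a e) (b e)) e R) s' ∧
      (∀ c, ∀ t ∈ iter (fun e => semijoin (atomVars Ψ) (tval Ψ w) (a e) (b e)) e R c, Fit w t) ∧
      ordF s' = ordF s ∧ parF s' = parF s) ⟨h, hT, hR, rfl, rfl⟩
          fun e he s' ⟨i1, i2, i3, i4, i5⟩ => ?_
  have P₁ : Prepared Ψ w (s'.set 14 e) := i1.of_eq (fun r hr => by
    rw [set_reg, if_neg (by omega)]) fun _ _ => rfl
  obtain ⟨e1, e2⟩ := hea e he _ P₁ i4 i5 (by simp)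
  simp only [block_cons, block_single, eval_assign]
  rw [e1, e2]
  set s₁ := ((s'.set 14 e).set 6 (a e)).set 7 (b e)
  have P₂ : Prepared Ψ w s₁ := P₁.of_eq (fun r hr => by
    rw [set_reg, set_reg, if_neg (by omega), if_neg (by omega)]) fun _ _ => rfl
  have T := eval_semijoinC hb P₂ i2 i3 (hab e he).1 (hab e he).2 (by simp [s₁]) (by simp [s₁])
  have P₃ := P₂.eval (Γ := ctx Ψ w) semijoinC (by decide)
  have a6 : (semijoinC.eval (ctx Ψ w) s₁).arr 6 = s'.arr 6 := semijoinC.eval_arr s₁ (by decide)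
  have a7 : (semijoinC.eval (ctx Ψ w) s₁).arr 7 = s'.arr 7 := semijoinC.eval_arr s₁ (by decide)
  refine ⟨P₃.of_eq (fun r hr => by rw [set_reg, if_neg (by omega)]) fun _ _ => rfl, T,
    fit_semijoin i3 _ _, ?_, ?_⟩
  · rw [← i4]; funext i; simp only [ordF, set_arr, a6]
  · rw [← i5]; funext i; simp only [parF, set_arr, a7]

/-- The tables are fully reduced. -/
theorem eval_solveC (hb : Ψ.IsBinary) {s : State} {D : ℕ} {g : ℕ → ℕ × ℕ} (h : Prepared Ψ w s)
    (hD : Fixed Ψ D g s) (hm : 0 < Ψ.body.length) :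
    HasTab Ψ w (reduce (atomVars Ψ) (tval Ψ w) (Ψ.body.length - 1) (ordF s) (parF s)
      (tableSet Ψ w D g)) (solveC.eval (ctx Ψ w) s) := by
  have T := eval_initC h hD
  have P := h.eval (Γ := ctx Ψ w) initC (by decide)
  have o : ordF (initC.eval (ctx Ψ w) s) = ordF s := by
    funext i; simp only [ordF, initC.eval_arr s (show 6 ∉ initC.arrs by decide)]
  have p : parF (initC.eval (ctx Ψ w) s) = parF s := by
    funext i; simp only [parF, initC.eval_arr s (show 7 ∉ initC.arrs by decide)]
  rw [solveC, block_cons, block_cons, block_single]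
  set s₁ := initC.eval (ctx Ψ w) s
  have hle : ∀ e < Ψ.body.length - 1, ordF s e < Ψ.body.length ∧ parF s e < Ψ.body.length :=
    fun e he => ⟨by have := h.tree.ord_le e he; omega, by have := h.tree.par_le he; omega⟩
  obtain ⟨P₂, T₂, F₂, o₂, p₂⟩ := eval_semijoins hb P T (fun c t => tableSet_fit)
    (a := fun k => parF s (Ψ.body.length - 1 - 1 - k)) (b := fun k =>
    ordF s (Ψ.body.length - 1 - 1 - k)) (d := upC) rfl (fun e he =>
      ⟨(hle _ (by omega)).2, (hle _ (by omega)).1⟩) fun e he s' P' o' p' h14 => by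
    rw [o] at o'
    rw [p] at p'
    rw [← o', ← p']
    simp [ordF, parF, P'.parsed.m, h14]
  obtain ⟨-, T₃, -⟩ := eval_semijoins hb P₂ T₂ F₂ (a := ordF s) (b := parF s)
    (d := downC) rfl hle fun e he s' P' o' p' h14 => by
    rw [o₂, o] at o'
    rw [p₂, p] at p'
    rw [← o', ← p']
    simp [ordF, parF, h14]
  exact T₃

end

/-! ### Results and reduced tables -/

section

variable {k : ℕ} {w : Word k} {Ψ : RegCQ k}

/-- The substitutions for `w` that satisfy all atoms. -/
def Sol (Ψ : RegCQ k) (w : Word k) : Set (Subst k) := {σ | σ 0 = w ∧ ∀ χ ∈ Ψ.body, χ.Sat σ}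

/-- The numbers of the values of the variables of the head under a substitution. -/
noncomputable def headCode (Ψ : RegCQ k) (w : Word k) (σ : Subst k) (h : ℕ) : ℕ × ℕ :=
  code w (σ (Ψ.head.getD h 0))

theorem Atom.isBinary_of_mem (hb : Ψ.IsBinary) {χ : Atom k} (h : χ ∈ Ψ.body) : χ.IsBinary := by
  cases χ with
  | eqn y α => exact hb y α h
  | mem y γ => trivial

theorem head_getD {h : ℕ} (hh : h < Ψ.head.length) : Ψ.head[h]? = some (Ψ.head.getD h 0) := by
  simp [hh]

theorem head_getD_ne {h : ℕ} (hh : h < Ψ.head.length) : Ψ.head.getD h 0 ≠ 0 :=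
  head_ne_zero (List.mem_of_getElem? (head_getD hh))

/-- Every variable of the head has a slot in some atom. -/
theorem exists_slot (hb : Ψ.IsBinary) {h : ℕ} (hh : h < Ψ.head.length) :
    ∃ (c : ℕ) (χ : Atom k), Ψ.body[c]? = some χ ∧ ∃ j < 3, χ.sv j = Ψ.head.getD h 0 := by
  obtain ⟨χ, hχ, hx⟩ := Ψ.head_free _ (List.mem_of_getElem? (head_getD hh))
  obtain ⟨c, hc⟩ := List.mem_iff_getElem?.1 hχ
  rw [Atom.vars_eq (Atom.isBinary_of_mem hb hχ)] at hx
  exact ⟨c, χ, hc, hx.2⟩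

/-- Every triple of the reduced tables is part of a solution. -/
theorem exists_sol (hb : Ψ.IsBinary) {o p : ℕ → ℕ} {D c : ℕ} {g : ℕ → ℕ × ℕ} {χ : Atom k}
    (hT : TreeOrder (atomVars Ψ) (Ψ.body.length - 1) o p) (hD : D ≤ Ψ.head.length)
    (hχ : Ψ.body[c]? = some χ) {t : ℕ × ℕ × ℕ}
    (ht : t ∈ reduce (atomVars Ψ) (tval Ψ w) (Ψ.body.length - 1) o p (tableSet Ψ w D g) c) :
    ∃ σ ∈ Sol Ψ w, (∀ h < D, headCode Ψ w σ h = g h) ∧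
      ∀ j < 3, χ.sv j ≠ 0 → σ (χ.sv j) = wd w (span j t) := by
  have hlt : ∀ {i ξ}, Ψ.body[i]? = some ξ → i ≤ Ψ.body.length - 1 := fun h => by
    have := (List.getElem?_eq_some_iff.1 h).1
    omega
  obtain ⟨σ, h1, h2⟩ := reduce_extend hT (hlt hχ) ht
  have hv : ∀ {i ξ t'}, Ψ.body[i]? = some ξ → ξ.Base w t' →
      (∀ x ∈ atomVars Ψ i, σ x = tval Ψ w i t' x) → ∀ j < 3, ξ.sv j ≠ 0 →
      Function.update σ 0 w (ξ.sv j) = wd w (span j t') := by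
    intro i ξ t' hi hB h j hj h0
    rw [Function.update_of_ne h0, h _ ((mem_atomVars hb hi).2 ⟨h0, j, hj, rfl⟩), tval_eq hi,
      Atom.val_sv hB hj h0]
  have hloc : ∀ {i : ℕ} {ξ : Atom k}, Ψ.body[i]? = some ξ → ∃ t', ξ.Base w t' ∧ (∀ j < 3, ∀ h < D,
      Ψ.head[h]? = some (ξ.sv j) → code w (wd w (span j t')) = g h) ∧
      ∀ j < 3, ξ.sv j ≠ 0 → Function.update σ 0 w (ξ.sv j) = wd w (span j t') := by
    intro i ξ hi
    obtain ⟨t', ⟨ξ', hξ', hB, hg⟩, hx⟩ := h2 i (hlt hi)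
    obtain rfl : ξ = ξ' := Option.some.inj (hi.symm.trans hξ')
    exact ⟨t', hB, hg, hv hi hB hx⟩
  refine ⟨Function.update σ 0 w, ⟨by simp, fun ξ hξ => ?_⟩, fun h hh => ?_, ?_⟩
  · obtain ⟨i, hi⟩ := List.mem_iff_getElem?.1 hξ
    obtain ⟨t', hB, -, hx⟩ := hloc hi
    exact (Atom.sat_iff (Atom.isBinary_of_mem hb hξ) (by simp)).2 ⟨t', hB, hx⟩
  · obtain ⟨i, ξ, hi, j, hj, e⟩ := exists_slot hb (show h < Ψ.head.length by omega)
    obtain ⟨t', hB, hg, hx⟩ := hloc hi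
    rw [headCode, ← e, hx j hj (e ▸ head_getD_ne (by omega))]
    exact hg j hj h hh (by rw [e, head_getD (by omega)])
  · obtain ⟨ξ, hξ, hB, -⟩ := reduce_subset _ _ ht
    obtain rfl : χ = ξ := Option.some.inj (hχ.symm.trans hξ)
    exact hv hχ hB h1

/-- Every solution is represented in the reduced tables. -/
theorem exists_triple (hb : Ψ.IsBinary) {o p : ℕ → ℕ} {D c : ℕ} {g : ℕ → ℕ × ℕ} {χ : Atom k}
    (hT : TreeOrder (atomVars Ψ) (Ψ.body.length - 1) o p) (hD : D ≤ Ψ.head.length)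
    (hχ : Ψ.body[c]? = some χ) {σ : Subst k} (hσ : σ ∈ Sol Ψ w)
    (hg : ∀ h < D, headCode Ψ w σ h = g h) :
    ∃ t ∈ reduce (atomVars Ψ) (tval Ψ w) (Ψ.body.length - 1) o p (tableSet Ψ w D g) c,
      ∀ j < 3, χ.sv j ≠ 0 → σ (χ.sv j) = wd w (span j t) := by
  have hc := (List.getElem?_eq_some_iff.1 hχ).1
  have hex : ∀ i : ℕ, ∃ t, ∀ ξ : Atom k, Ψ.body[i]? = some ξ →
      ξ.Base w t ∧ ∀ j < 3, ξ.sv j ≠ 0 → σ (ξ.sv j) = wd w (span j t) := by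
    intro i
    cases hi : Ψ.body[i]? with
    | none => exact ⟨(0, 0, 0), by simp⟩
    | some ξ =>
      have hm := List.mem_of_getElem? hi
      obtain ⟨t, ht⟩ := (Atom.sat_iff (Atom.isBinary_of_mem hb hm) hσ.1).1 (hσ.2 ξ hm)
      exact ⟨t, fun _ e => Option.some.inj e ▸ ht⟩
  choose f hf using hex
  refine ⟨f c, mem_reduce (σ := σ) hT (fun i hi => ?_) (by omega), (hf c χ hχ).2⟩
  obtain ⟨ξ, hξ⟩ : ∃ ξ, Ψ.body[i]? = some ξ := ⟨_, List.getElem?_eq_getElem (by omega)⟩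
  obtain ⟨hB, hv⟩ := hf i ξ hξ
  refine ⟨⟨ξ, hξ, hB, fun j hj h hh e => ?_⟩, fun x hx => ?_⟩
  · rw [head_getD (by omega)] at e
    have e' := Option.some.inj e
    rw [← hg h hh, headCode, e', hv j hj (e' ▸ head_getD_ne (by omega))]
  · obtain ⟨h0, j, hj, rfl⟩ := (mem_atomVars hb hξ).1 hx
    rw [tval_eq hξ, Atom.val_sv hB hj h0, hv j hj h0]

/-- The values of the variables of the head are factors. -/
theorem Sol.head_eq_wd (hb : Ψ.IsBinary) {σ : Subst k} (hσ : σ ∈ Sol Ψ w) {h : ℕ}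
    (hh : h < Ψ.head.length) :
    ∃ u : ℕ × ℕ, u.1 + u.2 ≤ w.length ∧ σ (Ψ.head.getD h 0) = wd w u := by
  obtain ⟨c, χ, hχ, j, hj, e⟩ := exists_slot hb hh
  have hm := List.mem_of_getElem? hχ
  obtain ⟨t, hB, ht⟩ := (Atom.sat_iff (Atom.isBinary_of_mem hb hm) hσ.1).1 (hσ.2 χ hm)
  exact ⟨span j t, span_le hB.1 j, by rw [← e]; exact ht j hj (e ▸ head_getD_ne hh)⟩

/-- The numbers, in lexicographic order, of the heads of the solutions. -/
def Codes (Ψ : RegCQ k) (w : Word k) : Set (ℕ → ℕ ×ₗ ℕ) :=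
  {f | ∃ σ ∈ Sol Ψ w, ∀ h < Ψ.head.length, f h = toLex (headCode Ψ w σ h)}

/-- The tuple of numbers that is stored in the arrays `11` and `12`. -/
def cur (s : State) (h : ℕ) : ℕ ×ₗ ℕ :=
  toLex (s.arr 11 [h, 0, 0, 0, 0, 0], s.arr 12 [h, 0, 0, 0, 0, 0])

theorem fixed_cur {s : State} {D : ℕ} (h : s.reg 20 = D) (hD : D ≤ Ψ.head.length) :
    Fixed Ψ D (fun h => ofLex (cur s h)) s :=
  ⟨h, hD, fun _ _ => rfl, fun _ _ => rfl⟩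

/-- The tables contain exactly the values of the solutions that agree with the stored tuple up to
the position `D`. -/
structure Solved (Ψ : RegCQ k) (w : Word k) (D : ℕ) (s : State) : Prop where
  prep : Prepared Ψ w s
  sound : ∀ (c : ℕ) (χ : Atom k), Ψ.body[c]? = some χ → ∀ i < w.length + 1, ∀ p < w.length + 1,
    ∀ q < w.length + 1, s.arr 8 [c, i, p, q, 0, 0] ≠ 0 → Fit w (i, p, q) ∧
      ∃ σ ∈ Sol Ψ w, (∀ h < D, toLex (headCode Ψ w σ h) = cur s h) ∧
        ∀ j < 3, χ.sv j ≠ 0 → σ (χ.sv j) = wd w (span j (i, p, q))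
  complete : ∀ (c : ℕ) (χ : Atom k), Ψ.body[c]? = some χ → ∀ σ ∈ Sol Ψ w,
    (∀ h < D, toLex (headCode Ψ w σ h) = cur s h) → ∃ i < w.length + 1, ∃ p < w.length + 1,
      ∃ q < w.length + 1, s.arr 8 [c, i, p, q, 0, 0] ≠ 0 ∧
        ∀ j < 3, χ.sv j ≠ 0 → σ (χ.sv j) = wd w (span j (i, p, q))

theorem eval_solveC' (hb : Ψ.IsBinary) (hm : 0 < Ψ.body.length) {s : State} {D : ℕ}
    (h : Prepared Ψ w s) (h20 : s.reg 20 = D) (hD : D ≤ Ψ.head.length) :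
    Solved Ψ w D (solveC.eval (ctx Ψ w) s) := by
  have T := eval_solveC hb h (fixed_cur h20 hD) hm
  have hcur : cur (solveC.eval (ctx Ψ w) s) = cur s := by
    funext i
    simp only [cur, solveC.eval_arr s (show 11 ∉ solveC.arrs by decide),
      solveC.eval_arr s (show 12 ∉ solveC.arrs by decide)]
  refine ⟨h.eval (Γ := ctx Ψ w) solveC (by decide), fun c χ hχ i hi p hp q hq ht => ?_,
    fun c χ hχ σ hσ hg => ?_⟩
  · rw [T c (List.getElem?_eq_some_iff.1 hχ).1 i hi p hp q hq] at ht
    obtain ⟨σ, h1, h2, h3⟩ := exists_sol hb h.tree hD hχ ht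
    exact ⟨tableSet_fit (reduce_subset _ _ ht), σ, h1, fun j hj => by rw [h2 j hj, hcur]; rfl, h3⟩
  · rw [hcur] at hg
    obtain ⟨⟨i, p, q⟩, h1, h2⟩ := exists_triple hb h.tree hD hχ hσ (g := fun h => ofLex (cur s h))
      fun j hj => by rw [← hg j hj]; rfl
    have hf := tableSet_fit (reduce_subset _ _ h1)
    simp only [Fit] at hf
    exact ⟨i, by omega, p, by omega, q, by omega,
      (T c (List.getElem?_eq_some_iff.1 hχ).1 i (by omega) p (by omega) q (by omega)).2 h1, h2⟩

theorem holds_existsE {D : ℕ} {s : State} (h : Solved Ψ w D s) (hm : 0 < Ψ.body.length) :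
    existsE.holds (ctx Ψ w) s ↔ ∃ σ ∈ Sol Ψ w, ∀ h < D, toLex (headCode Ψ w σ h) = cur s h := by
  have hχ : Ψ.body[0]? = some Ψ.body[0] := List.getElem?_eq_getElem hm
  simp only [existsE, holds_any, holds_arr4, denote_reg, set_reg, set_arr, denote_const,
    Nat.reduceEqDiff, if_false, if_true, h.prep.parsed.n, OfNat.zero_ne_ofNat]
  constructor
  · rintro ⟨i, hi, p, hp, q, hq, ht⟩
    obtain ⟨-, σ, h1, h2, -⟩ := h.sound 0 _ hχ i hi p hp q hq ht
    exact ⟨σ, h1, h2⟩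
  · rintro ⟨σ, h1, h2⟩
    obtain ⟨i, hi, p, hp, q, hq, ht, -⟩ := h.complete 0 _ hχ σ h1 h2
    exact ⟨i, hi, p, hp, q, hq, ht⟩

/-- The possible values for the next position `D` of the head, after the stored tuple up to `D`;
with the flag `28` only those that are larger than the stored value. -/
def Next (Ψ : RegCQ k) (w : Word k) (D : ℕ) (s : State) (v : ℕ ×ₗ ℕ) : Prop :=
  ∃ f ∈ Codes Ψ w, (∀ h < D, f h = cur s h) ∧ f D = v ∧ (s.reg 28 ≠ 0 → cur s D < v)

/-- Finding the lexicographically least pair, one entry after the other. -/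
theorem lb_lex {n : ℕ} {N : ℕ → ℕ → Prop} (hN : ∀ i l, N i l → i < n ∧ l < n) {a b : ℕ}
    (ha : (lb n fun i => ∃ l < n, N i l) = a) (hb : a < n → lb n (N a) = b) :
    (a < n ↔ ∃ i l, N i l) ∧ ∀ i l, N i l → N a b ∧ toLex (a, b) ≤ toLex (i, l) := by
  subst ha
  refine ⟨?_, fun i l h => ?_⟩
  · rw [lb_lt_iff]
    exact ⟨fun ⟨i, _, l, _, h⟩ => ⟨i, l, h⟩, fun ⟨i, l, h⟩ => ⟨i, (hN i l h).1, l, (hN i l h).2, h⟩⟩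
  · have hi : ∃ l < n, N i l := ⟨l, (hN i l h).2, h⟩
    have h1 := lb_spec (p := fun i => ∃ l < n, N i l) (lb_lt_iff.2 ⟨i, (hN i l h).1, hi⟩)
    rw [← hb (lb_lt_iff.2 ⟨i, (hN i l h).1, hi⟩)]
    refine ⟨lb_spec (lb_lt_iff.2 h1), ?_⟩
    rw [Prod.Lex.toLex_le_toLex]
    rcases (lb_le_of (B := n) (p := fun i => ∃ l < n, N i l) hi).lt_or_eq with hlt | heq
    · exact .inl hlt
    · refine .inr ⟨heq, ?_⟩
      simp only [heq]
      exact lb_le_of h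

/-- The program finds a slot of the variable at the position `D` of the head. -/
theorem denote_headSlot (hb : Ψ.IsBinary) {s : State} {D : ℕ} (h : Prepared Ψ w s)
    (h20 : s.reg 20 = D) (hD : D < Ψ.head.length) :
    ∃ (c j : ℕ) (χ : Atom k), Ψ.body[c]? = some χ ∧ j < 3 ∧ χ.sv j = Ψ.head.getD D 0 ∧
      (Expr.find 10 vM (any 11 (.const 3) (eq (aVar (.reg 10) (.reg 11)) (aHVar (.reg 20))))).denote
        (ctx Ψ w) s = c ∧
      (Expr.find 11 (.const 3) (eq (aVar (.reg 24) (.reg 11)) (aHVar (.reg 20)))).denote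
        (ctx Ψ w) (s.set 24 c) = j := by
  have hv : s.arr 5 [D, 0, 0, 0, 0, 0] = varCode Ψ w (Ψ.head.getD D 0) := by
    rw [h.head.var D hD]; simp [hD]
  have e : ∀ {c : ℕ} {χ : Atom k}, Ψ.body[c]? = some χ → ∀ i < 3, (s.arr 1 [c, i, 0, 0, 0, 0] =
      varCode Ψ w (Ψ.head.getD D 0) ↔ χ.sv i = Ψ.head.getD D 0) := fun hc i hi => by
    rw [h.vars _ _ hc i hi, varCode_sv_inj hc]
  obtain ⟨c₀, χ₀, h0, i₀, hi₀, e₀⟩ := exists_slot hb hD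
  have hlt : (lb Ψ.body.length fun c => ∃ i < 3, s.arr 1 [c, i, 0, 0, 0, 0] =
      varCode Ψ w (Ψ.head.getD D 0)) < Ψ.body.length :=
    lb_lt_iff.2 ⟨c₀, (List.getElem?_eq_some_iff.1 h0).1, i₀, hi₀, (e h0 i₀ hi₀).2 e₀⟩
  have hsp := lb_spec hlt
  generalize hc : (lb Ψ.body.length fun c => ∃ i < 3, s.arr 1 [c, i, 0, 0, 0, 0] =
      varCode Ψ w (Ψ.head.getD D 0)) = c at hlt hsp
  have hlt2 := lb_lt_iff.2 hsp
  refine ⟨c, _, Ψ.body[c], List.getElem?_eq_getElem hlt, hlt2,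
    (e (List.getElem?_eq_getElem hlt) _ hlt2).1 (lb_spec hlt2), ?_, ?_⟩
  · rw [← hc]; simp [-List.getD_eq_getElem?_getD, h20, hv, h.parsed.m]
  · simp [-List.getD_eq_getElem?_getD, h20, hv]

/-- The scalar variables `26` and `27` get the least next value, if there is one. -/
theorem eval_valuesC (hb : Ψ.IsBinary) {s : State} {D : ℕ} (h : Solved Ψ w D s)
    (h20 : s.reg 20 = D) (hD : D < Ψ.head.length) :
    ((valuesC.eval (ctx Ψ w) s).reg 26 < w.length + 1 ↔ ∃ v, Next Ψ w D s v) ∧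
      ∀ v, Next Ψ w D s v →
        Next Ψ w D s (toLex ((valuesC.eval (ctx Ψ w) s).reg 26,
            (valuesC.eval (ctx Ψ w) s).reg 27)) ∧
        toLex ((valuesC.eval (ctx Ψ w) s).reg 26, (valuesC.eval (ctx Ψ w) s).reg 27) ≤ v := by
  have hP := h.prep.parsed
  obtain ⟨c, j, χ, hχ, hj, hsv, hc24, hc25⟩ := denote_headSlot hb h.prep h20 hD
  have hsv0 : χ.sv j ≠ 0 := hsv ▸ head_getD_ne hD
  set s₁ := (s.set 24 c).set 25 j with hs₁
  obtain ⟨A, hA, hA1, -⟩ := eval_fill (Γ := ctx Ψ w) (L := [(10, vN), (11, vN)]) (a := 10)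
    (e₁ := .reg 10) (e₂ := .reg 11) (e₃ := k0) (e₄ := k0) (e₅ := k0) (e₆ := k0) (e := k0)
    (loopsOk_iff.2 rfl) (by decide) (by decide) s₁ (bs := [w.length + 1, w.length + 1])
    (by simp [hs₁, hP.n]) (fun _ _ _ _ _ => rfl)
  obtain ⟨B, hB, hB1⟩ := eval_mark (Γ := ctx Ψ w) (L := loops3) (a := 10)
    (e₁ := spanCan (.reg 25) 10) (e₂ := spanLen (.reg 25) 10) (e₃ := k0) (e₄ := k0) (e₅ := k0)
    (e₆ := k0) (g := aTab (.reg 24) (.reg 10) (.reg 11) (.reg 12)) (loopsOk_iff.2 rfl)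
    (by decide) (by decide) (s₁.withArr 10 A) (bs := [w.length + 1, w.length + 1, w.length + 1])
    (by simp [hs₁, hP.n])
  have hcell : ∀ i p q, Fit w (i, p, q) → cell (ctx Ψ w) (spanCan (.reg 25) 10)
      (spanLen (.reg 25) 10) k0 k0 k0 k0 ((s₁.withArr 10 A).sets [10, 11, 12] [i, p, q]) =
      [(code w (wd w (span j (i, p, q)))).1, (code w (wd w (span j (i, p, q)))).2, 0, 0, 0, 0] := by
    intro i p q hf
    have hC : HasCan w ((s₁.withArr 10 A).sets [10, 11, 12] [i, p, q]) := h.prep.can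
    rw [cell, denote_spanCan (t := (i, p, q)) hC hf (by simp) (by simp) (by simp)
      (j := j) (by simp [hs₁]) hj, denote_spanLen (t := (i, p, q)) hf (by simp) (by simp)
      (j := j) (by simp [hs₁]) hj]
    rfl
  have hval : ∀ i < w.length + 1, ∀ l < w.length + 1, (B [i, l, 0, 0, 0, 0] ≠ 0 ↔
      ∃ σ ∈ Sol Ψ w, (∀ h < D, toLex (headCode Ψ w σ h) = cur s h) ∧
          headCode Ψ w σ D = (i, l)) := by
    intro i hi l hl
    have h0 := hA1 [i, l] (by simp; omega)
    simp only [cell, List.map_cons, List.map_nil, sets_cons, sets_nil, denote_reg, set_reg,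
      Nat.reduceEqDiff, if_true, if_false, denote_const] at h0
    rw [hB1]
    simp only [withArr_arr, if_true, h0, ne_eq, not_true_eq_false, false_or, mem_tuples_cons,
      mem_tuples_nil, List.map_cons, List.map_nil]
    have ht : ∀ i p q, (aTab (.reg 24) (.reg 10) (.reg 11) (.reg 12)).denote (ctx Ψ w)
        ((s₁.withArr 10 A).sets [10, 11, 12] [i, p, q]) = s.arr 8 [c, i, p, q, 0, 0] := by
      intro i p q
      simp [hs₁]
    constructor
    · rintro ⟨_, ⟨i', hi', _, ⟨p', hp', _, ⟨q', hq', _, rfl, rfl⟩, rfl⟩, rfl⟩, e, ht'⟩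
      rw [ht] at ht'
      obtain ⟨hf, σ, h1, h2, h3⟩ := h.sound c χ hχ i' hi' p' hp' q' hq' ht'
      rw [hcell i' p' q' hf] at e
      refine ⟨σ, h1, h2, ?_⟩
      rw [headCode, ← hsv, h3 j hj hsv0]
      simp only [List.cons.injEq, and_true] at e
      exact Prod.ext e.1 e.2
    · rintro ⟨σ, h1, h2, h3⟩
      obtain ⟨i', hi', p', hp', q', hq', ht', hv⟩ := h.complete c χ hχ σ h1 h2
      refine ⟨_, ⟨i', hi', _, ⟨p', hp', _, ⟨q', hq', _, rfl, rfl⟩, rfl⟩, rfl⟩, ?_, by rwa [ht]⟩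
      rw [hcell i' p' q' (h.sound c χ hχ i' hi' p' hp' q' hq' ht').1, ← hv j hj hsv0, hsv]
      simp only [headCode] at h3
      rw [h3]
  have hle : ∀ v, Next Ψ w D s v → (ofLex v).1 < w.length + 1 ∧ (ofLex v).2 < w.length + 1 := by
    rintro v ⟨f, ⟨σ, hσ, hf⟩, -, rfl, -⟩
    obtain ⟨u, hu, e⟩ := Sol.head_eq_wd hb hσ hD
    have := code_le hu
    rw [hf D hD, headCode, e, ofLex_toLex]
    omega
  have hnext : ∀ i < w.length + 1, ∀ l < w.length + 1, (Next Ψ w D s (toLex (i, l)) ↔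
      B [i, l, 0, 0, 0, 0] ≠ 0 ∧ (s.reg 28 ≠ 0 → cur s D < toLex (i, l))) := by
    intro i hi l hl
    rw [hval i hi l hl]
    constructor
    · rintro ⟨f, ⟨σ, hσ, hf⟩, h1, h2, h3⟩
      refine ⟨⟨σ, hσ, fun h hh => by rw [← hf h (by omega), h1 h hh], ?_⟩, h3⟩
      rw [hf D hD] at h2
      exact toLex.injective h2
    · rintro ⟨⟨σ, hσ, h1, h2⟩, h3⟩
      exact ⟨fun h => toLex (headCode Ψ w σ h), ⟨σ, hσ, fun _ _ => rfl⟩, h1, by simp only [h2], h3⟩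
  set s₃ := s₁.withArr 10 B with hs₃
  have hcand : ∀ s' : State, s'.arr = s₃.arr → s'.reg 28 = s.reg 28 → s'.reg 20 = D →
      ∀ (ei el : Expr), ∀ i < w.length + 1, ∀ l < w.length + 1, ei.denote (ctx Ψ w) s' = i →
      el.denote (ctx Ψ w) s' = l → ((candE ei el).holds (ctx Ψ w) s' ↔
        Next Ψ w D s (toLex (i, l))) := by
    intro s' ha h28 h20' ei el i hi l hl hei hel
    rw [hnext i hi l hl, cur, Prod.Lex.toLex_lt_toLex]
    simp [candE, hei, hel, ha, hs₃, hs₁, h28, h20']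
    tauto
  obtain ⟨a, ha⟩ : ∃ a, (lb (w.length + 1) fun i => ∃ l < w.length + 1,
    Next Ψ w D s (toLex (i, l))) = a := ⟨_, rfl⟩
  obtain ⟨b, hb'⟩ : ∃ b, (Expr.find 11 vN (candE (.reg 26) (.reg 11))).denote (ctx Ψ w)
    (s₃.set 26 a) = b := ⟨_, rfl⟩
  have n₃ : s₃.reg 0 = w.length + 1 := by simp [hs₃, hs₁, hP.n]
  have e : valuesC.eval (ctx Ψ w) s = (s₃.set 26 a).set 27 b := by
    have e₂ : (Cmd.loops loops3 (.store2 10 (spanCan (.reg 25) 10) (spanLen (.reg 25) 10)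
        (.ite (aTab (.reg 24) (.reg 10) (.reg 11) (.reg 12)) k1
        (aVal (spanCan (.reg 25) 10) (spanLen (.reg 25) 10))))).eval (ctx Ψ w) (s₁.withArr 10 A) =
        s₃ := by
      rw [hs₃, ← State.withArr_withArr s₁ 10 A B]; exact hB
    have e₁ : (Cmd.loops [(10, vN), (11, vN)] (.store2 10 (.reg 10) (.reg 11) k0)).eval (ctx Ψ w)
        s₁ =
        s₁.withArr 10 A := hA
    have e₃ : (Expr.find 10 vN (any 11 vN (candE (.reg 10) (.reg 11)))).denote (ctx Ψ w)
        s₃ = a := by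
      rw [← ha, denote_find, denote_reg, n₃]
      refine lb_congr fun i hi => ?_
      rw [holds_any, denote_reg, set_reg, if_neg (by omega), n₃]
      exact exists_congr fun l => and_congr_right fun hl =>
        hcand ((s₃.set 10 i).set 11 l) rfl (by simp [hs₃, hs₁])
          (by simp [hs₃, hs₁, h20]) _ _ i hi l hl (by simp) (by simp)
    simp only [valuesC, block_cons, block_single, eval_assign]
    rw [hc24, hc25, ← hs₁, e₁, e₂, e₃, hb']
  rw [e]
  obtain ⟨l1, l2⟩ := lb_lex (N := fun i l => Next Ψ w D s (toLex (i, l)))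
    (fun i l h => hle _ h) ha (b := b) fun ha' => by
      rw [← hb', denote_find, denote_reg, set_reg, if_neg (by omega), n₃]
      refine lb_congr fun l hl => ?_
      exact (hcand ((s₃.set 26 a).set 11 l) rfl (by simp [hs₃, hs₁]) (by simp [hs₃, hs₁, h20])
        _ _ a ha' l hl (by simp) (by simp)).symm
  simp only [set_reg, reduceIte, Nat.reduceEqDiff]
  exact ⟨l1.trans ⟨fun ⟨i, l, h⟩ => ⟨_, h⟩, fun ⟨v, h⟩ => ⟨_, _, h⟩⟩, fun v => l2 _ _⟩

end

/-! ### The next result -/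

section

variable {k : ℕ} {w : Word k} {Ψ : RegCQ k}

theorem Codes.of_eq {f f' : ℕ → ℕ ×ₗ ℕ} (h : f ∈ Codes Ψ w) (e : ∀ h < Ψ.head.length, f' h = f h) :
    f' ∈ Codes Ψ w := by
  obtain ⟨σ, h1, h2⟩ := h
  exact ⟨σ, h1, fun h hh => (e h hh).trans (h2 h hh)⟩

theorem cur_eval {Γ : Ctx} (c : Cmd) (s : State) (h : 11 ∉ c.arrs ∧ 12 ∉ c.arrs) :
    cur (c.eval Γ s) = cur s := by
  funext i
  simp only [cur, c.eval_arr s h.1, c.eval_arr s h.2]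

theorem Next.congr {D : ℕ} {s s' : State} (hc : cur s' = cur s) (hr : s'.reg 28 = s.reg 28)
    {v : ℕ ×ₗ ℕ} : Next Ψ w D s' v ↔ Next Ψ w D s v := by
  simp only [Next, hc, hr]

/-- Choosing the least value for the position `D` of the head. -/
theorem eval_choose (hb : Ψ.IsBinary) (hm : 0 < Ψ.body.length) {s s' : State} {D : ℕ}
    (h : Prepared Ψ w s) (h20 : s.reg 20 = D) (hD : D < Ψ.head.length)
    (hs' : valuesC.eval (ctx Ψ w) (solveC.eval (ctx Ψ w) s) = s') :
    Prepared Ψ w s' ∧ cur s' = cur s ∧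
      (∀ r ∈ [15, 20, 21, 22, 23, 28], s'.reg r = s.reg r) ∧
      (s'.reg 26 < w.length + 1 ↔ ∃ v, Next Ψ w D s v) ∧
      ∀ v, Next Ψ w D s v → Next Ψ w D s (toLex (s'.reg 26, s'.reg 27)) ∧
        toLex (s'.reg 26, s'.reg 27) ≤ v := by
  have S := eval_solveC' hb hm h h20 hD.le
  have c₁ := cur_eval (Γ := ctx Ψ w) solveC s (by decide)
  have r₁ : ∀ r ∈ [15, 20, 21, 22, 23, 28], (solveC.eval (ctx Ψ w) s).reg r = s.reg r :=
    fun r hr => solveC.eval_reg s (by revert r; decide)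
  set s₁ := solveC.eval (ctx Ψ w) s
  have V := eval_valuesC hb S ((r₁ 20 (by simp)).trans h20) hD
  have r₂ : ∀ r ∈ [15, 20, 21, 22, 23, 28], (valuesC.eval (ctx Ψ w) s₁).reg r = s₁.reg r :=
    fun r hr => valuesC.eval_reg s₁ (by revert r; decide)
  have c₂ := cur_eval (Γ := ctx Ψ w) valuesC s₁ (by decide)
  have P := S.prep.eval (Γ := ctx Ψ w) valuesC (by decide)
  rw [hs'] at V r₂ c₂ P
  simp only [Next.congr c₁ (r₁ 28 (by simp))] at V
  exact ⟨P, c₂.trans c₁, fun r hr => (r₂ r hr).trans (r₁ r hr), V.1, V.2⟩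

theorem eval_keepC {Γ : Ctx} {s : State} {D : ℕ} (h20 : s.reg 20 = D) (h : ℕ) :
    cur (keepC.eval Γ s) h = if h = D then toLex (s.reg 26, s.reg 27) else cur s h := by
  rw [keepC, block_cons, block_single]
  simp only [Cmd.store1, Cmd.eval, cur, State.put, denote_reg, denote_const, h20,
    Function.update_apply, Nat.reduceEqDiff, if_true, if_false, List.cons.injEq, and_true]
  split <;> rfl

/-- Choosing the least values for the positions of the head from `d` on. -/
theorem eval_fillC (hb : Ψ.IsBinary) (hm : 0 < Ψ.body.length) {s : State} {d : ℕ}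
    (h : Prepared Ψ w s) (h22 : s.reg 22 = d) (hd : d ≤ Ψ.head.length)
    (hex : ∃ f ∈ Codes Ψ w, ∀ h < d, f h = cur s h) :
    (∀ h < d, cur (fillC.eval (ctx Ψ w) s) h = cur s h) ∧ cur (fillC.eval (ctx Ψ w) s) ∈ Codes Ψ w ∧
      ∀ h, d ≤ h → h < Ψ.head.length → ∀ g ∈ Codes Ψ w,
        (∀ i < h, g i = cur (fillC.eval (ctx Ψ w) s) i) → cur (fillC.eval (ctx Ψ w) s) h ≤ g h := by
  rw [fillC, block_cons, block_single, eval_assign, eval_loop]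
  rw [show vR.denote (ctx Ψ w) (s.set 28 (k0.denote (ctx Ψ w) s)) = Ψ.head.length by
    simp [h.parsed.r]]
  -- invariant: the stored tuple extends to a result up to `k`, and is chosen greedily from `d` on
  have key := iter_inv (f := fun k s' => (((Cmd.ite (le (.reg 22) (.reg 15))
      (.block [.assign 20 (.reg 15), solveC, valuesC, keepC]) .skip).eval (ctx Ψ w)
        (s'.set 15 k)).set 15 (s'.reg 15))) (n := Ψ.head.length)
    (s := s.set 28 (k0.denote (ctx Ψ w) s))
    (fun k s' => Prepared Ψ w s' ∧ s'.reg 22 = d ∧ s'.reg 28 = 0 ∧ (∀ h < d, cur s' h = cur s h) ∧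
      (∃ f ∈ Codes Ψ w, ∀ h < max d k, f h = cur s' h) ∧
      ∀ h, d ≤ h → h < k → ∀ g ∈ Codes Ψ w, (∀ i < h, g i = cur s' i) → cur s' h ≤ g h)
    ⟨h.of_eq (fun r hr => by rw [set_reg, if_neg (by omega)]) fun _ _ => rfl, by simp [h22],
      by simp, fun _ _ => rfl, by rw [max_eq_left (Nat.zero_le d)]; exact hex, by omega⟩ ?_
  · obtain ⟨-, -, -, h1, ⟨f, hf, e⟩, h3⟩ := key
    exact ⟨h1, Codes.of_eq hf fun i hi => (e i (by omega)).symm, h3⟩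
  · rintro k hk s' ⟨i1, i2, i3, i4, ⟨f, hf, e⟩, i6⟩
    rw [eval_ite]
    by_cases hdk : d ≤ k
    swap
    · rw [if_neg (by simp [i2]; omega)]
      exact ⟨i1.of_eq (fun r hr => by
        simp only [Cmd.eval, set_reg]; split <;> simp_all) fun _ _ => rfl,
        by simpa [Cmd.eval] using i2,
        by simpa [Cmd.eval] using i3, i4, ⟨f, hf, fun i hi => e i (by omega)⟩,
        fun i hi hi' => absurd hi (by omega)⟩
    rw [if_pos (by simp [i2]; omega)]
    simp only [block_cons, block_single, eval_assign, denote_reg, set_reg, reduceIte]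
    obtain ⟨P, c₁, r₁, -, hv⟩ := eval_choose (s := (s'.set 15 k).set 20 k) (D := k) hb hm
      (i1.of_eq (fun r hr => by rw [set_reg, set_reg, if_neg (by omega), if_neg (by omega)])
        fun _ _ => rfl) (by simp) hk rfl
    set s₂ := valuesC.eval (ctx Ψ w) (solveC.eval (ctx Ψ w) ((s'.set 15 k).set 20 k))
    have c₀ : cur ((s'.set 15 k).set 20 k) = cur s' := rfl
    have c₂ := eval_keepC (Γ := ctx Ψ w) (s := s₂) (D := k) (by rw [r₁ 20 (by simp)]; simp)
    rw [c₁, c₀] at c₂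
    have r₂ : ∀ r ∈ [22, 28], (keepC.eval (ctx Ψ w) s₂).reg r = s'.reg r := fun r hr => by
      rw [keepC.eval_reg s₂ (by revert r; decide), r₁ r (by revert r; decide)]
      fin_cases hr <;> simp
    rw [max_eq_right hdk] at e
    have n₀ : ∀ g ∈ Codes Ψ w, (∀ i < k, g i = cur s' i) →
        Next Ψ w k ((s'.set 15 k).set 20 k) (g k) := fun g hg hgk =>
      ⟨g, hg, hgk, rfl, fun h => absurd (by simpa using i3) h⟩
    obtain ⟨⟨f', hf', e', ev, -⟩, -⟩ := hv _ (n₀ f hf e)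
    rw [c₀] at e'
    have cr : ∀ v, cur ((keepC.eval (ctx Ψ w) s₂).set 15 v) = cur (keepC.eval (ctx Ψ w) s₂) :=
      fun _ => rfl
    refine ⟨(P.eval (Γ := ctx Ψ w) keepC (by decide)).of_eq
      (fun r hr => by rw [set_reg, if_neg (by omega)]) fun _ _ => rfl, ?_, ?_, ?_, ?_, ?_⟩
    · rw [if_neg (by omega), r₂ 22 (by simp), i2]
    · rw [if_neg (by omega), r₂ 28 (by simp), i3]
    · intro h hh
      rw [cr, c₂, if_neg (by omega), i4 h hh]
    · refine ⟨f', hf', fun h hh => ?_⟩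
      rw [cr, c₂]
      split
      · rename_i heq; rw [heq, ev]
      · exact e' h (by omega)
    · intro h hdh hh g hg hgk
      simp only [cr, c₂] at hgk ⊢
      have hgk' : ∀ i < h, g i = cur s' i := fun i hi => by
        have := hgk i hi
        rwa [if_neg (by omega)] at this
      split
      · rename_i heq
        subst heq
        exact (hv _ (n₀ g hg hgk')).2
      · exact i6 h hdh (by omega) g hg hgk'

/-- Increasing the last entry of the stored tuple that can be increased. -/
theorem eval_backC (hb : Ψ.IsBinary) (hm : 0 < Ψ.body.length) {s : State}
    (h : Prepared Ψ w s) :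
    ((backC.eval (ctx Ψ w) s).reg 21 = 0 ∧ ∀ d < Ψ.head.length, ∀ g ∈ Codes Ψ w,
      (∀ i < d, g i = cur s i) → ¬ cur s d < g d) ∨
    ((backC.eval (ctx Ψ w) s).reg 21 ≠ 0 ∧ ∃ d < Ψ.head.length,
      (backC.eval (ctx Ψ w) s).reg 22 = d + 1 ∧
      (∀ h < d, cur (backC.eval (ctx Ψ w) s) h = cur s h) ∧
      cur s d < cur (backC.eval (ctx Ψ w) s) d ∧
      (∃ f ∈ Codes Ψ w, ∀ h < d + 1, f h = cur (backC.eval (ctx Ψ w) s) h) ∧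
      (∀ g ∈ Codes Ψ w, (∀ i < d, g i = cur s i) → cur s d < g d →
        cur (backC.eval (ctx Ψ w) s) d ≤ g d) ∧
      ∀ d', d < d' → d' < Ψ.head.length → ∀ g ∈ Codes Ψ w, (∀ i < d', g i = cur s i) →
        ¬ cur s d' < g d') := by
  have hN := ctx_N (Ψ := Ψ) (w := w)
  have hr := length_head_add_two_le (Ψ := Ψ)
  rw [backC, block_cons, block_cons, block_single, eval_assign, eval_assign, eval_loop]
  set s₀ := (s.set 21 (k0.denote (ctx Ψ w) s)).set 28 (k1.denote (ctx Ψ w)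
    (s.set 21 (k0.denote (ctx Ψ w) s)))
  rw [show vR.denote (ctx Ψ w) s₀ = Ψ.head.length by simp [s₀, h.parsed.r]]
  -- invariant: either none of the last `k` entries can be increased, or the last entry that can be
  -- increased has been
  have key := iter_inv (f := fun k s' => ((Cmd.ite (.reg 21) .skip (.block [
      .assign 20 (.sub (.sub vR k1) (.reg 15)), solveC, valuesC,
      .ite (lt (.reg 26) vN) (.block [keepC, .assign 21 k1, .assign 22 (.add (.reg 20) k1)])
        .skip])).eval (ctx Ψ w) (s'.set 15 k)).set 15 (s'.reg 15)) (n := Ψ.head.length) (s := s₀)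
    (fun k s' => Prepared Ψ w s' ∧ s'.reg 28 ≠ 0 ∧
      ((s'.reg 21 = 0 ∧ cur s' = cur s ∧ ∀ d < Ψ.head.length, Ψ.head.length - k ≤ d →
        ∀ g ∈ Codes Ψ w, (∀ i < d, g i = cur s i) → ¬ cur s d < g d) ∨
      (s'.reg 21 ≠ 0 ∧ ∃ d < Ψ.head.length, s'.reg 22 = d + 1 ∧ (∀ h < d, cur s' h = cur s h) ∧
        cur s d < cur s' d ∧ (∃ f ∈ Codes Ψ w, ∀ h < d + 1, f h = cur s' h) ∧
        (∀ g ∈ Codes Ψ w, (∀ i < d, g i = cur s i) → cur s d < g d → cur s' d ≤ g d) ∧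
        ∀ d', d < d' → d' < Ψ.head.length → ∀ g ∈ Codes Ψ w, (∀ i < d', g i = cur s i) →
          ¬ cur s d' < g d')))
    ⟨h.of_eq (fun r hr => by
      simp only [s₀, set_reg]; rw [if_neg (by omega), if_neg (by omega)]) fun _ _ => rfl,
      by simp [s₀], .inl ⟨by simp [s₀], rfl, by omega⟩⟩ ?_
  · obtain ⟨-, -, h | h⟩ := key
    · exact .inl ⟨h.1, fun d hd => h.2.2 d hd (by omega)⟩
    · exact .inr h
  rintro k hk s' ⟨i1, i2, i3⟩
  rw [eval_ite]
  have P₀ : Prepared Ψ w (s'.set 15 k) := i1.of_eq (fun r hr => by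
    rw [set_reg, if_neg (by omega)]) fun _ _ => rfl
  rcases i3 with ⟨h21, hc, hlast⟩ | hfound
  swap
  · rw [if_pos (by simpa using hfound.1)]
    exact ⟨P₀.of_eq (fun r hr => by simp only [Cmd.eval]; rw [set_reg, if_neg (by omega)])
      fun _ _ => rfl, by simpa [Cmd.eval] using i2, .inr (by simpa [Cmd.eval, cur] using hfound)⟩
  rw [if_neg (by simpa using h21)]
  obtain ⟨D, hD⟩ : ∃ D, Ψ.head.length - 1 - k = D := ⟨_, rfl⟩
  have e20 : (Expr.sub (.sub vR k1) (.reg 15)).denote (ctx Ψ w) (s'.set 15 k) = D := by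
    simp [i1.parsed.r, hD]
  simp only [block_cons, block_single]
  rw [eval_assign, e20]
  obtain ⟨s₂, hs₂⟩ : ∃ s₂, valuesC.eval (ctx Ψ w) (solveC.eval (ctx Ψ w)
    ((s'.set 15 k).set 20 D)) = s₂ := ⟨_, rfl⟩
  obtain ⟨P, c₁, r₁, hv0, hv⟩ := eval_choose (s := (s'.set 15 k).set 20 D) (D := D) hb hm
    (P₀.of_eq (fun r hr => by rw [set_reg, if_neg (by omega)]) fun _ _ => rfl) (by simp)
    (by omega) hs₂
  have c₀ : cur ((s'.set 15 k).set 20 D) = cur s := hc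
  rw [c₀] at c₁
  have n₀ : ∀ v, Next Ψ w D ((s'.set 15 k).set 20 D) v ↔
      ∃ f ∈ Codes Ψ w, (∀ h < D, f h = cur s h) ∧ f D = v ∧ cur s D < v := fun v => by
    simp only [Next, c₀]
    have : ((s'.set 15 k).set 20 D).reg 28 ≠ 0 := by simpa using i2
    simp only [this, ne_eq, not_false_eq_true, true_implies]
  simp only [n₀] at hv0 hv
  have q : ∀ r ∈ [21, 22, 28], s₂.reg r = s'.reg r := fun r hr => by
    rw [r₁ r (by revert r; decide)]
    fin_cases hr <;> simp
  rw [hs₂, eval_ite]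
  have hlt : (lt (.reg 26) vN).holds (ctx Ψ w) s₂ ↔ s₂.reg 26 < w.length + 1 := by
    simp [P.parsed.n]
  rw [hlt]
  by_cases h26 : s₂.reg 26 < w.length + 1
  swap
  · rw [if_neg h26]
    rw [hv0] at h26
    refine ⟨P.of_eq (fun r hr => by simp only [Cmd.eval]; rw [set_reg, if_neg (by omega)])
      fun _ _ => rfl, ?_, .inl ⟨?_, c₁, fun d hd hdk g hg hgd hlt => ?_⟩⟩
    · simp only [Cmd.eval]; rw [set_reg, if_neg (by omega), q 28 (by simp)]; exact i2
    · simp only [Cmd.eval]; rw [set_reg, if_neg (by omega), q 21 (by simp)]; exact h21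
    · by_cases hdD : d = D
      · subst hdD
        exact h26 ⟨_, g, hg, hgd, rfl, hlt⟩
      · exact hlast d hd (by omega) g hg hgd hlt
  rw [if_pos h26]
  obtain ⟨v, hv1⟩ := hv0.1 h26
  obtain ⟨⟨f, hf, e, ev, hlt'⟩, -⟩ := hv v hv1
  have c₂ := eval_keepC (Γ := ctx Ψ w) (s := s₂) (D := D) (by rw [r₁ 20 (by simp)]; simp)
  have r20 : (keepC.eval (ctx Ψ w) s₂).reg 20 = D := by
    rw [keepC.eval_reg s₂ (by decide), r₁ 20 (by simp)]; simp
  have P₃ := P.eval (Γ := ctx Ψ w) keepC (by decide)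
  have r28 : (keepC.eval (ctx Ψ w) s₂).reg 28 = s'.reg 28 := by
    rw [keepC.eval_reg s₂ (by decide), q 28 (by simp)]
  simp only [block_cons, block_single, eval_assign]
  set s₃ := keepC.eval (ctx Ψ w) s₂
  rw [c₁] at c₂
  refine ⟨P₃.of_eq (fun r hr => by
      simp only [set_reg]; rw [if_neg (by omega), if_neg (by omega), if_neg (by omega)])
    fun _ _ => rfl, by simpa [r28] using i2, .inr ⟨by simp, D, by omega, ?_, fun h hh => ?_, ?_,
      ⟨f, hf, fun h hh => ?_⟩, fun g hg hgD hlt => ?_, fun d hd hd' => hlast d hd' (by omega)⟩⟩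
  · simp only [denote_add, denote_reg, denote_const, set_reg, reduceIte, Nat.reduceEqDiff, r20]
    omega
  · exact (c₂ h).trans (if_neg (by omega))
  · exact ((c₂ D).trans (if_pos rfl)).symm ▸ hlt'
  · refine Eq.trans ?_ (c₂ h).symm
    split
    · rename_i heq; rw [heq, ev]
    · exact e h (by omega)
  · exact ((c₂ D).trans (if_pos rfl)).symm ▸ (hv _ ⟨g, hg, hgD, rfl, hlt⟩).2

theorem eval_firstC (hb : Ψ.IsBinary) (hm : 0 < Ψ.body.length) {s : State}
    (h : Prepared Ψ w s) :
    Prepared Ψ w (firstC.eval (ctx Ψ w) s) ∧ (firstC.eval (ctx Ψ w) s).reg 22 = 0 ∧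
      (firstC.eval (ctx Ψ w) s).reg 23 = 1 ∧
      ((Sol Ψ w).Nonempty → (firstC.eval (ctx Ψ w) s).reg 21 = 1) ∧
      (¬ (Sol Ψ w).Nonempty → (firstC.eval (ctx Ψ w) s).reg 21 = 0) := by
  refine ⟨h.eval (Γ := ctx Ψ w) firstC (by decide), ?_⟩
  simp only [firstC, block_cons, block_single, eval_assign]
  have S := eval_solveC' hb hm (s := s.set 20 (k0.denote (ctx Ψ w) s)) (D := 0)
    (h.of_eq (fun r hr => by rw [set_reg, if_neg (by omega)]) fun _ _ => rfl) (by simp)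
    (Nat.zero_le _)
  have he := holds_existsE S hm
  set s₁ := solveC.eval (ctx Ψ w) (s.set 20 (k0.denote (ctx Ψ w) s))
  have he' : existsE.holds (ctx Ψ w) s₁ ↔ (Sol Ψ w).Nonempty := he.trans
    ⟨fun ⟨σ, h, _⟩ => ⟨σ, h⟩, fun ⟨σ, h⟩ => ⟨σ, h, by omega⟩⟩
  refine ⟨by simp, by simp, fun hne => ?_, fun hne => ?_⟩
  · simp only [set_reg, denote_ite, if_pos (he'.2 hne)]
    simp
  · simp only [set_reg, denote_ite, if_neg (fun h => hne (he'.1 h))]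
    simp

/-- The tuple that follows the stored tuple in the lexicographic order; at the beginning this is the
first one. -/
theorem eval_nextC (hb : Ψ.IsBinary) (hm : 0 < Ψ.body.length) {s s' : State}
    (h : Prepared Ψ w s) (hs' : nextC.eval (ctx Ψ w) s = s') :
    Prepared Ψ w s' ∧ s'.reg 23 ≠ 0 ∧
    ((s'.reg 21 = 0 ∧ ∀ g ∈ Codes Ψ w, ¬ (s.reg 23 ≠ 0 → LexLt Ψ.head.length (cur s) g)) ∨
    (s'.reg 21 ≠ 0 ∧ cur s' ∈ Codes Ψ w ∧
      (s.reg 23 ≠ 0 → LexLt Ψ.head.length (cur s) (cur s')) ∧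
      ∀ g ∈ Codes Ψ w, (s.reg 23 ≠ 0 → LexLt Ψ.head.length (cur s) g) →
        ¬ LexLt Ψ.head.length g (cur s'))) := by
  subst hs'
  refine ⟨h.eval (Γ := ctx Ψ w) nextC (by decide), ?_⟩
  rw [nextC, eval_seq]
  have fill : ∀ s₁ : State, (fillC.eval (ctx Ψ w) s₁).reg 23 = s₁.reg 23 ∧
      (fillC.eval (ctx Ψ w) s₁).reg 21 = s₁.reg 21 := fun s₁ =>
    ⟨fillC.eval_reg s₁ (by decide), fillC.eval_reg s₁ (by decide)⟩
  rw [eval_ite (c := backC)]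
  by_cases h23 : s.reg 23 = 0
  · rw [if_neg (by simpa using h23)]
    obtain ⟨P, f22, f23, f1, f0⟩ := eval_firstC hb hm h
    set s₁ := firstC.eval (ctx Ψ w) s
    rw [eval_ite]
    by_cases hne : (Sol Ψ w).Nonempty
    · rw [if_pos (by simp [f1 hne]), (fill s₁).1, (fill s₁).2]
      obtain ⟨σ, hσ⟩ := hne
      obtain ⟨-, g2, g3⟩ := eval_fillC hb hm P f22 (Nat.zero_le _)
        ⟨fun h => toLex (headCode Ψ w σ h), ⟨σ, hσ, fun _ _ => rfl⟩, by omega⟩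
      refine ⟨by simp [f23], .inr ⟨by simp [f1 ⟨σ, hσ⟩], g2, fun h => absurd h23 h,
        fun g hg _ => not_lexLt_of_greedy (d := 0) hg (by omega) g3⟩⟩
    · rw [if_neg (by simp [f0 hne])]
      refine ⟨by simp [Cmd.eval, f23], .inl ⟨f0 hne, ?_⟩⟩
      rintro g ⟨σ, hσ, -⟩
      exact absurd ⟨σ, hσ⟩ hne
  · rw [if_pos (by simpa using h23)]
    have P := h.eval (Γ := ctx Ψ w) backC (by decide)
    have B := eval_backC hb hm h
    have b23 : (backC.eval (ctx Ψ w) s).reg 23 = s.reg 23 := backC.eval_reg s (by decide)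
    set s₁ := backC.eval (ctx Ψ w) s
    rw [eval_ite]
    rcases B with ⟨h21, hno⟩ | ⟨h21, d, hd, b22, hpre, hlt, hex, hmin, hlast⟩
    · rw [if_neg (by simpa using h21)]
      refine ⟨by simpa [Cmd.eval, b23] using h23, .inl ⟨h21, fun g hg hh => ?_⟩⟩
      obtain ⟨d, hd, e, l⟩ := hh h23
      exact hno d hd g hg (fun i hi => (e i hi).symm) l
    · rw [if_pos (by simpa using h21), (fill s₁).1, (fill s₁).2]
      obtain ⟨g1, g2, g3⟩ := eval_fillC hb hm P b22 hd hex
      set f' := cur (fillC.eval (ctx Ψ w) s₁)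
      have e₁ : ∀ h < d, f' h = cur s h := fun i hi => (g1 i (by omega)).trans (hpre i hi)
      have e₂ : f' d = cur s₁ d := g1 d (by omega)
      refine ⟨by rw [b23]; exact h23, .inr ⟨h21, g2, fun _ =>
        ⟨d, hd, fun i hi => (e₁ i hi).symm, by rw [e₂]; exact hlt⟩, fun g hg hh => ?_⟩⟩
      exact not_lexLt_succ (K := Codes Ψ w) (d := d) e₁ (by rw [e₂]; exact hmin)
        (by rw [e₂]; exact hlt) hlast (fun i hi hi' g hg => g3 i hi hi' g hg) hg (hh h23)

end

/-! ### The enumeration of the results -/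

section

variable {k : ℕ} {w : Word k} {Ψ : RegCQ k}

theorem RepresentsTuple.concat {b : List ℕ} {t : List (Word k)} (h : RepresentsTuple w b t)
    {i j : ℕ} {u : Word k} (h' : 1 ≤ i ∧ i ≤ j ∧ j ≤ w.length + 1 ∧
      u = (w.drop (i - 1)).take (j - i)) :
    RepresentsTuple w (b ++ [i, j]) (t ++ [u]) := by
  match b, t, h with
  | [], [], _ => exact ⟨h', trivial⟩
  | i' :: j' :: b, u' :: t, h => exact ⟨h.1, RepresentsTuple.concat h.2 h'⟩

/-- The numbers of the entries of a tuple. -/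
noncomputable def tupleCode (w : Word k) (u : List (Word k)) (h : ℕ) : ℕ ×ₗ ℕ :=
  toLex (code w (u.getD h []))

theorem tupleCode_map {σ : Subst k} {h : ℕ} (hh : h < Ψ.head.length) :
    tupleCode w (Ψ.head.map σ) h = toLex (headCode Ψ w σ h) := by
  simp [tupleCode, headCode, hh]

theorem mem_codes {f : ℕ → ℕ ×ₗ ℕ} :
    f ∈ Codes Ψ w ↔ ∃ u ∈ Ψ.results w, ∀ h < Ψ.head.length, f h = tupleCode w u h := by
  constructor
  · rintro ⟨σ, hσ, h⟩
    exact ⟨Ψ.head.map σ, RegCQ.mem_results.2 ⟨σ, hσ.1, hσ.2, rfl⟩, fun i hi => by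
      rw [h i hi, tupleCode_map hi]⟩
  · rintro ⟨u, hu, h⟩
    obtain ⟨σ, h1, h2, rfl⟩ := RegCQ.mem_results.1 hu
    exact ⟨σ, ⟨h1, h2⟩, fun i hi => by rw [h i hi, tupleCode_map hi]⟩

/-- A result is a tuple of factors, and determined by the numbers of its entries. -/
theorem eq_map_wd (hb : Ψ.IsBinary) {u : List (Word k)} (hu : u ∈ Ψ.results w) :
    (∀ h < Ψ.head.length, (tupleCode w u h).1 + (tupleCode w u h).2 ≤ w.length) ∧
      u = (List.range Ψ.head.length).map fun h => wd w (ofLex (tupleCode w u h)) := by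
  obtain ⟨σ, h1, h2, rfl⟩ := RegCQ.mem_results.1 hu
  refine ⟨fun h hh => ?_, List.ext_getElem (by simp) fun h hh _ => ?_⟩
  · obtain ⟨v, hv, e⟩ := Sol.head_eq_wd hb (σ := σ) ⟨h1, h2⟩ hh
    rw [tupleCode_map hh, headCode, e]
    exact code_le hv
  · have hh' : h < Ψ.head.length := by simpa using hh
    obtain ⟨v, hv, e⟩ := Sol.head_eq_wd hb (σ := σ) ⟨h1, h2⟩ hh'
    simp only [List.getElem_map, List.getElem_range]
    rw [tupleCode_map hh', headCode, e, ofLex_toLex, wd_code hv, ← e]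
    simp [hh']

theorem eq_of_tupleCode (hb : Ψ.IsBinary) {u v : List (Word k)} (hu : u ∈ Ψ.results w)
    (hv : v ∈ Ψ.results w) (h : ∀ i < Ψ.head.length, tupleCode w u i = tupleCode w v i) :
      u = v := by
  rw [(eq_map_wd hb hu).2, (eq_map_wd hb hv).2]
  refine List.map_congr_left fun i hi => ?_
  rw [h i (List.mem_range.1 hi)]

theorem finite_results (hb : Ψ.IsBinary) : (Ψ.results w).Finite := by
  refine Set.Finite.of_finite_image (f := fun u (i : Fin Ψ.head.length) =>
    ofLex (tupleCode w u i)) ((Set.Finite.pi' fun _ : Fin Ψ.head.length =>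
      Set.finite_Iic ((w.length, w.length) : ℕ × ℕ)).subset ?_) fun u hu v hv e =>
        eq_of_tupleCode hb hu hv fun i hi => congrFun e ⟨i, hi⟩
  rintro _ ⟨u, hu, rfl⟩ i
  have := (eq_map_wd hb hu).1 i i.2
  exact ⟨by change (tupleCode w u i).1 ≤ _; simp only; omega,
    by change (tupleCode w u i).2 ≤ _; simp only; omega⟩

/-- The output of the stored tuple. -/
theorem eval_outC (hb : Ψ.IsBinary) {s : State} (h : Prepared Ψ w s) (ho : s.out = [])
    {u : List (Word k)} (hu : u ∈ Ψ.results w)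
    (hc : ∀ h < Ψ.head.length, cur s h = tupleCode w u h) :
    RepresentsTuple w (outC.eval (ctx Ψ w) s).out u := by
  have hN := ctx_N (Ψ := Ψ) (w := w)
  obtain ⟨hle, hu'⟩ := eq_map_wd hb hu
  rw [hu', outC, eval_loop, show vR.denote (ctx Ψ w) s = Ψ.head.length from h.parsed.r]
  refine (iter_inv (fun d (s' : State) => s'.arr = s.arr ∧ RepresentsTuple w s'.out
    ((List.range d).map fun h => wd w (ofLex (tupleCode w u h)))) ⟨rfl, ?_⟩ ?_).2
  · rw [ho]; trivial
  · rintro d hd s' ⟨ha, hr⟩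
    refine ⟨ha, ?_⟩
    have l := hle d hd
    rw [← hc d hd] at l
    simp only [cur] at l
    change _ + _ ≤ _ at l
    change s.arr 11 [d, 0, 0, 0, 0, 0] + s.arr 12 [d, 0, 0, 0, 0, 0] ≤ _ at l
    rw [List.range_succ, List.map_append, List.map_singleton]
    have : (((Cmd.write (.add (aCI (.reg 15)) k1)).seq (.write (.add (.add (aCI (.reg 15))
        (aCL (.reg 15))) k1))).eval (ctx Ψ w) (s'.set 15 d)).out = s'.out ++
        [s.arr 11 [d, 0, 0, 0, 0, 0] + 1,
          s.arr 11 [d, 0, 0, 0, 0, 0] + s.arr 12 [d, 0, 0, 0, 0, 0] + 1] := by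
      simp only [Cmd.eval, denote_add, denote_arr1, denote_reg, denote_const, set_reg, reduceIte,
        set_arr, ha, List.append_assoc, List.singleton_append]
      rw [min_eq_left (by omega), min_eq_left (b := (ctx Ψ w).N - 1) (by omega),
        min_eq_left (by omega)]
      rfl
    change RepresentsTuple w (Cmd.eval _ _ _).out _
    rw [this, ← hc d hd]
    refine hr.concat ⟨by omega, by omega, by omega, ?_⟩
    simp only [cur, ofLex_toLex, wd]
    congr 1
    omega

/-- The code for the next result and for its output enumerates the results behind the stored tuple,
or all results at the beginning. -/
theorem enumRuns (hb : Ψ.IsBinary) (hm : 0 < Ψ.body.length) {W S n K : ℕ}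
    (hW : Fits (ctx Ψ w) W) (hS : 1 ≤ S) (hn : 1 ≤ n) (hK₁ : nextC.cost.val S n ≤ K)
    (hK₂ : outC.cost.val S n ≤ K) (M : ℕ) {s : State} (h : Prepared Ψ w s)
    (hs : s.Bdd (ctx Ψ w).N) (hB : Small S n s) (ho : s.out = [])
    (hM : {u ∈ Ψ.results w | s.reg 23 ≠ 0 → LexLt Ψ.head.length (cur s) (tupleCode w u)}.ncard
      < M) :
    ∃ L out, EnumRuns (ctx Ψ w) W K 21 (fun o => nextC.code o 2) (fun o => outC.code o 2) s L ∧
      List.Forall₂ (RepresentsTuple w) L out ∧ out.Nodup ∧ ∀ u, u ∈ out ↔ u ∈ Ψ.results w ∧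
        (s.reg 23 ≠ 0 → LexLt Ψ.head.length (cur s) (tupleCode w u)) := by
  -- `M` bounds the number of the remaining results
  induction M generalizing s with
  | zero => omega
  | succ M ih =>
    have R₁ := (nextC.runs hW hS hn nextC_ok hs hB le_rfl).mono hK₁
    have hs₁ := nextC.eval_bdd hW.eight_le nextC_ok hs
    have hB₁ := hB.eval (Γ := ctx Ψ w) nextC_ok
    have ho₁ := (nextC.eval_out (Γ := ctx Ψ w) s (by decide)).trans ho
    obtain ⟨P, h23, hcase⟩ := eval_nextC hb hm h rfl
    set s₁ := nextC.eval (ctx Ψ w) s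
    have mem : ∀ {u}, u ∈ Ψ.results w → tupleCode w u ∈ Codes Ψ w := fun hu =>
      mem_codes.2 ⟨_, hu, fun _ _ => rfl⟩
    rcases hcase with ⟨h21, hno⟩ | ⟨h21, hcur, hlt, hleast⟩
    · refine ⟨[], [], .done R₁ h21, .nil, List.nodup_nil, fun u => ?_⟩
      simp only [List.not_mem_nil, false_iff, not_and]
      exact fun hu => hno _ (mem hu)
    obtain ⟨u, hu, huc⟩ := mem_codes.1 hcur
    have R₂ := (outC.runs hW hS hn outC_ok hs₁ hB₁ le_rfl).mono hK₂
    have hs₂ := outC.eval_bdd hW.eight_le outC_ok hs₁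
    have hB₂ := hB₁.eval (Γ := ctx Ψ w) outC_ok
    have P₂ := P.eval (Γ := ctx Ψ w) outC (by decide)
    have c₂ := cur_eval (Γ := ctx Ψ w) outC s₁ (by decide)
    have r₂ : (outC.eval (ctx Ψ w) s₁).reg 23 = s₁.reg 23 := outC.eval_reg s₁ (by decide)
    have hout := eval_outC hb P ho₁ hu huc
    set s₂ := outC.eval (ctx Ψ w) s₁
    have hcu : cur ({ s₂ with out := [] } : State) = cur s₁ := c₂
    have hru : ({ s₂ with out := [] } : State).reg 23 ≠ 0 := by
      change s₂.reg 23 ≠ 0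
      rw [r₂]; exact h23
    -- the results behind the new tuple
    have later : ∀ v, (({ s₂ with out := [] } : State).reg 23 ≠ 0 →
        LexLt Ψ.head.length (cur { s₂ with out := [] }) (tupleCode w v)) ↔
        LexLt Ψ.head.length (tupleCode w u) (tupleCode w v) := by
      intro v
      rw [hcu]
      have tr : LexLt Ψ.head.length (cur s₁) (tupleCode w v) ↔
          LexLt Ψ.head.length (tupleCode w u) (tupleCode w v) := by
        refine exists_congr fun d => and_congr_right fun hd => ?_
        rw [huc d hd]
        refine and_congr_left fun _ => forall₂_congr fun h hh => ?_
        rw [huc h (by omega)]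
      exact ⟨fun h => tr.1 (h hru), fun h _ => tr.2 h⟩
    have first : s.reg 23 ≠ 0 → LexLt Ψ.head.length (cur s) (tupleCode w u) := fun h => by
      obtain ⟨d, hd, e, l⟩ := hlt h
      exact ⟨d, hd, fun i hi => by rw [e i hi, huc i (by omega)], by rwa [← huc d hd]⟩
    have split : ∀ v ∈ Ψ.results w, ((s.reg 23 ≠ 0 → LexLt Ψ.head.length (cur s) (tupleCode w v)) ↔
        v = u ∨ LexLt Ψ.head.length (tupleCode w u) (tupleCode w v)) := by
      intro v hv
      constructor
      · intro hh
        by_cases hl : LexLt Ψ.head.length (tupleCode w u) (tupleCode w v)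
        · exact .inr hl
        · refine .inl (eq_of_tupleCode hb hv hu (LexLt.eq_of_not (fun hl' => ?_) hl))
          refine hleast _ (mem hv) hh ?_
          obtain ⟨d, hd, e, l⟩ := hl'
          exact ⟨d, hd, fun i hi => by rw [e i hi, huc i (by omega)], by rwa [huc d hd]⟩
      · rintro (rfl | hl) h
        · exact first h
        · exact (first h).trans hl
    have irr : ¬ LexLt Ψ.head.length (tupleCode w u) (tupleCode w u) :=
      LexLt.irrefl fun _ _ => rfl
    obtain ⟨L, out, hL, hrep, hnd, hmem⟩ := ih (s := { s₂ with out := [] })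
      (P₂.of_eq (fun _ _ => rfl) fun _ _ => rfl) ⟨hs₂.reg, hs₂.arr⟩
      ⟨hB₂.reg0, hB₂.reg1, hB₂.reg2, hB₂.reg3⟩ rfl (by
        refine lt_of_lt_of_le (Set.ncard_lt_ncard ?_ ((finite_results hb).subset fun v hv => hv.1))
          (Nat.le_of_lt_succ hM)
        refine (Set.ssubset_iff_of_subset ?_).2 ⟨u, ⟨hu, first⟩, fun hv => irr ((later u).1 hv.2)⟩
        exact fun v hv => ⟨hv.1, (split v hv.1).2 (.inr ((later v).1 hv.2))⟩)
    refine ⟨_, u :: out, .next R₁ h21 R₂ hL, .cons hout hrep, List.nodup_cons.2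
      ⟨fun hin => irr ((later u).1 ((hmem u).1 hin).2), hnd⟩, fun v => ?_⟩
    rw [List.mem_cons, hmem]
    constructor
    · rintro (rfl | ⟨hv, hl⟩)
      · exact ⟨hu, first⟩
      · exact ⟨hv, (split v hv).2 (.inr ((later v).1 hl))⟩
    · rintro ⟨hv, hl⟩
      rcases (split v hv).1 hl with rfl | hl
      · exact .inl rfl
      · exact .inr ⟨hv, (later v).2 hl⟩

/-! ### Running times -/

theorem encodeRegex_length (γ : RegularExpression (Fin k)) :
    (encodeRegex γ).length ≤ 2 * regexSize γ := by
  induction γ <;> simp only [encodeRegex, regexSize, List.length_append, List.length_cons,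
    List.length_nil] at * <;> omega

theorem encodeAtom_length_le (χ : Atom k) : (encodeAtom χ).length ≤ 3 * χ.size := by
  rw [encodeAtom_length_eq]
  cases χ with
  | eqn x α => simp [Atom.tag, Atom.rlen, Atom.size]; omega
  | mem x γ =>
    have := encodeRegex_length γ
    simp [Atom.tag, Atom.rlen, Atom.size]; omega

/-- The input for the query is at most five times as long as the query, so that the bounds in terms
of the former are bounds in terms of the latter. -/
theorem queryLen_le (hm : 0 < Ψ.body.length) : queryLen Ψ ≤ 5 * Ψ.size := by
  have h1 : ∀ l : List (Atom k), (l.flatMap encodeAtom).length ≤ 3 * (l.map Atom.size).sum := by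
    intro l
    induction l with
    | nil => simp
    | cons χ l ih =>
      have := encodeAtom_length_le χ
      simp only [List.flatMap_cons, List.length_append, List.map_cons, List.sum_cons]
      omega
  have h2 : 1 ≤ (Ψ.body.map Atom.size).sum := by
    have := List.single_le_sum (l := Ψ.body.map Atom.size) (by simp) Ψ.body[0].size
      (List.mem_map_of_mem (List.getElem_mem hm))
    refine le_trans ?_ this
    cases Ψ.body[0] <;> simp [Atom.size]
  have := h1 Ψ.body
  simp only [queryLen, atomPos, List.take_length, RegCQ.size]
  omega

theorem body_length_pos (h : Ψ.IsAcyclic) : 0 < Ψ.body.length := by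
  obtain ⟨T, hT, -⟩ := h
  obtain ⟨⟨χ, hχ⟩⟩ := hT.connected.nonempty
  exact List.length_pos_of_mem hχ

theorem Bd.val_le {S n : ℕ} (hS : 1 ≤ S) (hn : 1 ≤ n) {x : Bd} (hx : x.a ≤ 2 ∧ x.b ≤ 3) :
    x.val S n ≤ x.k * (S ^ 2 * n ^ 3) := by
  rw [Bd.val, mul_assoc]
  exact Nat.mul_le_mul le_rfl (Nat.mul_le_mul (Nat.pow_le_pow_right hS hx.1)
    (Nat.pow_le_pow_right hn hx.2))

/-- Concatenation of pieces of code. -/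
def seqCode (f g : ℕ → List Instr) (o : ℕ) : List Instr := f o ++ g (o + (f o).length)

theorem Runs.seqCode {Γ : Ctx} {W t K K' : ℕ} {s s' s'' : State} {f g : ℕ → List Instr}
    (h : Runs Γ W s t f s' K) (h' : Runs Γ W s' t g s'' K') :
    Runs Γ W s t (FC.seqCode f g) s'' (K + K') := h.seq h'

/-- Code of an assignment. -/
def assignCode (r : ℕ) (e : Expr) (o : ℕ) : List Instr := (Cmd.assign r e).code o 2

/-- The number of the atoms, as it stands in the input. -/
def bodyLenE : Expr := .inp (.add vR k1)

/-- The length of the word plus one, if the scalar variable `5` is the length of the query. -/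
def posNumE : Expr := .add (.inp (.reg 5)) k1

/-- The position of the first letter, if the scalar variable `5` is the length of the query. -/
def wordPosE : Expr := .add (.reg 5) k1

/-- Code that reads the input and prepares the tables that do not depend on the enumeration. The
scalar variables that bound the loops get their values here. -/
def startCode : ℕ → List Instr :=
  seqCode (assignCode 2 (.inp k0)) <| seqCode (assignCode 1 bodyLenE) <|
  seqCode (fun o => parseLoop.code o 2) <| seqCode (assignCode 3 (.reg 5)) <|
  seqCode (assignCode 0 posNumE) <| seqCode (assignCode 4 wordPosE) fun o => prepC.code o 2

/-- The constant in the running time of the preparation. -/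
def startCost : ℕ :=
  parseLoop.cost.k + prepC.cost.k + ((Expr.inp k0).cost.k + bodyLenE.cost.k + (Expr.reg 5).cost.k +
    posNumE.cost.k + wordPosE.cost.k) + 5

theorem runs_assign {Γ : Ctx} {W S n r v : ℕ} (hW : Fits Γ W) (hS : 1 ≤ S) (hn : 1 ≤ n) {s : State}
    {e : Expr} (he : e.ok) (hc : e.cost.a ≤ 2 ∧ e.cost.b ≤ 3) (hs : s.Bdd Γ.N) (hB : Small S n s)
    (hv : e.denote Γ s = v) :
    Runs Γ W s 2 (assignCode r e) (s.set r v) ((e.cost.k + 1) * (S ^ 2 * n ^ 3)) ∧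
      (s.set r v).Bdd Γ.N := by
  subst hv
  have hlt := e.denote_lt hW.eight_le he hs
  refine ⟨(Runs.assign hW hlt (e.evaluates hW hS hn he hs hB le_rfl)).mono ?_, hs.set hlt⟩
  have h1 := Bd.val_le hS hn hc
  have h2 : 1 ≤ S ^ 2 * n ^ 3 := Nat.mul_pos (pow_pos hS 2) (pow_pos hn 3)
  rw [add_mul, one_mul]
  omega

/-- The running time of the preparation, and the state after it. -/
theorem runs_start (hb : Ψ.IsBinary) (ha : Ψ.IsAcyclic) {W S : ℕ} (hW : Fits (ctx Ψ w) W)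
    (hS : 5 * Ψ.size = S) :
    ∃ s, Runs (ctx Ψ w) W State.zero 2 startCode s (startCost * (S ^ 2 * (w.length + 1) ^ 3)) ∧
      Prepared Ψ w s ∧ s.Bdd (ctx Ψ w).N ∧ Small S (w.length + 1) s ∧ s.out = [] ∧
      s.reg 23 = 0 := by
  have hN := ctx_N (Ψ := Ψ) (w := w)
  have h8 := hW.eight_le
  have hm := body_length_pos ha
  have hQ : queryLen Ψ ≤ S := hS ▸ queryLen_le hm
  have hr := length_head_add_two_le (Ψ := Ψ)
  have hbl := length_body_le (Ψ := Ψ)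
  have hS1 : 1 ≤ S := by omega
  have hn : 1 ≤ w.length + 1 := by omega
  have small : ∀ s : State, s.reg 0 ≤ w.length + 1 → s.reg 1 ≤ S → s.reg 2 ≤ S → s.reg 3 ≤ S →
      Small S (w.length + 1) s := fun s h0 h1 h2 h3 => ⟨h0, h1, h2, h3⟩
  have z : ∀ r, State.zero.reg r = 0 := fun _ => rfl
  obtain ⟨R₁, b₁⟩ := runs_assign (r := 2) hW hS1 hn (e := .inp k0) (by decide) (by decide)
    (s := State.zero) ⟨fun _ => by rw [z]; omega, fun _ _ => by simp only [State.zero]; omega⟩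
    (small _ (by simp [z]) (by simp [z]) (by simp [z]) (by simp [z])) (v := Ψ.head.length) (by
      rw [denote_inp, denote_const, inp_zero]; omega)
  obtain ⟨R₂, b₂⟩ := runs_assign (r := 1) hW hS1 hn (e := bodyLenE) (by decide) (by decide) b₁
    (small _ (by simp [z]) (by simp [z]) (by simp; omega) (by simp [z]))
    (v := Ψ.body.length) (by
      have : min (Ψ.head.length + 1) ((ctx Ψ w).N - 1) = 1 + Ψ.head.length := by omega
      simp only [bodyLenE, denote_inp, denote_add, denote_reg, set_reg, reduceIte, denote_const,
          this,
        inp_body]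
      omega)
  set s₂ := (State.zero.set 2 Ψ.head.length).set 1 Ψ.body.length with hs₂
  have B₂ : Small S (w.length + 1) s₂ :=
    small _ (by simp [hs₂, z]) (by simp [hs₂]; omega) (by simp [hs₂]; omega) (by simp [hs₂, z])
  have R₃ := (parseLoop.runs hW hS1 hn parseLoop_ok b₂ B₂ le_rfl).mono
      (Bd.val_le hS1 hn parseLoop_cost)
  have b₃ := parseLoop.eval_bdd h8 parseLoop_ok b₂
  have B₃ := B₂.eval (Γ := ctx Ψ w) parseLoop_ok
  have o₃ : (parseLoop.eval (ctx Ψ w) s₂).out = [] := parseLoop.eval_out s₂ (by decide)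
  obtain ⟨h5, hpos⟩ := eval_parseLoop (Ψ := Ψ) (w := w) (s := s₂) (by simp [hs₂]) (by simp [hs₂])
  have p : ∀ r ∈ [0, 1, 2, 3, 23], (parseLoop.eval (ctx Ψ w) s₂).reg r = s₂.reg r := fun r hr =>
    parseLoop.eval_reg s₂ (by revert r; decide)
  set s₃ := parseLoop.eval (ctx Ψ w) s₂
  obtain ⟨R₄, b₄⟩ := runs_assign (r := 3) hW hS1 hn (e := .reg 5) (by decide) (by decide) b₃ B₃
    (v := queryLen Ψ) h5
  obtain ⟨R₅, b₅⟩ := runs_assign (r := 0) hW hS1 hn (e := posNumE) (by decide) (by decide) b₄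
    (small _ (by simpa using B₃.reg0) (by simpa using B₃.reg1) (by simpa using B₃.reg2) (by simpa))
    (v := w.length + 1) (by
      simp only [posNumE, denote_inp, denote_add, denote_reg, set_reg, Nat.reduceEqDiff, if_false,
          h5,
        inp_len, denote_const]
      omega)
  have B₅ : Small S (w.length + 1) ((s₃.set 3 (queryLen Ψ)).set 0 (w.length + 1)) :=
    small _ (by simp) (by simpa using B₃.reg1) (by simpa using B₃.reg2) (by simpa)
  obtain ⟨R₆, b₆⟩ := runs_assign (r := 4) hW hS1 hn (e := wordPosE) (by decide) (by decide) b₅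
    B₅ (v := queryLen Ψ + 1) (by
      simp only [wordPosE, denote_add, denote_reg, set_reg, Nat.reduceEqDiff, if_false, h5,
        OfNat.ofNat_ne_zero, denote_const]
      omega)
  set s₆ := ((s₃.set 3 (queryLen Ψ)).set 0 (w.length + 1)).set 4 (queryLen Ψ + 1) with hs₆
  have B₆ : Small S (w.length + 1) s₆ := B₅.set (by omega)
  have hP : Parsed Ψ w s₆ := by
    refine ⟨by simp [hs₆], ?_, ?_, by simp [hs₆], by simp [hs₆], hpos⟩
    · simp [hs₆, p 1 (by simp), hs₂]
    · simp [hs₆, p 2 (by simp), hs₂]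
  have R₇ := (prepC.runs hW hS1 hn prepC_ok b₆ B₆ le_rfl).mono (Bd.val_le hS1 hn prepC_cost)
  refine ⟨prepC.eval (ctx Ψ w) s₆,
      ((R₁.seqCode (R₂.seqCode (R₃.seqCode (R₄.seqCode (R₅.seqCode (R₆.seqCode R₇)))))).mono ?_),
    eval_prepC hb ha hm hP, prepC.eval_bdd h8 prepC_ok b₆, B₆.eval (Γ := ctx Ψ w) prepC_ok, ?_, ?_⟩
  · simp only [startCost]
    ring_nf
    omega
  · rw [prepC.eval_out s₆ (by decide)]; exact o₃
  · rw [prepC.eval_reg s₆ (by decide)]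
    simp [hs₆, p 23 (by simp), hs₂, z]

theorem decider_bound {a b S n : ℕ} (h : 1 ≤ (5 * S) ^ 2 * n ^ 3) :
    a * ((5 * S) ^ 2 * n ^ 3) + b * ((5 * S) ^ 2 * n ^ 3) + 7 ≤
      25 * (a + b + 7) * S ^ 2 * n ^ 3 := by
  calc _ ≤ (a + b + 7) * ((5 * S) ^ 2 * n ^ 3) := by nlinarith
    _ = _ := by ring

theorem enumerator_bound {a b S n : ℕ} (h : 1 ≤ (5 * S) ^ 2 * n ^ 3) :
    a * ((5 * S) ^ 2 * n ^ 3) + 2 * (b * ((5 * S) ^ 2 * n ^ 3)) + 10 ≤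
      25 * (a + 2 * b + 10) * S ^ 2 * n ^ 3 := by
  calc _ ≤ (a + 2 * b + 10) * ((5 * S) ^ 2 * n ^ 3) := by nlinarith
    _ = _ := by ring

end

end FC

theorem mainTheorem4 (k : ℕ) (hk : 2 ≤ k) :
    (∃ (P : FC.Program) (c C : ℕ),
      ∀ Ψ : FC.RegCQ k, Ψ.IsBinary → Ψ.IsAcyclic →
      ∀ (w : FC.Word k) (W : ℕ), FC.WordSize c W (FC.encode Ψ w) →
        P.DecidesIn W (FC.encode Ψ w) (C * Ψ.size ^ 2 * (w.length + 1) ^ 3)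
          (Ψ.results w).Nonempty) ∧
    (∃ (P : FC.Program) (c C : ℕ),
      ∀ Ψ : FC.RegCQ k, Ψ.IsBinary → Ψ.IsAcyclic →
      ∀ (w : FC.Word k) (W : ℕ), FC.WordSize c W (FC.encode Ψ w) →
        P.EnumeratesWithDelay W (FC.encode Ψ w) (C * Ψ.size ^ 2 * (w.length + 1) ^ 3)
          (FC.RepresentsTuple w) (Ψ.results w)) := by
  have pos : ∀ {Ψ : FC.RegCQ k}, Ψ.IsAcyclic → 1 ≤ 5 * Ψ.size := @fun Ψ h => by
    have h1 := FC.queryLen_le (FC.body_length_pos h)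
    have h2 := FC.length_head_add_two_le (Ψ := Ψ)
    omega
  refine ⟨⟨FC.decider (FC.seqCode FC.startCode fun o => FC.firstC.code o 2) 21, 30,
    25 * (FC.startCost + FC.firstC.cost.k + 7), fun Ψ hb ha w W hW => ?_⟩,
    ⟨FC.enumerator FC.startCode (fun o => FC.nextC.code o 2) (fun o => FC.outC.code o 2) 21, 30,
    25 * (FC.startCost + 2 * (FC.nextC.cost.k + FC.outC.cost.k) + 10), fun Ψ hb ha w W hW => ?_⟩⟩
  · have hF := FC.fits_ctxOf hW
    have hm := FC.body_length_pos ha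
    obtain ⟨s, R, hP, hs, hB, -, -⟩ := FC.runs_start (w := w) hb ha hF rfl
    have hX : 1 ≤ (5 * Ψ.size) ^ 2 * (w.length + 1) ^ 3 :=
      Nat.mul_pos (pow_pos (pos ha) 2) (pow_pos (by omega) 3)
    have R' := (FC.firstC.runs hF (pos ha) (by omega) FC.firstC_ok hs hB le_rfl).mono
      (FC.Bd.val_le (pos ha) (by omega) FC.firstC_cost)
    obtain ⟨-, -, -, h1, h0⟩ := FC.eval_firstC hb hm hP
    have hne : (Ψ.results w).Nonempty ↔ (FC.Sol Ψ w).Nonempty :=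
      ⟨fun ⟨u, hu⟩ => let ⟨σ, h1, h2, _⟩ := FC.RegCQ.mem_results.1 hu; ⟨σ, h1, h2⟩,
        fun ⟨σ, hσ⟩ => ⟨_, FC.RegCQ.mem_results.2 ⟨σ, hσ.1, hσ.2, rfl⟩⟩⟩
    refine FC.decider_spec hF (R.seqCode R') (FC.decider_bound hX)
        (fun h => h1 (hne.1 h)) fun h => h0 fun h' => h (hne.2 h')
  · have hF := FC.fits_ctxOf hW
    have hm := FC.body_length_pos ha
    obtain ⟨s, R, hP, hs, hB, ho, h23⟩ := FC.runs_start (w := w) hb ha hF rfl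
    have hX : 1 ≤ (5 * Ψ.size) ^ 2 * (w.length + 1) ^ 3 :=
      Nat.mul_pos (pow_pos (pos ha) 2) (pow_pos (by omega) 3)
    have k1 := FC.Bd.val_le (pos ha) (show 1 ≤ w.length + 1 by omega) FC.nextC_cost
    have k2 := FC.Bd.val_le (pos ha) (show 1 ≤ w.length + 1 by omega) FC.outC_cost
    obtain ⟨L, out, hL, hrep, hnd, hmem⟩ := FC.enumRuns hb hm hF (pos ha)
      (show 1 ≤ w.length + 1 by omega)
      (K := (FC.nextC.cost.k + FC.outC.cost.k) * ((5 * Ψ.size) ^ 2 * (w.length + 1) ^ 3))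
      (k1.trans (Nat.mul_le_mul_right _ (Nat.le_add_right _ _)))
      (k2.trans (Nat.mul_le_mul_right _ (Nat.le_add_left _ _))) _ hP hs hB ho (Nat.lt_succ_self _)
    obtain ⟨⟨T, hT, e⟩, hdelay⟩ := FC.enumerator_spec (D := 25 * (FC.startCost +
      2 * (FC.nextC.cost.k + FC.outC.cost.k) + 10) * Ψ.size ^ 2 * (w.length + 1) ^ 3) hF R hL
        (FC.enumerator_bound hX)
    refine ⟨⟨T, hT, out, by rw [e]; exact hrep, hnd, fun u => ?_⟩, hdelay⟩
    rw [hmem]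
    exact and_iff_left fun h => absurd h23 h
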